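/- Let $d\ge 3$, let $\|\cdot\|$ be any norm on $\mathbb{R}^d$, let $\lambda^d$ be Lebesgue measure on $\mathbb{R}^d$, and let $p\in[1,\frac d2)$. For finite Borel measures $\mu,\nu$ on $\mathbb{R}^d$ of equal mass let $\mathcal{M}(\mu,\nu)$ be the set of finite Borel measures on $\mathbb{R}^d\times\mathbb{R}^d$ with first marginal $\mu$ and second marginal $\nu$, and put $$\rho_p(\mu,\nu)=\inf_{\xi\in\mathcal{M}(\mu,\nu)}\Bigl(\int\|x-y\|^p\,\xi(dx,dy)\Bigr)^{1/p}.$$ For a probability measure $\mu$ on $\mathbb{R}^d$ and $N\ge 1$ let $\hat\mu_N=\frac1N\sum_{j=1}^N\delta_{X_j}$ with $X_1,\dots,X_N$ independent and $\mu$-distributed, and put $V^{\mathrm{rand}}_{N,p}(\mu)=\mathbb{E}[\rho_p^p(\mu,\hat\mu_N)]^{1/p}$. Let $\mathcal{U}$ be the uniform distribution on $[0,1)^d$, let $\Lambda$ be the set of probability measures $\mathcal{U}'$ on $[0,1]^d$ with $\mathcal{U}'(A)\le\mathcal{U}(A)$ for each Borel set $A\subset(0,1)^d$, and put $$\underline{V}^{\mathrm{rand}}_{N,p}=\mathbb{E}\Bigl[\inf_{\mathcal{U}'\in\Lambda,\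 \xi\in\mathcal{M}(\mathcal{U}',\hat{\mathcal{U}}_N)}\int\|x-y\|^p\,\xi(dx,dy)\Bigr]^{1/p}.$$ (i) There exist constants $\kappa^{\mathrm{unif}}_p,\underline{\kappa}^{\mathrm{unif}}_p\in(0,\infty)$ (depending only on $d$, $p$ and the norm) such that $$\lim_{N\to\infty}N^{1/d}\,V^{\mathrm{rand}}_{N,p}(\mathcal{U})=\kappa^{\mathrm{unif}}_p\qquad\text{and}\qquad\lim_{N\to\infty}N^{1/d}\,\underline{V}^{\mathrm{rand}}_{N,p}=\underline{\kappa}^{\mathrm{unif}}_p.$$ (ii) Let $\mu$ be a probability measure on $\mathbb{R}^d$ with $\int\|x\|^q\,\mu(dx)<\infty$ for some $q>\frac{dp}{d-p}$, and let $f=\frac{d\mu_a}{d\lambda^d}$ be the density of the absolutely continuous part $\mu_a$ of $\mu$. Suppose that $f$ is Riemann integrable (that is, some version of $f$ is Riemann integrable on every bounded box) or that $p=1$. Then $$\limsup_{N\to\infty}N^{1/d}\,V^{\mathrm{rand}}_{N,p}(\mu)\le\kappa^{\mathrm{unif}}_p\Bigl(\int_{\mathbb{R}^d}f^{1-p/d}\,d\lambda^d\Bigr)^{1/p}$$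 and $$\liminf_{N\to\infty}N^{1/d}\,V^{\mathrm{rand}}_{N,p}(\mu)\ge\underline{\kappa}^{\mathrm{unif}}_p\Bigl(\int_{\mathbb{R}^d}f^{1-p/d}\,d\lambda^d\Bigr)^{1/p}.$$ -/

import Mathlib

open MeasureTheory Filter Topology
open scoped ENNReal NNReal

namespace RandQuant

/-- `M(μ, ν)`: the finite measures on `ℝ^d × ℝ^d` with first marginal `μ` and second
marginal `ν`. -/
def transports {d : ℕ} (μ ν : Measure (Fin d → ℝ)) :
    Set (Measure ((Fin d → ℝ) × (Fin d → ℝ))) :=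
  {ξ | IsFiniteMeasure ξ ∧ ξ.map Prod.fst = μ ∧ ξ.map Prod.snd = ν}

/-- The cost `∫ ‖x - y‖ ^ p dξ(x, y)` of a transport `ξ`, where `nrm` is the norm `‖·‖`. -/
noncomputable def cost {d : ℕ} (nrm : Seminorm ℝ (Fin d → ℝ)) (p : ℝ)
    (ξ : Measure ((Fin d → ℝ) × (Fin d → ℝ))) : ℝ≥0∞ :=
  ∫⁻ z, ENNReal.ofReal (nrm (z.1 - z.2) ^ p) ∂ξ

/-- The `p`-th Wasserstein metric `ρ_p(μ, ν)` with respect to the norm `nrm`. -/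
noncomputable def wasserstein {d : ℕ} (nrm : Seminorm ℝ (Fin d → ℝ)) (p : ℝ)
    (μ ν : Measure (Fin d → ℝ)) : ℝ≥0∞ :=
  ⨅ ξ ∈ transports μ ν, cost nrm p ξ ^ (1 / p)

/-- The empirical measure `(1/N) ∑ δ_{x_j}` of the points `x_1, …, x_N`. -/
noncomputable def empirical {d N : ℕ} (x : Fin N → Fin d → ℝ) : Measure (Fin d → ℝ) :=
  (N : ℝ≥0∞)⁻¹ • ∑ j, Measure.dirac (x j)

/-- The random quantization error `V^rand_{N,p}(μ) = E[ρ_p^p(μ, μ̂_N)]^{1/p}`. The sample of `N`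
independent `μ`-distributed points is the identity on `(ℝ^d)^N` with the product measure. -/
noncomputable def Vrand {d : ℕ} (nrm : Seminorm ℝ (Fin d → ℝ)) (N : ℕ) (p : ℝ)
    (μ : Measure (Fin d → ℝ)) : ℝ≥0∞ :=
  (∫⁻ x, wasserstein nrm p μ (empirical x) ^ p ∂(Measure.pi fun _ : Fin N => μ)) ^ (1 / p)

/-- The uniform distribution on `[0,1)^d`. -/
noncomputable def unifCube (d : ℕ) : Measure (Fin d → ℝ) :=
  volume.restrict (Set.univ.pi fun _ => Set.Ico 0 1)

/-- `Λ`: the probability measures `U'` on `[0,1]^d` with `U'(A) ≤ U(A)` for each Borel set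
`A ⊆ (0,1)^d`, where `U` is the uniform distribution on `[0,1)^d`. -/
def leakyMeasures (d : ℕ) : Set (Measure (Fin d → ℝ)) :=
  {U' | IsProbabilityMeasure U' ∧ U' (Set.univ.pi fun _ => Set.Icc 0 1)ᶜ = 0 ∧
    ∀ A : Set (Fin d → ℝ), MeasurableSet A → A ⊆ (Set.univ.pi fun _ => Set.Ioo 0 1) →
      U' A ≤ unifCube d A}

/-- The random quantization error of the uniform distribution on `[0,1)^d` with leakage at the
boundary: the `p`-th root of the expected value of the minimal cost of a transport to the
empirical measure from any measure in `Λ`. -/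
noncomputable def VrandLeaky {d : ℕ} (nrm : Seminorm ℝ (Fin d → ℝ)) (N : ℕ) (p : ℝ) : ℝ≥0∞ :=
  (∫⁻ x, (⨅ U' ∈ leakyMeasures d, ⨅ ξ ∈ transports U' (empirical x), cost nrm p ξ)
    ∂(Measure.pi fun _ : Fin N => unifCube d)) ^ (1 / p)

/-- The density of the absolutely continuous part of `μ` (with respect to Lebesgue measure) is
Riemann integrable: it has a version that is Riemann integrable on each bounded box. -/
def HasRiemannIntegrableDensity {d : ℕ} (μ : Measure (Fin d → ℝ)) : Prop :=
  ∃ f : (Fin d → ℝ) → ℝ,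
    f =ᵐ[volume] (fun x => (μ.rnDeriv volume x).toReal) ∧
    ∀ I : BoxIntegral.Box (Fin d),
      BoxIntegral.Integrable I BoxIntegral.IntegrationParams.Riemann f
        BoxIntegral.BoxAdditiveMap.volume

end RandQuant

/-! Write θ = 1 - p/d. After multiplication by N, the `p`-th power of the error is the expected cost
`sampleCost` of moving N • μ onto N unit point masses, and the theorem says that it behaves like N ^
θ. Everything is phrased through partial transports (`pcost`), in which missing mass at a point x is
charged w x. The penalty w = ∞ gives the balanced problem (`iInf_cost_eq`), and w = `exitCost` of
the open cube gives the leaky one (`iInf_leaky_eq`).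

Upper estimates rest on subadditivity. For a mixture ∑ m i • μ i the numbers of sample points per
component are binomial; each component can be served by itself, and only the fluctuation of these
numbers has to be routed through a base point (`sampleCost_mixture_le`). Along dyadic cells the
level-l error is of order 2 ^ (-l p) * √(2 ^ (l d) * N). It grows geometrically because p < d/2, so
the finest level, with about one point per cell, dominates and gives the order N ^ θ
(`exists_sampleCost_le`). The same splitting along dyadic shells, with the moment of order q > d p /
(d - p), makes the part outside a large box negligible (`exists_thinCost_compl_box_le`).

Lower estimates rest on superadditivity. Mass that crosses the boundary of a cell costs at least the
exit cost, so the leaky costs of disjoint cells add up to at most the total cost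
(`sum_pcost_restrict_le`).

For the uniform distribution, cutting the cube into K ^ d subcubes with about n points each makes
the normalized costs almost monotone under refinement, with an error n ^ (-(1/2 - p/d)) that tends
to zero. A Fekete type argument gives both limits, and a volume count shows that the leaky one is
positive.

For general μ a grid with about t / N as volume of a cell is used. By `exists_good_cells` the
measure is close in total variation to a uniform one on most cells. The cells near the singular part
have small total volume and are negligible by Hölder's inequality. Summing cell by cell turns ∑ r ^
p * μ(cell) ^ θ into ∫ f ^ θ. The limits are taken in the order N → ∞, ε → 0, t → ∞, η → 0, and at
last the box exhausts the space. -/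

namespace RandQuant

/-! ### Comparison of the norm with the sup norm, and the cost of a single move. -/

section GroundCost

variable {d : ℕ} (nrm : Seminorm ℝ (Fin d → ℝ)) (p : ℝ)

/-- The ground cost `‖y - x‖ ^ p`. -/
noncomputable def gcost (y x : Fin d → ℝ) : ℝ≥0∞ := ENNReal.ofReal (nrm (y - x) ^ p)

theorem exists_seminorm_le : ∃ C : ℝ, 0 < C ∧ ∀ x, nrm x ≤ C * ‖x‖ := by
  refine ⟨∑ i, nrm (Pi.single i 1) + 1, ?_, fun x => ?_⟩
  · have : 0 ≤ ∑ i, nrm (Pi.single i (1:ℝ)) := Finset.sum_nonneg fun i _ => apply_nonneg _ _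
    linarith
  · have h1 : x = ∑ i, x i • (Pi.single i (1:ℝ) : Fin d → ℝ) := by
      simpa [← Pi.single_smul'] using (Finset.univ_sum_single x).symm
    have h2 : nrm x ≤ ∑ i, |x i| * nrm (Pi.single i 1) := by
      conv_lhs => rw [h1]
      refine (Finset.le_sum_of_subadditive nrm (map_zero nrm).le (map_add_le_add _) _ _).trans ?_
      refine Finset.sum_le_sum fun i _ => ?_
      rw [map_smul_eq_mul, Real.norm_eq_abs]
    have h3 : ∑ i, |x i| * nrm (Pi.single i 1) ≤ ∑ i, ‖x‖ * nrm (Pi.single i 1) :=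
      Finset.sum_le_sum fun i _ => mul_le_mul_of_nonneg_right (norm_le_pi_norm x i)
        (apply_nonneg _ _)
    rw [← Finset.mul_sum] at h3
    nlinarith [norm_nonneg x]

theorem continuous_seminorm : Continuous nrm := by
  obtain ⟨C, hC, h⟩ := exists_seminorm_le nrm
  refine Seminorm.continuous_of_continuousAt_zero ?_
  rw [ContinuousAt, map_zero]
  refine squeeze_zero (fun x => apply_nonneg _ _) h ?_
  have : Continuous fun x : Fin d → ℝ => C * ‖x‖ := by fun_prop
  simpa using this.tendsto 0

/-- Compactness of the unit sphere turns definiteness into a uniform bound. It is needed for the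
positivity of the leaky constant and for passing from moments of `nrm` to moments of the sup norm.
-/
theorem exists_le_seminorm (hnrm : ∀ x, nrm x = 0 → x = 0) :
    ∃ c : ℝ, 0 < c ∧ ∀ x, c * ‖x‖ ≤ nrm x := by
  rcases (Metric.sphere (0 : Fin d → ℝ) 1).eq_empty_or_nonempty with h | h
  · refine ⟨1, one_pos, fun x => ?_⟩
    by_cases hx : x = 0
    · simp [hx]
    · exfalso
      have : (‖x‖⁻¹ • x) ∈ Metric.sphere (0 : Fin d → ℝ) 1 := by
        simp [norm_smul, inv_mul_cancel₀ (norm_ne_zero_iff.2 hx)]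
      simp [h] at this
  · obtain ⟨z, hz, hmin⟩ := (isCompact_sphere (0 : Fin d → ℝ) 1).exists_isMinOn h
      (continuous_seminorm nrm).continuousOn
    have hz1 : ‖z‖ = 1 := by simpa using hz
    refine ⟨nrm z, lt_of_le_of_ne (apply_nonneg _ _) fun h0 => ?_, fun x => ?_⟩
    · have := hnrm z h0.symm
      simp [this] at hz1
    · by_cases hx : x = 0
      · simp [hx]
      · have hx' : ‖x‖ ≠ 0 := norm_ne_zero_iff.2 hx
        have h1 : (‖x‖⁻¹ • x) ∈ Metric.sphere (0 : Fin d → ℝ) 1 := by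
          simp [norm_smul, inv_mul_cancel₀ hx']
        have h2 : nrm z ≤ nrm (‖x‖⁻¹ • x) := hmin h1
        rw [map_smul_eq_mul, norm_inv, norm_norm] at h2
        have h3 : 0 < ‖x‖ := norm_pos_iff.2 hx
        rwa [inv_mul_eq_div, le_div_iff₀ h3] at h2

variable {p}

theorem continuous_gcost (hp : 0 ≤ p) : Continuous fun z : (Fin d → ℝ) × (Fin d → ℝ) =>
    gcost nrm p z.1 z.2 := by
  unfold gcost
  refine ENNReal.continuous_ofReal.comp (Continuous.rpow_const ?_ fun _ => Or.inr hp)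
  exact (continuous_seminorm nrm).comp (continuous_fst.sub continuous_snd)

theorem measurable_gcost (hp : 0 ≤ p) : Measurable fun z : (Fin d → ℝ) × (Fin d → ℝ) =>
    gcost nrm p z.1 z.2 := (continuous_gcost nrm hp).measurable

theorem measurable_gcost_left (hp : 0 ≤ p) (x : Fin d → ℝ) :
    Measurable fun y => gcost nrm p y x :=
  (measurable_gcost nrm hp).comp (by fun_prop : Measurable fun y => (y, x))

theorem gcost_comm (y x : Fin d → ℝ) : gcost nrm p y x = gcost nrm p x y := by
  rw [gcost, gcost, map_sub_rev]

theorem gcost_self (hp : 0 < p) (x : Fin d → ℝ) : gcost nrm p x x = 0 := by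
  simp [gcost, hp.ne']

/-- The triangle inequality combined with convexity of t ^ p. A detour through a base point z costs
the factor 2 ^ (p - 1), and the two endpoints become decoupled. -/
theorem gcost_le_add (hp : 1 ≤ p) (y x z : Fin d → ℝ) :
    gcost nrm p y x ≤ 2 ^ (p - 1) * (gcost nrm p y z + gcost nrm p x z) := by
  have h0 : 0 ≤ p := by linarith
  rw [gcost_comm nrm x z]
  simp only [gcost]
  rw [← ENNReal.ofReal_rpow_of_nonneg (apply_nonneg _ _) h0,
    ← ENNReal.ofReal_rpow_of_nonneg (apply_nonneg _ _) h0,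
    ← ENNReal.ofReal_rpow_of_nonneg (apply_nonneg _ _) h0]
  refine le_trans ?_ (ENNReal.rpow_add_le_mul_rpow_add_rpow _ _ hp)
  refine ENNReal.rpow_le_rpow ?_ h0
  rw [← ENNReal.ofReal_add (apply_nonneg _ _) (apply_nonneg _ _)]
  refine ENNReal.ofReal_le_ofReal ?_
  have : y - x = (y - z) + (z - x) := by abel
  rw [this]
  exact map_add_le_add _ _ _

theorem gcost_smul_add {s : ℝ} (hs : 0 ≤ s) (z y x : Fin d → ℝ) :
    gcost nrm p (s • y + z) (s • x + z) = ENNReal.ofReal (s ^ p) * gcost nrm p y x := by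
  rw [gcost, gcost, ← ENNReal.ofReal_mul (Real.rpow_nonneg hs _), add_sub_add_right_eq_sub,
    ← smul_sub, map_smul_eq_mul, Real.norm_of_nonneg hs, Real.mul_rpow hs (apply_nonneg _ _)]

end GroundCost

/-! ### Partial transports to unit point masses, and their monotonicity and stability. -/

section PartialCost

variable {d : ℕ} (nrm : Seminorm ℝ (Fin d → ℝ)) (p : ℝ)
variable {J : Type*} [Fintype J]

/-- Families of measures of mass at most one with sum at most `ρ`: the partial transports from
`ρ` to unit point masses indexed by `J`. -/
def partialPlans (ρ : Measure (Fin d → ℝ)) : Set (J → Measure (Fin d → ℝ)) :=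
  {ν | ∑ j, ν j ≤ ρ ∧ ∀ j, ν j Set.univ ≤ 1}

/-- The cost of a partial transport `ν` to the points `x`; a missing unit of mass
at `x j` is charged `w (x j)`. -/
noncomputable def planCost (w : (Fin d → ℝ) → ℝ≥0∞) (x : J → Fin d → ℝ)
    (ν : J → Measure (Fin d → ℝ)) : ℝ≥0∞ :=
  ∑ j, (∫⁻ y, gcost nrm p y (x j) ∂ν j + (1 - ν j Set.univ) * w (x j))

/-- The optimal cost of a partial transport from `ρ` to the points `x`. -/
noncomputable def pcost (ρ : Measure (Fin d → ℝ)) (w : (Fin d → ℝ) → ℝ≥0∞)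
    (x : J → Fin d → ℝ) : ℝ≥0∞ :=
  ⨅ ν ∈ partialPlans (J := J) ρ, planCost nrm p w x ν

variable {nrm p}

theorem pcost_le {ρ : Measure (Fin d → ℝ)} {w : (Fin d → ℝ) → ℝ≥0∞} {x : J → Fin d → ℝ}
    {ν : J → Measure (Fin d → ℝ)} (h : ν ∈ partialPlans ρ) :
    pcost nrm p ρ w x ≤ planCost nrm p w x ν := iInf₂_le ν h

theorem zero_mem_partialPlans (ρ : Measure (Fin d → ℝ)) :
    (0 : J → Measure (Fin d → ℝ)) ∈ partialPlans ρ := by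
  constructor
  · simp [Measure.zero_le]
  · simp

theorem exists_planCost_le (ρ : Measure (Fin d → ℝ)) (w : (Fin d → ℝ) → ℝ≥0∞)
    (x : J → Fin d → ℝ) {ε : ℝ≥0∞} (hε : ε ≠ 0) :
    ∃ ν ∈ partialPlans ρ, planCost nrm p w x ν ≤ pcost nrm p ρ w x + ε := by
  by_cases h : pcost nrm p ρ w x = ∞
  · exact ⟨0, zero_mem_partialPlans ρ, by simp [h]⟩
  · have h1 : pcost nrm p ρ w x < pcost nrm p ρ w x + ε := ENNReal.lt_add_right h hε
    obtain ⟨ν, hν⟩ := iInf_lt_iff.1 h1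
    obtain ⟨hν1, hν2⟩ := iInf_lt_iff.1 hν
    exact ⟨ν, hν1, hν2.le⟩

theorem pcost_mono {ρ ρ' : Measure (Fin d → ℝ)} {w w' : (Fin d → ℝ) → ℝ≥0∞}
    (x : J → Fin d → ℝ) (hρ : ρ ≤ ρ') (hw : w ≤ w') :
    pcost nrm p ρ' w x ≤ pcost nrm p ρ w' x := by
  refine le_iInf₂ fun ν hν => (pcost_le ⟨hν.1.trans hρ, hν.2⟩).trans ?_
  exact Finset.sum_le_sum fun j _ => add_le_add le_rfl (mul_le_mul_right (hw _) _)

theorem planCost_empty [IsEmpty J] (w : (Fin d → ℝ) → ℝ≥0∞) (x : J → Fin d → ℝ)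
    (ν : J → Measure (Fin d → ℝ)) : planCost nrm p w x ν = 0 := by
  simp [planCost]

theorem pcost_empty [IsEmpty J] (ρ : Measure (Fin d → ℝ)) (w : (Fin d → ℝ) → ℝ≥0∞)
    (x : J → Fin d → ℝ) : pcost nrm p ρ w x = 0 :=
  le_antisymm ((pcost_le (zero_mem_partialPlans ρ)).trans (planCost_empty _ _ _).le) zero_le

/-- Replacing the points raises the cost by at most the charges for the replaced points. -/
theorem pcost_le_add_sum_ne [DecidableEq J] (ρ : Measure (Fin d → ℝ)) (w : (Fin d → ℝ) → ℝ≥0∞)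
    (x x' : J → Fin d → ℝ) [DecidablePred fun j => x j ≠ x' j] :
    pcost nrm p ρ w x' ≤ pcost nrm p ρ w x + ∑ j, if x j ≠ x' j then w (x' j) else 0 := by
  classical
  rw [pcost, pcost, ENNReal.iInf_add]
  refine le_iInf fun ν => ?_
  rw [ENNReal.iInf_add]
  refine le_iInf fun hν => ?_
  let ν' : J → Measure (Fin d → ℝ) := fun j => if x j ≠ x' j then 0 else ν j
  have hle : ∀ j, ν' j ≤ ν j := fun j => by
    by_cases h : x j ≠ x' j
    · simp only [ν', if_pos h, Measure.zero_le]
    · simp only [ν', if_neg h, le_refl]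
  refine (iInf₂_le ν' ⟨(Finset.sum_le_sum fun j _ => hle j).trans hν.1,
    fun j => (hle j Set.univ).trans (hν.2 j)⟩).trans ?_
  rw [planCost, planCost, ← Finset.sum_add_distrib]
  refine Finset.sum_le_sum fun j _ => ?_
  by_cases h : x j ≠ x' j
  · simp only [ν', if_pos h]
    simp
  · simp only [ν', if_neg h]
    push Not at h
    simp [h]

/-- Dropping points does not raise the cost. -/
theorem pcost_comp_le {J' : Type*} [Fintype J'] (ρ : Measure (Fin d → ℝ))
    (w : (Fin d → ℝ) → ℝ≥0∞) (x : J → Fin d → ℝ) {e : J' → J} (he : Function.Injective e) :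
    pcost nrm p ρ w (x ∘ e) ≤ pcost nrm p ρ w x := by
  classical
  refine le_iInf₂ fun ν hν => (pcost_le (ν := ν ∘ e) ⟨?_, fun j => hν.2 _⟩).trans ?_
  · refine le_trans ?_ hν.1
    have := Finset.sum_le_sum_of_subset_of_nonneg (f := ν)
      (Finset.subset_univ (Finset.univ.image e)) fun j _ _ => Measure.zero_le _
    rw [Finset.sum_image (fun a _ b _ h => he h)] at this
    exact this
  · have := Finset.sum_le_sum_of_subset
      (f := fun j => ∫⁻ y, gcost nrm p y (x j) ∂ν j + (1 - ν j Set.univ) * w (x j))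
      (Finset.subset_univ (Finset.univ.image e))
    rw [Finset.sum_image (fun a _ b _ h => he h)] at this
    exact this

/-- Splitting the points into two groups, where one of the groups is not served. -/
theorem pcost_le_comp_add {J' J'' : Type*} [Fintype J'] [Fintype J''] (ρ : Measure (Fin d → ℝ))
    (w : (Fin d → ℝ) → ℝ≥0∞) (x : J' ⊕ J'' → Fin d → ℝ) :
    pcost nrm p ρ w x ≤ pcost nrm p ρ w (x ∘ Sum.inl) + ∑ j, w (x (Sum.inr j)) := by
  rw [pcost, pcost, ENNReal.iInf_add]
  refine le_iInf fun ν => ?_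
  rw [ENNReal.iInf_add]
  refine le_iInf fun hν => ?_
  have hadm : (Sum.elim ν 0 : J' ⊕ J'' → Measure (Fin d → ℝ)) ∈ partialPlans ρ := by
    refine ⟨by simpa using hν.1, ?_⟩
    rintro (j | j)
    · exact hν.2 j
    · simp
  refine (iInf₂_le _ hadm).trans ?_
  simp [planCost]

/-- Removing a part `σ` of the source raises the cost by at most `D * σ univ`. -/
theorem pcost_le_add_mass (ρ σ : Measure (Fin d → ℝ)) [IsFiniteMeasure ρ] [IsFiniteMeasure σ]
    {w : (Fin d → ℝ) → ℝ≥0∞} {D : ℝ≥0∞} (hw : ∀ x, w x ≤ D) (x : J → Fin d → ℝ) :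
    pcost nrm p ρ w x ≤ pcost nrm p (ρ + σ) w x + D * σ Set.univ := by
  rw [pcost, pcost, ENNReal.iInf_add]
  refine le_iInf fun ν => ?_
  rw [ENNReal.iInf_add]
  refine le_iInf fun hν => ?_
  -- The densities h and k of ρ and σ with respect to τ add up to one. The part h of each ν j stays,
  -- and the part k is given up; the parts given up have total mass at most that of σ, and each unit
  -- is charged at most D.
  set τ := ρ + σ with hτ
  set h := ρ.rnDeriv τ with hh
  set k := σ.rnDeriv τ with hk
  have : IsFiniteMeasure τ := by rw [hτ]; infer_instance
  have hdρ : ρ.HaveLebesgueDecomposition τ := Measure.haveLebesgueDecomposition_of_sigmaFinite ρ τ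
  have hdσ : σ.HaveLebesgueDecomposition τ := Measure.haveLebesgueDecomposition_of_sigmaFinite σ τ
  have hdτ : (ρ + σ).HaveLebesgueDecomposition τ :=
    Measure.haveLebesgueDecomposition_of_sigmaFinite τ τ
  have hρτ : ρ ≪ τ := Measure.absolutelyContinuous_of_le (Measure.le_add_right le_rfl)
  have hστ : σ ≪ τ := Measure.absolutelyContinuous_of_le (Measure.le_add_left le_rfl)
  have hmh : Measurable h := Measure.measurable_rnDeriv _ _
  have hmk : Measurable k := Measure.measurable_rnDeriv _ _
  have hsum : ∀ᵐ y ∂τ, h y + k y = 1 := by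
    filter_upwards [Measure.rnDeriv_add ρ σ τ, Measure.rnDeriv_self τ] with y h1 h2
    rw [← hτ, h2] at h1
    simpa using h1.symm
  have hac : ∀ j, ν j ≪ τ := fun j => Measure.absolutelyContinuous_of_le
    ((Finset.single_le_sum (fun i _ => Measure.zero_le (ν i)) (Finset.mem_univ j)).trans hν.1)
  have hspl : ∀ j, (ν j).withDensity h + (ν j).withDensity k = ν j := fun j => by
    rw [← withDensity_add_left hmh]
    conv_rhs => rw [← withDensity_one (μ := ν j)]
    exact withDensity_congr_ae ((hac j).ae_le hsum)
  have hwd : ∀ g : (Fin d → ℝ) → ℝ≥0∞, ∑ j, (ν j).withDensity g = (∑ j, ν j).withDensity g := by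
    intro g
    rw [← Measure.sum_fintype, ← Measure.sum_fintype, withDensity_sum]
  have hle : ∀ g : (Fin d → ℝ) → ℝ≥0∞, ∑ j, (ν j).withDensity g ≤ τ.withDensity g := by
    intro g
    rw [hwd]
    refine Measure.le_iff.2 fun s hs => ?_
    rw [withDensity_apply _ hs, withDensity_apply _ hs]
    exact lintegral_mono' (Measure.restrict_mono le_rfl hν.1) le_rfl
  have hle1 : ∀ j, (ν j).withDensity h ≤ ν j := fun j => by
    conv_rhs => rw [← hspl j]
    exact Measure.le_add_right le_rfl
  have hadm : (fun j => (ν j).withDensity h) ∈ partialPlans ρ := by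
    refine ⟨(hle h).trans ?_, fun j => (hle1 j _).trans (hν.2 j)⟩
    rw [hh, Measure.withDensity_rnDeriv_eq _ _ hρτ]
  refine (iInf₂_le _ hadm).trans ?_
  · have hσ : ∑ j, ((ν j).withDensity k) Set.univ ≤ σ Set.univ := by
      have := hle k Set.univ
      rwa [hk, Measure.withDensity_rnDeriv_eq _ _ hστ, Measure.finsetSum_apply] at this
    calc planCost nrm p w x (fun j => (ν j).withDensity h)
        ≤ planCost nrm p w x ν + ∑ j, D * ((ν j).withDensity k) Set.univ := by
          rw [planCost, planCost, ← Finset.sum_add_distrib]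
          refine Finset.sum_le_sum fun j _ => ?_
          rw [add_assoc]
          refine add_le_add (lintegral_mono' (hle1 j) le_rfl) ?_
          have h1 : 1 - ((ν j).withDensity h) Set.univ ≤
              (1 - ν j Set.univ) + ((ν j).withDensity k) Set.univ := by
            have h2 : ν j Set.univ =
                ((ν j).withDensity k) Set.univ + ((ν j).withDensity h) Set.univ := by
              conv_lhs => rw [← hspl j, Measure.add_apply, add_comm]
            rw [tsub_le_iff_right, add_assoc, ← h2]
            exact le_tsub_add
          refine (mul_le_mul_left h1 _).trans ?_
          rw [add_mul]
          rw [mul_comm D]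
          gcongr
          exact hw _
      _ ≤ _ := by
          rw [← Finset.mul_sum]
          gcongr

end PartialCost

theorem div_mul_le_self (a b : ℝ≥0∞) : a / b * b ≤ a := by
  rw [mul_comm]
  exact ENNReal.mul_div_le

/-! ### Completing partial plans, and subadditivity for mixtures. -/

section Completion

variable {d : ℕ} {nrm : Seminorm ℝ (Fin d → ℝ)} {p : ℝ}
variable {J : Type*} [Fintype J]

/-- A partial plan with remaining source mass `κ` is completed by spreading `κ` evenly over the
missing target mass. -/
theorem pcost_top_le_completion {ρ κ : Measure (Fin d → ℝ)} {ν : J → Measure (Fin d → ℝ)}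
    (hsum : ∑ j, ν j + κ = ρ) (hν : ∀ j, ν j Set.univ ≤ 1)
    (hρ : ρ Set.univ = Fintype.card J) (x : J → Fin d → ℝ) :
    (∑ j, (1 - ν j Set.univ) = κ Set.univ) ∧
    pcost nrm p ρ (fun _ => ∞) x ≤ ∑ j, (∫⁻ y, gcost nrm p y (x j) ∂ν j +
      (1 - ν j Set.univ) / κ Set.univ * ∫⁻ y, gcost nrm p y (x j) ∂κ) := by
  have hmass : ∑ j, (1 - ν j Set.univ) = κ Set.univ := by
    have h1 : ∑ j, (1 - ν j Set.univ) + ∑ j, ν j Set.univ = Fintype.card J := by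
      rw [← Finset.sum_add_distrib, Finset.sum_congr rfl fun j _ => tsub_add_cancel_of_le (hν j)]
      simp
    have h2 : κ Set.univ + ∑ j, ν j Set.univ = Fintype.card J := by
      rw [← hρ, ← hsum, Measure.add_apply, Measure.finsetSum_apply, add_comm]
    have h3 : ∑ j, ν j Set.univ ≠ ∞ :=
      ENNReal.sum_ne_top.2 fun j _ => ((hν j).trans_lt ENNReal.one_lt_top).ne
    exact (ENNReal.add_left_inj h3).1 (h1.trans h2.symm)
  refine ⟨hmass, ?_⟩
  have hκ : κ Set.univ ≠ ∞ := by
    rw [← hmass]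
    exact ENNReal.sum_ne_top.2 fun j _ => (tsub_le_self.trans_lt ENNReal.one_lt_top).ne
  -- If κ has no mass, `hmass` makes every deficit vanish, so the division by zero does no harm.
  have huniv : ∀ j, (ν j + ((1 - ν j Set.univ) / κ Set.univ) • κ) Set.univ = 1 := fun j => by
    rw [Measure.add_apply, Measure.smul_apply, smul_eq_mul, ENNReal.div_mul_cancel' _ fun h =>
      absurd h hκ, add_tsub_cancel_of_le (hν j)]
    intro h0
    rw [h0, Finset.sum_eq_zero_iff] at hmass
    exact hmass j (Finset.mem_univ j)
  have hadm : (fun j => ν j + ((1 - ν j Set.univ) / κ Set.univ) • κ) ∈ partialPlans ρ := by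
    refine ⟨?_, fun j => (huniv j).le⟩
    rw [Finset.sum_add_distrib, ← hsum, ← Finset.sum_smul]
    refine add_le_add le_rfl ?_
    simp_rw [div_eq_mul_inv]
    rw [← Finset.sum_mul, hmass, ← div_eq_mul_inv]
    refine Measure.le_iff.2 fun s _ => ?_
    rw [Measure.smul_apply, smul_eq_mul]
    exact (mul_le_mul_left ENNReal.div_self_le_one _).trans (one_mul _).le
  refine (pcost_le hadm).trans (Finset.sum_le_sum fun j _ => ?_)
  rw [huniv j, tsub_self, zero_mul, add_zero, lintegral_add_measure, lintegral_smul_measure,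
    smul_eq_mul]

/-- Routing the remaining source mass through z makes source and target pay only for their own
distances to z, whatever the matching between them. -/
theorem pcost_top_le_completion_base (hp : 1 ≤ p) {ρ κ : Measure (Fin d → ℝ)}
    {ν : J → Measure (Fin d → ℝ)}
    (hsum : ∑ j, ν j + κ = ρ) (hν : ∀ j, ν j Set.univ ≤ 1)
    (hρ : ρ Set.univ = Fintype.card J) (x : J → Fin d → ℝ) (z : Fin d → ℝ) :
    pcost nrm p ρ (fun _ => ∞) x ≤ ∑ j, ∫⁻ y, gcost nrm p y (x j) ∂ν j +
      2 ^ (p - 1) * (∫⁻ y, gcost nrm p y z ∂κ +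
        ∑ j, (1 - ν j Set.univ) * gcost nrm p (x j) z) := by
  obtain ⟨hmass, hle⟩ := pcost_top_le_completion (nrm := nrm) (p := p) hsum hν hρ x
  have hp0 : 0 ≤ p := by linarith
  refine hle.trans ?_
  rw [Finset.sum_add_distrib]
  refine add_le_add le_rfl ?_
  have hκ : κ Set.univ ≠ ∞ := by
    rw [← hmass]
    exact ENNReal.sum_ne_top.2 fun j _ => (tsub_le_self.trans_lt ENNReal.one_lt_top).ne
  have hone : ∑ j, (1 - ν j Set.univ) / κ Set.univ ≤ 1 := by
    simp_rw [div_eq_mul_inv]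
    rw [← Finset.sum_mul, hmass, ← div_eq_mul_inv]
    exact ENNReal.div_self_le_one
  have hbd : ∀ j, ∫⁻ y, gcost nrm p y (x j) ∂κ ≤
      2 ^ (p - 1) * (∫⁻ y, gcost nrm p y z ∂κ + κ Set.univ * gcost nrm p (x j) z) := fun j => by
    refine (lintegral_mono fun y => gcost_le_add nrm hp y (x j) z).trans ?_
    have hm := measurable_gcost_left nrm hp0 z
    rw [lintegral_const_mul _ (hm.add_const _), lintegral_add_right _ measurable_const,
      lintegral_const, mul_comm (κ Set.univ)]
  calc ∑ j, (1 - ν j Set.univ) / κ Set.univ * ∫⁻ y, gcost nrm p y (x j) ∂κ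
      ≤ ∑ j, (1 - ν j Set.univ) / κ Set.univ *
          (2 ^ (p - 1) * (∫⁻ y, gcost nrm p y z ∂κ + κ Set.univ * gcost nrm p (x j) z)) :=
        Finset.sum_le_sum fun j _ => mul_le_mul_right (hbd j) _
    _ = 2 ^ (p - 1) * ((∑ j, (1 - ν j Set.univ) / κ Set.univ) * ∫⁻ y, gcost nrm p y z ∂κ +
          ∑ j, (1 - ν j Set.univ) / κ Set.univ * κ Set.univ * gcost nrm p (x j) z) := by
        rw [mul_add, Finset.sum_mul, Finset.mul_sum, Finset.mul_sum, ← Finset.sum_add_distrib]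
        refine Finset.sum_congr rfl fun j _ => ?_
        ring
    _ ≤ _ := by
        gcongr with j
        · exact (mul_le_mul_left hone _).trans (one_mul _).le
        · exact div_mul_le_self _ _

/-- For balanced problems with bounded ground cost, charging `D` for missing mass is as good as
forbidding missing mass. -/
theorem pcost_top_le_const {ρ : Measure (Fin d → ℝ)} (hρ : ρ Set.univ = Fintype.card J)
    (x : J → Fin d → ℝ) {D : ℝ≥0∞} (hD : ∀ j, ∀ᵐ y ∂ρ, gcost nrm p y (x j) ≤ D) :
    pcost nrm p ρ (fun _ => ∞) x ≤ pcost nrm p ρ (fun _ => D) x := by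
  refine le_iInf₂ fun ν hν => ?_
  have hfin : IsFiniteMeasure ρ := ⟨by rw [hρ]; exact ENNReal.natCast_lt_top _⟩
  have hfin' : IsFiniteMeasure (∑ j, ν j) := isFiniteMeasure_of_le ρ hν.1
  have hsum : ∑ j, ν j + (ρ - ∑ j, ν j) = ρ := by
    rw [add_comm, Measure.sub_add_cancel_of_le hν.1]
  refine (pcost_top_le_completion hsum hν.2 hρ x).2.trans (Finset.sum_le_sum fun j _ => ?_)
  refine add_le_add le_rfl ?_
  have h1 : ∫⁻ y, gcost nrm p y (x j) ∂(ρ - ∑ j, ν j) ≤ D * (ρ - ∑ j, ν j) Set.univ := by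
    rw [← lintegral_const]
    exact lintegral_mono_ae ((Measure.absolutelyContinuous_of_le Measure.sub_le).ae_le (hD j))
  calc _ ≤ (1 - ν j Set.univ) / (ρ - ∑ j, ν j) Set.univ * (D * (ρ - ∑ j, ν j) Set.univ) := by
        gcongr
    _ = (1 - ν j Set.univ) / (ρ - ∑ j, ν j) Set.univ * (ρ - ∑ j, ν j) Set.univ * D := by ring
    _ ≤ _ := by gcongr; exact div_mul_le_self _ _

/-- Each component is served by a nearly optimal plan for as many units of its own mass as it has
points. Where the supply N * m i falls short the plan is scaled down; the unmet demand and the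
unused supply of the other components meet through z. -/
theorem pcost_mixture_le (hp : 1 ≤ p) {ι : Type*} [Fintype ι] [DecidableEq ι]
    (μ : ι → Measure (Fin d → ℝ)) [∀ i, IsProbabilityMeasure (μ i)] (m : ι → ℝ≥0∞)
    (hm : ∑ i, m i = 1) (l : J → ι) (x : J → Fin d → ℝ) (z : Fin d → ℝ) (c : ι → ℕ)
    (hc : ∀ i, Fintype.card {j // l j = i} = c i) :
    pcost nrm p (∑ i, (Fintype.card J * m i) • μ i) (fun _ => ∞) x ≤
      ∑ i, pcost nrm p ((c i : ℝ≥0∞) • μ i) (fun _ => ∞) (fun j : {j // l j = i} => x j) +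
      2 ^ (p - 1) * (∑ i, (Fintype.card J * m i - c i) * ∫⁻ y, gcost nrm p y z ∂μ i +
        ∑ j, (c (l j) - Fintype.card J * m (l j)) / c (l j) * gcost nrm p (x j) z) := by
  set N : ℝ≥0∞ := (Fintype.card J : ℝ≥0∞) with hN
  by_cases htop : ∑ i, pcost nrm p ((c i : ℝ≥0∞) • μ i) (fun _ => ∞)
      (fun j : {j // l j = i} => x j) = ∞
  · simp [htop]
  have htop' : ∀ i, pcost nrm p ((c i : ℝ≥0∞) • μ i) (fun _ => ∞)
      (fun j : {j // l j = i} => x j) ≠ ∞ := fun i => (ENNReal.sum_ne_top.1 htop) i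
        (Finset.mem_univ i)
  refine ENNReal.le_of_forall_pos_le_add fun ε hε _ => ?_
  set δ : ℝ≥0∞ := ε / (Fintype.card ι + 1 : ℕ) with hδ
  have hδ0 : δ ≠ 0 := ENNReal.div_ne_zero.2 ⟨by exact_mod_cast hε.ne', ENNReal.natCast_ne_top _⟩
  have hδt : δ ≠ ∞ := ENNReal.div_ne_top ENNReal.coe_ne_top (by simp)
  choose ν hν hcost using fun i => exists_planCost_le (nrm := nrm) (p := p)
    ((c i : ℝ≥0∞) • μ i) (fun _ => ∞) (fun j : {j // l j = i} => x j) hδ0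
  have hone : ∀ i (j : {j // l j = i}), ν i j Set.univ = 1 := fun i j => by
    by_contra hne
    have h1 : planCost nrm p (fun _ => ∞) (fun j : {j // l j = i} => x j) (ν i) = ∞ := by
      rw [planCost, ENNReal.sum_eq_top]
      refine ⟨j, Finset.mem_univ j, ?_⟩
      rw [ENNReal.mul_top, add_top]
      exact (tsub_pos_of_lt (lt_of_le_of_ne ((hν i).2 j) hne)).ne'
    have := hcost i
    rw [h1, top_le_iff] at this
    exact ENNReal.add_ne_top.2 ⟨htop' i, hδt⟩ this
  have hsumi : ∀ i, ∑ j, ν i j = (c i : ℝ≥0∞) • μ i := fun i => by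
    have : IsFiniteMeasure (∑ j, ν i j) := ⟨by
      rw [Measure.finsetSum_apply, Finset.sum_congr rfl fun j _ => hone i j]; simp⟩
    refine Measure.eq_of_le_of_measure_univ_eq (hν i).1 ?_
    rw [Measure.finsetSum_apply, Finset.sum_congr rfl fun j _ => hone i j]
    simp [hc]
  -- The fraction of the demand in component i that its own supply cannot meet; truncated
  -- subtraction makes it zero when the supply suffices.
  set u : ι → ℝ≥0∞ := fun i => (c i - N * m i) / c i with hu
  have hu1 : ∀ i, u i ≤ 1 := fun i => ENNReal.div_le_of_le_mul (by simp)
  have hmt : ∀ i, m i ≠ ∞ := fun i => by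
    refine ne_top_of_le_ne_top ENNReal.one_ne_top (hm ▸ ?_)
    exact Finset.single_le_sum (fun _ _ => zero_le) (Finset.mem_univ i)
  have hNm : ∀ i, N * m i ≠ ∞ := fun i => ENNReal.mul_ne_top (ENNReal.natCast_ne_top _) (hmt i)
  have huc : ∀ i, (1 - u i) * c i + (N * m i - c i) = N * m i := fun i => by
    rw [ENNReal.sub_mul fun _ _ => ENNReal.natCast_ne_top _, one_mul]
    have h1 : u i * c i = c i - N * m i := by
      rw [hu]
      refine ENNReal.div_mul_cancel' (fun h => ?_) (fun h => absurd h (ENNReal.natCast_ne_top _))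
      simp [h]
    rw [h1]
    rcases le_total (c i : ℝ≥0∞) (N * m i) with h | h
    · rw [tsub_eq_zero_of_le h, tsub_zero, add_tsub_cancel_of_le h]
    · rw [tsub_eq_zero_of_le h, add_zero, ENNReal.sub_sub_cancel (ENNReal.natCast_ne_top _) h]
  have hplan : ∑ j, (1 - u (l j)) • ν (l j) ⟨j, rfl⟩ + ∑ i, (N * m i - c i) • μ i =
      ∑ i, (N * m i) • μ i := by
    have : ∑ j, (1 - u (l j)) • ν (l j) ⟨j, rfl⟩ = ∑ i, ((1 - u i) * c i) • μ i := by
      rw [← Fintype.sum_fiberwise l]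
      refine Finset.sum_congr rfl fun i _ => ?_
      rw [mul_smul, ← hsumi, Finset.smul_sum]
      refine Finset.sum_congr rfl ?_
      rintro ⟨j, rfl⟩ _
      rfl
    rw [this, ← Finset.sum_add_distrib]
    refine Finset.sum_congr rfl fun i _ => ?_
    rw [← add_smul, huc]
  have huniv : ∀ j, ((1 - u (l j)) • ν (l j) ⟨j, rfl⟩) Set.univ = 1 - u (l j) := fun j => by
    rw [Measure.smul_apply, hone, smul_eq_mul, mul_one]
  have htot : (∑ i, (N * m i) • μ i) Set.univ = Fintype.card J := by
    rw [Measure.finsetSum_apply]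
    simp only [Measure.smul_apply, measure_univ, smul_eq_mul, mul_one]
    rw [← Finset.mul_sum, hm, mul_one]
  refine (pcost_top_le_completion_base hp hplan
    (fun j => (huniv j).le.trans tsub_le_self) htot x z).trans ?_
  rw [add_right_comm]
  refine add_le_add ?_ ?_
  · calc ∑ j, ∫⁻ y, gcost nrm p y (x j) ∂((1 - u (l j)) • ν (l j) ⟨j, rfl⟩)
        ≤ ∑ j, ∫⁻ y, gcost nrm p y (x j) ∂(ν (l j) ⟨j, rfl⟩) := by
          refine Finset.sum_le_sum fun j _ => ?_
          rw [lintegral_smul_measure, smul_eq_mul]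
          exact (mul_le_mul_left tsub_le_self _).trans (one_mul _).le
      _ = ∑ i, planCost nrm p (fun _ => ∞) (fun j : {j // l j = i} => x j) (ν i) := by
          rw [← Fintype.sum_fiberwise l]
          refine Finset.sum_congr rfl fun i _ => ?_
          rw [planCost]
          refine Finset.sum_congr rfl ?_
          rintro ⟨j, rfl⟩ _
          rw [hone]
          simp
      _ ≤ _ := by
          refine (Finset.sum_le_sum fun i _ => hcost i).trans ?_
          rw [Finset.sum_add_distrib]
          gcongr
          rw [Finset.sum_const, Finset.card_univ, nsmul_eq_mul, hδ]
          calc (Fintype.card ι : ℝ≥0∞) * (ε / (Fintype.card ι + 1 : ℕ))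
              ≤ ((Fintype.card ι + 1 : ℕ) : ℝ≥0∞) * (ε / (Fintype.card ι + 1 : ℕ)) := by
                gcongr; simp
            _ = ε := ENNReal.mul_div_cancel (by simp) (ENNReal.natCast_ne_top _)
  · rw [lintegral_finsetSum_measure]
    simp only [lintegral_smul_measure, smul_eq_mul, huniv]
    gcongr with j
    exact (ENNReal.sub_sub_cancel ENNReal.one_ne_top (hu1 _)).le

end Completion

/-! ### Exit costs, measurability, superadditivity and scaling. -/

section ExitCost

variable {d : ℕ} (nrm : Seminorm ℝ (Fin d → ℝ)) (p : ℝ)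

/-- The cheapest cost of moving `x` out of `Q`. -/
noncomputable def exitCost (Q : Set (Fin d → ℝ)) (x : Fin d → ℝ) : ℝ≥0∞ :=
  ⨅ y ∈ Qᶜ, gcost nrm p y x

variable {nrm p}

theorem exitCost_mono {Q Q' : Set (Fin d → ℝ)} (h : Q ⊆ Q') (x : Fin d → ℝ) :
    exitCost nrm p Q x ≤ exitCost nrm p Q' x :=
  biInf_mono (Set.compl_subset_compl.2 h)

theorem exitCost_of_notMem (hp : 0 < p) {Q : Set (Fin d → ℝ)} {x : Fin d → ℝ} (h : x ∉ Q) :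
    exitCost nrm p Q x = 0 :=
  le_antisymm ((iInf₂_le x h).trans (gcost_self nrm hp x).le) zero_le

theorem upperSemicontinuous_exitCost (hp : 0 ≤ p) (Q : Set (Fin d → ℝ)) :
    UpperSemicontinuous (exitCost nrm p Q) := by
  refine upperSemicontinuous_biInf fun y _ => Continuous.upperSemicontinuous ?_
  exact (continuous_gcost nrm hp).comp (by fun_prop : Continuous fun x => (y, x))

/-- Minkowski's inequality in L^p(ν) bounds the function by the continuous `H`, which agrees with it
at the point x. The argument also covers an infinite integral. -/
theorem upperSemicontinuous_lintegral_gcost (hp : 1 ≤ p) (ν : Measure (Fin d → ℝ))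
    [IsFiniteMeasure ν] : UpperSemicontinuous fun x => ∫⁻ y, gcost nrm p y x ∂ν := by
  have hp0 : 0 ≤ p := by linarith
  have hp' : 0 < p := by linarith
  intro x t ht
  let a : (Fin d → ℝ) → ℝ≥0∞ := fun u => ENNReal.ofReal (nrm u)
  have ha : Continuous a := ENNReal.continuous_ofReal.comp (continuous_seminorm nrm)
  have hga : ∀ y x, gcost nrm p y x = a (y - x) ^ p := fun y x => by
    rw [gcost, ENNReal.ofReal_rpow_of_nonneg (apply_nonneg _ _) hp0]
  let H : (Fin d → ℝ) → ℝ≥0∞ := fun x' =>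
    ((∫⁻ y, gcost nrm p y x ∂ν) ^ (1 / p) + a (x - x') * (ν Set.univ) ^ (1 / p)) ^ p
  have hHc : Continuous H := by
    have h1 : Continuous fun x' => a (x - x') * (ν Set.univ) ^ (1 / p) := by
      refine (ENNReal.continuous_mul_const ?_).comp (ha.comp (by fun_prop))
      exact ENNReal.rpow_ne_top_of_nonneg (by positivity) (measure_ne_top _ _)
    exact ENNReal.continuous_rpow_const.comp (continuous_const.add h1)
  have hHx : H x = ∫⁻ y, gcost nrm p y x ∂ν := by
    simp only [H, sub_self]
    have : a 0 = 0 := by simp [a]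
    rw [this, zero_mul, add_zero, ← ENNReal.rpow_mul, one_div, inv_mul_cancel₀ hp'.ne',
      ENNReal.rpow_one]
  have hle : ∀ x', ∫⁻ y, gcost nrm p y x' ∂ν ≤ H x' := fun x' => by
    have hm : Measurable fun y => a (y - x) :=
      (ha.comp (by fun_prop : Continuous fun y => y - x)).measurable
    have h1 := ENNReal.lintegral_Lp_add_le (μ := ν) (p := p) (f := fun y => a (y - x))
      (g := fun _ => a (x - x')) hm.aemeasurable aemeasurable_const hp
    have h2 : ∫⁻ y, gcost nrm p y x' ∂ν ≤
        ∫⁻ y, ((fun y => a (y - x)) + (fun _ => a (x - x') : (Fin d → ℝ) → ℝ≥0∞)) y ^ p ∂ν := by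
      refine lintegral_mono fun y => ?_
      rw [hga]
      refine ENNReal.rpow_le_rpow ?_ hp0
      simp only [a, Pi.add_apply]
      rw [← ENNReal.ofReal_add (apply_nonneg _ _) (apply_nonneg _ _)]
      refine ENNReal.ofReal_le_ofReal ?_
      have : y - x' = (y - x) + (x - x') := by abel
      rw [this]
      exact map_add_le_add _ _ _
    refine h2.trans ?_
    rw [← ENNReal.rpow_le_rpow_iff (one_div_pos.2 hp')]
    refine h1.trans ?_
    simp only [H]
    rw [← ENNReal.rpow_mul _ p, mul_one_div_cancel hp'.ne', ENNReal.rpow_one]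
    simp only [hga, lintegral_const]
    rw [ENNReal.mul_rpow_of_nonneg _ _ (by positivity), ← ENNReal.rpow_mul,
      mul_one_div_cancel hp'.ne', ENNReal.rpow_one]
  have hev : ∀ᶠ x' in 𝓝 x, H x' < t := hHc.continuousAt.eventually_lt continuousAt_const
    (by rw [hHx]; exact ht)
  exact hev.mono fun x' hx' => (hle x').trans_lt hx'

/-- The infimum runs over uncountably many plans, so measurability of the single costs would not be
enough. Upper semicontinuity survives arbitrary infima. -/
theorem measurable_pcost (hp : 1 ≤ p) {J : Type*} [Fintype J] (ρ : Measure (Fin d → ℝ))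
    {w : (Fin d → ℝ) → ℝ≥0∞} (hw : UpperSemicontinuous w) :
    Measurable fun x : J → Fin d → ℝ => pcost nrm p ρ w x := by
  refine UpperSemicontinuous.measurable ?_
  refine upperSemicontinuous_biInf fun ν hν => ?_
  refine upperSemicontinuous_sum fun j _ => ?_
  have : IsFiniteMeasure (ν j) := ⟨(hν.2 j).trans_lt ENNReal.one_lt_top⟩
  refine UpperSemicontinuous.add ?_ ?_
  · exact (upperSemicontinuous_lintegral_gcost hp (ν j)).comp (continuous_apply j)
  · have h1 : Continuous fun t : ℝ≥0∞ => (1 - ν j Set.univ) * t :=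
      ENNReal.continuous_const_mul (tsub_le_self.trans_lt ENNReal.one_lt_top).ne
    exact h1.comp_upperSemicontinuous (hw.comp (continuous_apply j))
      fun a b hab => mul_le_mul_right hab _

/-- Superadditivity: if leaving each of the disjoint sets `Q i` is charged at the cheapest exit
cost, then the separate costs add up to at most the total cost. -/
theorem sum_pcost_restrict_le (hp : 0 < p) {J : Type*} [Fintype J] {ι : Type*} (s : Finset ι)
    (ρ : Measure (Fin d → ℝ)) (Q : ι → Set (Fin d → ℝ)) (hQ : ∀ i ∈ s, MeasurableSet (Q i))
    (hdisj : (s : Set ι).PairwiseDisjoint Q) {w : (Fin d → ℝ) → ℝ≥0∞}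
    (hw : ∀ i ∈ s, ∀ x, exitCost nrm p (Q i) x ≤ w x) (x : J → Fin d → ℝ) :
    ∑ i ∈ s, pcost nrm p (ρ.restrict (Q i)) (exitCost nrm p (Q i)) x ≤ pcost nrm p ρ w x := by
  classical
  refine le_iInf₂ fun ν hν => ?_
  have hstep : ∀ i ∈ s, pcost nrm p (ρ.restrict (Q i)) (exitCost nrm p (Q i)) x ≤
      ∑ j, if x j ∈ Q i then
        ∫⁻ y, gcost nrm p y (x j) ∂ν j + (1 - ν j Set.univ) * w (x j) else 0 := by
    intro i hi
    -- The plan for Q i keeps what moves inside Q i. Points outside Q i receive nothing, since their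
    -- exit cost is zero.
    have hadm : (fun j => if x j ∈ Q i then (ν j).restrict (Q i) else 0) ∈
        partialPlans (ρ.restrict (Q i)) := by
      constructor
      · calc ∑ j, (if x j ∈ Q i then (ν j).restrict (Q i) else 0)
            ≤ ∑ j, (ν j).restrict (Q i) := Finset.sum_le_sum fun j _ => by
              split_ifs
              · exact le_rfl
              · exact Measure.zero_le _
          _ = (∑ j, ν j).restrict (Q i) := by
              rw [← Measure.restrictₗ_apply, map_sum]; rfl
          _ ≤ _ := Measure.restrict_mono le_rfl hν.1
      · intro j
        dsimp only
        split_ifs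
        · exact (Measure.restrict_le_self _).trans (hν.2 j)
        · simp
    refine (pcost_le hadm).trans (Finset.sum_le_sum fun j _ => ?_)
    by_cases hx : x j ∈ Q i
    · simp only [hx, if_true]
      have hcompl : MeasurableSet (Q i)ᶜ := (hQ i hi).compl
      rw [← lintegral_add_compl (μ := ν j) _ (hQ i hi), add_assoc]
      refine add_le_add le_rfl ?_
      -- Mass that came from outside Q i has already paid at least the exit cost, so it can be
      -- counted as missing mass.
      have h1 : 1 - ((ν j).restrict (Q i)) Set.univ ≤ ν j (Q i)ᶜ + (1 - ν j Set.univ) := by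
        rw [Measure.restrict_apply_univ, tsub_le_iff_right, add_right_comm,
          add_comm (ν j (Q i)ᶜ), measure_add_measure_compl (hQ i hi)]
        exact le_add_tsub
      refine (mul_le_mul_left h1 _).trans ?_
      rw [add_mul]
      refine add_le_add ?_ (mul_le_mul_right (hw i hi _) _)
      rw [mul_comm, ← setLIntegral_const]
      exact setLIntegral_mono' hcompl fun y hy => iInf₂_le y hy
    · simp [hx, exitCost_of_notMem hp hx]
  refine (Finset.sum_le_sum hstep).trans ?_
  rw [Finset.sum_comm, planCost]
  refine Finset.sum_le_sum fun j _ => ?_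
  by_cases hex : ∃ i ∈ s, x j ∈ Q i
  · obtain ⟨i, hi, hxi⟩ := hex
    rw [Finset.sum_eq_single_of_mem i hi, if_pos hxi]
    intro k hk hki
    rw [if_neg]
    intro hxk
    exact Set.disjoint_left.1 (hdisj hk hi hki) hxk hxi
  · push Not at hex
    rw [Finset.sum_eq_zero fun i hi => if_neg (hex i hi)]
    exact zero_le

/-- Behaviour of the cost under dilations and translations. -/
theorem pcost_map_le (hp : 0 ≤ p) {J : Type*} [Fintype J] (ρ : Measure (Fin d → ℝ)) {s : ℝ}
    (hs : 0 < s) (z : Fin d → ℝ) {w w' : (Fin d → ℝ) → ℝ≥0∞}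
    (hw : ∀ y, w (s • y + z) ≤ ENNReal.ofReal (s ^ p) * w' y) (x : J → Fin d → ℝ) :
    pcost nrm p (ρ.map fun y => s • y + z) w (fun j => s • x j + z) ≤
      ENNReal.ofReal (s ^ p) * pcost nrm p ρ w' x := by
  have hmT : Measurable fun y : Fin d → ℝ => s • y + z := by fun_prop
  have h0 : ENNReal.ofReal (s ^ p) ≠ 0 := by
    rw [Ne, ENNReal.ofReal_eq_zero, not_le]; positivity
  have h1 : ENNReal.ofReal (s ^ p) * pcost nrm p ρ w' x =
      ⨅ ν ∈ partialPlans (J := J) ρ, ENNReal.ofReal (s ^ p) * planCost nrm p w' x ν := by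
    rw [pcost, ENNReal.mul_iInf_of_ne h0 ENNReal.ofReal_ne_top]
    exact iInf_congr fun ν => ENNReal.mul_iInf_of_ne h0 ENNReal.ofReal_ne_top
  rw [h1]
  refine le_iInf₂ fun ν hν => ?_
  have hadm : (fun j => (ν j).map fun y => s • y + z) ∈
      partialPlans (ρ.map fun y => s • y + z) := by
    constructor
    · have : ∑ j, (ν j).map (fun y => s • y + z) = (∑ j, ν j).map fun y => s • y + z := by
        rw [← Measure.mapₗ_apply_of_measurable hmT, map_sum]
        simp [Measure.mapₗ_apply_of_measurable hmT]
      rw [this]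
      exact Measure.map_mono hν.1 hmT
    · intro j
      rw [Measure.map_apply hmT MeasurableSet.univ]
      exact hν.2 j
  refine (pcost_le hadm).trans ?_
  rw [planCost, planCost, Finset.mul_sum]
  refine Finset.sum_le_sum fun j _ => ?_
  rw [lintegral_map (measurable_gcost_left nrm hp _) hmT, mul_add,
    Measure.map_apply hmT MeasurableSet.univ, Set.preimage_univ]
  refine add_le_add (le_of_eq ?_) ?_
  · rw [← lintegral_const_mul _ (measurable_gcost_left nrm hp _)]
    refine lintegral_congr fun y => ?_
    exact gcost_smul_add nrm hs.le z y _
  · rw [mul_left_comm]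
    exact mul_le_mul_right (hw _) _

end ExitCost

/-! ### Binomial averages as a recursion over a commutative semiring. -/

section Binomial

variable {R : Type*} [CommSemiring R]

/-- The average of `φ` over the number of successes in `N` trials with weights `a` for success and
`b` for failure. -/
def binomAvg (a b : R) : (ℕ → R) → ℕ → R
  | φ, 0 => φ 0
  | φ, N + 1 => a * binomAvg a b (fun n => φ (n + 1)) N + b * binomAvg a b φ N

theorem binomAvg_add (a b : R) (φ ψ : ℕ → R) (N : ℕ) :
    binomAvg a b (fun n => φ n + ψ n) N = binomAvg a b φ N + binomAvg a b ψ N := by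
  induction N generalizing φ ψ with
  | zero => rfl
  | succ N ih => simp only [binomAvg, ih]; ring

theorem binomAvg_const_mul (a b c : R) (φ : ℕ → R) (N : ℕ) :
    binomAvg a b (fun n => c * φ n) N = c * binomAvg a b φ N := by
  induction N generalizing φ with
  | zero => rfl
  | succ N ih => simp only [binomAvg, ih]; ring

theorem binomAvg_sum {ι : Type*} (s : Finset ι) (a b : R) (φ : ι → ℕ → R) (N : ℕ) :
    binomAvg a b (fun n => ∑ i ∈ s, φ i n) N = ∑ i ∈ s, binomAvg a b (φ i) N := by
  induction N generalizing φ with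
  | zero => rfl
  | succ N ih => simp only [binomAvg, ih, Finset.sum_add_distrib, Finset.mul_sum]

theorem binomAvg_const {a b : R} (h : a + b = 1) (c : R) (N : ℕ) :
    binomAvg a b (fun _ => c) N = c := by
  induction N with
  | zero => rfl
  | succ N ih => simp only [binomAvg, ih, ← add_mul, h, one_mul]

theorem binomAvg_zero_one (φ : ℕ → R) (N : ℕ) : binomAvg 0 1 φ N = φ 0 := by
  induction N with
  | zero => rfl
  | succ N ih => simp [binomAvg, ih]

/-- Thinning a binomial number of successes again gives a binomial number; a trial now fails at
either stage, hence the weight b + a * b'. This is what lets cells be subdivided repeatedly. -/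
theorem binomAvg_comp (a b a' b' : R) (φ : ℕ → R) (N : ℕ) :
    binomAvg a b (binomAvg a' b' φ) N = binomAvg (a * a') (b + a * b') φ N := by
  induction N generalizing φ with
  | zero => rfl
  | succ N ih =>
    have h : (fun n => binomAvg a' b' φ (n + 1)) = fun n =>
        a' * binomAvg a' b' (fun k => φ (k + 1)) n + b' * binomAvg a' b' φ n := rfl
    simp only [binomAvg]
    rw [binomAvg_add, binomAvg_const_mul, binomAvg_const_mul, ih, ih]
    ring

theorem binomAvg_cast {a b : R} (h : a + b = 1) (N : ℕ) :
    binomAvg a b (fun n => (n : R)) N = N * a := by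
  induction N with
  | zero => simp [binomAvg]
  | succ N ih =>
    have h1 := binomAvg_add a b (fun n => (n : R)) (fun _ => 1) N
    rw [ih, binomAvg_const h] at h1
    simp only [binomAvg, Nat.cast_add, Nat.cast_one, h1, ih]
    calc a * (N * a + 1) + b * (N * a) = (a + b) * (N * a) + a := by ring
      _ = _ := by rw [h]; ring

/-- The N-fold product of a mixture expands into a sum over label sequences. A function of the
number of labels i alone sees only the binomial law of that number. -/
theorem sum_prod_count {ι : Type*} [Fintype ι] [DecidableEq ι] (m : ι → R) (i : ι)
    (φ : ℕ → R) (N : ℕ) :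
    ∑ l : Fin N → ι, (∏ j, m (l j)) * φ (Fintype.card {j // l j = i}) =
      binomAvg (m i) (∑ k ∈ Finset.univ.erase i, m k) φ N := by
  induction N generalizing φ with
  | zero => simp [binomAvg]
  | succ N ih =>
    have hcard : ∀ (k : ι) (l : Fin N → ι),
        Fintype.card {j // (Fin.cons k l : Fin (N + 1) → ι) j = i} =
          Fintype.card {j // l j = i} + if k = i then 1 else 0 := fun k l => by
      rw [Fintype.card_subtype, Fintype.card_subtype, Fin.card_filter_univ_succ]
      by_cases h : k = i <;> simp [h]
    rw [← (Fin.consEquiv fun _ => ι).sum_comp, Fintype.sum_prod_type]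
    have hk : ∀ k : ι, ∑ l : Fin N → ι, (∏ j, m ((Fin.consEquiv fun _ => ι) (k, l) j)) *
        φ (Fintype.card {j // (Fin.consEquiv fun _ => ι) (k, l) j = i}) =
        m k * binomAvg (m i) (∑ k ∈ Finset.univ.erase i, m k)
          (fun n => φ (n + if k = i then 1 else 0)) N := fun k => by
      rw [← ih, Finset.mul_sum]
      refine Finset.sum_congr rfl fun l _ => ?_
      change (∏ j, m ((Fin.cons k l : Fin (N + 1) → ι) j)) *
        φ (Fintype.card {j // (Fin.cons k l : Fin (N + 1) → ι) j = i}) = _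
      rw [hcard, Fin.prod_univ_succ]
      simp [mul_assoc]
    rw [Finset.sum_congr rfl fun k _ => hk k, ← Finset.add_sum_erase _ _ (Finset.mem_univ i),
      binomAvg, Finset.sum_mul]
    congr 1
    · simp
    · refine Finset.sum_congr rfl fun k hk => ?_
      simp [Finset.ne_of_mem_erase hk]

end Binomial

/-! ### Inequalities for binomial averages: mean deviation and concave powers. -/

section BinomialReal

theorem binomAvg_mono_real {a b : ℝ} (ha : 0 ≤ a) (hb : 0 ≤ b) {φ ψ : ℕ → ℝ} (h : ∀ n, φ n ≤ ψ n)
    (N : ℕ) : binomAvg a b φ N ≤ binomAvg a b ψ N := by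
  induction N generalizing φ ψ with
  | zero => exact h 0
  | succ N ih =>
    exact add_le_add (mul_le_mul_of_nonneg_left (ih fun n => h (n + 1)) ha)
      (mul_le_mul_of_nonneg_left (ih h) hb)

theorem binomAvg_mono {a b : ℝ≥0∞} {φ ψ : ℕ → ℝ≥0∞} (h : ∀ n, φ n ≤ ψ n)
    (N : ℕ) : binomAvg a b φ N ≤ binomAvg a b ψ N := by
  induction N generalizing φ ψ with
  | zero => exact h 0
  | succ N ih =>
    exact add_le_add (mul_le_mul_right (ih fun n => h (n + 1)) _) (mul_le_mul_right (ih h) _)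

theorem binomAvg_ofReal {a b : ℝ} (ha : 0 ≤ a) (hb : 0 ≤ b) {φ : ℕ → ℝ} (h : ∀ n, 0 ≤ φ n)
    (N : ℕ) : 0 ≤ binomAvg a b φ N ∧
      binomAvg (ENNReal.ofReal a) (ENNReal.ofReal b) (fun n => ENNReal.ofReal (φ n)) N =
      ENNReal.ofReal (binomAvg a b φ N) := by
  induction N generalizing φ with
  | zero => exact ⟨h 0, rfl⟩
  | succ N ih =>
    obtain ⟨h1, h2⟩ := ih fun n => h (n + 1)
    obtain ⟨h3, h4⟩ := ih h
    refine ⟨by simp only [binomAvg]; positivity, ?_⟩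
    simp only [binomAvg]
    rw [h2, h4, ENNReal.ofReal_add (by positivity) (by positivity), ENNReal.ofReal_mul ha,
      ENNReal.ofReal_mul hb]

theorem binomAvg_sq {a : ℝ} (N : ℕ) :
    binomAvg a (1 - a) (fun n => ((n : ℝ) - N * a) ^ 2) N = N * a * (1 - a) := by
  have hab : a + (1 - a) = 1 := by ring
  have hsq : ∀ N : ℕ, binomAvg a (1 - a) (fun n => (n : ℝ) ^ 2) N =
      N * a * (1 - a) + (N * a) ^ 2 := by
    intro N
    induction N with
    | zero => simp [binomAvg]
    | succ N ih =>
      have h1 : (fun n : ℕ => ((n + 1 : ℕ) : ℝ) ^ 2) =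
          fun n : ℕ => ((n : ℝ) ^ 2 + 2 * (n : ℝ)) + 1 := by
        funext n; push_cast; ring
      rw [binomAvg, h1, binomAvg_add, binomAvg_add, binomAvg_const_mul, ih, binomAvg_cast hab,
        binomAvg_const hab]
      push_cast
      ring
  have h2 : (fun n : ℕ => ((n : ℝ) - N * a) ^ 2) =
      fun n : ℕ => ((n : ℝ) ^ 2 + (-2 * (N * a)) * (n : ℝ)) + (N * a) ^ 2 := by
    funext n; ring
  rw [h2, binomAvg_add, binomAvg_add, binomAvg_const_mul, hsq, binomAvg_cast hab,
    binomAvg_const hab]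
  ring

/-- Cauchy-Schwarz against the variance, in the pointwise form |t| ≤ t ^ 2 / (2 s) + s / 2 with s =
√(N a), which needs only linearity and monotonicity of the average. -/
theorem binomAvg_abs_le_sqrt {a : ℝ} (ha : 0 ≤ a) (ha1 : a ≤ 1) (N : ℕ) :
    binomAvg a (1 - a) (fun n => |(n : ℝ) - N * a|) N ≤ Real.sqrt (N * a) := by
  have hab : a + (1 - a) = 1 := by ring
  rcases eq_or_lt_of_le (show 0 ≤ N * a by positivity) with h0 | h0
  · rcases mul_eq_zero.1 h0.symm with h | h
    · have : N = 0 := by exact_mod_cast h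
      subst this
      simp [binomAvg]
    · subst h
      rw [sub_zero, binomAvg_zero_one]
      simp
  · set s := Real.sqrt (N * a) with hs
    have hs0 : 0 < s := Real.sqrt_pos.2 h0
    have hs2 : s * s = N * a := Real.mul_self_sqrt h0.le
    have hpt : ∀ n : ℕ, |(n : ℝ) - N * a| ≤ (1 / (2 * s)) * ((n : ℝ) - N * a) ^ 2 + s / 2 := by
      intro n
      set t := |(n : ℝ) - N * a| with ht
      have h2 : ((n : ℝ) - N * a) ^ 2 = t ^ 2 := (sq_abs _).symm
      rw [h2]
      have h3 : 1 / (2 * s) * t ^ 2 + s / 2 - t = (t - s) ^ 2 / (2 * s) := by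
        field_simp; ring
      have h4 : 0 ≤ (t - s) ^ 2 / (2 * s) := by positivity
      linarith
    refine (binomAvg_mono_real ha (by linarith) hpt N).trans ?_
    rw [binomAvg_add, binomAvg_const_mul, binomAvg_sq, binomAvg_const hab, ← hs2]
    have : 1 / (2 * s) * (s * s * (1 - a)) + s / 2 = s - s * a / 2 := by
      field_simp; ring
    rw [this]
    have : 0 ≤ s * a / 2 := by positivity
    linarith

/-- Jensen's inequality for the concave power: Bernoulli's inequality provides the tangent line at
the mean, and the average of an affine function is explicit. -/
theorem binomAvg_rpow_le {a : ℝ} (ha : 0 ≤ a) (ha1 : a ≤ 1) {c θ : ℝ} (hc : 0 ≤ c) (hθ : 0 < θ)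
    (hθ1 : θ ≤ 1) (N : ℕ) :
    binomAvg a (1 - a) (fun n => ((n : ℝ) * c) ^ θ) N ≤ (N * a * c) ^ θ := by
  have hab : a + (1 - a) = 1 := by ring
  rcases eq_or_lt_of_le (show 0 ≤ N * a * c by positivity) with h0 | h0
  · rcases mul_eq_zero.1 h0.symm with h | h
    · rcases mul_eq_zero.1 h with h | h
      · have : N = 0 := by exact_mod_cast h
        subst this
        simp [binomAvg]
      · subst h
        rw [sub_zero, binomAvg_zero_one]
        simp
    · subst h
      simp only [mul_zero]
      rw [binomAvg_const hab]
  · set b := N * a * c with hb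
    have hpt : ∀ n : ℕ, ((n : ℝ) * c) ^ θ ≤ (b ^ θ * θ * b⁻¹ * c) * (n : ℝ) +
        b ^ θ * (1 - θ) := by
      intro n
      have h1 := _root_.rpow_one_add_le_one_add_mul_self (s := n * c / b - 1)
        (by have : 0 ≤ (n:ℝ) * c / b := by positivity
            linarith) hθ.le hθ1
      have h2 : 1 + ((n : ℝ) * c / b - 1) = n * c / b := by ring
      rw [h2, Real.div_rpow (by positivity) h0.le, div_le_iff₀ (by positivity)] at h1
      refine h1.trans (le_of_eq ?_)
      field_simp
      ring
    refine (binomAvg_mono_real ha (by linarith) hpt N).trans (le_of_eq ?_)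
    rw [binomAvg_add, binomAvg_const_mul, binomAvg_cast hab, binomAvg_const hab]
    have : b ^ θ * θ * b⁻¹ * c * (N * a) = b ^ θ * θ * (b⁻¹ * b) := by rw [hb]; ring
    rw [this, inv_mul_cancel₀ h0.ne']
    ring

/-- The mean absolute deviation of a binomial random variable. -/
noncomputable def binomDev (N : ℕ) (m : ℝ≥0∞) : ℝ≥0∞ :=
  binomAvg m (1 - m) (fun n => (N * m - n) + (n - N * m)) N

theorem ennreal_tsub_add_tsub {a b : ℝ} (ha : 0 ≤ a) (hb : 0 ≤ b) :
    (ENNReal.ofReal a - ENNReal.ofReal b) + (ENNReal.ofReal b - ENNReal.ofReal a) =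
      ENNReal.ofReal |b - a| := by
  rw [← ENNReal.ofReal_sub _ hb, ← ENNReal.ofReal_sub _ ha]
  rcases le_total a b with h | h
  · rw [ENNReal.ofReal_of_nonpos (by linarith : a - b ≤ 0), zero_add,
      abs_of_nonneg (by linarith)]
  · rw [ENNReal.ofReal_of_nonpos (by linarith : b - a ≤ 0), add_zero,
      abs_of_nonpos (by linarith), neg_sub]

theorem binomAvg_abs_ennreal {m : ℝ≥0∞} (hm : m ≤ 1) (N : ℕ) :
    binomDev N m ≤ ENNReal.ofReal (Real.sqrt (N * m.toReal)) ∧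
      binomDev N m ≤ ENNReal.ofReal (2 * (N * m.toReal)) := by
  obtain ⟨a, rfl⟩ : ∃ a : ℝ≥0, m = a := ⟨m.toNNReal, (ENNReal.coe_toNNReal
    (hm.trans_lt ENNReal.one_lt_top).ne).symm⟩
  have ha : (0 : ℝ) ≤ a := a.2
  have ha1 : (a : ℝ) ≤ 1 := by exact_mod_cast hm
  have h1 : binomDev N (a : ℝ≥0∞) =
      ENNReal.ofReal (binomAvg (a : ℝ) (1 - a) (fun n => |(n : ℝ) - N * a|) N) := by
    rw [← (binomAvg_ofReal ha (by linarith) (fun n => abs_nonneg _) N).2, binomDev,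
      ENNReal.ofReal_sub _ ha, ENNReal.ofReal_one, ENNReal.ofReal_coe_nnreal]
    congr 1
    funext n
    have := ennreal_tsub_add_tsub (a := N * a) (b := n) (by positivity) (by positivity)
    rw [← this, ENNReal.ofReal_mul (by positivity)]
    simp
  rw [h1, ENNReal.coe_toReal]
  refine ⟨ENNReal.ofReal_le_ofReal (binomAvg_abs_le_sqrt ha ha1 N), ENNReal.ofReal_le_ofReal ?_⟩
  have h2 : ∀ n : ℕ, |(n : ℝ) - N * a| ≤ n + N * a := fun n =>
    (abs_sub _ _).trans (by rw [abs_of_nonneg (by positivity), abs_of_nonneg (by positivity)])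
  refine (binomAvg_mono_real ha (by linarith) h2 N).trans (le_of_eq ?_)
  rw [binomAvg_add, binomAvg_cast (by ring), binomAvg_const (by ring)]
  ring

theorem binomDev_le_half {m : ℝ≥0∞} (hm : m ≤ 1) (N : ℕ) :
    binomDev N m ≤ (N * m) ^ (1 / 2 : ℝ) := by
  refine (binomAvg_abs_ennreal hm N).1.trans (le_of_eq ?_)
  have hm' : m ≠ ∞ := (hm.trans_lt ENNReal.one_lt_top).ne
  rw [Real.sqrt_eq_rpow, ← ENNReal.ofReal_rpow_of_nonneg (by positivity) (by norm_num),
    ENNReal.ofReal_mul (by positivity), ENNReal.ofReal_toReal hm', ENNReal.ofReal_natCast]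

theorem binomDev_le_two_mul {m : ℝ≥0∞} (hm : m ≤ 1) (N : ℕ) :
    binomDev N m ≤ 2 * (N * m) := by
  refine (binomAvg_abs_ennreal hm N).2.trans (le_of_eq ?_)
  have hm' : m ≠ ∞ := (hm.trans_lt ENNReal.one_lt_top).ne
  rw [ENNReal.ofReal_mul (by positivity), ENNReal.ofReal_mul (by positivity),
    ENNReal.ofReal_toReal hm', ENNReal.ofReal_natCast]
  simp

/-- The linear bound is used when the mean is at most one, the square root bound otherwise. Cells
use the exponent 1/2, shells 1 - p/d, and the far tail 1. -/
theorem binomDev_le_rpow {m : ℝ≥0∞} (hm : m ≤ 1) (N : ℕ) {θ : ℝ} (hθ : 1 / 2 ≤ θ) (hθ1 : θ ≤ 1) :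
    binomDev N m ≤ 2 * (N * m) ^ θ := by
  rcases le_total (N * m) 1 with h | h
  · refine (binomDev_le_two_mul hm N).trans ?_
    gcongr
    conv_lhs => rw [← ENNReal.rpow_one (N * m)]
    exact ENNReal.rpow_le_rpow_of_exponent_ge h hθ1
  · refine (binomDev_le_half hm N).trans ?_
    refine (ENNReal.rpow_le_rpow_of_exponent_le h hθ).trans ?_
    rw [two_mul]
    exact le_self_add

theorem binomAvg_rpow_le_ennreal {m c : ℝ≥0∞} (hm : m ≤ 1) (hc : c ≠ ∞) {θ : ℝ} (hθ : 0 < θ)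
    (hθ1 : θ ≤ 1) (N : ℕ) :
    binomAvg m (1 - m) (fun n => (n * c) ^ θ) N ≤ (N * m * c) ^ θ := by
  have hm' : m ≠ ∞ := (hm.trans_lt ENNReal.one_lt_top).ne
  lift m to ℝ≥0 using hm'
  lift c to ℝ≥0 using hc
  have ha : (0 : ℝ) ≤ m := m.2
  have ha1 : (m : ℝ) ≤ 1 := by exact_mod_cast hm
  have hcast : ∀ x : ℝ≥0, ((x : ℝ≥0∞)) ^ θ = ENNReal.ofReal ((x : ℝ) ^ θ) := fun x => by
    rw [← ENNReal.ofReal_rpow_of_nonneg (NNReal.coe_nonneg x) hθ.le, ENNReal.ofReal_coe_nnreal]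
  have h1 : binomAvg (m : ℝ≥0∞) (1 - m) (fun n => ((n : ℝ≥0∞) * c) ^ θ) N =
      ENNReal.ofReal (binomAvg (m : ℝ) (1 - m) (fun n => ((n : ℝ) * c) ^ θ) N) := by
    rw [← (binomAvg_ofReal ha (by linarith) (fun n => by positivity) N).2,
      ENNReal.ofReal_sub _ ha, ENNReal.ofReal_one, ENNReal.ofReal_coe_nnreal]
    congr 1
    funext n
    have := hcast (n * c)
    push_cast at this
    exact this
  have h2 := hcast (N * m * c)
  push_cast at h2
  rw [h1, h2]
  exact ENNReal.ofReal_le_ofReal (binomAvg_rpow_le ha ha1 c.2 hθ hθ1 N)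

end BinomialReal

/-! ### Product measures: mixtures, marginals and coupling. -/

section ProductMeasure

variable {E : Type*} [MeasurableSpace E] {J : Type*} [Fintype J]

theorem pi_sum {ι : Type*} [Fintype ι] [DecidableEq J] (ν : ι → Measure E)
    [∀ i, IsFiniteMeasure (ν i)] :
    Measure.pi (fun _ : J => ∑ i, ν i) = ∑ l : J → ι, Measure.pi fun j => ν (l j) := by
  refine Measure.pi_eq fun s _ => ?_
  rw [Measure.finsetSum_apply]
  simp only [Measure.pi_pi, Measure.finsetSum_apply]
  rw [Finset.prod_univ_sum, Fintype.piFinset_univ]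

theorem pi_smul (c : J → ℝ≥0∞) (hc : ∀ j, c j ≠ ∞) (μ : J → Measure E)
    [∀ j, IsFiniteMeasure (μ j)] :
    Measure.pi (fun j => c j • μ j) = (∏ j, c j) • Measure.pi μ := by
  have : ∀ j, IsFiniteMeasure (c j • μ j) := fun j => Measure.smul_finite _ (hc j)
  refine Measure.pi_eq fun s _ => ?_
  simp [Measure.pi_pi, Finset.prod_mul_distrib]

theorem pi_map_comp {J' : Type*} [Fintype J'] (μ : J → Measure E)
    [∀ j, IsProbabilityMeasure (μ j)] {e : J' → J} (he : Function.Injective e) :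
    (Measure.pi μ).map (fun x => x ∘ e) = Measure.pi fun j => μ (e j) := by
  classical
  refine (Measure.pi_eq fun s hs => ?_).symm
  have hm : Measurable fun x : J → E => x ∘ e := by
    refine measurable_pi_lambda _ fun j => measurable_pi_apply _
  rw [Measure.map_apply hm (MeasurableSet.univ_pi hs)]
  let t : J → Set E := fun j => if h : ∃ k, e k = j then s h.choose else Set.univ
  have ht : ∀ k, t (e k) = s k := fun k => by
    have h : ∃ k', e k' = e k := ⟨k, rfl⟩
    simp only [t, dif_pos h]
    rw [he h.choose_spec]
  have hpre : (fun x : J → E => x ∘ e) ⁻¹' Set.univ.pi s = Set.univ.pi t := by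
    ext x
    simp only [Set.mem_preimage, Set.mem_univ_pi, Function.comp]
    constructor
    · intro h j
      by_cases hj : ∃ k, e k = j
      · obtain ⟨k, rfl⟩ := hj
        rw [ht]; exact h k
      · simp [t, hj]
    · intro h k
      rw [← ht]; exact h _
  rw [hpre, Measure.pi_pi]
  calc ∏ j, μ j (t j) = ∏ j ∈ Finset.univ.image e, μ j (t j) := by
        refine (Finset.prod_subset (Finset.subset_univ _) fun j _ hj => ?_).symm
        have : ¬ ∃ k, e k = j := by simpa using hj
        simp [t, this]
    _ = ∏ k, μ (e k) (t (e k)) := Finset.prod_image fun a _ b _ h => he h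
    _ = _ := by simp only [ht]

/-- Comparison of two product measures whose factors share the part `ω`. -/
theorem lintegral_pi_le_add_of_common [MeasurableEq E] {ω α β P P' : Measure E}
    [IsProbabilityMeasure P] [IsProbabilityMeasure P'] (hP : P = ω + α) (hP' : P' = ω + β)
    {w : E → ℝ≥0∞} (hw : Measurable w) {F : (J → E) → ℝ≥0∞} (hF : Measurable F)
    (hFw : ∀ x x', F x' ≤ F x + ∑ j, ({z : E × E | z.1 ≠ z.2}.indicator (fun z => w z.2))
      (x j, x' j)) :
    ∫⁻ x, F x ∂(Measure.pi fun _ : J => P') ≤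
      ∫⁻ x, F x ∂(Measure.pi fun _ : J => P) + Fintype.card J * ∫⁻ y, w y ∂β := by
  have hωα : IsFiniteMeasure (ω + α) := hP ▸ inferInstance
  have hωβ : IsFiniteMeasure (ω + β) := hP' ▸ inferInstance
  have hω : IsFiniteMeasure ω := isFiniteMeasure_of_le (ω + α) (Measure.le_add_right le_rfl)
  have hα : IsFiniteMeasure α := isFiniteMeasure_of_le (ω + α) (Measure.le_add_left le_rfl)
  have hβ : IsFiniteMeasure β := isFiniteMeasure_of_le (ω + β) (Measure.le_add_left le_rfl)
  have hmass : α Set.univ = β Set.univ := by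
    have h1 : ω Set.univ + α Set.univ = 1 := by rw [← Measure.add_apply, ← hP, measure_univ]
    have h2 : ω Set.univ + β Set.univ = 1 := by rw [← Measure.add_apply, ← hP', measure_univ]
    exact (ENNReal.add_right_inj (measure_ne_top ω _)).1 (h1.trans h2.symm)
  set t := α Set.univ with ht
  have htt : t ≠ ∞ := measure_ne_top _ _
  -- The coupling of P and P' keeps the common part on the diagonal and joins the remainders
  -- independently; t is their common mass. When t = 0 both remainders vanish, so t⁻¹ is harmless.
  set π : Measure (E × E) := ω.map (fun y => (y, y)) + t⁻¹ • α.prod β with hπ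
  have hmd : Measurable fun y : E => (y, y) := by fun_prop
  have hfst : π.map Prod.fst = P := by
    rw [hπ, Measure.map_add _ _ measurable_fst, Measure.map_map measurable_fst hmd,
      Measure.map_smul, Measure.map_fst_prod, hP, ← hmass, smul_smul]
    congr 1
    · exact Measure.map_id
    · by_cases h0 : t = 0
      · rw [Measure.measure_univ_eq_zero.1 h0, smul_zero]
      · rw [ENNReal.inv_mul_cancel h0 htt, one_smul]
  have hsnd : π.map Prod.snd = P' := by
    rw [hπ, Measure.map_add _ _ measurable_snd, Measure.map_map measurable_snd hmd,
      Measure.map_smul, Measure.map_snd_prod, hP', smul_smul]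
    congr 1
    · exact Measure.map_id
    · by_cases h0 : t = 0
      · rw [Measure.measure_univ_eq_zero.1 (hmass.symm.trans h0), smul_zero]
      · rw [ENNReal.inv_mul_cancel h0 htt, one_smul]
  have hπp : IsProbabilityMeasure π := ⟨by
    have : π.map Prod.fst Set.univ = 1 := by rw [hfst, measure_univ]
    rwa [Measure.map_apply measurable_fst MeasurableSet.univ] at this⟩
  have h1 : Measure.pi (fun _ : J => P') =
      (Measure.pi fun _ : J => π).map fun z j => (z j).2 := by
    have : ∀ j : J, SigmaFinite (π.map Prod.snd) := fun _ => by rw [hsnd]; infer_instance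
    rw [Measure.pi_map_pi (f := fun _ => Prod.snd) fun _ => measurable_snd.aemeasurable]
    simp only [hsnd]
  have h2 : Measure.pi (fun _ : J => P) =
      (Measure.pi fun _ : J => π).map fun z j => (z j).1 := by
    have : ∀ j : J, SigmaFinite (π.map Prod.fst) := fun _ => by rw [hfst]; infer_instance
    rw [Measure.pi_map_pi (f := fun _ => Prod.fst) fun _ => measurable_fst.aemeasurable]
    simp only [hfst]
  have hms : Measurable fun (z : J → E × E) j => (z j).2 := by fun_prop
  have hmf : Measurable fun (z : J → E × E) j => (z j).1 := by fun_prop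
  rw [h1, h2, lintegral_map hF hms, lintegral_map hF hmf]
  set I : E × E → ℝ≥0∞ := {z : E × E | z.1 ≠ z.2}.indicator fun z => w z.2 with hI
  have hdiag : MeasurableSet {z : E × E | z.1 ≠ z.2} :=
    (measurableSet_eq_fun measurable_fst measurable_snd).compl
  have hIm : Measurable I := (hw.comp measurable_snd).indicator hdiag
  have hIπ : ∫⁻ z, I z ∂π ≤ ∫⁻ y, w y ∂β := by
    rw [hπ, lintegral_add_measure, lintegral_map hIm hmd, lintegral_smul_measure]
    have : ∀ y : E, I (y, y) = 0 := fun y => by simp [hI]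
    simp only [this, lintegral_zero, zero_add, smul_eq_mul]
    calc t⁻¹ * ∫⁻ z, I z ∂α.prod β ≤ t⁻¹ * ∫⁻ z, w z.2 ∂α.prod β := by
          gcongr with z
          exact Set.indicator_le_self _ _ _
      _ = t⁻¹ * (t * ∫⁻ y, w y ∂β) := by
          rw [lintegral_prod (fun z : E × E => w z.2) (hw.comp measurable_snd).aemeasurable]
          simp only [lintegral_const]
          rw [mul_comm t]
      _ ≤ _ := by
          rw [← mul_assoc]
          exact (mul_le_mul_left (ENNReal.inv_mul_le_one t) _).trans (one_mul _).le
  refine (lintegral_mono fun z : J → E × E => hFw (fun j => (z j).1) fun j => (z j).2).trans ?_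
  have hIj : ∀ j : J, Measurable fun z : J → E × E => I ((z j).1, (z j).2) := fun j =>
    hIm.comp (measurable_pi_apply j)
  rw [lintegral_add_right _ (Finset.measurable_fun_sum _ fun j _ => hIj j)]
  refine add_le_add le_rfl ?_
  rw [lintegral_finsetSum _ fun j _ => hIj j]
  have : ∀ j : J, ∫⁻ z : J → E × E, I ((z j).1, (z j).2) ∂(Measure.pi fun _ : J => π) =
      ∫⁻ z, I z ∂π := fun j =>
    (measurePreserving_eval (fun _ : J => π) j).lintegral_comp hIm
  simp only [this, Finset.sum_const, Finset.card_univ, nsmul_eq_mul]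
  gcongr

end ProductMeasure

/-! ### Transports to the empirical measure as families of plans. -/

section Transports

variable {d : ℕ} {nrm : Seminorm ℝ (Fin d → ℝ)} {p : ℝ}

/-- The transport is split according to its destination. Sample points may coincide, so a plain
restriction to {z.2 = x j} would count mass several times. -/
theorem exists_plan_of_mem_transports (hp : 0 ≤ p) {N : ℕ} (hN : N ≠ 0) {x : Fin N → Fin d → ℝ}
    {μ : Measure (Fin d → ℝ)} {ξ : Measure ((Fin d → ℝ) × (Fin d → ℝ))}
    (hξ : ξ ∈ transports μ (empirical x)) :
    ∃ ν : Fin N → Measure (Fin d → ℝ), ∑ j, ν j = (N : ℝ≥0∞) • μ ∧ (∀ j, ν j Set.univ = 1) ∧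
      ∑ j, ∫⁻ y, gcost nrm p y (x j) ∂ν j = N * cost nrm p ξ := by
  classical
  obtain ⟨hfin, hfst, hsnd⟩ := hξ
  have hN0 : (N : ℝ≥0∞) ≠ 0 := by exact_mod_cast hN
  have hNt : (N : ℝ≥0∞) ≠ ∞ := ENNReal.natCast_ne_top N
  -- Mass arriving at z is shared equally among the indices k with x k = z; the weights h j form a
  -- partition of unity on the sample.
  let mult : (Fin d → ℝ) → ℝ≥0∞ := fun z => ∑ k, if x k = z then 1 else 0
  let h : Fin N → (Fin d → ℝ) → ℝ≥0∞ := fun j => ({x j} : Set (Fin d → ℝ)).indicator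
    fun _ => (mult (x j))⁻¹
  have hmult0 : ∀ j, mult (x j) ≠ 0 := fun j h0 => by
    have := Finset.sum_eq_zero_iff.1 h0 j (Finset.mem_univ j)
    simp at this
  have hmultt : ∀ z, mult z ≠ ∞ := fun z => ENNReal.sum_ne_top.2 fun k _ => by
    split_ifs <;> simp
  have hh : ∀ j, Measurable (h j) := fun j =>
    measurable_const.indicator (measurableSet_singleton _)
  have hsum : ∀ k, ∑ j, h j (x k) = 1 := fun k => by
    have : ∀ j, h j (x k) = (mult (x k))⁻¹ * if x j = x k then 1 else 0 := fun j => by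
      by_cases hjk : x j = x k
      · simp [h, hjk]
      · simp [h, hjk, Ne.symm hjk]
    simp_rw [this]
    rw [← Finset.mul_sum]
    exact ENNReal.inv_mul_cancel (hmult0 k) (hmultt _)
  have hsum' : ∀ j, ∑ k, h j (x k) = 1 := fun j => by
    have : ∀ k, h j (x k) = (mult (x j))⁻¹ * if x k = x j then 1 else 0 := fun k => by
      by_cases hjk : x k = x j
      · simp [h, hjk]
      · simp [h, hjk]
    simp_rw [this]
    rw [← Finset.mul_sum]
    exact ENNReal.inv_mul_cancel (hmult0 j) (hmultt _)
  have hae : ∀ᵐ z ∂ξ, z.2 ∈ Set.range x := by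
    have hms : MeasurableSet (Set.range x) := (Set.finite_range x).measurableSet
    have h1 : (ξ.map Prod.snd) (Set.range x)ᶜ = 0 := by
      rw [hsnd, empirical, Measure.smul_apply, Measure.finsetSum_apply,
        Finset.sum_eq_zero fun j _ => ?_, smul_zero]
      rw [Measure.dirac_apply' _ hms.compl]
      simp
    rw [Measure.map_apply measurable_snd hms.compl] at h1
    exact h1
  have hae1 : ∀ᵐ z ∂ξ, ∑ j, h j z.2 = 1 := by
    filter_upwards [hae] with z hz
    obtain ⟨k, hk⟩ := hz
    rw [← hk, hsum]
  have hh2 : ∀ j, Measurable fun z : (Fin d → ℝ) × (Fin d → ℝ) => h j z.2 := fun j =>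
    (hh j).comp measurable_snd
  let ν : Fin N → Measure (Fin d → ℝ) := fun j =>
    ((N : ℝ≥0∞) • ξ.withDensity fun z => h j z.2).map Prod.fst
  have hint : ∀ j (g : (Fin d → ℝ) → ℝ≥0∞), Measurable g →
      ∫⁻ y, g y ∂ν j = N * ∫⁻ z, h j z.2 * g z.1 ∂ξ := fun j g hg => by
    have hg1 : Measurable fun z : (Fin d → ℝ) × (Fin d → ℝ) => g z.1 := hg.comp measurable_fst
    rw [lintegral_map hg measurable_fst, lintegral_smul_measure, smul_eq_mul,
      lintegral_withDensity_eq_lintegral_mul _ (hh2 j) hg1]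
    rfl
  refine ⟨ν, ?_, fun j => ?_, ?_⟩
  · refine Measure.ext fun s hs => ?_
    rw [Measure.finsetSum_apply, Measure.smul_apply, ← hfst, Measure.map_apply measurable_fst hs]
    have : ∀ j, ν j s = N * ∫⁻ z, h j z.2 * (s.indicator 1 z.1) ∂ξ := fun j => by
      rw [← hint j _ (measurable_one.indicator hs), lintegral_indicator_one hs]
    simp_rw [this]
    have hi1 : Measurable fun z : (Fin d → ℝ) × (Fin d → ℝ) =>
        (s.indicator 1 z.1 : ℝ≥0∞) := (measurable_one.indicator hs).comp measurable_fst
    rw [← Finset.mul_sum, ← lintegral_finsetSum _ fun j _ => (hh2 j).fun_mul hi1, smul_eq_mul]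
    congr 1
    rw [← lintegral_indicator_one (measurable_fst hs)]
    refine lintegral_congr_ae ?_
    filter_upwards [hae1] with z hz
    rw [← Finset.sum_mul, hz, one_mul]
    rfl
  · have h1 := hint j 1 measurable_one
    simp only [Pi.one_apply, lintegral_one, mul_one] at h1
    rw [h1]
    have h2 : ∫⁻ z, h j z.2 ∂ξ = ∫⁻ y, h j y ∂(empirical x) := by
      rw [← hsnd, lintegral_map (hh j) measurable_snd]
    rw [h2, empirical, lintegral_smul_measure, lintegral_finsetSum_measure]
    simp_rw [lintegral_dirac' _ (hh j)]
    rw [hsum', smul_eq_mul, mul_one, ENNReal.mul_inv_cancel hN0 hNt]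
  · have : ∀ j, ∫⁻ y, gcost nrm p y (x j) ∂ν j =
        N * ∫⁻ z, h j z.2 * gcost nrm p z.1 z.2 ∂ξ := fun j => by
      rw [hint j _ (measurable_gcost_left nrm hp _)]
      congr 1
      refine lintegral_congr fun z => ?_
      by_cases hz : z.2 = x j
      · rw [hz]
      · have : h j z.2 = 0 := by simp [h, hz]
        rw [this, zero_mul, zero_mul]
    simp_rw [this]
    rw [← Finset.mul_sum, ← lintegral_finsetSum _ fun j _ =>
      (hh2 j).fun_mul (measurable_gcost nrm hp)]
    congr 1
    refine lintegral_congr_ae ?_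
    filter_upwards [hae1] with z hz
    rw [← Finset.sum_mul, hz, one_mul, gcost]

theorem exists_mem_transports_of_plan (hp : 0 ≤ p) {N : ℕ} (hN : N ≠ 0) (x : Fin N → Fin d → ℝ)
    {μ : Measure (Fin d → ℝ)} {ν : Fin N → Measure (Fin d → ℝ)}
    (hsum : ∑ j, ν j = (N : ℝ≥0∞) • μ) (hν : ∀ j, ν j Set.univ = 1) :
    ∃ ξ ∈ transports μ (empirical x),
      cost nrm p ξ = (N : ℝ≥0∞)⁻¹ * ∑ j, ∫⁻ y, gcost nrm p y (x j) ∂ν j := by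
  have hN0 : (N : ℝ≥0∞) ≠ 0 := by exact_mod_cast hN
  have hNt : (N : ℝ≥0∞) ≠ ∞ := ENNReal.natCast_ne_top N
  have hpr : ∀ j, IsProbabilityMeasure (ν j) := fun j => ⟨hν j⟩
  have hm : ∀ j, Measurable fun y : Fin d → ℝ => (y, x j) := fun j => by fun_prop
  let ξ : Measure ((Fin d → ℝ) × (Fin d → ℝ)) :=
    (N : ℝ≥0∞)⁻¹ • ∑ j, (ν j).map fun y => (y, x j)
  have hmapsum : ∀ f : (Fin d → ℝ) × (Fin d → ℝ) → Fin d → ℝ, Measurable f →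
      (∑ j, (ν j).map fun y => (y, x j)).map f = ∑ j, (ν j).map fun y => f (y, x j) := by
    intro f hf
    rw [← Measure.mapₗ_apply_of_measurable hf, map_sum]
    refine Finset.sum_congr rfl fun j _ => ?_
    rw [Measure.mapₗ_apply_of_measurable hf, Measure.map_map hf (hm j)]
    rfl
  refine ⟨ξ, ⟨?_, ?_, ?_⟩, ?_⟩
  · have : ∀ j, IsFiniteMeasure ((ν j).map fun y => (y, x j)) := fun j => inferInstance
    exact Measure.smul_finite _ (ENNReal.inv_ne_top.2 hN0)
  · rw [Measure.map_smul, hmapsum _ measurable_fst]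
    simp only [Measure.map_id']
    rw [hsum, smul_smul, ENNReal.inv_mul_cancel hN0 hNt, one_smul]
  · rw [Measure.map_smul, hmapsum _ measurable_snd, empirical]
    congr 1
    refine Finset.sum_congr rfl fun j _ => ?_
    rw [Measure.map_const, hν, one_smul]
  · rw [cost, lintegral_smul_measure, lintegral_finsetSum_measure, smul_eq_mul]
    congr 1
    refine Finset.sum_congr rfl fun j _ => ?_
    exact lintegral_map (measurable_gcost nrm hp) (hm j)

theorem planCost_top_of_univ {J : Type*} [Fintype J] {x : J → Fin d → ℝ}
    {ν : J → Measure (Fin d → ℝ)} (hν : ∀ j, ν j Set.univ = 1) :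
    planCost nrm p (fun _ => ∞) x ν = ∑ j, ∫⁻ y, gcost nrm p y (x j) ∂ν j := by
  refine Finset.sum_congr rfl fun j _ => ?_
  rw [hν]; simp

theorem univ_eq_one_of_planCost_top {J : Type*} [Fintype J] {ρ : Measure (Fin d → ℝ)}
    {x : J → Fin d → ℝ} {ν : J → Measure (Fin d → ℝ)} (hadm : ν ∈ partialPlans ρ)
    (h : planCost nrm p (fun _ => ∞) x ν ≠ ∞) (j : J) : ν j Set.univ = 1 := by
  by_contra hne
  refine h ?_
  rw [planCost, ENNReal.sum_eq_top]
  refine ⟨j, Finset.mem_univ j, ?_⟩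
  rw [ENNReal.mul_top, add_top]
  exact (tsub_pos_of_lt (lt_of_le_of_ne (hadm.2 j) hne)).ne'

/-- A partial plan of finite cost under the penalty ∞ has ν j of mass one for every j, so it
exhausts N • μ and is a genuine transport. Multiplying by N gives all target points unit mass, which
makes costs for different sample sizes comparable. -/
theorem iInf_cost_eq (hp : 0 ≤ p) {N : ℕ} (hN : N ≠ 0) (x : Fin N → Fin d → ℝ)
    (μ : Measure (Fin d → ℝ)) [IsProbabilityMeasure μ] :
    ⨅ ξ ∈ transports μ (empirical x), cost nrm p ξ =
      (N : ℝ≥0∞)⁻¹ * pcost nrm p ((N : ℝ≥0∞) • μ) (fun _ => ∞) x := by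
  have hN0 : (N : ℝ≥0∞) ≠ 0 := by exact_mod_cast hN
  have hNt : (N : ℝ≥0∞) ≠ ∞ := ENNReal.natCast_ne_top N
  refine le_antisymm ?_ (le_iInf₂ fun ξ hξ => ?_)
  · have h0 : (N : ℝ≥0∞)⁻¹ ≠ 0 := ENNReal.inv_ne_zero.2 hNt
    have h1 : (N : ℝ≥0∞)⁻¹ ≠ ∞ := ENNReal.inv_ne_top.2 hN0
    rw [pcost, ENNReal.mul_iInf_of_ne h0 h1]
    refine le_iInf fun ν => ?_
    rw [ENNReal.mul_iInf_of_ne h0 h1]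
    refine le_iInf fun hν => ?_
    by_cases htop : planCost nrm p (fun _ => ∞) x ν = ∞
    · rw [htop, ENNReal.mul_top h0]; exact le_top
    have hone := univ_eq_one_of_planCost_top hν htop
    have hsum : ∑ j, ν j = (N : ℝ≥0∞) • μ := by
      have hu : (∑ j, ν j) Set.univ = N := by
        rw [Measure.finsetSum_apply, Finset.sum_congr rfl fun j _ => hone j]; simp
      have : IsFiniteMeasure (∑ j, ν j) := ⟨by rw [hu]; exact hNt.lt_top⟩
      refine Measure.eq_of_le_of_measure_univ_eq hν.1 ?_
      rw [hu]; simp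
    obtain ⟨ξ, hξ, hc⟩ := exists_mem_transports_of_plan (nrm := nrm) hp hN x hsum hone
    rw [planCost_top_of_univ hone, ← hc]
    exact iInf₂_le ξ hξ
  · obtain ⟨ν, hsum, hone, hc⟩ := exists_plan_of_mem_transports (nrm := nrm) hp hN hξ
    have h1 : pcost nrm p ((N : ℝ≥0∞) • μ) (fun _ => ∞) x ≤ N * cost nrm p ξ := by
      rw [← hc, ← planCost_top_of_univ hone]
      exact pcost_le ⟨hsum.le, fun j => (hone j).le⟩
    calc _ ≤ (N : ℝ≥0∞)⁻¹ * (N * cost nrm p ξ) := by gcongr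
      _ = _ := by rw [← mul_assoc, ENNReal.inv_mul_cancel hN0 hNt, one_mul]

theorem wasserstein_rpow (hp : 0 < p) {N : ℕ} (hN : N ≠ 0) (x : Fin N → Fin d → ℝ)
    (μ : Measure (Fin d → ℝ)) [IsProbabilityMeasure μ] :
    wasserstein nrm p μ (empirical x) ^ p =
      (N : ℝ≥0∞)⁻¹ * pcost nrm p ((N : ℝ≥0∞) • μ) (fun _ => ∞) x := by
  rw [← iInf_cost_eq hp.le hN, wasserstein]
  have h1 : ∀ t : ℝ≥0∞, (t ^ (1 / p)) ^ p = t := fun t => by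
    rw [← ENNReal.rpow_mul, one_div, inv_mul_cancel₀ hp.ne', ENNReal.rpow_one]
  have h2 := (ENNReal.orderIsoRpow p hp).map_iInf
    (fun ξ => ⨅ _ : ξ ∈ transports μ (empirical x), cost nrm p ξ ^ (1 / p))
  simp only [ENNReal.orderIsoRpow_apply] at h2
  rw [h2]
  refine iInf_congr fun ξ => ?_
  have h3 := (ENNReal.orderIsoRpow p hp).map_iInf
    (fun _ : ξ ∈ transports μ (empirical x) => cost nrm p ξ ^ (1 / p))
  simp only [ENNReal.orderIsoRpow_apply] at h3
  rw [h3]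
  exact iInf_congr fun _ => h1 _

end Transports

/-! ### Expected costs; both quantization errors expressed through them. -/

section MeanCost

variable {d : ℕ} (nrm : Seminorm ℝ (Fin d → ℝ)) (p : ℝ)

/-- The expected cost of a partial transport from `ρ` to `n` independent `μ`-distributed points. -/
noncomputable def meanCost (ρ : Measure (Fin d → ℝ)) (w : (Fin d → ℝ) → ℝ≥0∞) (n : ℕ)
    (μ : Measure (Fin d → ℝ)) : ℝ≥0∞ :=
  ∫⁻ x, pcost nrm p ρ w x ∂(Measure.pi fun _ : Fin n => μ)

/-- The expected cost of the transport from `n • μ` to `n` independent `μ`-distributed points. -/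
noncomputable def sampleCost (n : ℕ) (μ : Measure (Fin d → ℝ)) : ℝ≥0∞ :=
  meanCost nrm p ((n : ℝ≥0∞) • μ) (fun _ => ∞) n μ

/-- The open unit cube. -/
def openCube (d : ℕ) : Set (Fin d → ℝ) := Set.univ.pi fun _ => Set.Ioo 0 1

/-- The expected cost of the transport from `n` times the uniform distribution to `n` independent
uniform points, where points may be served from the boundary of the cube. -/
noncomputable def leakyCost (n : ℕ) : ℝ≥0∞ :=
  meanCost nrm p ((n : ℝ≥0∞) • unifCube d) (exitCost nrm p (openCube d)) n (unifCube d)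

variable {nrm p}

theorem isOpen_openCube : IsOpen (openCube d) := isOpen_set_pi Set.finite_univ fun _ _ => isOpen_Ioo

theorem unifCube_eq_restrict_openCube : unifCube d = volume.restrict (openCube d) := by
  rw [unifCube, openCube]
  refine Measure.restrict_congr_set ?_
  exact (Measure.univ_pi_Ico_ae_eq_Icc (μ := fun _ : Fin d => (volume : Measure ℝ))
    (f := fun _ => 0) (g := fun _ => 1)).trans
    (Measure.univ_pi_Ioo_ae_eq_Icc (μ := fun _ : Fin d => (volume : Measure ℝ))).symm

instance isProbabilityMeasure_unifCube : IsProbabilityMeasure (unifCube d) := ⟨by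
  rw [unifCube, Measure.restrict_apply_univ, Real.volume_pi_Ico]; simp⟩

theorem Vrand_eq (hp : 0 < p) {N : ℕ} (hN : N ≠ 0) (μ : Measure (Fin d → ℝ))
    [IsProbabilityMeasure μ] :
    Vrand nrm N p μ = ((N : ℝ≥0∞)⁻¹ * sampleCost nrm p N μ) ^ (1 / p) := by
  rw [Vrand, sampleCost, meanCost, ← lintegral_const_mul']
  · simp_rw [wasserstein_rpow hp hN]
  · exact ENNReal.inv_ne_top.2 (by exact_mod_cast hN)

/-- The exit cost ranges over the whole complement, while measures in Λ live on the closed cube. A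
segment from the open cube to a point off the closed cube meets the boundary by connectedness, and
the meeting point is no dearer; compactness of the boundary yields a minimizer. -/
theorem exists_notMem_openCube (hd : 0 < d) (hp : 0 < p) (x : Fin d → ℝ)
    (hx : x ∈ Set.univ.pi fun _ : Fin d => Set.Icc (0 : ℝ) 1) :
    ∃ b ∈ Set.univ.pi fun _ : Fin d => Set.Icc (0 : ℝ) 1, b ∉ openCube d ∧
      gcost nrm p b x ≤ exitCost nrm p (openCube d) x := by
  set K := Set.univ.pi fun _ : Fin d => Set.Icc (0 : ℝ) 1 with hK
  have hKc : IsCompact K := isCompact_univ_pi fun _ => isCompact_Icc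
  have hKQ : IsCompact (K \ openCube d) := hKc.diff isOpen_openCube
  have hne : (K \ openCube d).Nonempty := by
    refine ⟨0, fun i _ => by simp, fun h => ?_⟩
    have := h ⟨0, hd⟩ trivial
    simp at this
  obtain ⟨b, hb, hmin⟩ := hKQ.exists_isMinOn hne (f := fun y => gcost nrm p y x)
    ((continuous_gcost nrm hp.le).comp (by fun_prop : Continuous fun y => (y, x))).continuousOn
  refine ⟨b, hb.1, hb.2, le_iInf₂ fun y hy => ?_⟩
  obtain ⟨y', hy', hle⟩ : ∃ y' ∈ K \ openCube d, gcost nrm p y' x ≤ gcost nrm p y x := by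
    by_cases hxQ : x ∈ openCube d
    · by_cases hyK : y ∈ K
      · exact ⟨y, ⟨hyK, hy⟩, le_rfl⟩
      have hseg : (segment ℝ x y ∩ (K \ openCube d)).Nonempty := by
        by_contra hemp
        rw [Set.not_nonempty_iff_eq_empty] at hemp
        have hpre : IsPreconnected (segment ℝ x y) := (convex_segment x y).isPreconnected
        have := hpre (openCube d) Kᶜ isOpen_openCube hKc.isClosed.isOpen_compl
          (fun z hz => by
            by_contra hcon
            simp only [Set.mem_union, Set.mem_compl_iff, not_or, not_not] at hcon
            have : z ∈ segment ℝ x y ∩ (K \ openCube d) := ⟨hz, hcon.2, hcon.1⟩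
            rw [hemp] at this
            exact this)
          ⟨x, left_mem_segment ℝ x y, hxQ⟩ ⟨y, right_mem_segment ℝ x y, hyK⟩
        obtain ⟨z, _, hzQ, hzK⟩ := this
        exact hzK fun i hi => Set.Ioo_subset_Icc_self (hzQ i hi)
      obtain ⟨z, hz, hzK⟩ := hseg
      refine ⟨z, hzK, ?_⟩
      rw [segment_eq_image'] at hz
      obtain ⟨t, ht, rfl⟩ := hz
      rw [gcost, gcost]
      refine ENNReal.ofReal_le_ofReal (Real.rpow_le_rpow (apply_nonneg _ _) ?_ hp.le)
      have : x + t • (y - x) - x = t • (y - x) := by abel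
      simp only [this]
      rw [map_smul_eq_mul, Real.norm_of_nonneg ht.1]
      exact mul_le_of_le_one_left (apply_nonneg _ _) ht.2
    · exact ⟨x, ⟨hx, hxQ⟩, by rw [gcost_self nrm hp]; exact zero_le⟩
  exact (hmin hy').trans hle

/-- A measure in Λ is dominated by the uniform one inside the open cube and unrestricted on the
boundary. Supplying a point from the boundary is thus the same as leaving its mass missing and
paying the exit cost. -/
theorem iInf_leaky_eq (hd : 0 < d) (hp : 0 < p) {N : ℕ} (hN : N ≠ 0) (x : Fin N → Fin d → ℝ)
    (hx : ∀ j, x j ∈ Set.univ.pi fun _ : Fin d => Set.Icc (0 : ℝ) 1) :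
    ⨅ U' ∈ leakyMeasures d, ⨅ ξ ∈ transports U' (empirical x), cost nrm p ξ =
      (N : ℝ≥0∞)⁻¹ *
        pcost nrm p ((N : ℝ≥0∞) • unifCube d) (exitCost nrm p (openCube d)) x := by
  have hN0 : (N : ℝ≥0∞) ≠ 0 := by exact_mod_cast hN
  have hNt : (N : ℝ≥0∞) ≠ ∞ := ENNReal.natCast_ne_top N
  have hms : MeasurableSet (openCube d) := isOpen_openCube.measurableSet
  refine le_antisymm ?_ (le_iInf₂ fun U' hU' => ?_)
  · have h0 : (N : ℝ≥0∞)⁻¹ ≠ 0 := ENNReal.inv_ne_zero.2 hNt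
    have h1 : (N : ℝ≥0∞)⁻¹ ≠ ∞ := ENNReal.inv_ne_top.2 hN0
    rw [pcost, ENNReal.mul_iInf_of_ne h0 h1]
    refine le_iInf fun ν => ?_
    rw [ENNReal.mul_iInf_of_ne h0 h1]
    refine le_iInf fun hν => ?_
    choose b hbK hbQ hbc using fun j => exists_notMem_openCube (nrm := nrm) hd hp (x j) (hx j)
    -- The missing mass of x j becomes a point mass at a cheapest boundary point b j.
    let ν' : Fin N → Measure (Fin d → ℝ) := fun j =>
      ν j + (1 - ν j Set.univ) • Measure.dirac (b j)
    have hone : ∀ j, ν' j Set.univ = 1 := fun j => by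
      simp only [ν', Measure.add_apply, Measure.smul_apply, measure_univ, smul_eq_mul, mul_one]
      exact add_tsub_cancel_of_le (hν.2 j)
    let U' : Measure (Fin d → ℝ) := (N : ℝ≥0∞)⁻¹ • ∑ j, ν' j
    have hsum : ∑ j, ν' j = (N : ℝ≥0∞) • U' := by
      simp only [U']
      rw [smul_smul, ENNReal.mul_inv_cancel hN0 hNt, one_smul]
    have hU : U' ∈ leakyMeasures d := by
      refine ⟨⟨?_⟩, ?_, fun A hA hAQ => ?_⟩
      · simp only [U', Measure.smul_apply, Measure.finsetSum_apply, hone]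
        simp [ENNReal.inv_mul_cancel hN0 hNt]
      · have hKm : MeasurableSet (Set.univ.pi fun _ : Fin d => Set.Icc (0 : ℝ) 1)ᶜ :=
          (MeasurableSet.univ_pi fun _ => measurableSet_Icc).compl
        have h2 : ∀ j, ν' j (Set.univ.pi fun _ : Fin d => Set.Icc (0 : ℝ) 1)ᶜ = 0 := fun j => by
          simp only [ν', Measure.add_apply, Measure.smul_apply]
          rw [Measure.dirac_apply' _ hKm, Set.indicator_of_notMem (Set.notMem_compl_iff.2 (hbK j)), smul_zero,
            add_zero]
          have h3 : ν j ≤ (N : ℝ≥0∞) • unifCube d :=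
            (Finset.single_le_sum (fun i _ => Measure.zero_le (ν i)) (Finset.mem_univ j)).trans
              hν.1
          refine le_antisymm ((h3 _).trans ?_) zero_le
          rw [Measure.smul_apply, unifCube, Measure.restrict_apply hKm]
          have : ((Set.univ.pi fun _ : Fin d => Set.Icc (0 : ℝ) 1)ᶜ ∩
              Set.univ.pi fun _ => Set.Ico 0 1) = ∅ := by
            refine Set.disjoint_iff_inter_eq_empty.1 (Set.disjoint_left.2 fun z hz hz' => hz ?_)
            exact fun i hi => Set.Ico_subset_Icc_self (hz' i hi)
          rw [this]; simp
        simp only [U', Measure.smul_apply, Measure.finsetSum_apply, h2]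
        simp
      · have h2 : ∀ j, ν' j A = ν j A := fun j => by
          simp only [ν', Measure.add_apply, Measure.smul_apply]
          rw [Measure.dirac_apply' _ hA, Set.indicator_of_notMem (fun h => hbQ j (hAQ h)),
            smul_zero, add_zero]
        simp only [U', Measure.smul_apply, Measure.finsetSum_apply, h2, smul_eq_mul]
        have h3 := hν.1 A
        rw [Measure.finsetSum_apply, Measure.smul_apply, smul_eq_mul] at h3
        calc _ ≤ (N : ℝ≥0∞)⁻¹ * (N * unifCube d A) := by gcongr
          _ = _ := by rw [← mul_assoc, ENNReal.inv_mul_cancel hN0 hNt, one_mul]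
    have : IsProbabilityMeasure U' := hU.1
    refine (iInf₂_le U' hU).trans ?_
    rw [iInf_cost_eq hp.le hN]
    gcongr
    refine (pcost_le ⟨hsum.le, fun j => (hone j).le⟩).trans ?_
    rw [planCost_top_of_univ hone, planCost]
    refine Finset.sum_le_sum fun j _ => ?_
    simp only [ν']
    rw [lintegral_add_measure, lintegral_smul_measure,
      lintegral_dirac' _ (measurable_gcost_left nrm hp.le _), smul_eq_mul]
    gcongr
    exact hbc j
  · have : IsProbabilityMeasure U' := hU'.1
    rw [iInf_cost_eq hp.le hN]
    gcongr
    -- Superadditivity with the open cube as the only cell discards the mass of U' on the boundary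
    -- at the price of the exit cost.
    have h1 := sum_pcost_restrict_le (nrm := nrm) hp ({()} : Finset Unit) ((N : ℝ≥0∞) • U')
      (fun _ => openCube d) (fun _ _ => hms) (by simp) (w := fun _ => ∞) (fun _ _ _ => le_top) x
    rw [Finset.sum_singleton] at h1
    refine le_trans (pcost_mono x ?_ le_rfl) h1
    rw [Measure.restrict_smul]
    refine Measure.le_iff.2 fun A hA => ?_
    rw [Measure.smul_apply, Measure.smul_apply, smul_eq_mul, smul_eq_mul,
      Measure.restrict_apply hA]
    refine mul_le_mul_right ?_ _
    refine (hU'.2.2 _ (hA.inter hms) Set.inter_subset_right).trans ?_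
    exact measure_mono Set.inter_subset_left

theorem VrandLeaky_eq (hd : 0 < d) (hp : 0 < p) {N : ℕ} (hN : N ≠ 0) :
    VrandLeaky nrm N p = ((N : ℝ≥0∞)⁻¹ * leakyCost nrm p N) ^ (1 / p) := by
  rw [VrandLeaky, leakyCost, meanCost, ← lintegral_const_mul']
  · congr 1
    refine lintegral_congr_ae ?_
    have h1 : ∀ j : Fin N, ∀ᵐ x ∂(Measure.pi fun _ : Fin N => unifCube d),
        x j ∈ Set.univ.pi fun _ : Fin d => Set.Icc (0 : ℝ) 1 := fun j => by
      have h2 : ∀ᵐ y ∂(unifCube d), y ∈ Set.univ.pi fun _ : Fin d => Set.Icc (0 : ℝ) 1 := by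
        rw [unifCube]
        filter_upwards [ae_restrict_mem (MeasurableSet.univ_pi fun _ => measurableSet_Ico)]
          with y hy i hi
        exact Set.Ico_subset_Icc_self (hy i hi)
      exact (measurePreserving_eval (fun _ : Fin N => unifCube d) j).quasiMeasurePreserving.ae h2
    filter_upwards [ae_all_iff.2 h1] with x hx
    exact iInf_leaky_eq hd hp hN x hx
  · exact ENNReal.inv_ne_top.2 (by exact_mod_cast hN)

end MeanCost

/-! ### Expected costs under reindexing, scaling, mixing and perturbation. -/

section Reindex

variable {d : ℕ} {nrm : Seminorm ℝ (Fin d → ℝ)} {p : ℝ}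

theorem lintegral_pcost_comp (hp : 1 ≤ p) {J J' : Type*} [Fintype J] [Fintype J']
    {e : J' → J} (he : Function.Injective e) (μ : J → Measure (Fin d → ℝ))
    [∀ j, IsProbabilityMeasure (μ j)] (ρ : Measure (Fin d → ℝ)) {w : (Fin d → ℝ) → ℝ≥0∞}
    (hw : UpperSemicontinuous w) :
    ∫⁻ x, pcost nrm p ρ w (x ∘ e) ∂(Measure.pi μ) =
      ∫⁻ x, pcost nrm p ρ w x ∂(Measure.pi fun j => μ (e j)) := by
  rw [← pi_map_comp μ he, lintegral_map (measurable_pcost hp ρ hw)]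
  exact measurable_pi_lambda _ fun j => measurable_pi_apply _

theorem pcost_comp_equiv {J J' : Type*} [Fintype J] [Fintype J'] (e : J' ≃ J)
    (ρ : Measure (Fin d → ℝ)) (w : (Fin d → ℝ) → ℝ≥0∞) (x : J → Fin d → ℝ) :
    pcost nrm p ρ w (x ∘ e) = pcost nrm p ρ w x := by
  refine le_antisymm (pcost_comp_le ρ w x e.injective) ?_
  have h := pcost_comp_le (nrm := nrm) (p := p) ρ w (x ∘ e) e.symm.injective
  have : (x ∘ e) ∘ e.symm = x := by funext j; simp
  rwa [this] at h

theorem lintegral_pcost_eq_meanCost (hp : 1 ≤ p) {J : Type*} [Fintype J]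
    (μ : Measure (Fin d → ℝ)) [IsProbabilityMeasure μ] (ρ : Measure (Fin d → ℝ))
    {w : (Fin d → ℝ) → ℝ≥0∞} (hw : UpperSemicontinuous w) {n : ℕ} (hn : Fintype.card J = n) :
    ∫⁻ x, pcost nrm p ρ w x ∂(Measure.pi fun _ : J => μ) = meanCost nrm p ρ w n μ := by
  subst hn
  have e : Fin (Fintype.card J) ≃ J := (Fintype.equivFin J).symm
  rw [meanCost, ← lintegral_pcost_comp hp e.injective (fun _ : J => μ) ρ hw]
  exact lintegral_congr fun x => (pcost_comp_equiv e ρ w x).symm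

theorem meanCost_mono_points (hp : 1 ≤ p) (μ : Measure (Fin d → ℝ)) [IsProbabilityMeasure μ]
    (ρ : Measure (Fin d → ℝ)) {w : (Fin d → ℝ) → ℝ≥0∞} (hw : UpperSemicontinuous w) {n n' : ℕ}
    (h : n ≤ n') : meanCost nrm p ρ w n μ ≤ meanCost nrm p ρ w n' μ := by
  rw [meanCost, ← lintegral_pcost_comp hp (Fin.castLE_injective h) (fun _ => μ) ρ hw]
  exact lintegral_mono fun x => pcost_comp_le ρ w x (Fin.castLE_injective h)

theorem meanCost_add_points_le (hp : 1 ≤ p) (μ : Measure (Fin d → ℝ)) [IsProbabilityMeasure μ]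
    (ρ : Measure (Fin d → ℝ)) {w : (Fin d → ℝ) → ℝ≥0∞} (hw : UpperSemicontinuous w) {D : ℝ≥0∞}
    (hD : ∀ x, w x ≤ D) (n k : ℕ) :
    meanCost nrm p ρ w (n + k) μ ≤ meanCost nrm p ρ w n μ + k * D := by
  have h1 : ∀ x : Fin n ⊕ Fin k → Fin d → ℝ,
      pcost nrm p ρ w x ≤ pcost nrm p ρ w (x ∘ Sum.inl) + k * D := fun x => by
    refine (pcost_le_comp_add ρ w x).trans (add_le_add le_rfl ?_)
    refine (Finset.sum_le_sum fun j _ => hD _).trans ?_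
    simp
  rw [← lintegral_pcost_eq_meanCost hp (J := Fin n ⊕ Fin k) μ ρ hw (by simp)]
  refine (lintegral_mono h1).trans ?_
  rw [lintegral_add_right _ measurable_const, lintegral_const, measure_univ, mul_one,
    lintegral_pcost_comp hp Sum.inl_injective (fun _ => μ) ρ hw]
  rfl

theorem meanCost_mono_source (ρ ρ' : Measure (Fin d → ℝ)) (h : ρ ≤ ρ')
    (w : (Fin d → ℝ) → ℝ≥0∞) (n : ℕ) (μ : Measure (Fin d → ℝ)) :
    meanCost nrm p ρ' w n μ ≤ meanCost nrm p ρ w n μ :=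
  lintegral_mono fun x => pcost_mono x h le_rfl

theorem meanCost_le_add_mass (μ : Measure (Fin d → ℝ)) [IsProbabilityMeasure μ]
    (ρ σ : Measure (Fin d → ℝ)) [IsFiniteMeasure ρ] [IsFiniteMeasure σ]
    {w : (Fin d → ℝ) → ℝ≥0∞} {D : ℝ≥0∞} (hD : ∀ x, w x ≤ D) (n : ℕ) :
    meanCost nrm p ρ w n μ ≤ meanCost nrm p (ρ + σ) w n μ + D * σ Set.univ := by
  refine (lintegral_mono fun x => pcost_le_add_mass ρ σ hD x).trans ?_
  rw [lintegral_add_right _ measurable_const, lintegral_const,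
    measure_univ (μ := Measure.pi fun _ : Fin n => μ), mul_one]
  exact le_rfl

theorem upperSemicontinuous_fun_const (c : ℝ≥0∞) :
    UpperSemicontinuous fun _ : Fin d → ℝ => c := continuous_const.upperSemicontinuous

theorem sampleCost_zero (μ : Measure (Fin d → ℝ)) : sampleCost nrm p 0 μ = 0 := by
  simp [sampleCost, meanCost, pcost_empty]

theorem meanCost_map_le (hp : 1 ≤ p) (ρ μ : Measure (Fin d → ℝ)) [IsProbabilityMeasure μ] {s : ℝ}
    (hs : 0 < s) (z : Fin d → ℝ) {w w' : (Fin d → ℝ) → ℝ≥0∞} (hwc : UpperSemicontinuous w)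
    (hw : ∀ y, w (s • y + z) ≤ ENNReal.ofReal (s ^ p) * w' y) (n : ℕ) :
    meanCost nrm p (ρ.map fun y => s • y + z) w n (μ.map fun y => s • y + z) ≤
      ENNReal.ofReal (s ^ p) * meanCost nrm p ρ w' n μ := by
  have hmT : Measurable fun y : Fin d → ℝ => s • y + z := by fun_prop
  have hpr : IsProbabilityMeasure (μ.map fun y => s • y + z) :=
    Measure.isProbabilityMeasure_map hmT.aemeasurable
  have h1 : Measure.pi (fun _ : Fin n => μ.map fun y => s • y + z) =
      (Measure.pi fun _ : Fin n => μ).map fun x j => s • x j + z :=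
    (Measure.pi_map_pi (f := fun _ y => s • y + z) fun _ => hmT.aemeasurable).symm
  have hm2 : Measurable fun (x : Fin n → Fin d → ℝ) j => s • x j + z :=
    measurable_pi_lambda _ fun j => hmT.comp (measurable_pi_apply j)
  rw [meanCost, h1, lintegral_map (measurable_pcost hp _ hwc) hm2, meanCost,
    ← lintegral_const_mul' _ _ ENNReal.ofReal_ne_top]
  exact lintegral_mono fun x => pcost_map_le (by linarith) ρ hs z hw x

theorem map_inv_map (μ : Measure (Fin d → ℝ)) {s : ℝ} (hs : 0 < s) (z : Fin d → ℝ) :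
    (μ.map fun y => s • y + z).map (fun y => s⁻¹ • y + (-(s⁻¹ • z))) = μ := by
  rw [Measure.map_map (by fun_prop) (by fun_prop)]
  have : ((fun y : Fin d → ℝ => s⁻¹ • y + (-(s⁻¹ • z))) ∘ fun y => s • y + z) = id := by
    funext y
    simp [smul_smul, inv_mul_cancel₀ hs.ne']
  rw [this, Measure.map_id]

theorem sampleCost_map (hp : 1 ≤ p) (μ : Measure (Fin d → ℝ)) [IsProbabilityMeasure μ] {s : ℝ}
    (hs : 0 < s) (z : Fin d → ℝ) (n : ℕ) :
    sampleCost nrm p n (μ.map fun y => s • y + z) =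
      ENNReal.ofReal (s ^ p) * sampleCost nrm p n μ := by
  have key : ∀ (μ : Measure (Fin d → ℝ)) [IsProbabilityMeasure μ] {s : ℝ} (_ : 0 < s)
      (z : Fin d → ℝ), sampleCost nrm p n (μ.map fun y => s • y + z) ≤
      ENNReal.ofReal (s ^ p) * sampleCost nrm p n μ := fun μ _ s hs z => by
    rw [sampleCost, ← Measure.map_smul]
    refine meanCost_map_le hp _ μ hs z (upperSemicontinuous_fun_const _) (fun y => ?_) n
    rw [ENNReal.mul_top]
    rw [Ne, ENNReal.ofReal_eq_zero, not_le]; positivity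
  refine le_antisymm (key μ hs z) ?_
  have hpr : IsProbabilityMeasure (μ.map fun y => s • y + z) :=
    Measure.isProbabilityMeasure_map (by fun_prop)
  have h1 := key (μ.map fun y => s • y + z) (inv_pos.2 hs) (-(s⁻¹ • z))
  rw [map_inv_map μ hs z] at h1
  calc _ ≤ ENNReal.ofReal (s ^ p) * (ENNReal.ofReal (s⁻¹ ^ p) *
        sampleCost nrm p n (μ.map fun y => s • y + z)) := by gcongr
    _ = _ := by
      rw [← mul_assoc, ← ENNReal.ofReal_mul (by positivity), ← Real.mul_rpow hs.le
        (inv_pos.2 hs).le, mul_inv_cancel₀ hs.ne', Real.one_rpow, ENNReal.ofReal_one, one_mul]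

theorem lintegral_gcost_eval {J : Type*} [Fintype J] (hp : 0 ≤ p) (μ : J → Measure (Fin d → ℝ))
    [∀ j, IsProbabilityMeasure (μ j)] (z : Fin d → ℝ) (j : J) :
    ∫⁻ x, gcost nrm p (x j) z ∂(Measure.pi μ) = ∫⁻ y, gcost nrm p y z ∂(μ j) :=
  (measurePreserving_eval μ j).lintegral_comp (measurable_gcost_left nrm hp z)

/-- The empty plan, completed through z. The bound is linear in n, and it is used where cells
contain about one point or the mass is tiny. -/
theorem sampleCost_le_moment (hp : 1 ≤ p) (μ : Measure (Fin d → ℝ)) [IsProbabilityMeasure μ]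
    (z : Fin d → ℝ) (n : ℕ) :
    sampleCost nrm p n μ ≤ 2 ^ p * (n * ∫⁻ y, gcost nrm p y z ∂μ) := by
  have hp0 : 0 ≤ p := by linarith
  have hm : ∀ j : Fin n, Measurable fun x : Fin n → Fin d → ℝ => gcost nrm p (x j) z := fun j =>
    (measurable_gcost_left nrm hp0 z).comp (measurable_pi_apply j)
  have h1 : ∀ x : Fin n → Fin d → ℝ, pcost nrm p ((n : ℝ≥0∞) • μ) (fun _ => ∞) x ≤
      2 ^ (p - 1) * (n * ∫⁻ y, gcost nrm p y z ∂μ + ∑ j, gcost nrm p (x j) z) := fun x => by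
    have := pcost_top_le_completion_base (nrm := nrm) hp (ρ := (n : ℝ≥0∞) • μ)
      (κ := (n : ℝ≥0∞) • μ) (ν := fun _ : Fin n => 0) (by simp) (by simp) (by simp) x z
    simpa using this
  refine (lintegral_mono h1).trans ?_
  rw [lintegral_const_mul _ ((Finset.measurable_fun_sum _ fun j _ => hm j).const_add _),
    lintegral_add_left measurable_const, lintegral_const, measure_univ, mul_one,
    lintegral_finsetSum _ fun j _ => hm j]
  simp only [lintegral_gcost_eval hp0]
  rw [Finset.sum_const, Finset.card_univ, Fintype.card_fin, nsmul_eq_mul, ← two_mul, ← mul_assoc]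
  gcongr
  have : (2 : ℝ≥0∞) ^ (p - 1) * 2 = 2 ^ p := by
    conv_lhs => rw [← ENNReal.rpow_one 2, ← ENNReal.rpow_mul, one_mul]
    rw [← ENNReal.rpow_add _ _ (by norm_num) (by norm_num), sub_add_cancel]
  rw [this]

/-- Given the labels, the points of each component are independent with law μ i, so
`pcost_mixture_le` can be integrated. Supply and demand of component i differ by |N * m i - n| with
n binomial, and each unit of imbalance is charged, on average, the moment of μ i about z. -/
theorem sampleCost_mixture_le (hp : 1 ≤ p) {ι : Type*} [Fintype ι]
    (μ : ι → Measure (Fin d → ℝ)) [∀ i, IsProbabilityMeasure (μ i)] (m : ι → ℝ≥0∞)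
    (hm : ∑ i, m i = 1) (z : Fin d → ℝ) (N : ℕ) :
    sampleCost nrm p N (∑ i, m i • μ i) ≤
      ∑ i, binomAvg (m i) (1 - m i) (fun n => sampleCost nrm p n (μ i)) N +
      2 ^ (p - 1) * ∑ i, (∫⁻ y, gcost nrm p y z ∂μ i) * binomDev N (m i) := by
  classical
  have hp0 : 0 ≤ p := by linarith
  have hmt : ∀ i, m i ≠ ∞ := fun i => by
    refine ne_top_of_le_ne_top ENNReal.one_ne_top (hm ▸ ?_)
    exact Finset.single_le_sum (fun _ _ => zero_le) (Finset.mem_univ i)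
  have hcompl : ∀ i, ∑ k ∈ Finset.univ.erase i, m k = 1 - m i := fun i => by
    rw [← hm, ← Finset.add_sum_erase _ _ (Finset.mem_univ i), ENNReal.add_sub_cancel_left (hmt i)]
  have hfin : ∀ i, IsFiniteMeasure (m i • μ i) := fun i => Measure.smul_finite _ (hmt i)
  set M : ι → ℝ≥0∞ := fun i => ∫⁻ y, gcost nrm p y z ∂μ i with hM
  let c : (Fin N → ι) → ι → ℕ := fun l i => Fintype.card {j // l j = i}
  have hsource : (N : ℝ≥0∞) • ∑ i, m i • μ i = ∑ i, ((Fintype.card (Fin N) : ℝ≥0∞) * m i) • μ i := by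
    rw [Finset.smul_sum, Fintype.card_fin]
    exact Finset.sum_congr rfl fun i _ => smul_smul _ _ _
  have hl : ∀ l : Fin N → ι,
      ∫⁻ x, pcost nrm p ((N : ℝ≥0∞) • ∑ i, m i • μ i) (fun _ => ∞) x
        ∂(Measure.pi fun j => μ (l j)) ≤
      ∑ i, (sampleCost nrm p (c l i) (μ i) +
        2 ^ (p - 1) * M i * ((N * m i - c l i) + (c l i - N * m i))) := fun l => by
    have hmg : ∀ j : Fin N, Measurable fun x : Fin N → Fin d → ℝ => gcost nrm p (x j) z :=
      fun j => (measurable_gcost_left nrm hp0 z).comp (measurable_pi_apply j)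
    have hmp : ∀ i, Measurable fun x : Fin N → Fin d → ℝ => pcost nrm p ((c l i : ℝ≥0∞) • μ i)
        (fun _ => ∞) (fun j : {j // l j = i} => x j) := fun i =>
      (measurable_pcost hp _ (upperSemicontinuous_fun_const _)).comp
        (measurable_pi_lambda _ fun j => measurable_pi_apply _)
    refine (lintegral_mono fun x => hsource ▸ pcost_mixture_le hp μ m hm l x z (c l)
      fun i => rfl).trans ?_
    rw [lintegral_add_left (Finset.measurable_fun_sum _ fun i _ => hmp i),
      lintegral_finsetSum _ fun i _ => hmp i,
      lintegral_const_mul _ ((Finset.measurable_fun_sum _ fun j _ =>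
        (hmg j).const_mul _).const_add _), lintegral_add_left measurable_const, lintegral_const,
      measure_univ, mul_one, lintegral_finsetSum _ fun j _ => (hmg j).const_mul _,
      Finset.sum_add_distrib]
    refine add_le_add (Finset.sum_le_sum fun i _ => le_of_eq ?_) ?_
    · have h1 := lintegral_pcost_comp (nrm := nrm) hp (Subtype.val_injective (p := fun j => l j = i))
        (fun j => μ (l j)) ((c l i : ℝ≥0∞) • μ i)
        (upperSemicontinuous_fun_const ∞)
      have h2 : (fun j : {j // l j = i} => μ (l j)) = fun _ => μ i := by
        funext j; rw [j.2]
      rw [h2, lintegral_pcost_eq_meanCost hp (μ i) _ (upperSemicontinuous_fun_const _) rfl] at h1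
      exact h1
    · simp_rw [lintegral_const_mul _ (hmg _), lintegral_gcost_eval hp0]
      have h3 : ∑ j, (c l (l j) - Fintype.card (Fin N) * m (l j)) / c l (l j) *
          ∫⁻ y, gcost nrm p y z ∂μ (l j) ≤ ∑ i, (c l i - N * m i) * M i := by
        rw [← Fintype.sum_fiberwise l]
        refine Finset.sum_le_sum fun i _ => ?_
        have : ∀ j : {j // l j = i}, (c l (l j) - Fintype.card (Fin N) * m (l j)) / c l (l j) *
            ∫⁻ y, gcost nrm p y z ∂μ (l j) = (c l i - N * m i) / c l i * M i := fun j => by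
          rw [j.2, Fintype.card_fin]
        rw [Finset.sum_congr rfl fun j _ => this j, Finset.sum_const, Finset.card_univ,
          nsmul_eq_mul, ← mul_assoc]
        gcongr
        rw [mul_comm]
        exact div_mul_le_self _ _
      refine (mul_le_mul_right (add_le_add le_rfl h3) _).trans (le_of_eq ?_)
      rw [Fintype.card_fin, ← Finset.sum_add_distrib, Finset.mul_sum]
      refine Finset.sum_congr rfl fun i _ => ?_
      ring
  rw [sampleCost, meanCost, pi_sum, lintegral_finsetSum_measure]
  calc _ ≤ ∑ l : Fin N → ι, (∏ j, m (l j)) * ∑ i, (sampleCost nrm p (c l i) (μ i) +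
        2 ^ (p - 1) * M i * ((N * m i - c l i) + (c l i - N * m i))) := by
        refine Finset.sum_le_sum fun l _ => ?_
        rw [pi_smul _ (fun j => hmt _), lintegral_smul_measure, smul_eq_mul]
        gcongr
        exact hl l
    _ = ∑ i, (∑ l : Fin N → ι, (∏ j, m (l j)) * (sampleCost nrm p (c l i) (μ i)) +
          2 ^ (p - 1) * M i * ∑ l : Fin N → ι, (∏ j, m (l j)) *
            ((N * m i - c l i) + (c l i - N * m i))) := by
        simp_rw [Finset.mul_sum, ← Finset.sum_add_distrib]
        rw [Finset.sum_comm]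
        refine Finset.sum_congr rfl fun i _ => Finset.sum_congr rfl fun l _ => ?_
        ring
    _ = _ := by
        rw [Finset.mul_sum, ← Finset.sum_add_distrib]
        refine Finset.sum_congr rfl fun i _ => ?_
        have h1 := sum_prod_count m i (fun n => sampleCost nrm p n (μ i)) N
        have h2 := sum_prod_count m i (fun n => (N * m i - n) + (n - N * m i)) N
        rw [hcompl] at h1 h2
        rw [h1, h2, mul_assoc]
        rfl

/-- Bounded perturbations of the distribution change the cost by at most their mass. -/
theorem sampleCost_le_add_of_common (hp : 1 ≤ p) {ω α β P P' : Measure (Fin d → ℝ)}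
    [IsProbabilityMeasure P] [IsProbabilityMeasure P'] (hP : P = ω + α) (hP' : P' = ω + β)
    {Q : Set (Fin d → ℝ)} (hQ : ∀ᵐ y ∂P, y ∈ Q) {D : ℝ≥0∞}
    (hD : ∀ y ∈ Q, ∀ x ∈ Q, gcost nrm p y x ≤ D) (n : ℕ) :
    sampleCost nrm p n P ≤ sampleCost nrm p n P' + n * (2 * D * β Set.univ) := by
  classical
  have hωα : IsFiniteMeasure (ω + α) := hP ▸ inferInstance
  have hωβ : IsFiniteMeasure (ω + β) := hP' ▸ inferInstance
  have hω : IsFiniteMeasure ω := isFiniteMeasure_of_le (ω + α) (Measure.le_add_right le_rfl)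
  have hβ : IsFiniteMeasure β := isFiniteMeasure_of_le (ω + β) (Measure.le_add_left le_rfl)
  have hmass : α Set.univ = β Set.univ := by
    have h1 : ω Set.univ + α Set.univ = 1 := by rw [← Measure.add_apply, ← hP, measure_univ]
    have h2 : ω Set.univ + β Set.univ = 1 := by rw [← Measure.add_apply, ← hP', measure_univ]
    exact (ENNReal.add_right_inj (measure_ne_top ω _)).1 (h1.trans h2.symm)
  have hae : ∀ᵐ x ∂(Measure.pi fun _ : Fin n => P), ∀ j, x j ∈ Q := ae_all_iff.2 fun j =>
    (measurePreserving_eval (fun _ : Fin n => P) j).quasiMeasurePreserving.ae hQ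
  -- With the charge D in place of ∞, each resampled point and each removed unit of source mass
  -- costs at most D. The change of the sample and the change of the source account for the factor
  -- 2.
  have h1 : sampleCost nrm p n P ≤ meanCost nrm p ((n : ℝ≥0∞) • P) (fun _ => D) n P := by
    refine lintegral_mono_ae ?_
    filter_upwards [hae] with x hx
    refine pcost_top_le_const (by simp) x fun j => ?_
    refine (Measure.ae_smul_measure hQ _).mono fun y hy => hD y hy _ (hx j)
  have h2 := lintegral_pi_le_add_of_common (J := Fin n) hP' hP (w := fun _ => D) measurable_const
    (measurable_pcost (nrm := nrm) hp ((n : ℝ≥0∞) • P) (upperSemicontinuous_fun_const D))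
    (fun x x' => by
      have := pcost_le_add_sum_ne (nrm := nrm) (p := p) ((n : ℝ≥0∞) • P) (fun _ => D) x x'
      simpa [Set.indicator_apply] using this)
  have h3 : meanCost nrm p ((n : ℝ≥0∞) • P) (fun _ => D) n P' ≤
      sampleCost nrm p n P' + D * (n * β Set.univ) := by
    have hnω : IsFiniteMeasure ((n : ℝ≥0∞) • ω) := Measure.smul_finite _ (ENNReal.natCast_ne_top _)
    have hnβ : IsFiniteMeasure ((n : ℝ≥0∞) • β) := Measure.smul_finite _ (ENNReal.natCast_ne_top _)
    calc _ ≤ meanCost nrm p ((n : ℝ≥0∞) • ω) (fun _ => D) n P' := by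
          refine meanCost_mono_source _ _ ?_ _ _ _
          rw [hP, smul_add]
          exact Measure.le_add_right le_rfl
      _ ≤ meanCost nrm p ((n : ℝ≥0∞) • ω + (n : ℝ≥0∞) • β) (fun _ => D) n P' +
          D * ((n : ℝ≥0∞) • β) Set.univ := meanCost_le_add_mass P' _ _ (fun _ => le_rfl) n
      _ ≤ _ := by
          rw [← smul_add, ← hP', Measure.smul_apply, smul_eq_mul]
          refine add_le_add (lintegral_mono fun x => ?_) le_rfl
          exact pcost_mono x le_rfl fun _ => le_top
  calc sampleCost nrm p n P ≤ _ := h1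
    _ ≤ _ := h2
    _ ≤ (sampleCost nrm p n P' + D * (n * β Set.univ)) + n * (D * β Set.univ) := by
      refine add_le_add h3 ?_
      simp [hmass]
    _ = _ := by ring

end Reindex

/-! ### Costs of a part of a probability measure, with a binomial number of points. -/

section ThinCost

variable {d : ℕ} (nrm : Seminorm ℝ (Fin d → ℝ)) (p : ℝ)

/-- The probability measure proportional to `ν`; a Dirac measure if `ν = 0`. -/
noncomputable def normalized (ν : Measure (Fin d → ℝ)) : Measure (Fin d → ℝ) :=
  open Classical in if ν Set.univ = 0 then Measure.dirac 0 else (ν Set.univ)⁻¹ • ν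

/-- The expected cost caused by the part `ν` of a probability measure in a sample of size `N`. -/
noncomputable def thinCost (N : ℕ) (ν : Measure (Fin d → ℝ)) : ℝ≥0∞ :=
  binomAvg (ν Set.univ) (1 - ν Set.univ) (fun n => sampleCost nrm p n (normalized ν)) N

variable {nrm p}

instance isProbabilityMeasure_normalized (ν : Measure (Fin d → ℝ)) [IsFiniteMeasure ν] :
    IsProbabilityMeasure (normalized ν) := by
  unfold normalized
  split_ifs with h
  · infer_instance
  · exact ⟨by rw [Measure.smul_apply, smul_eq_mul, ENNReal.inv_mul_cancel h (measure_ne_top _ _)]⟩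

theorem normalized_of_ne_zero {ν : Measure (Fin d → ℝ)} (h : ν Set.univ ≠ 0) :
    normalized ν = (ν Set.univ)⁻¹ • ν := if_neg h

theorem univ_smul_normalized (ν : Measure (Fin d → ℝ)) [IsFiniteMeasure ν] :
    ν Set.univ • normalized ν = ν := by
  by_cases h : ν Set.univ = 0
  · rw [h, zero_smul, Measure.measure_univ_eq_zero.1 h]
  · rw [normalized_of_ne_zero h, smul_smul, ENNReal.mul_inv_cancel h (measure_ne_top _ _),
      one_smul]

theorem thinCost_of_univ_eq_zero {ν : Measure (Fin d → ℝ)} (h : ν Set.univ = 0) (N : ℕ) :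
    thinCost nrm p N ν = 0 := by
  rw [thinCost, h, tsub_zero, binomAvg_zero_one, sampleCost_zero]

theorem thinCost_of_prob (ν : Measure (Fin d → ℝ)) [IsProbabilityMeasure ν] (N : ℕ) :
    thinCost nrm p N ν = sampleCost nrm p N ν := by
  have h1 : ∀ (φ : ℕ → ℝ≥0∞) (N : ℕ), binomAvg 1 0 φ N = φ N := fun φ N => by
    induction N generalizing φ with
    | zero => rfl
    | succ N ih => simp [binomAvg, ih]
  rw [thinCost, measure_univ, tsub_self, h1, normalized_of_ne_zero (by simp)]
  simp

theorem thinCost_mono_of_le {ν : Measure (Fin d → ℝ)} {φ : ℕ → ℝ≥0∞}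
    (h : ∀ n, sampleCost nrm p n (normalized ν) ≤ φ n) (N : ℕ) :
    thinCost nrm p N ν ≤ binomAvg (ν Set.univ) (1 - ν Set.univ) φ N := binomAvg_mono h N

theorem thinCost_le_moment (hp : 1 ≤ p) (ν : Measure (Fin d → ℝ)) [IsFiniteMeasure ν]
    (hν : ν Set.univ ≤ 1) (z : Fin d → ℝ) (N : ℕ) :
    thinCost nrm p N ν ≤ 2 ^ p * (N * ∫⁻ y, gcost nrm p y z ∂ν) := by
  refine (thinCost_mono_of_le (fun n => sampleCost_le_moment hp _ z n) N).trans (le_of_eq ?_)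
  rw [binomAvg_const_mul]
  congr 1
  have : (fun n : ℕ => (n : ℝ≥0∞) * ∫⁻ y, gcost nrm p y z ∂(normalized ν)) =
      fun n : ℕ => (∫⁻ y, gcost nrm p y z ∂(normalized ν)) * (n : ℝ≥0∞) := by
    funext n; exact mul_comm _ _
  rw [this, binomAvg_const_mul, binomAvg_cast (add_tsub_cancel_of_le hν)]
  conv_rhs => rw [← univ_smul_normalized ν]
  rw [lintegral_smul_measure, smul_eq_mul]
  ring

/-- The mixture estimate for sub-probability measures, in a form that can be iterated: both sides
again involve `thinCost` with the same N. Each part may use its own exponent for the fluctuation. -/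
theorem thinCost_sum_le (hp : 1 ≤ p) {ι : Type*} (s : Finset ι) (ν : ι → Measure (Fin d → ℝ))
    [∀ i, IsFiniteMeasure (ν i)] (hν : (∑ i ∈ s, ν i) Set.univ ≤ 1) (z : Fin d → ℝ) {θ : ι → ℝ}
    (hθ : ∀ i, 1 / 2 ≤ θ i) (hθ1 : ∀ i, θ i ≤ 1) (N : ℕ) :
    thinCost nrm p N (∑ i ∈ s, ν i) ≤ ∑ i ∈ s, thinCost nrm p N (ν i) +
      2 ^ p * ∑ i ∈ s, (∫⁻ y, gcost nrm p y z ∂(normalized (ν i))) *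
        (N * ν i Set.univ) ^ θ i := by
  set τ := ∑ i ∈ s, ν i with hτ
  have hτf : IsFiniteMeasure τ := ⟨hν.trans_lt ENNReal.one_lt_top⟩
  set t := τ Set.univ with ht
  have htt : t ≠ ∞ := measure_ne_top _ _
  by_cases h0 : t = 0
  · rw [thinCost_of_univ_eq_zero h0]; exact zero_le
  set m : ι → ℝ≥0∞ := fun i => ν i Set.univ / t with hm
  have hmt : ∀ i, t * m i = ν i Set.univ := fun i => ENNReal.mul_div_cancel h0 htt
  have hsum : ∑ i : s, m i = 1 := by
    rw [Finset.sum_coe_sort s m]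
    simp only [hm, div_eq_mul_inv]
    rw [← Finset.sum_mul, ← Measure.finsetSum_apply, ← hτ, ← ht, ENNReal.mul_inv_cancel h0 htt]
  have hm1 : ∀ i ∈ s, m i ≤ 1 := fun i hi => by
    rw [← hsum, Finset.sum_coe_sort s m]
    exact Finset.single_le_sum (fun _ _ => zero_le) hi
  have hnorm : normalized τ = ∑ i : s, m i • normalized (ν i) := by
    rw [normalized_of_ne_zero h0, Finset.sum_coe_sort s fun i => m i • normalized (ν i), hτ,
      Finset.smul_sum]
    refine Finset.sum_congr rfl fun i _ => ?_
    conv_lhs => rw [← univ_smul_normalized (ν i)]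
    rw [smul_smul, ← hτ, ← ht, hm]
    simp only [div_eq_mul_inv, mul_comm]
  have hstep : ∀ n, sampleCost nrm p n (normalized τ) ≤
      ∑ i ∈ s, (binomAvg (m i) (1 - m i) (fun n => sampleCost nrm p n (normalized (ν i))) n +
        2 ^ p * (∫⁻ y, gcost nrm p y z ∂(normalized (ν i))) * (n * m i) ^ θ i) := fun n => by
    rw [hnorm]
    refine (sampleCost_mixture_le hp (fun i : s => normalized (ν i)) (fun i => m i) hsum z
      n).trans ?_
    rw [Finset.sum_coe_sort s fun i => binomAvg (m i) (1 - m i)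
        (fun n => sampleCost nrm p n (normalized (ν i))) n,
      Finset.sum_coe_sort s fun i => (∫⁻ y, gcost nrm p y z ∂(normalized (ν i))) *
        binomDev n (m i), Finset.sum_add_distrib, Finset.mul_sum]
    refine add_le_add le_rfl (Finset.sum_le_sum fun i hi => ?_)
    have h2 : (2 : ℝ≥0∞) ^ p = 2 ^ (p - 1) * 2 := by
      conv_rhs => rw [← ENNReal.rpow_one 2, ← ENNReal.rpow_mul, one_mul]
      rw [← ENNReal.rpow_add _ _ (by norm_num) (by norm_num), sub_add_cancel]
    rw [h2, mul_assoc, mul_assoc, mul_left_comm]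
    have := binomDev_le_rpow (hm1 i hi) n (hθ i) (hθ1 i)
    calc _ ≤ (∫⁻ y, gcost nrm p y z ∂(normalized (ν i))) *
          (2 ^ (p - 1) * (2 * (n * m i) ^ θ i)) := by gcongr
      _ = _ := by ring
  refine (thinCost_mono_of_le hstep N).trans ?_
  rw [binomAvg_sum]
  simp_rw [binomAvg_add]
  rw [Finset.sum_add_distrib]
  refine add_le_add (Finset.sum_le_sum fun i hi => le_of_eq ?_) ?_
  -- Two-stage thinning, into the sum with weight t and then into part i with weight m i, is
  -- thinning with the weight t * m i, the mass of ν i.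
  · rw [binomAvg_comp, thinCost, ← ht, hmt]
    congr 1
    have h1 : t * (1 - m i) = t - ν i Set.univ := by
      rw [ENNReal.mul_sub fun _ _ => htt, mul_one, hmt]
    have h2 : ν i Set.univ ≤ t := by
      rw [← hmt i]
      exact (mul_le_mul_right (hm1 i hi) _).trans (mul_one _).le
    rw [h1]
    exact tsub_add_tsub_cancel hν h2
  · rw [Finset.mul_sum]
    refine Finset.sum_le_sum fun i hi => ?_
    rw [binomAvg_const_mul, mul_assoc]
    gcongr
    have := binomAvg_rpow_le_ennreal (c := m i) hν
      ((hm1 i hi).trans_lt ENNReal.one_lt_top).ne (by linarith [hθ i]) (hθ1 i) N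
    rwa [mul_assoc, hmt] at this

end ThinCost

/-! ### Grids of half-open cubes. -/

section Cells

variable {d : ℕ}

/-- The index of the cell of side `r` containing `x`. -/
noncomputable def cellIdx (r : ℝ) (x : Fin d → ℝ) : Fin d → ℤ := fun i => ⌊x i / r⌋

/-- The half-open cubes of side `r` with corners in `r ℤ^d`. -/
def cell (r : ℝ) (k : Fin d → ℤ) : Set (Fin d → ℝ) := {x | cellIdx r x = k}

/-- The cube `[-R, R)^d`. -/
def box (d : ℕ) (R : ℝ) : Set (Fin d → ℝ) := Set.univ.pi fun _ => Set.Ico (-R) R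

/-- The indices of the cells of side `R / M` in `[-R, R)^d`. -/
noncomputable def gridIdx (d M : ℕ) : Finset (Fin d → ℤ) := Fintype.piFinset fun _ => Finset.Ico (-(M : ℤ)) M

theorem cell_eq_pi {r : ℝ} (hr : 0 < r) (k : Fin d → ℤ) :
    cell r k = Set.univ.pi fun i => Set.Ico (r * k i) (r * (k i + 1)) := by
  ext x
  simp only [cell, cellIdx, funext_iff, Set.mem_ofPred_eq, Set.mem_univ_pi, Set.mem_Ico,
    Int.floor_eq_iff]
  refine forall_congr' fun i => ?_
  rw [le_div_iff₀ hr, div_lt_iff₀ hr, mul_comm, mul_comm r (_ + 1)]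

theorem measurable_cellIdx (r : ℝ) : Measurable (cellIdx (d := d) r) :=
  measurable_pi_lambda _ fun i => by
    show Measurable fun x : Fin d → ℝ => ⌊x i / r⌋
    exact (Measurable.div_const (measurable_pi_apply (X := fun _ : Fin d => ℝ) i) r).floor

theorem measurableSet_cell (r : ℝ) (k : Fin d → ℤ) : MeasurableSet (cell r k) :=
  measurable_cellIdx r (measurableSet_singleton k)

theorem disjoint_cell (r : ℝ) {k k' : Fin d → ℤ} (h : k ≠ k') : Disjoint (cell r k) (cell r k') :=
  Set.disjoint_left.2 fun _ hx hx' => h (hx.symm.trans hx')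

theorem volume_cell {r : ℝ} (hr : 0 < r) (k : Fin d → ℤ) :
    volume (cell r k) = ENNReal.ofReal r ^ d := by
  rw [cell_eq_pi hr, Real.volume_pi_Ico]
  have : ∀ i, r * ((k i : ℝ) + 1) - r * k i = r := fun i => by ring
  simp [this]

theorem measurableSet_box (R : ℝ) : MeasurableSet (box d R) :=
  MeasurableSet.univ_pi fun _ => measurableSet_Ico

theorem card_gridIdx (M : ℕ) : (gridIdx d M).card = (2 * M) ^ d := by
  rw [gridIdx, Fintype.card_piFinset]
  simp
  congr 1
  omega

theorem norm_sub_le_of_mem_cell {r : ℝ} (hr : 0 < r) {k : Fin d → ℤ} {x y : Fin d → ℝ}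
    (hx : x ∈ cell r k) (hy : y ∈ cell r k) : ‖y - x‖ ≤ r := by
  rw [cell_eq_pi hr] at hx hy
  rw [pi_norm_le_iff_of_nonneg hr.le]
  intro i
  have h1 := hx i trivial
  have h2 := hy i trivial
  rw [Set.mem_Ico] at h1 h2
  rw [Pi.sub_apply, Real.norm_eq_abs, abs_le]
  constructor <;> linarith

theorem cellIdx_mem_gridIdx {R : ℝ} (hR : 0 < R) {M : ℕ} (hM : 0 < M) {x : Fin d → ℝ} :
    cellIdx (R / M) x ∈ gridIdx d M ↔ x ∈ box d R := by
  have hM' : (0 : ℝ) < M := by exact_mod_cast hM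
  have hr : 0 < R / M := by positivity
  simp only [gridIdx, box, cellIdx, Fintype.mem_piFinset, Finset.mem_Ico, Set.mem_univ_pi,
    Set.mem_Ico, Int.le_floor, Int.floor_lt]
  refine forall_congr' fun i => ?_
  rw [le_div_iff₀ hr, div_lt_iff₀ hr]
  push_cast
  have : (M : ℝ) * (R / M) = R := by field_simp
  rw [neg_mul, this]

theorem cellIdx_half {r : ℝ} (x : Fin d → ℝ) (i : Fin d) :
    cellIdx r x i = cellIdx (r / 2) x i / 2 := by
  have := Int.floor_div_natCast (x i / (r / 2)) 2
  simp only [cellIdx]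
  have h2 : x i / (r / 2) / ((2 : ℕ) : ℝ) = x i / r := by
    by_cases hr : r = 0
    · simp [hr]
    · push_cast; field_simp
  rw [h2] at this
  exact_mod_cast this

theorem sum_restrict_cell {ν : Measure (Fin d → ℝ)} {r : ℝ} {S : Finset (Fin d → ℤ)}
    (h : ∀ᵐ x ∂ν, cellIdx r x ∈ S) : ∑ k ∈ S, ν.restrict (cell r k) = ν := by
  refine Measure.ext fun s hs => ?_
  rw [Measure.finsetSum_apply]
  have h1 : ∀ k ∈ S, (ν.restrict (cell r k)) s = ν (s ∩ cell r k) := fun k _ =>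
    Measure.restrict_apply hs
  rw [Finset.sum_congr rfl h1, ← measure_biUnion_finset]
  · refine measure_congr ?_
    filter_upwards [h] with x hx
    refine propext ⟨fun hx' => ?_, fun hx' => ?_⟩
    · obtain ⟨k, _, hk⟩ := Set.mem_iUnion₂.1 hx'
      exact hk.1
    · exact Set.mem_iUnion₂.2 ⟨_, hx, hx', rfl⟩
  · intro k _ k' _ hkk'
    exact (disjoint_cell r hkk').mono Set.inter_subset_right Set.inter_subset_right
  · exact fun k _ => hs.inter (measurableSet_cell r k)

/-- Concavity: the extreme case is that of equal summands. -/
theorem sum_rpow_le {ι : Type*} (s : Finset ι) (a : ι → ℝ≥0∞) {θ : ℝ} (hθ : 0 < θ) (hθ1 : θ ≤ 1) :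
    ∑ i ∈ s, a i ^ θ ≤ (s.card : ℝ≥0∞) ^ (1 - θ) * (∑ i ∈ s, a i) ^ θ := by
  have h1 := ENNReal.rpow_sum_le_const_mul_sum_rpow s (fun i => a i ^ θ) (p := 1 / θ)
    (by rw [le_div_iff₀ hθ]; linarith)
  have h2 : ∀ i, (a i ^ θ) ^ (1 / θ) = a i := fun i => by
    rw [← ENNReal.rpow_mul, mul_one_div_cancel hθ.ne', ENNReal.rpow_one]
  simp only [h2] at h1
  have h3 := ENNReal.rpow_le_rpow h1 hθ.le
  rw [← ENNReal.rpow_mul, one_div, inv_mul_cancel₀ hθ.ne', ENNReal.rpow_one,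
    ENNReal.mul_rpow_of_nonneg _ _ hθ.le, ← ENNReal.rpow_mul] at h3
  have h4 : (θ⁻¹ - 1) * θ = 1 - θ := by field_simp
  rwa [h4] at h3

end Cells

/-! ### Dyadic subdivision and the upper bound of order N ^ (1 - p/d). -/

section Hierarchy

variable {d : ℕ} {nrm : Seminorm ℝ (Fin d → ℝ)} {p C : ℝ}

theorem gcost_le_of_norm_le (hp : 0 ≤ p) (hC : 0 < C) (hnC : ∀ x, nrm x ≤ C * ‖x‖)
    {x y : Fin d → ℝ} {r : ℝ} (h : ‖y - x‖ ≤ r) :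
    gcost nrm p y x ≤ ENNReal.ofReal ((C * r) ^ p) := by
  refine ENNReal.ofReal_le_ofReal (Real.rpow_le_rpow (apply_nonneg _ _) ?_ hp)
  exact (hnC _).trans (mul_le_mul_of_nonneg_left h hC.le)

/-- For ν = 0 the normalization is an arbitrary point mass at which g may exceed D; the power of the
mass then makes both sides vanish. -/
theorem lintegral_normalized_mul_rpow_le (ν : Measure (Fin d → ℝ)) [IsFiniteMeasure ν]
    {g : (Fin d → ℝ) → ℝ≥0∞} {D : ℝ≥0∞} (hg : ∀ᵐ y ∂ν, g y ≤ D) {θ : ℝ} (hθ : 0 < θ) (N : ℕ) :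
    (∫⁻ y, g y ∂(normalized ν)) * (N * ν Set.univ) ^ θ ≤ D * (N * ν Set.univ) ^ θ := by
  by_cases h0 : ν Set.univ = 0
  · rw [h0, mul_zero, ENNReal.zero_rpow_of_pos hθ, mul_zero, mul_zero]
  · gcongr
    rw [normalized_of_ne_zero h0, lintegral_smul_measure, smul_eq_mul]
    have h1 : ∫⁻ y, g y ∂ν ≤ D * ν Set.univ := by
      rw [← lintegral_const]; exact lintegral_mono_ae hg
    calc _ ≤ (ν Set.univ)⁻¹ * (D * ν Set.univ) := by gcongr
      _ = D * ((ν Set.univ)⁻¹ * ν Set.univ) := by ring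
      _ = D := by rw [ENNReal.inv_mul_cancel h0 (measure_ne_top _ _), mul_one]

theorem thinCost_sum_le_of_bdd (hp : 1 ≤ p) {ι : Type*} (s : Finset ι)
    (ν : ι → Measure (Fin d → ℝ)) [∀ i, IsFiniteMeasure (ν i)]
    (hν : (∑ i ∈ s, ν i) Set.univ ≤ 1) (z : Fin d → ℝ) {D : ℝ≥0∞}
    (hD : ∀ i ∈ s, ∀ᵐ y ∂(ν i), gcost nrm p y z ≤ D) (N : ℕ) :
    thinCost nrm p N (∑ i ∈ s, ν i) ≤ ∑ i ∈ s, thinCost nrm p N (ν i) +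
      2 ^ p * D * ∑ i ∈ s, (N * ν i Set.univ) ^ (1 / 2 : ℝ) := by
  refine (thinCost_sum_le (θ := fun _ => 1 / 2) hp s ν hν z (fun _ => le_rfl)
    (fun _ => by norm_num) N).trans ?_
  rw [mul_assoc, Finset.mul_sum s _ D]
  exact add_le_add le_rfl (mul_le_mul_right (Finset.sum_le_sum fun i hi =>
    lintegral_normalized_mul_rpow_le (ν i) (hD i hi) one_half_pos N) _)

theorem sum_half_rpow_le {ι : Type*} (s : Finset ι) (ν : ι → Measure (Fin d → ℝ))
    (hν : (∑ i ∈ s, ν i) Set.univ ≤ 1) (N : ℕ) :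
    ∑ i ∈ s, (N * ν i Set.univ) ^ (1 / 2 : ℝ) ≤
      ENNReal.ofReal (Real.sqrt s.card * Real.sqrt N) := by
  rw [Measure.finsetSum_apply] at hν
  refine (sum_rpow_le s _ (by norm_num) (by norm_num)).trans ?_
  rw [← Finset.mul_sum, Real.sqrt_eq_rpow, Real.sqrt_eq_rpow,
    ENNReal.ofReal_mul (by positivity), ← ENNReal.ofReal_rpow_of_nonneg (by positivity)
    (by norm_num), ← ENNReal.ofReal_rpow_of_nonneg (by positivity) (by norm_num),
    ENNReal.ofReal_natCast, ENNReal.ofReal_natCast]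
  norm_num
  gcongr
  exact (mul_le_mul_right hν _).trans (mul_one _).le

theorem two_rpow_ofReal : (2 : ℝ≥0∞) ^ p = ENNReal.ofReal (2 ^ p) := by
  rw [← ENNReal.ofReal_rpow_of_pos (by norm_num)]
  simp

/-- Splitting a measure on `[-R, R)^d` into its parts on the cells of side `R / 2 ^ L`. -/
theorem exists_thinCost_le_sum_cells (hp : 1 ≤ p) (hpd : p < (d : ℝ) / 2)
    (hC : 0 < C) (hnC : ∀ x, nrm x ≤ C * ‖x‖) :
    ∃ A : ℝ, 0 < A ∧ ∀ R : ℝ, 0 < R → ∀ ν : Measure (Fin d → ℝ), ν Set.univ ≤ 1 →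
      (∀ᵐ x ∂ν, x ∈ box d R) → ∀ N L : ℕ,
      thinCost nrm p N ν ≤
        ∑ k ∈ gridIdx d (2 ^ L), thinCost nrm p N (ν.restrict (cell (R / (2 ^ L : ℕ)) k)) +
        ENNReal.ofReal (A * R ^ p * (2 ^ ((d : ℝ) / 2 - p)) ^ L * Real.sqrt N) := by
  have hp0 : 0 ≤ p := by linarith
  -- The ratio of the errors on successive levels: halving the side gains 2 ^ (-p), and 2 ^ d times
  -- as many cells lose 2 ^ (d / 2). As p < d / 2, it exceeds one and the finest level dominates.
  set b : ℝ := 2 ^ ((d : ℝ) / 2 - p) with hb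
  have hb1 : 1 < b := Real.one_lt_rpow (by norm_num) (by linarith)
  set c : ℝ := 2 ^ p * C ^ p * 2 ^ d with hc
  have hc0 : 0 < c := by positivity
  have hbb : 0 < b - 1 := by linarith
  -- Passing from level L to L + 1 adds c * R ^ p * b ^ L * √N. The constant A solves A + c ≤ A * b,
  -- which closes the induction, and it is at least c, which starts it.
  refine ⟨c * (1 + 1 / (b - 1)), by positivity, fun R hR ν hν hbox N L => ?_⟩
  have hνf : IsFiniteMeasure ν := ⟨hν.trans_lt ENNReal.one_lt_top⟩
  set A := c * (1 + 1 / (b - 1)) with hA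
  have hcA : c ≤ A := by
    rw [hA]; exact le_mul_of_one_le_right hc0.le (by have : 0 ≤ 1 / (b - 1) := by positivity
                                                     linarith)
  have hcA' : A + c ≤ A * b := by
    have : A * (b - 1) = c * (b - 1) + c := by rw [hA]; field_simp
    nlinarith
  have hsqrt : ∀ L : ℕ, Real.sqrt ((gridIdx d (2 ^ L)).card) = 2 ^ (((L : ℝ) + 1) * (d / 2)) := by
    intro L
    rw [card_gridIdx, Real.sqrt_eq_rpow]
    have : (((2 * 2 ^ L) ^ d : ℕ) : ℝ) = (2 : ℝ) ^ (((L : ℝ) + 1) * d) := by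
      rw [Real.rpow_mul (by norm_num), Real.rpow_add (by norm_num)]
      push_cast
      rw [Real.rpow_natCast, Real.rpow_natCast, Real.rpow_one, mul_comm (2 : ℝ)]
    rw [this, ← Real.rpow_mul (by norm_num)]
    congr 1; ring
  have hsum : ∀ L : ℕ, ∑ k ∈ gridIdx d (2 ^ L), ν.restrict (cell (R / (2 ^ L : ℕ)) k) = ν := by
    intro L
    refine sum_restrict_cell ?_
    filter_upwards [hbox] with x hx
    exact (cellIdx_mem_gridIdx hR (by positivity)).2 hx
  induction L with
  | zero =>
    have hz : ∀ᵐ y ∂ν, gcost nrm p y 0 ≤ ENNReal.ofReal ((C * R) ^ p) := by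
      filter_upwards [hbox] with y hy
      refine gcost_le_of_norm_le hp0 hC hnC ?_
      rw [sub_zero, pi_norm_le_iff_of_nonneg hR.le]
      intro i
      have := hy i trivial
      rw [Set.mem_Ico] at this
      rw [Real.norm_eq_abs, abs_le]
      exact ⟨this.1, this.2.le⟩
    have h1 := thinCost_sum_le_of_bdd (nrm := nrm) hp (gridIdx d (2 ^ 0))
      (fun k => ν.restrict (cell (R / (2 ^ 0 : ℕ)) k)) (by rw [hsum]; exact hν) 0
      (fun k _ => ae_restrict_of_ae hz) N
    rw [hsum] at h1
    refine h1.trans (add_le_add le_rfl ?_)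
    refine (mul_le_mul_right (sum_half_rpow_le _ _ (by rw [hsum]; exact hν) N) _).trans ?_
    rw [two_rpow_ofReal, ← ENNReal.ofReal_mul (by positivity), ← ENNReal.ofReal_mul (by positivity)]
    refine ENNReal.ofReal_le_ofReal ?_
    rw [hsqrt, pow_zero, mul_one, Real.mul_rpow hC.le hR.le]
    have h2 : (2 : ℝ) ^ (((0 : ℕ) : ℝ) + 1) * 1 = 2 := by norm_num
    have h3 : (2 : ℝ) ^ ((((0 : ℕ) : ℝ) + 1) * (d / 2)) ≤ 2 ^ d := by
      rw [← Real.rpow_natCast 2 d]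
      refine Real.rpow_le_rpow_of_exponent_le (by norm_num) ?_
      have : (0 : ℝ) ≤ d := by positivity
      push_cast; linarith
    calc 2 ^ p * (C ^ p * R ^ p) * (2 ^ ((((0 : ℕ) : ℝ) + 1) * (d / 2)) * Real.sqrt N)
        ≤ 2 ^ p * (C ^ p * R ^ p) * (2 ^ d * Real.sqrt N) := by gcongr
      _ = c * R ^ p * Real.sqrt N := by rw [hc]; ring
      _ ≤ A * R ^ p * Real.sqrt N := by gcongr
  | succ L ih =>
    set r : ℝ := R / (2 ^ L : ℕ) with hr
    have hr0 : 0 < r := by positivity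
    have hr2 : R / (2 ^ (L + 1) : ℕ) = r / 2 := by
      rw [hr]; push_cast; rw [pow_succ]; field_simp
    rw [hr2]
    have hsum' := hsum (L + 1)
    rw [hr2] at hsum'
    -- The index of the parent cell; integer division rounds down, as the floor in `cellIdx` does,
    -- also for negative indices.
    let f : (Fin d → ℤ) → Fin d → ℤ := fun k' i => k' i / 2
    have hf : ∀ k' ∈ gridIdx d (2 ^ (L + 1)), f k' ∈ gridIdx d (2 ^ L) := by
      intro k' hk'
      simp only [gridIdx, Fintype.mem_piFinset, Finset.mem_Ico] at hk' ⊢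
      intro i
      have := hk' i
      simp only [f]
      push_cast [pow_succ] at this ⊢
      omega
    have hfc : ∀ x, f (cellIdx (r / 2) x) = cellIdx r x := fun x => by
      funext i; exact (cellIdx_half x i).symm
    have hstep : ∀ k ∈ gridIdx d (2 ^ L), thinCost nrm p N (ν.restrict (cell r k)) ≤
        ∑ k' ∈ gridIdx d (2 ^ (L + 1)) with f k' = k,
          thinCost nrm p N (ν.restrict (cell (r / 2) k')) +
        2 ^ p * ENNReal.ofReal ((C * r) ^ p) *
          ∑ k' ∈ gridIdx d (2 ^ (L + 1)) with f k' = k,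
            (N * (ν.restrict (cell (r / 2) k')) Set.univ) ^ (1 / 2 : ℝ) := by
      intro k hk
      have hsub : ∀ k', f k' = k → cell (r / 2) k' ⊆ cell r k := by
        rintro k' rfl x hx
        have hx' : cellIdx (r / 2) x = k' := hx
        rw [cell, Set.mem_ofPred_eq, ← hfc, hx']
      have hcell : ∑ k' ∈ gridIdx d (2 ^ (L + 1)) with f k' = k, ν.restrict (cell (r / 2) k') =
          ν.restrict (cell r k) := by
        have h1 : ∀ᵐ x ∂(ν.restrict (cell r k)), cellIdx (r / 2) x ∈
            (gridIdx d (2 ^ (L + 1))).filter fun k' => f k' = k := by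
          filter_upwards [ae_restrict_mem (measurableSet_cell r k), ae_restrict_of_ae hbox]
            with x hx hxb
          rw [Finset.mem_filter, hfc]
          refine ⟨?_, hx⟩
          rw [← hr2]
          exact (cellIdx_mem_gridIdx hR (by positivity)).2 hxb
        conv_rhs => rw [← sum_restrict_cell h1]
        refine Finset.sum_congr rfl fun k' hk' => ?_
        rw [Measure.restrict_restrict (measurableSet_cell _ _),
          Set.inter_eq_left.2 (hsub k' (Finset.mem_filter.1 hk').2)]
      let z : Fin d → ℝ := fun i => r * k i
      have hz : z ∈ cell r k := by
        rw [cell_eq_pi hr0]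
        intro i _
        refine ⟨le_rfl, ?_⟩
        simp only [z]
        nlinarith
      have h1 := thinCost_sum_le_of_bdd (nrm := nrm) hp
        ((gridIdx d (2 ^ (L + 1))).filter fun k' => f k' = k)
        (fun k' => ν.restrict (cell (r / 2) k'))
        (by rw [hcell]; exact (Measure.restrict_le_self _).trans hν) z
        (D := ENNReal.ofReal ((C * r) ^ p)) (fun k' hk' => by
          filter_upwards [ae_restrict_mem (measurableSet_cell (r / 2) k')] with y hy
          exact gcost_le_of_norm_le hp0 hC hnC (norm_sub_le_of_mem_cell hr0 hz
            (hsub k' (Finset.mem_filter.1 hk').2 hy))) N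
      rwa [hcell] at h1
    refine ih.trans ?_
    refine (add_le_add (Finset.sum_le_sum hstep) le_rfl).trans ?_
    rw [Finset.sum_add_distrib, ← Finset.mul_sum, Finset.sum_fiberwise_of_maps_to hf,
      Finset.sum_fiberwise_of_maps_to hf, add_assoc]
    refine add_le_add le_rfl ?_
    refine (add_le_add (mul_le_mul_right (sum_half_rpow_le _ _ (by rw [hsum']; exact hν) N) _)
      le_rfl).trans ?_
    rw [two_rpow_ofReal, ← ENNReal.ofReal_mul (by positivity), ← ENNReal.ofReal_mul (by positivity),
      ← ENNReal.ofReal_add (by positivity) (by positivity)]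
    refine ENNReal.ofReal_le_ofReal ?_
    have hkey : 2 ^ p * (C * r) ^ p * (Real.sqrt ((gridIdx d (2 ^ (L + 1))).card) * Real.sqrt N) =
        c * R ^ p * b ^ L * Real.sqrt N := by
      rw [hsqrt, Real.mul_rpow hC.le hr0.le, hr, Real.div_rpow hR.le (by positivity)]
      have h1 : ((2 ^ L : ℕ) : ℝ) ^ p = 2 ^ ((L : ℝ) * p) := by
        rw [Real.rpow_mul (by norm_num), Real.rpow_natCast]; push_cast; rfl
      have h2 : b ^ L = 2 ^ ((L : ℝ) * (d / 2)) / 2 ^ ((L : ℝ) * p) := by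
        rw [hb, ← Real.rpow_natCast, ← Real.rpow_mul (by norm_num), ← Real.rpow_sub (by norm_num)]
        congr 1; ring
      have h3 : (2 : ℝ) ^ ((((L + 1 : ℕ) : ℝ) + 1) * (d / 2)) =
          2 ^ d * 2 ^ ((L : ℝ) * (d / 2)) := by
        rw [← Real.rpow_natCast 2 d, ← Real.rpow_add (by norm_num)]
        congr 1; push_cast; ring
      rw [h1, h2, h3, hc]
      field_simp
    rw [hkey]
    calc c * R ^ p * b ^ L * Real.sqrt N + A * R ^ p * b ^ L * Real.sqrt N
        = (A + c) * (R ^ p * b ^ L * Real.sqrt N) := by ring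
      _ ≤ (A * b) * (R ^ p * b ^ L * Real.sqrt N) := by gcongr
      _ = _ := by ring

theorem exists_pow_two_near {x : ℝ} (hx : 1 ≤ x) : ∃ L : ℕ, (2 : ℝ) ^ L ≤ x ∧ x < 2 ^ (L + 1) :=
  exists_nat_pow_near hx (by norm_num)

/-- The upper bound of optimal order for measures on `[-R, R)^d`. -/
theorem exists_sampleCost_le (hp : 1 ≤ p) (hpd : p < (d : ℝ) / 2)
    (hC : 0 < C) (hnC : ∀ x, nrm x ≤ C * ‖x‖) :
    ∃ A : ℝ, 0 < A ∧ ∀ R : ℝ, 0 < R → ∀ μ : Measure (Fin d → ℝ), IsProbabilityMeasure μ →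
      (∀ᵐ x ∂μ, x ∈ box d R) → ∀ N : ℕ,
      sampleCost nrm p N μ ≤ ENNReal.ofReal (A * R ^ p * (N : ℝ) ^ (1 - p / d)) := by
  have hp0 : 0 ≤ p := by linarith
  have hd0 : (0 : ℝ) < d := by linarith
  obtain ⟨A, hA, h⟩ := exists_thinCost_le_sum_cells (nrm := nrm) hp hpd hC hnC
  refine ⟨4 ^ p * C ^ p + A, by positivity, fun R hR μ hμ hbox N => ?_⟩
  rcases Nat.eq_zero_or_pos N with rfl | hN
  · rw [sampleCost_zero]; exact zero_le
  have hN' : (1 : ℝ) ≤ N := by exact_mod_cast hN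
  have hN0 : (0 : ℝ) < N := by linarith
  -- With 2 ^ L close to N ^ (1 / d) the trivial cost N * r ^ p within the cells and the accumulated
  -- error b ^ L * √N are both of order N ^ (1 - p/d).
  obtain ⟨L, hL1, hL2⟩ := exists_pow_two_near (x := (N : ℝ) ^ (1 / (d : ℝ)))
    (Real.one_le_rpow hN' (by positivity))
  have h1 := h R hR μ (by simp) hbox N L
  rw [thinCost_of_prob] at h1
  refine h1.trans ?_
  set r : ℝ := R / (2 ^ L : ℕ) with hr
  have hr0 : 0 < r := by positivity
  have hcell : ∀ k, thinCost nrm p N (μ.restrict (cell r k)) ≤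
      ENNReal.ofReal (2 ^ p * (N * (C * r) ^ p)) * μ.restrict (cell r k) Set.univ := by
    intro k
    let z : Fin d → ℝ := fun i => r * k i
    have hz : z ∈ cell r k := by
      rw [cell_eq_pi hr0]
      intro i _
      refine ⟨le_rfl, ?_⟩
      simp only [z]
      nlinarith
    refine (thinCost_le_moment hp _ ((Measure.restrict_le_self _).trans (by simp)) z N).trans ?_
    rw [two_rpow_ofReal, ENNReal.ofReal_mul (by positivity), ENNReal.ofReal_mul (by positivity),
      mul_assoc, mul_assoc, ENNReal.ofReal_natCast]
    gcongr
    rw [← lintegral_const]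
    refine lintegral_mono_ae ?_
    filter_upwards [ae_restrict_mem (measurableSet_cell r k)] with y hy
    exact gcost_le_of_norm_le hp0 hC hnC (norm_sub_le_of_mem_cell hr0 hz hy)
  have hsum : ∑ k ∈ gridIdx d (2 ^ L), (μ.restrict (cell r k)) Set.univ = 1 := by
    rw [← Measure.finsetSum_apply, sum_restrict_cell, measure_univ]
    filter_upwards [hbox] with x hx
    exact (cellIdx_mem_gridIdx hR (by positivity)).2 hx
  have h2 : ∑ k ∈ gridIdx d (2 ^ L), thinCost nrm p N (μ.restrict (cell r k)) ≤
      ENNReal.ofReal (2 ^ p * (N * (C * r) ^ p)) := by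
    refine (Finset.sum_le_sum fun k _ => hcell k).trans ?_
    rw [← Finset.mul_sum, hsum, mul_one]
  refine (add_le_add h2 le_rfl).trans ?_
  rw [← ENNReal.ofReal_add (by positivity) (by positivity)]
  refine ENNReal.ofReal_le_ofReal ?_
  have h2L : (0 : ℝ) < 2 ^ L := by positivity
  have e1 : 2 ^ p * (N * (C * r) ^ p) ≤ 4 ^ p * C ^ p * R ^ p * (N : ℝ) ^ (1 - p / d) := by
    have hrle : r ≤ 2 * R * (N : ℝ) ^ (-(1 / (d : ℝ))) := by
      rw [hr, div_le_iff₀ (by positivity), Real.rpow_neg hN0.le]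
      push_cast
      have hpos : (0 : ℝ) < (N : ℝ) ^ (1 / (d : ℝ)) := by positivity
      rw [pow_succ] at hL2
      have : R * (N : ℝ) ^ (1 / (d : ℝ)) ≤ 2 * R * 2 ^ L := by nlinarith
      calc R = (R * (N : ℝ) ^ (1 / (d : ℝ))) * ((N : ℝ) ^ (1 / (d : ℝ)))⁻¹ := by field_simp
        _ ≤ (2 * R * 2 ^ L) * ((N : ℝ) ^ (1 / (d : ℝ)))⁻¹ := by gcongr
        _ = _ := by ring
    calc 2 ^ p * (N * (C * r) ^ p) ≤
          2 ^ p * (N * (C * (2 * R * (N : ℝ) ^ (-(1 / (d : ℝ))))) ^ p) := by gcongr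
      _ = (2 ^ p * 2 ^ p) * C ^ p * R ^ p * ((N : ℝ) ^ (1 : ℝ) * (N : ℝ) ^ (-(1 / (d : ℝ)) * p)) := by
          rw [Real.mul_rpow hC.le (by positivity), Real.mul_rpow (by positivity) (by positivity),
            Real.mul_rpow (by norm_num) hR.le, ← Real.rpow_mul hN0.le, Real.rpow_one]
          ring
      _ = _ := by
          rw [← Real.mul_rpow (by norm_num) (by norm_num), ← Real.rpow_add hN0]
          norm_num
          left
          congr 1
          ring
  have e2 : (2 ^ ((d : ℝ) / 2 - p)) ^ L * Real.sqrt N ≤ (N : ℝ) ^ (1 - p / d) := by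
    rw [← Real.rpow_natCast, ← Real.rpow_mul (by norm_num), mul_comm ((d : ℝ) / 2 - p),
      Real.rpow_mul (by norm_num), Real.rpow_natCast, Real.sqrt_eq_rpow]
    calc ((2 : ℝ) ^ L) ^ ((d : ℝ) / 2 - p) * (N : ℝ) ^ (1 / 2 : ℝ)
        ≤ ((N : ℝ) ^ (1 / (d : ℝ))) ^ ((d : ℝ) / 2 - p) * (N : ℝ) ^ (1 / 2 : ℝ) := by
          gcongr
      _ = _ := by
          rw [← Real.rpow_mul hN0.le, ← Real.rpow_add hN0]
          congr 1
          field_simp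
          ring
  calc 2 ^ p * (N * (C * r) ^ p) + A * R ^ p * (2 ^ ((d : ℝ) / 2 - p)) ^ L * Real.sqrt N
      ≤ 4 ^ p * C ^ p * R ^ p * (N : ℝ) ^ (1 - p / d) + A * R ^ p * (N : ℝ) ^ (1 - p / d) := by
        refine add_le_add e1 ?_
        rw [mul_assoc (A * R ^ p)]
        gcongr
    _ = _ := by ring

end Hierarchy

/-! ### The tail outside a large box, controlled by the moment of order q. -/

section Pierce

variable {d : ℕ} {nrm : Seminorm ℝ (Fin d → ℝ)} {p C : ℝ}

theorem sampleCost_map_add (hp : 1 ≤ p) (μ : Measure (Fin d → ℝ)) [IsProbabilityMeasure μ]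
    (z : Fin d → ℝ) (n : ℕ) :
    sampleCost nrm p n (μ.map fun y => y + z) = sampleCost nrm p n μ := by
  have := sampleCost_map (nrm := nrm) hp μ one_pos z n
  simpa using this

theorem ae_normalized {ν : Measure (Fin d → ℝ)} (h0 : ν Set.univ ≠ 0) {P : (Fin d → ℝ) → Prop}
    (h : ∀ᵐ x ∂ν, P x) : ∀ᵐ x ∂(normalized ν), P x := by
  rw [normalized_of_ne_zero h0]
  exact Measure.ae_smul_measure h _

/-- The upper bound of optimal order for thinned samples of measures on a cube of side `2 R`. -/
theorem exists_thinCost_le (hp : 1 ≤ p) (hpd : p < (d : ℝ) / 2)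
    (hC : 0 < C) (hnC : ∀ x, nrm x ≤ C * ‖x‖) :
    ∃ A : ℝ, 0 < A ∧ ∀ R : ℝ, 0 < R → ∀ (z : Fin d → ℝ) (ν : Measure (Fin d → ℝ)),
      ν Set.univ ≤ 1 → (∀ᵐ x ∂ν, x - z ∈ box d R) → ∀ N : ℕ,
      thinCost nrm p N ν ≤ ENNReal.ofReal (A * R ^ p) * (N * ν Set.univ) ^ (1 - p / d) := by
  have hd0 : (0 : ℝ) < d := by linarith
  have hpd1 : p / d < 1 := by rw [div_lt_one hd0]; linarith
  have hpd0 : 0 ≤ p / d := by positivity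
  obtain ⟨A, hA, h⟩ := exists_sampleCost_le (nrm := nrm) hp hpd hC hnC
  refine ⟨A, hA, fun R hR z ν hν hz N => ?_⟩
  have hνf : IsFiniteMeasure ν := ⟨hν.trans_lt ENNReal.one_lt_top⟩
  by_cases h0 : ν Set.univ = 0
  · rw [thinCost_of_univ_eq_zero h0]; exact zero_le
  have hs : ∀ n : ℕ, sampleCost nrm p n (normalized ν) ≤
      ENNReal.ofReal (A * R ^ p) * ((n : ℝ≥0∞) * 1) ^ (1 - p / d) := by
    intro n
    have hm : Measurable fun y : Fin d → ℝ => y + -z := measurable_add_const _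
    have h1 := h R hR ((normalized ν).map fun y => y + -z)
      (Measure.isProbabilityMeasure_map hm.aemeasurable) (by
        refine (ae_map_iff (p := fun x => x ∈ box d R) hm.aemeasurable (measurableSet_box R)).2 ?_
        filter_upwards [ae_normalized h0 hz] with x hx
        rwa [← sub_eq_add_neg]) n
    rw [sampleCost_map_add hp] at h1
    refine h1.trans_eq ?_
    rw [ENNReal.ofReal_mul (by positivity), mul_one,
      ← ENNReal.ofReal_rpow_of_nonneg (by positivity) (by linarith), ENNReal.ofReal_natCast]
  refine (thinCost_mono_of_le hs N).trans ?_
  rw [binomAvg_const_mul]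
  refine mul_le_mul_right ?_ _
  simpa using binomAvg_rpow_le_ennreal hν ENNReal.one_ne_top (by linarith : 0 < 1 - p / d)
    (by linarith) N

theorem measure_compl_box_le (μ : Measure (Fin d → ℝ)) {q R : ℝ} (hR : 0 < R) (hq : 0 < q) :
    ENNReal.ofReal (R ^ q) * μ (box d R)ᶜ ≤ ∫⁻ x, ENNReal.ofReal (‖x‖ ^ q) ∂μ := by
  rw [← setLIntegral_const]
  refine (setLIntegral_mono_ae (by fun_prop) ?_).trans (setLIntegral_le_lintegral _ _)
  refine Eventually.of_forall fun x hx => ENNReal.ofReal_le_ofReal ?_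
  refine Real.rpow_le_rpow hR.le ?_ hq.le
  by_contra! h
  refine hx fun i _ => ?_
  have := (pi_norm_lt_iff hR).1 h i
  rw [Real.norm_eq_abs, abs_lt] at this
  exact ⟨this.1.le, this.2⟩

theorem norm_le_of_mem_box {R : ℝ} (hR : 0 < R) {x : Fin d → ℝ} (hx : x ∈ box d R) :
    ‖x‖ ≤ R := by
  rw [pi_norm_le_iff_of_nonneg hR.le]
  intro i
  have := hx i trivial
  rw [Set.mem_Ico] at this
  rw [Real.norm_eq_abs, abs_le]
  exact ⟨this.1, this.2.le⟩

theorem box_mono {R R' : ℝ} (h : R ≤ R') : box d R ⊆ box d R' :=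
  Set.pi_mono fun _ _ => Set.Ico_subset_Ico (by linarith) h

theorem lintegral_normalized_mul (ν : Measure (Fin d → ℝ)) [IsFiniteMeasure ν]
    (g : (Fin d → ℝ) → ℝ≥0∞) : (∫⁻ y, g y ∂(normalized ν)) * ν Set.univ = ∫⁻ y, g y ∂ν := by
  conv_rhs => rw [← univ_smul_normalized ν]
  rw [lintegral_smul_measure, smul_eq_mul, mul_comm]

theorem tendsto_lintegral_compl_box (μ : Measure (Fin d → ℝ))
    {g : (Fin d → ℝ) → ℝ≥0∞} (hg : ∫⁻ x, g x ∂μ ≠ ∞) :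
    Tendsto (fun n : ℕ => ∫⁻ x in (box d (2 ^ n))ᶜ, g x ∂μ) atTop (𝓝 0) := by
  have hfin : IsFiniteMeasure (μ.withDensity g) := isFiniteMeasure_withDensity hg
  have h1 : ∀ n : ℕ, ∫⁻ x in (box d (2 ^ n))ᶜ, g x ∂μ = (μ.withDensity g) (box d (2 ^ n))ᶜ :=
    fun n => (withDensity_apply _ (measurableSet_box _).compl).symm
  simp only [h1]
  have h2 : ⋂ n : ℕ, (box d (2 ^ n))ᶜ = ∅ := by
    rw [← Set.compl_iUnion, Set.compl_empty_iff, Set.eq_univ_iff_forall]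
    intro x
    obtain ⟨n, hn⟩ := pow_unbounded_of_one_lt ‖x‖ (by norm_num : (1 : ℝ) < 2)
    refine Set.mem_iUnion.2 ⟨n, fun i _ => ?_⟩
    have := (pi_norm_lt_iff (by positivity)).1 hn i
    rw [Real.norm_eq_abs, abs_lt] at this
    exact ⟨this.1.le, this.2⟩
  rw [← measure_empty (μ := μ.withDensity g), ← h2]
  refine tendsto_measure_iInter_atTop (fun n => (measurableSet_box _).compl.nullMeasurableSet) ?_
    ⟨0, measure_ne_top _ _⟩
  intro m n hmn
  exact Set.compl_subset_compl.2 (box_mono (pow_le_pow_right₀ (by norm_num) hmn))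

theorem sum_shells_add (μ : Measure (Fin d → ℝ)) (K n : ℕ) :
    ∑ i ∈ Finset.range n, μ.restrict (box d (2 ^ (K + i + 1)) \ box d (2 ^ (K + i))) +
      μ.restrict (box d (2 ^ (K + n)))ᶜ = μ.restrict (box d (2 ^ K))ᶜ := by
  induction n with
  | zero => simp
  | succ n ih =>
    rw [Finset.sum_range_succ, add_assoc, ← ih]
    congr 1
    rw [← Measure.restrict_union _ (measurableSet_box _).compl]
    · congr 1
      ext x
      have : box d (2 ^ (K + n)) ⊆ box d (2 ^ (K + (n + 1))) :=
        box_mono (pow_le_pow_right₀ (by norm_num) (by omega))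
      have := @this x
      simp only [← add_assoc] at this ⊢
      simp only [Set.mem_union, Set.mem_sdiff, Set.mem_compl_iff]
      tauto
    · rw [Set.disjoint_left]
      intro x hx hx'
      exact hx' hx.1

/-- The shell between the boxes of radius 2 ^ k and 2 ^ (k + 1) costs a multiple of 2 ^ (k p) *
μ(shell) ^ θ * N ^ θ. By Markov's inequality this decays geometrically in k, so the tail is small
uniformly in N on the scale N ^ θ. -/
theorem exists_thinCost_compl_box_le (hp : 1 ≤ p) (hpd : p < (d : ℝ) / 2)
    (hC : 0 < C) (hnC : ∀ x, nrm x ≤ C * ‖x‖) (μ : Measure (Fin d → ℝ)) [IsProbabilityMeasure μ]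
    {q : ℝ} (hq : (d : ℝ) * p / ((d : ℝ) - p) < q) (hμ : ∫⁻ x, ENNReal.ofReal (‖x‖ ^ q) ∂μ ≠ ∞)
    (hμp : ∫⁻ x, gcost nrm p x 0 ∂μ ≠ ∞) :
    ∃ B : ℝ≥0∞, B ≠ ∞ ∧ ∃ ρ : ℝ≥0∞, ρ < 1 ∧ ∀ K N : ℕ,
      thinCost nrm p N (μ.restrict (box d (2 ^ K))ᶜ) ≤ B * ρ ^ K * (N : ℝ≥0∞) ^ (1 - p / d) := by
  have hp0 : 0 ≤ p := by linarith
  have hd0 : (0 : ℝ) < d := by linarith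
  have hpd1 : p / d < 1 := by rw [div_lt_one hd0]; linarith
  have hpd0 : 0 ≤ p / d := by positivity
  have hpd2 : p / d ≤ 1 / 2 := by rw [div_le_iff₀ hd0]; linarith
  set θ := 1 - p / d with hθ
  have hq0 : 0 < q := lt_of_le_of_lt (div_nonneg (by positivity) (by linarith)) hq
  have hqθ : p < q * θ := by
    rw [div_lt_iff₀ (by linarith)] at hq
    rw [hθ]
    have : q * (1 - p / d) * d = q * (d - p) := by field_simp
    nlinarith
  obtain ⟨A, hA, hthin⟩ := exists_thinCost_le (nrm := nrm) hp hpd hC hnC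
  set M := ∫⁻ x, ENNReal.ofReal (‖x‖ ^ q) ∂μ with hM
  -- Since μ(shell) is at most M * 2 ^ (-k q), this is the ratio of successive shells; its exponent
  -- is negative exactly when q > d p / (d - p).
  set ρ : ℝ≥0∞ := (2 : ℝ≥0∞) ^ (p - q * θ) with hρ
  have hρ1 : ρ < 1 := by
    refine ENNReal.rpow_lt_one_of_one_lt_of_neg (by norm_num) (by linarith)
  set c : ℝ≥0∞ := ENNReal.ofReal (A * 2 ^ p + 2 ^ p * (C * 2) ^ p) * M ^ θ with hc
  have hcfin : c ≠ ∞ := ENNReal.mul_ne_top ENNReal.ofReal_ne_top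
    (ENNReal.rpow_ne_top_of_nonneg (by linarith) hμ)
  refine ⟨c * (1 - ρ)⁻¹, ENNReal.mul_ne_top hcfin
    (ENNReal.inv_ne_top.2 (tsub_pos_of_lt hρ1).ne'), ρ, hρ1, fun K N => ?_⟩
  set S : ℕ → Set (Fin d → ℝ) := fun k => box d (2 ^ (k + 1)) \ box d (2 ^ k) with hS
  have hmass : ∀ k : ℕ, (ENNReal.ofReal (2 ^ k)) ^ p * (μ (S k)) ^ θ ≤ M ^ θ * ρ ^ k := by
    intro k
    have h1 : ENNReal.ofReal ((2 ^ k) ^ q) * μ (S k) ≤ M :=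
      (mul_le_mul_right (measure_mono fun x hx => hx.2) _).trans
        (measure_compl_box_le μ (by positivity) hq0)
    have h2 : (ENNReal.ofReal ((2 ^ k) ^ q)) ^ θ * μ (S k) ^ θ ≤ M ^ θ := by
      rw [← ENNReal.mul_rpow_of_nonneg _ _ (by linarith)]
      exact ENNReal.rpow_le_rpow h1 (by linarith)
    have h3 : (ENNReal.ofReal (2 ^ k)) ^ p = ENNReal.ofReal ((2 ^ k) ^ q) ^ θ * ρ ^ k := by
      rw [← ENNReal.ofReal_rpow_of_pos (by positivity), ENNReal.ofReal_pow (by norm_num),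
        ← ENNReal.rpow_mul, hρ, ← ENNReal.rpow_natCast (_ ^ (p - q * θ)), ← ENNReal.rpow_mul,
        ← ENNReal.rpow_natCast, ← ENNReal.rpow_mul, ← ENNReal.rpow_mul]
      have : ENNReal.ofReal 2 = 2 := by simp
      rw [this, ← ENNReal.rpow_add _ _ (by norm_num) (by norm_num)]
      congr 1; ring
    rw [h3, mul_assoc, mul_comm (ρ ^ k), ← mul_assoc]
    exact mul_le_mul_left h2 _
  have hshellcost : ∀ k, ∀ᵐ y ∂(μ.restrict (S k)),
      gcost nrm p y 0 ≤ ENNReal.ofReal ((C * 2 ^ (k + 1)) ^ p) := by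
    intro k
    filter_upwards [ae_restrict_mem ((measurableSet_box _).diff (measurableSet_box _))] with y hy
    refine gcost_le_of_norm_le hp0 hC hnC ?_
    rw [sub_zero]
    exact norm_le_of_mem_box (by positivity) hy.1
  have hshell : ∀ k, thinCost nrm p N (μ.restrict (S k)) + 2 ^ p *
      ((∫⁻ y, gcost nrm p y 0 ∂(normalized (μ.restrict (S k)))) *
        (N * (μ.restrict (S k)) Set.univ) ^ θ) ≤ c * ρ ^ k * (N : ℝ≥0∞) ^ θ := by
    intro k
    have h1 := hthin (2 ^ (k + 1)) (by positivity) 0 (μ.restrict (S k))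
      ((Measure.restrict_le_self _).trans (by simp)) (by
        filter_upwards [ae_restrict_mem ((measurableSet_box _).diff (measurableSet_box _))]
          with y hy
        rw [sub_zero]; exact hy.1) N
    have h2 := lintegral_normalized_mul_rpow_le (μ.restrict (S k)) (hshellcost k)
      (by linarith : 0 < θ) N
    refine (add_le_add h1 (mul_le_mul_right h2 _)).trans ?_
    rw [two_rpow_ofReal, ← mul_assoc, ← ENNReal.ofReal_mul (by positivity), ← add_mul,
      ← ENNReal.ofReal_add (by positivity) (by positivity), Measure.restrict_apply_univ]
    have h3 : A * (2 ^ (k + 1)) ^ p + 2 ^ p * (C * 2 ^ (k + 1)) ^ p =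
        (A * 2 ^ p + 2 ^ p * (C * 2) ^ p) * (2 ^ k) ^ p := by
      rw [pow_succ', Real.mul_rpow (by norm_num) (by positivity), ← mul_assoc C,
        Real.mul_rpow (by positivity) (by positivity : (0 : ℝ) ≤ 2 ^ k)]
      ring
    rw [h3, ENNReal.ofReal_mul (by positivity), ← ENNReal.ofReal_rpow_of_pos (by positivity),
      ENNReal.mul_rpow_of_nonneg _ _ (by linarith)]
    calc _ = ENNReal.ofReal (A * 2 ^ p + 2 ^ p * (C * 2) ^ p) *
          (ENNReal.ofReal (2 ^ k) ^ p * μ (S k) ^ θ) * (N : ℝ≥0∞) ^ θ := by ring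
      _ ≤ ENNReal.ofReal (A * 2 ^ p + 2 ^ p * (C * 2) ^ p) *
          (M ^ θ * ρ ^ k) * (N : ℝ≥0∞) ^ θ := by
            exact mul_le_mul_left (mul_le_mul_right (hmass k) _) _
      _ = _ := by rw [hc]; ring
  have hmain : ∀ n : ℕ, thinCost nrm p N (μ.restrict (box d (2 ^ K))ᶜ) ≤
      c * (1 - ρ)⁻¹ * ρ ^ K * (N : ℝ≥0∞) ^ θ +
      2 * (2 ^ p * (N * ∫⁻ x in (box d (2 ^ (n + K)))ᶜ, gcost nrm p x 0 ∂μ)) := by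
    intro n
    -- Finitely many shells and one remainder. The remainder gets the exponent 1, for which its
    -- error term is a plain moment; this moment tends to zero as n → ∞ with N fixed.
    let ν : ℕ → Measure (Fin d → ℝ) := fun i =>
      if i < n then μ.restrict (S (K + i)) else μ.restrict (box d (2 ^ (K + n)))ᶜ
    have hνf : ∀ i, IsFiniteMeasure (ν i) := fun i => by
      simp only [ν]; split_ifs <;> infer_instance
    have hν1 : ∀ i ∈ Finset.range n, ν i = μ.restrict (S (K + i)) := fun i hi =>
      if_pos (Finset.mem_range.1 hi)
    have hν2 : ν n = μ.restrict (box d (2 ^ (K + n)))ᶜ := if_neg (lt_irrefl _)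
    have hsum : ∑ i ∈ Finset.range (n + 1), ν i = μ.restrict (box d (2 ^ K))ᶜ := by
      rw [Finset.sum_range_succ, hν2, Finset.sum_congr rfl hν1]
      exact sum_shells_add μ K n
    have h1 := thinCost_sum_le (nrm := nrm) hp (Finset.range (n + 1)) ν
      (by rw [hsum]; exact (Measure.restrict_le_self _).trans (by simp)) 0
      (θ := fun i => if i < n then θ else 1)
      (fun i => by split_ifs <;> [linarith; norm_num])
      (fun i => by split_ifs <;> [linarith; norm_num]) N
    rw [hsum, Finset.mul_sum, ← Finset.sum_add_distrib, Finset.sum_range_succ] at h1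
    refine h1.trans (add_le_add ?_ ?_)
    · calc _ ≤ ∑ i ∈ Finset.range n, c * ρ ^ (K + i) * (N : ℝ≥0∞) ^ θ := by
            refine Finset.sum_le_sum fun i hi => ?_
            rw [hν1 i hi, if_pos (Finset.mem_range.1 hi)]
            exact hshell (K + i)
        _ = c * (∑ i ∈ Finset.range n, ρ ^ i) * ρ ^ K * (N : ℝ≥0∞) ^ θ := by
            rw [Finset.mul_sum, Finset.sum_mul, Finset.sum_mul]
            refine Finset.sum_congr rfl fun i _ => ?_
            rw [pow_add]; ring
        _ ≤ _ := by
            gcongr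
            rw [← ENNReal.tsum_geometric]
            exact ENNReal.sum_le_tsum _
    · rw [hν2, if_neg (lt_irrefl _), ENNReal.rpow_one, add_comm K n, two_mul]
      refine add_le_add ?_ ?_
      · exact thinCost_le_moment hp _ ((Measure.restrict_le_self _).trans (by simp)) 0 N
      · rw [mul_left_comm (∫⁻ y, _ ∂_), lintegral_normalized_mul]
  have hlim : Tendsto (fun n : ℕ => c * (1 - ρ)⁻¹ * ρ ^ K * (N : ℝ≥0∞) ^ θ +
      2 * (2 ^ p * (N * ∫⁻ x in (box d (2 ^ (n + K)))ᶜ, gcost nrm p x 0 ∂μ))) atTop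
      (𝓝 (c * (1 - ρ)⁻¹ * ρ ^ K * (N : ℝ≥0∞) ^ θ + 2 * (2 ^ p * (N * 0)))) := by
    refine Tendsto.add tendsto_const_nhds ?_
    refine ENNReal.Tendsto.const_mul (ENNReal.Tendsto.const_mul (ENNReal.Tendsto.const_mul
      ((tendsto_lintegral_compl_box μ hμp).comp (tendsto_add_atTop_nat K))
      (Or.inr (ENNReal.natCast_ne_top N))) (Or.inr ?_)) (Or.inr (by norm_num))
    exact ENNReal.rpow_ne_top_of_nonneg hp0 (by norm_num)
  have := ge_of_tendsto' hlim hmain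
  simpa using this

/-- A two-component mixture. The fluctuation between Q and its complement is of order √N, hence
negligible against N ^ (1 - p/d). -/
theorem exists_sampleCost_le_split (hp : 1 ≤ p) (μ : Measure (Fin d → ℝ))
    [IsProbabilityMeasure μ] (hμp : ∫⁻ x, gcost nrm p x 0 ∂μ ≠ ∞) {Q : Set (Fin d → ℝ)}
    (hQ : MeasurableSet Q) :
    ∃ B : ℝ≥0∞, B ≠ ∞ ∧ ∀ N : ℕ, sampleCost nrm p N μ ≤ thinCost nrm p N (μ.restrict Q) +
      thinCost nrm p N (μ.restrict Qᶜ) + B * (N : ℝ≥0∞) ^ (1 / 2 : ℝ) := by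
  have hfin : ∀ S : Set (Fin d → ℝ), (∫⁻ y, gcost nrm p y 0 ∂(normalized (μ.restrict S))) *
      ((μ.restrict S) Set.univ) ^ (1 / 2 : ℝ) ≠ ∞ := by
    intro S
    by_cases h0 : (μ.restrict S) Set.univ = 0
    · rw [h0, ENNReal.zero_rpow_of_pos (by norm_num), mul_zero]; exact ENNReal.zero_ne_top
    · refine ENNReal.mul_ne_top ?_ (ENNReal.rpow_ne_top_of_nonneg (by norm_num)
        (measure_ne_top _ _))
      rw [normalized_of_ne_zero h0, lintegral_smul_measure, smul_eq_mul]
      exact ENNReal.mul_ne_top (ENNReal.inv_ne_top.2 h0)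
        (ne_top_of_le_ne_top hμp (setLIntegral_le_lintegral _ _))
  let ν : Bool → Measure (Fin d → ℝ) := fun b => bif b then μ.restrict Q else μ.restrict Qᶜ
  have hνf : ∀ b, IsFiniteMeasure (ν b) := fun b => by
    cases b <;> simp only [ν, cond_true, cond_false] <;> infer_instance
  have hsum : ∑ b, ν b = μ := by
    rw [Fintype.sum_bool]; exact Measure.restrict_add_restrict_compl hQ
  refine ⟨2 ^ p * ∑ b, (∫⁻ y, gcost nrm p y 0 ∂(normalized (ν b))) *
      ((ν b) Set.univ) ^ (1 / 2 : ℝ), ?_, fun N => ?_⟩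
  · refine ENNReal.mul_ne_top (ENNReal.rpow_ne_top_of_nonneg (by linarith) (by norm_num)) ?_
    rw [Fintype.sum_bool]
    exact ENNReal.add_ne_top.2 ⟨hfin Q, hfin Qᶜ⟩
  · have h1 := thinCost_sum_le (nrm := nrm) (θ := fun _ => 1 / 2) hp Finset.univ ν
      (by rw [hsum]; simp) 0 (fun _ => le_rfl) (fun _ => by norm_num) N
    rw [hsum, thinCost_of_prob] at h1
    refine h1.trans_eq ?_
    rw [Fintype.sum_bool]
    congr 1
    rw [mul_assoc, Finset.sum_mul]
    congr 1
    refine Finset.sum_congr rfl fun b _ => ?_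
    rw [ENNReal.mul_rpow_of_nonneg _ _ (by norm_num)]
    ring

end Pierce

/-! ### Uniform distributions on cubes. -/

section Uniform

variable {d : ℕ}

/-- The open cube of side `s` with corner `z`. -/
def openCell (s : ℝ) (z : Fin d → ℝ) : Set (Fin d → ℝ) :=
  Set.univ.pi fun i => Set.Ioo (z i) (z i + s)

/-- The uniform distribution on the cube of side `s` with corner `z`. -/
noncomputable def unifCell (s : ℝ) (z : Fin d → ℝ) : Measure (Fin d → ℝ) :=
  (unifCube d).map fun y => s • y + z

instance isProbabilityMeasure_unifCell (s : ℝ) (z : Fin d → ℝ) :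
    IsProbabilityMeasure (unifCell s z) :=
  Measure.isProbabilityMeasure_map (by fun_prop)

theorem measurableSet_openCell (s : ℝ) (z : Fin d → ℝ) : MeasurableSet (openCell s z) :=
  MeasurableSet.univ_pi fun _ => measurableSet_Ioo

theorem smul_add_mem_openCell {s : ℝ} (hs : 0 < s) (z y : Fin d → ℝ) :
    s • y + z ∈ openCell s z ↔ y ∈ openCube d := by
  simp only [openCell, openCube, Set.mem_univ_pi, Set.mem_Ioo, Pi.add_apply, Pi.smul_apply,
    smul_eq_mul]
  refine forall_congr' fun i => and_congr ?_ ?_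
  · rw [lt_add_iff_pos_left, mul_pos_iff_of_pos_left hs]
  · rw [add_comm, add_lt_add_iff_left, mul_lt_iff_lt_one_right hs]

theorem map_volume_smul_add {s : ℝ} (hs : 0 < s) (z : Fin d → ℝ) :
    (volume : Measure (Fin d → ℝ)).map (fun y => s • y + z) =
      (ENNReal.ofReal s ^ d)⁻¹ • volume := by
  have h1 : (volume : Measure (Fin d → ℝ)).map (fun y => s • y + z) =
      ((volume : Measure (Fin d → ℝ)).map (fun y => s • y)).map (fun y => y + z) := by
    rw [Measure.map_map (by fun_prop) (by fun_prop)]; rfl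
  rw [h1, Measure.map_addHaar_smul volume hs.ne', Measure.map_smul, map_add_right_eq_self]
  congr 1
  rw [Module.finrank_fin_fun, abs_of_nonneg (by positivity), ENNReal.ofReal_inv_of_pos
    (by positivity), ENNReal.ofReal_pow hs.le]

theorem unifCell_eq {s : ℝ} (hs : 0 < s) (z : Fin d → ℝ) :
    unifCell s z = (ENNReal.ofReal s ^ d)⁻¹ • volume.restrict (openCell s z) := by
  have hemb : MeasurableEmbedding fun y : Fin d → ℝ => s • y + z :=
    ((Homeomorph.smulOfNeZero s hs.ne').trans (Homeomorph.addRight z)).measurableEmbedding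
  have hpre : (fun y : Fin d → ℝ => s • y + z) ⁻¹' openCell s z = openCube d :=
    Set.ext fun y => smul_add_mem_openCell hs z y
  rw [unifCell, unifCube_eq_restrict_openCube, ← hpre, ← hemb.restrict_map,
    map_volume_smul_add hs, Measure.restrict_smul]

theorem ae_unifCell_mem {s : ℝ} (hs : 0 < s) (z : Fin d → ℝ) :
    ∀ᵐ x ∂(unifCell s z), x ∈ openCell s z := by
  rw [unifCell_eq hs]
  exact Measure.ae_smul_measure (ae_restrict_mem (measurableSet_openCell s z)) _

theorem cell_eq_pi_add {r : ℝ} (hr : 0 < r) (k : Fin d → ℤ) :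
    cell r k = Set.univ.pi fun i => Set.Ico (r * k i) (r * k i + r) := by
  rw [cell_eq_pi hr]; simp only [mul_add, mul_one]

theorem openCell_subset_cell {r : ℝ} (hr : 0 < r) (k : Fin d → ℤ) :
    openCell r (fun i => r * k i) ⊆ cell r k := by
  rw [cell_eq_pi_add hr]
  exact Set.pi_mono fun _ _ => Set.Ioo_subset_Ico_self

theorem openCell_ae_eq_cell {r : ℝ} (hr : 0 < r) (k : Fin d → ℤ) :
    (openCell r (fun i => r * k i) : Set (Fin d → ℝ)) =ᵐ[volume] cell r k := by
  rw [cell_eq_pi_add hr]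
  exact (Measure.univ_pi_Ioo_ae_eq_Icc (μ := fun _ : Fin d => (volume : Measure ℝ))).trans
    (Measure.univ_pi_Ico_ae_eq_Icc (μ := fun _ : Fin d => (volume : Measure ℝ))).symm

theorem unifCell_eq_cell {r : ℝ} (hr : 0 < r) (k : Fin d → ℤ) :
    unifCell r (fun i => r * k i) = (ENNReal.ofReal r ^ d)⁻¹ • volume.restrict (cell r k) := by
  rw [unifCell_eq hr, Measure.restrict_congr_set (openCell_ae_eq_cell hr k)]

theorem unifCell_one_zero : unifCell 1 (0 : Fin d → ℝ) = unifCube d := by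
  simp [unifCell]

end Uniform

/-! ### Local lower comparison on a cell, and dependence of the cost on the sample size. -/

section UnitCube

variable {d : ℕ} {nrm : Seminorm ℝ (Fin d → ℝ)} {p C : ℝ}

theorem thinCost_smul (m : ℝ≥0∞) (hm0 : m ≠ 0) (hm : m ≠ ∞) (P : Measure (Fin d → ℝ))
    [IsProbabilityMeasure P] (N : ℕ) :
    thinCost nrm p N (m • P) = binomAvg m (1 - m) (fun n => sampleCost nrm p n P) N := by
  have h1 : (m • P) Set.univ = m := by simp
  rw [thinCost, h1, normalized_of_ne_zero (by rw [h1]; exact hm0), h1, smul_smul,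
    ENNReal.inv_mul_cancel hm0 hm, one_smul]

theorem sampleCost_unifCell (hp : 1 ≤ p) {s : ℝ} (hs : 0 < s) (z : Fin d → ℝ) (n : ℕ) :
    sampleCost nrm p n (unifCell s z) = ENNReal.ofReal (s ^ p) * sampleCost nrm p n (unifCube d) :=
  sampleCost_map hp _ hs z n

theorem exitCost_smul_add {s : ℝ} (hs : 0 < s) (z y : Fin d → ℝ) :
    exitCost nrm p (openCell s z) (s • y + z) =
      ENNReal.ofReal (s ^ p) * exitCost nrm p (openCube d) y := by
  have h0 : ENNReal.ofReal (s ^ p) ≠ 0 := by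
    rw [Ne, ENNReal.ofReal_eq_zero, not_le]; positivity
  simp only [exitCost]
  rw [ENNReal.mul_iInf_of_ne h0 ENNReal.ofReal_ne_top]
  simp_rw [ENNReal.mul_iInf_of_ne h0 ENNReal.ofReal_ne_top, ← gcost_smul_add nrm hs.le z]
  have hsurj : Function.Surjective fun y : Fin d → ℝ => s • y + z :=
    ((Homeomorph.smulOfNeZero s hs.ne').trans (Homeomorph.addRight z)).surjective
  rw [← hsurj.iInf_comp]
  refine iInf_congr fun b => ?_
  simp only [Set.mem_compl_iff, smul_add_mem_openCell hs]

theorem exitCost_openCell_le (hd : 0 < d) (hp : 0 < p) (hC : 0 < C) (hnC : ∀ x, nrm x ≤ C * ‖x‖)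
    {s : ℝ} (hs : 0 < s) (z x : Fin d → ℝ) :
    exitCost nrm p (openCell s z) x ≤ ENNReal.ofReal ((C * s) ^ p) := by
  by_cases hx : x ∈ openCell s z
  · have hz : z ∉ openCell s z := fun h => by
      have := h ⟨0, hd⟩ trivial
      simp at this
    refine (iInf₂_le z hz).trans (gcost_le_of_norm_le hp.le hC hnC ?_)
    rw [pi_norm_le_iff_of_nonneg hs.le]
    intro i
    have := hx i trivial
    rw [Set.mem_Ioo] at this
    rw [Pi.sub_apply, Real.norm_eq_abs, abs_le]
    constructor <;> linarith
  · rw [exitCost_of_notMem hp hx]; exact zero_le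

theorem leakyCost_le_meanCost_unifCell (hp : 1 ≤ p) {s : ℝ} (hs : 0 < s) (z : Fin d → ℝ) (a : ℕ) :
    ENNReal.ofReal (s ^ p) * leakyCost nrm p a ≤
      meanCost nrm p ((a : ℝ≥0∞) • unifCell s z) (exitCost nrm p (openCell s z)) a
        (unifCell s z) := by
  have hp0 : 0 ≤ p := by linarith
  have h1 := meanCost_map_le (nrm := nrm) hp ((a : ℝ≥0∞) • unifCell s z) (unifCell s z)
    (inv_pos.2 hs) (-(s⁻¹ • z)) (w := exitCost nrm p (openCube d))
    (w' := exitCost nrm p (openCell s z)) (upperSemicontinuous_exitCost hp0 _) (fun y => by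
      have h2 := exitCost_smul_add (nrm := nrm) (p := p) hs z (s⁻¹ • y + -(s⁻¹ • z))
      have h3 : s • (s⁻¹ • y + -(s⁻¹ • z)) + z = y := by
        rw [smul_add, smul_smul, smul_neg, smul_smul, mul_inv_cancel₀ hs.ne', one_smul, one_smul,
          neg_add_cancel_right]
      rw [h3] at h2
      rw [h2, ← mul_assoc, ← ENNReal.ofReal_mul (by positivity), ← Real.mul_rpow (by positivity)
        hs.le, inv_mul_cancel₀ hs.ne', Real.one_rpow, ENNReal.ofReal_one, one_mul]) a
  rw [Measure.map_smul, unifCell, map_inv_map _ hs] at h1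
  calc _ ≤ ENNReal.ofReal (s ^ p) * (ENNReal.ofReal (s⁻¹ ^ p) * _) := by
        gcongr; exact h1
    _ = _ := by
      rw [← mul_assoc, ← ENNReal.ofReal_mul (by positivity), ← Real.mul_rpow hs.le (by positivity),
        mul_inv_cancel₀ hs.ne', Real.one_rpow, ENNReal.ofReal_one, one_mul]
      rfl

/-- Samples from a mixture contain a binomial number of points from each component. -/
theorem binomAvg_meanCost_le (hp : 1 ≤ p) (ρ V V' : Measure (Fin d → ℝ)) [IsProbabilityMeasure V]
    [IsProbabilityMeasure V'] {c : ℝ≥0∞} (hc : c ≤ 1) {w : (Fin d → ℝ) → ℝ≥0∞}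
    (hw : UpperSemicontinuous w) (N : ℕ) :
    binomAvg c (1 - c) (fun n => meanCost nrm p ρ w n V) N ≤
      meanCost nrm p ρ w N (c • V + (1 - c) • V') := by
  classical
  let ν : Bool → Measure (Fin d → ℝ) := fun b => bif b then V else V'
  let m : Bool → ℝ≥0∞ := fun b => bif b then c else 1 - c
  have hm : ∀ b, m b ≠ ∞ := fun b => by
    cases b
    · exact ne_top_of_le_ne_top ENNReal.one_ne_top tsub_le_self
    · exact ne_top_of_le_ne_top ENNReal.one_ne_top hc
  have hν : ∀ b, IsProbabilityMeasure (ν b) := fun b => by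
    cases b <;> simp only [ν, cond_true, cond_false] <;> infer_instance
  have hfin : ∀ b, IsFiniteMeasure (m b • ν b) := fun b => Measure.smul_finite _ (hm b)
  have h1 : c • V + (1 - c) • V' = ∑ b, m b • ν b := by rw [Fintype.sum_bool]; rfl
  have h2 : ∑ k ∈ Finset.univ.erase true, m k = 1 - c := by
    have : (Finset.univ : Finset Bool).erase true = {false} := by decide
    rw [this, Finset.sum_singleton]; rfl
  have h3 := sum_prod_count m true (fun n => meanCost nrm p ρ w n V) N
  rw [h2] at h3
  change _ = binomAvg c (1 - c) _ N at h3
  rw [← h3, h1, meanCost, pi_sum, lintegral_finsetSum_measure]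
  refine Finset.sum_le_sum fun l _ => ?_
  rw [pi_smul _ (fun j => hm _), lintegral_smul_measure, smul_eq_mul]
  refine mul_le_mul_right ?_ _
  have h4 := lintegral_pcost_comp (nrm := nrm) hp
    (Subtype.val_injective (p := fun j => l j = true)) (fun j => ν (l j)) ρ hw
  have h5 : (fun j : {j // l j = true} => ν (l j)) = fun _ => V := by
    funext j; rw [j.2]; rfl
  rw [h5, lintegral_pcost_eq_meanCost hp V _ hw rfl] at h4
  rw [← h4]
  exact lintegral_mono fun x => pcost_comp_le ρ w x Subtype.val_injective

/-- On the cell, μ is replaced by the uniform measure of mass a / N. The surplus α of μ is removed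
from the source, the deficit β is resampled, and the binomial number of points is replaced by a.
Each unit of these changes costs at most the largest exit cost, which (C * s) ^ p bounds. -/
theorem leakyCost_le_cell (hd : 0 < d) (hp : 1 ≤ p) (hC : 0 < C) (hnC : ∀ x, nrm x ≤ C * ‖x‖)
    {s : ℝ} (hs : 0 < s) (z : Fin d → ℝ) {μ ω α β : Measure (Fin d → ℝ)} [IsProbabilityMeasure μ]
    {N a : ℕ} (hN : N ≠ 0) (haN : a ≤ N) (hμ : μ.restrict (openCell s z) = ω + α)
    (hV : ((a : ℝ≥0∞) / N) • unifCell s z = ω + β) :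
    ENNReal.ofReal (s ^ p) * leakyCost nrm p a ≤
      ∫⁻ x, pcost nrm p (((N : ℝ≥0∞) • μ).restrict (openCell s z))
        (exitCost nrm p (openCell s z)) x ∂(Measure.pi fun _ : Fin N => μ) +
      ENNReal.ofReal ((C * s) ^ p) * (N * (α Set.univ + β Set.univ) + ENNReal.ofReal √a) := by
  classical
  have hp0 : 0 < p := by linarith
  set Q := openCell s z with hQ
  set w := exitCost nrm p Q with hw
  set V := unifCell s z with hVdef
  set c : ℝ≥0∞ := (a : ℝ≥0∞) / N with hc
  set D := ENNReal.ofReal ((C * s) ^ p) with hD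
  have hN0 : (N : ℝ≥0∞) ≠ 0 := by exact_mod_cast hN
  have hNt : (N : ℝ≥0∞) ≠ ∞ := ENNReal.natCast_ne_top N
  have hc1 : c ≤ 1 := by
    rw [hc, ENNReal.div_le_iff hN0 hNt, one_mul]; exact_mod_cast haN
  have hNc : (N : ℝ≥0∞) * c = a := ENNReal.mul_div_cancel hN0 hNt
  have hwu : UpperSemicontinuous w := upperSemicontinuous_exitCost hp0.le Q
  have hwD : ∀ x, w x ≤ D := exitCost_openCell_le hd hp0 hC hnC hs z
  have hzQ : z ∉ Q := fun h => by
    have := h ⟨0, hd⟩ trivial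
    simp at this
  have hcV : IsFiniteMeasure (c • V) :=
    Measure.smul_finite _ (ne_top_of_le_ne_top ENNReal.one_ne_top hc1)
  have hωα : IsFiniteMeasure (ω + α) := hμ ▸ inferInstance
  have hωβ : IsFiniteMeasure (ω + β) := hV ▸ inferInstance
  have hω : IsFiniteMeasure ω := isFiniteMeasure_of_le (ω + α) (Measure.le_add_right le_rfl)
  have hα : IsFiniteMeasure α := isFiniteMeasure_of_le (ω + α) (Measure.le_add_left le_rfl)
  have hβ : IsFiniteMeasure β := isFiniteMeasure_of_le (ω + β) (Measure.le_add_left le_rfl)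
  have hNω : IsFiniteMeasure ((N : ℝ≥0∞) • α) := Measure.smul_finite _ hNt
  have haV : IsFiniteMeasure ((a : ℝ≥0∞) • V) :=
    Measure.smul_finite _ (ENNReal.natCast_ne_top a)
  -- Points not used for the uniform part are parked at the corner z, which is outside the open cell
  -- and therefore exits for free. On average N * c = a points remain in the cell.
  set P' : Measure (Fin d → ℝ) := c • V + (1 - c) • Measure.dirac z with hP'
  have hPP' : IsProbabilityMeasure P' := ⟨by
    rw [hP', Measure.add_apply, Measure.smul_apply, Measure.smul_apply, measure_univ, measure_univ,
      smul_eq_mul, smul_eq_mul, mul_one, mul_one, add_tsub_cancel_of_le hc1]⟩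
  -- comparison of the sources
  have hsource : meanCost nrm p ((a : ℝ≥0∞) • V) w N μ ≤
      meanCost nrm p (((N : ℝ≥0∞) • μ).restrict Q) w N μ + D * (N * α Set.univ) := by
    refine (meanCost_le_add_mass μ _ ((N : ℝ≥0∞) • α) hwD N).trans (add_le_add ?_ le_rfl)
    refine meanCost_mono_source _ _ ?_ _ _ _
    rw [Measure.restrict_smul, hμ, smul_add, ← hNc, ← smul_smul, hV, smul_add]
    exact add_le_add (Measure.le_add_right le_rfl) le_rfl
  -- comparison of the samples
  have hsample : meanCost nrm p ((a : ℝ≥0∞) • V) w N P' ≤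
      meanCost nrm p ((a : ℝ≥0∞) • V) w N μ + N * (D * β Set.univ) := by
    have h1 := lintegral_pi_le_add_of_common (J := Fin N) (P := μ) (P' := P') (ω := ω)
      (α := α + μ.restrict Qᶜ) (β := β + (1 - c) • Measure.dirac z)
      (by rw [← add_assoc, ← hμ, Measure.restrict_add_restrict_compl (measurableSet_openCell s z)])
      (by rw [← add_assoc, ← hV]) hwu.measurable
      (measurable_pcost (nrm := nrm) hp ((a : ℝ≥0∞) • V) hwu)
      (fun x x' => by
        have := pcost_le_add_sum_ne (nrm := nrm) (p := p) ((a : ℝ≥0∞) • V) w x x'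
        simpa [Set.indicator_apply] using this)
    refine h1.trans (add_le_add le_rfl ?_)
    rw [Fintype.card_fin, lintegral_add_measure, lintegral_smul_measure,
      lintegral_dirac' _ hwu.measurable, hw, exitCost_of_notMem hp0 hzQ, smul_zero, add_zero]
    refine mul_le_mul_right ?_ _
    rw [← lintegral_const]
    exact lintegral_mono hwD
  have hpoints : meanCost nrm p ((a : ℝ≥0∞) • V) w a V ≤
      binomAvg c (1 - c) (fun n => meanCost nrm p ((a : ℝ≥0∞) • V) w n V) N +
        D * ENNReal.ofReal √a := by
    have hcc : c + (1 - c) = 1 := add_tsub_cancel_of_le hc1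
    -- If n ≥ a, points are dropped for free; if n < a, the a - n additional points are left
    -- unserved at the price D each.
    have h1 : ∀ n : ℕ, meanCost nrm p ((a : ℝ≥0∞) • V) w a V ≤
        meanCost nrm p ((a : ℝ≥0∞) • V) w n V + D * ((N * c - n) + (n - N * c)) := by
      intro n
      rcases le_total a n with h | h
      · exact (meanCost_mono_points hp V _ hwu h).trans le_self_add
      · obtain ⟨k, rfl⟩ := Nat.exists_eq_add_of_le h
        refine (meanCost_add_points_le hp V _ hwu hwD n k).trans (add_le_add le_rfl ?_)
        rw [mul_comm, hNc]
        refine mul_le_mul_right ?_ _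
        push_cast
        rw [ENNReal.add_sub_cancel_left (ENNReal.natCast_ne_top n)]
        exact le_self_add
    have h2 := binomAvg_mono (a := c) (b := 1 - c) h1 N
    rw [binomAvg_const hcc, binomAvg_add, binomAvg_const_mul] at h2
    refine h2.trans (add_le_add le_rfl (mul_le_mul_right ?_ _))
    refine (binomAvg_abs_ennreal hc1 N).1.trans (ENNReal.ofReal_le_ofReal ?_)
    refine Real.sqrt_le_sqrt (le_of_eq ?_)
    rw [← ENNReal.toReal_natCast, ← ENNReal.toReal_mul, hNc, ENNReal.toReal_natCast]
  calc _ ≤ meanCost nrm p ((a : ℝ≥0∞) • V) w a V := leakyCost_le_meanCost_unifCell hp hs z a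
    _ ≤ _ := hpoints
    _ ≤ meanCost nrm p ((a : ℝ≥0∞) • V) w N P' + D * ENNReal.ofReal √a :=
      add_le_add (binomAvg_meanCost_le hp _ V _ hc1 hwu N) le_rfl
    _ ≤ (meanCost nrm p (((N : ℝ≥0∞) • μ).restrict Q) w N μ + D * (N * α Set.univ) +
          N * (D * β Set.univ)) + D * ENNReal.ofReal √a :=
      add_le_add (hsample.trans (add_le_add hsource le_rfl)) le_rfl
    _ = _ := by rw [meanCost]; ring

theorem sampleCost_eq_meanCost (μ : Measure (Fin d → ℝ)) [IsProbabilityMeasure μ]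
    {Q : Set (Fin d → ℝ)} (hQ : ∀ᵐ y ∂μ, y ∈ Q) {D : ℝ≥0∞}
    (hD : ∀ y ∈ Q, ∀ x ∈ Q, gcost nrm p y x ≤ D) (n : ℕ) :
    sampleCost nrm p n μ = meanCost nrm p ((n : ℝ≥0∞) • μ) (fun _ => D) n μ := by
  have hae : ∀ᵐ x ∂(Measure.pi fun _ : Fin n => μ), ∀ j, x j ∈ Q := ae_all_iff.2 fun j =>
    (measurePreserving_eval (fun _ : Fin n => μ) j).quasiMeasurePreserving.ae hQ
  refine lintegral_congr_ae ?_
  filter_upwards [hae] with x hx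
  refine le_antisymm (pcost_top_le_const (by simp) x fun j => ?_) (pcost_mono x le_rfl fun _ => le_top)
  exact (Measure.ae_smul_measure hQ _).mono fun y hy => hD y hy _ (hx j)

theorem sampleCost_add_le (hp : 1 ≤ p) (μ : Measure (Fin d → ℝ)) [IsProbabilityMeasure μ]
    {Q : Set (Fin d → ℝ)} (hQ : ∀ᵐ y ∂μ, y ∈ Q) {D : ℝ≥0∞}
    (hD : ∀ y ∈ Q, ∀ x ∈ Q, gcost nrm p y x ≤ D) (n k : ℕ) :
    sampleCost nrm p (n + k) μ ≤ sampleCost nrm p n μ + k * D ∧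
      sampleCost nrm p n μ ≤ sampleCost nrm p (n + k) μ + k * D := by
  rw [sampleCost_eq_meanCost μ hQ hD, sampleCost_eq_meanCost μ hQ hD]
  have hu := upperSemicontinuous_fun_const (d := d) D
  have hf : ∀ n : ℕ, IsFiniteMeasure ((n : ℝ≥0∞) • μ) := fun n =>
    Measure.smul_finite _ (ENNReal.natCast_ne_top n)
  constructor
  · refine (meanCost_add_points_le hp μ _ hu (fun _ => le_rfl) n k).trans (add_le_add ?_ le_rfl)
    refine meanCost_mono_source _ _ ?_ _ _ _
    push_cast
    rw [add_smul]
    exact Measure.le_add_right le_rfl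
  · refine (meanCost_le_add_mass μ _ ((k : ℝ≥0∞) • μ) (fun _ => le_rfl) n).trans
      (add_le_add ?_ (le_of_eq ?_))
    · rw [← add_smul, ← Nat.cast_add]
      exact meanCost_mono_points hp μ _ hu (Nat.le_add_right _ _)
    · simp [mul_comm]

/-- Lipschitz dependence on the sample size, used to replace a random number of points by its mean.
-/
theorem sampleCost_abs_sub_le (hp : 1 ≤ p) (μ : Measure (Fin d → ℝ)) [IsProbabilityMeasure μ]
    {Q : Set (Fin d → ℝ)} (hQ : ∀ᵐ y ∂μ, y ∈ Q) {D : ℝ} (hD0 : 0 ≤ D)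
    (hD : ∀ y ∈ Q, ∀ x ∈ Q, gcost nrm p y x ≤ ENNReal.ofReal D) (n m : ℕ) :
    sampleCost nrm p m μ ≤ sampleCost nrm p n μ + ENNReal.ofReal (D * |(m : ℝ) - n|) := by
  have hcast : ∀ k : ℕ, (k : ℝ≥0∞) * ENNReal.ofReal D = ENNReal.ofReal (D * k) := fun k => by
    rw [mul_comm, ENNReal.ofReal_mul hD0, ENNReal.ofReal_natCast]
  rcases le_total n m with h | h <;> obtain ⟨k, rfl⟩ := Nat.exists_eq_add_of_le h
  · refine (sampleCost_add_le hp μ hQ hD n k).1.trans_eq ?_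
    rw [hcast]; congr 3; push_cast; rw [add_sub_cancel_left, abs_of_nonneg (by positivity)]
  · refine (sampleCost_add_le hp μ hQ hD m k).2.trans_eq ?_
    rw [hcast]; congr 3; push_cast
    rw [sub_add_cancel_left, abs_neg, abs_of_nonneg (by positivity)]

theorem leakyCost_le_sampleCost (n : ℕ) :
    leakyCost nrm p n ≤ sampleCost nrm p n (unifCube d) :=
  lintegral_mono fun x => pcost_mono x le_rfl fun _ => le_top

end UnitCube

/-! ### Convergence of almost subadditive sequences. -/

section Sequences

/-- A Fekete argument: the upper limit of h is at most h n + e n for every n ≠ 0, and n can be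
chosen with h n near the lower limit and e n small. -/
theorem exists_tendsto_of_eventually_le {h e : ℕ → ℝ} {B : ℝ} (hB : ∀ n, |h n| ≤ B)
    (he : Tendsto e atTop (𝓝 0)) {F : ℕ → ℕ → ℝ}
    (hF : ∀ n, n ≠ 0 → Tendsto (F n) atTop (𝓝 (h n + e n)))
    (hle : ∀ n, n ≠ 0 → ∀ᶠ N in atTop, h N ≤ F n N) : ∃ l, Tendsto h atTop (𝓝 l) := by
  have hbd : IsBoundedUnder (· ≤ ·) atTop h := isBoundedUnder_of ⟨B, fun n => (abs_le.1 (hB n)).2⟩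
  have hbd' : IsBoundedUnder (· ≥ ·) atTop h :=
    isBoundedUnder_of ⟨-B, fun n => (abs_le.1 (hB n)).1⟩
  refine ⟨liminf h atTop, ?_⟩
  rw [Metric.tendsto_nhds]
  intro ε hε
  have h1 : ∃ᶠ n in atTop, h n < liminf h atTop + ε / 4 :=
    frequently_lt_of_liminf_lt hbd.isCoboundedUnder_ge (by linarith)
  have h2 : ∀ᶠ n in atTop, e n < ε / 4 ∧ n ≠ 0 :=
    (he.eventually_lt_const (by linarith)).and (eventually_ne_atTop 0)
  obtain ⟨n, hn1, hn2, hn3⟩ := (h1.and_eventually h2).exists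
  have h3 : ∀ᶠ N in atTop, F n N < liminf h atTop + ε := (hF n hn3).eventually_lt_const (by linarith)
  have h4 : ∀ᶠ N in atTop, liminf h atTop - ε < h N :=
    eventually_lt_of_lt_liminf (by linarith) hbd'
  filter_upwards [hle n hn3, h3, h4] with N a b c
  rw [Real.dist_eq, abs_lt]
  constructor <;> linarith

/-- K is the integer part of (N / n) ^ (1 / d). Splitting the cube into K ^ d subcubes then puts
about n, and on average at least n, points into each. -/
theorem exists_floor_root {d : ℕ} (hd : d ≠ 0) {n : ℕ} (hn : n ≠ 0) :
    ∃ K : ℕ → ℕ, Tendsto (fun N : ℕ => (N : ℝ) / (K N : ℝ) ^ d) atTop (𝓝 n) ∧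
      Tendsto K atTop atTop ∧ ∀ N, n * K N ^ d ≤ N := by
  have hn0 : (0 : ℝ) < n := by positivity
  have hd0 : (0 : ℝ) < d := by positivity
  let x : ℕ → ℝ := fun N => ((N : ℝ) / n) ^ (1 / (d : ℝ))
  have hx : Tendsto x atTop atTop :=
    (tendsto_rpow_atTop (by positivity)).comp
      (tendsto_natCast_atTop_atTop.atTop_div_const hn0)
  have hxd : ∀ N, x N ^ d = (N : ℝ) / n := fun N => by
    simp only [x]
    rw [← Real.rpow_natCast, ← Real.rpow_mul (by positivity), one_div_mul_cancel hd0.ne',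
      Real.rpow_one]
  refine ⟨fun N => ⌊x N⌋₊, ?_, tendsto_nat_floor_atTop.comp hx, fun N => ?_⟩
  · have h1 : Tendsto (fun N => ((⌊x N⌋₊ : ℝ) / x N)) atTop (𝓝 1) :=
      (tendsto_nat_floor_div_atTop (R := ℝ)).comp hx
    have h2 := ((h1.inv₀ one_ne_zero).pow d).const_mul (n : ℝ)
    simp only [inv_one, one_pow, mul_one] at h2
    refine h2.congr fun N => ?_
    rw [inv_div, div_pow, hxd]
    field_simp
  · have h1 : (⌊x N⌋₊ : ℝ) ^ d ≤ x N ^ d := by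
      gcongr
      exact Nat.floor_le (by simp only [x]; positivity)
    rw [hxd, le_div_iff₀ hn0] at h1
    have : ((n * ⌊x N⌋₊ ^ d : ℕ) : ℝ) ≤ N := by push_cast; linarith
    exact_mod_cast this

end Sequences

/-! ### Existence of the limit for the uniform distribution. -/

section UpperLimit

variable {d : ℕ} {nrm : Seminorm ℝ (Fin d → ℝ)} {p C : ℝ}

theorem openCell_subset_box {s : ℝ} (hs : s ≤ 1) : openCell s (0 : Fin d → ℝ) ⊆ box d 1 := by
  intro x hx i _
  have := hx i trivial
  simp only [Pi.zero_apply, zero_add, Set.mem_Ioo] at this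
  rw [Set.mem_Ico]
  constructor <;> linarith

theorem norm_sub_le_of_mem_openCell {s : ℝ} (hs : 0 < s) {z x y : Fin d → ℝ}
    (hx : x ∈ openCell s z) (hy : y ∈ openCell s z) : ‖y - x‖ ≤ s := by
  rw [pi_norm_le_iff_of_nonneg hs.le]
  intro i
  have h1 := hx i trivial
  have h2 := hy i trivial
  rw [Set.mem_Ioo] at h1 h2
  rw [Pi.sub_apply, Real.norm_eq_abs, abs_le]
  constructor <;> linarith

theorem unifCell_restrict_cell {K M : ℕ} (hK : 0 < K) (hM : 0 < M) (k : Fin d → ℤ) :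
    (unifCell ((K : ℝ) / M) 0).restrict (cell (1 / (M : ℝ)) k) =
      if k ∈ Fintype.piFinset (fun _ : Fin d => Finset.Ico (0 : ℤ) K) then
        ((K : ℝ≥0∞) ^ d)⁻¹ • unifCell (1 / (M : ℝ)) (fun i => 1 / (M : ℝ) * k i) else 0 := by
  have hM' : (0 : ℝ) < M := by exact_mod_cast hM
  have hK' : (0 : ℝ) < K := by exact_mod_cast hK
  have hr : (0 : ℝ) < 1 / M := by positivity
  have hs : (0 : ℝ) < K / M := by positivity
  rw [unifCell_eq hs, Measure.restrict_smul, Measure.restrict_restrict (measurableSet_cell _ _)]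
  have hico : (openCell ((K : ℝ) / M) (0 : Fin d → ℝ) : Set (Fin d → ℝ)) =ᵐ[volume]
      Set.univ.pi fun _ : Fin d => Set.Ico (0 : ℝ) (K / M) := by
    have := (Measure.univ_pi_Ioo_ae_eq_Icc (μ := fun _ : Fin d => (volume : Measure ℝ))
      (f := fun _ => 0) (g := fun _ => (K : ℝ) / M)).trans
      (Measure.univ_pi_Ico_ae_eq_Icc (μ := fun _ : Fin d => (volume : Measure ℝ))).symm
    simpa [openCell, volume_pi] using this
  rw [Measure.restrict_congr_set ((EventuallyEq.refl _ (cell (1 / (M : ℝ)) k)).inter hico)]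
  split_ifs with h
  · have hsub : cell (1 / (M : ℝ)) k ⊆ Set.univ.pi fun _ : Fin d => Set.Ico (0 : ℝ) (K / M) := by
      rw [cell_eq_pi hr]
      refine Set.pi_mono fun i _ => Set.Ico_subset_Ico ?_ ?_
      · have : 0 ≤ k i := (Finset.mem_Ico.1 (Fintype.mem_piFinset.1 h i)).1
        have : (0 : ℝ) ≤ k i := by exact_mod_cast this
        positivity
      · have : k i + 1 ≤ K := (Finset.mem_Ico.1 (Fintype.mem_piFinset.1 h i)).2
        have : (k i : ℝ) + 1 ≤ K := by exact_mod_cast this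
        rw [one_div, div_eq_inv_mul]
        gcongr
    rw [Set.inter_eq_left.2 hsub, unifCell_eq_cell hr, smul_smul]
    congr 1
    have e1 : ENNReal.ofReal ((K : ℝ) / M) = K * ENNReal.ofReal (1 / M) := by
      rw [div_eq_mul_one_div, ENNReal.ofReal_mul (by positivity), ENNReal.ofReal_natCast]
    rw [e1, mul_pow, ENNReal.mul_inv]
    · left; positivity
    · left; exact ENNReal.pow_ne_top (ENNReal.natCast_ne_top K)
  · have hempty : cell (1 / (M : ℝ)) k ∩ (Set.univ.pi fun _ : Fin d => Set.Ico (0 : ℝ) (K / M)) =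
        ∅ := by
      rw [Set.eq_empty_iff_forall_notMem]
      rintro x ⟨hx, hx'⟩
      refine h (Fintype.mem_piFinset.2 fun i => ?_)
      have h1 := hx' i trivial
      have h2 : cellIdx (1 / (M : ℝ)) x i = k i := congrFun hx i
      rw [Set.mem_Ico] at h1
      rw [Finset.mem_Ico, ← h2, cellIdx, Int.floor_lt, Int.le_floor]
      have h3 : x i / (1 / (M : ℝ)) = x i * M := by field_simp
      rw [h3, Int.cast_zero, Int.cast_natCast, ← lt_div_iff₀ hM']
      exact ⟨mul_nonneg h1.1 hM'.le, h1.2⟩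
    rw [hempty, Measure.restrict_empty, smul_zero]

theorem sampleCost_unifCube_ne_top (hp : 1 ≤ p) (hC : 0 < C) (hnC : ∀ x, nrm x ≤ C * ‖x‖)
    (n : ℕ) : sampleCost nrm p n (unifCube d) ≠ ∞ := by
  have hmem : ∀ᵐ x ∂(unifCube d), x ∈ openCell 1 (0 : Fin d → ℝ) := by
    rw [← unifCell_one_zero]; exact ae_unifCell_mem one_pos 0
  have := sampleCost_abs_sub_le (nrm := nrm) hp (unifCube d) hmem (D := C ^ p) (by positivity)
    (fun y hy x hx => by
      have := gcost_le_of_norm_le (p := p) (by linarith) hC hnC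
        (norm_sub_le_of_mem_openCell one_pos hx hy)
      rwa [mul_one] at this) 0 n
  rw [sampleCost_zero, zero_add] at this
  exact ne_top_of_le_ne_top ENNReal.ofReal_ne_top this

/-- Splitting the cube into K ^ d equal subcubes: each costs K ^ (-p) times the unit cube cost with
a binomial number of points of mean N / K ^ d, which is compared with n by the Lipschitz property.
The last term is the accumulated error of the dyadic hierarchy. -/
theorem exists_sampleCost_unifCube_le (hp : 1 ≤ p) (hpd : p < (d : ℝ) / 2)
    (hC : 0 < C) (hnC : ∀ x, nrm x ≤ C * ‖x‖) :
    ∃ D E : ℝ, 0 < D ∧ 0 < E ∧ ∀ N n K : ℕ, 0 < K →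
      (sampleCost nrm p N (unifCube d)).toReal ≤
        (K : ℝ) ^ ((d : ℝ) - p) * ((sampleCost nrm p n (unifCube d)).toReal +
          D * (√((N : ℝ) / (K : ℝ) ^ d) + |(N : ℝ) / (K : ℝ) ^ d - n|)) +
        E * (K : ℝ) ^ ((d : ℝ) / 2 - p) * √N := by
  have hp0 : 0 ≤ p := by linarith
  obtain ⟨A, hA, hcells⟩ := exists_thinCost_le_sum_cells (nrm := nrm) hp hpd hC hnC
  set D : ℝ := C ^ p with hD
  refine ⟨D, A * 2 ^ p * 2 ^ ((d : ℝ) / 2 - p), by positivity, by positivity,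
    fun N n K hK => ?_⟩
  have hK' : (1 : ℝ) ≤ K := by exact_mod_cast hK
  have hK0 : (0 : ℝ) < K := by linarith
  set g : ℕ → ℝ := fun n => (sampleCost nrm p n (unifCube d)).toReal with hg
  have hgE : ∀ n, sampleCost nrm p n (unifCube d) = ENNReal.ofReal (g n) := fun n =>
    (ENNReal.ofReal_toReal (sampleCost_unifCube_ne_top hp hC hnC n)).symm
  have hg0 : ∀ n, 0 ≤ g n := fun n => ENNReal.toReal_nonneg
  have hmem : ∀ᵐ x ∂(unifCube d), x ∈ openCell 1 (0 : Fin d → ℝ) := by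
    rw [← unifCell_one_zero]; exact ae_unifCell_mem one_pos 0
  have hlip : ∀ n m : ℕ, g m ≤ g n + D * |(m : ℝ) - n| := by
    intro n m
    have := sampleCost_abs_sub_le (nrm := nrm) hp (unifCube d) hmem (D := D) (by positivity)
      (fun y hy x hx => by
        have := gcost_le_of_norm_le (p := p) hp0 hC hnC
          (norm_sub_le_of_mem_openCell one_pos hx hy)
        rwa [mul_one] at this) n m
    rw [hgE, hgE, ← ENNReal.ofReal_add (hg0 n) (by positivity),
      ENNReal.ofReal_le_ofReal_iff (by have := hg0 n; positivity)] at this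
    exact this
  obtain ⟨L, hL1, hL2⟩ := exists_pow_two_near hK'
  -- The hierarchy is dyadic whereas K is arbitrary. A cube of side K / M ≤ 1 consists of exactly K
  -- ^ d dyadic cells of side 1 / M, and scale invariance transfers the estimate to the unit cube; M
  -- ≤ 2 * K keeps the loss bounded.
  set M : ℕ := 2 ^ (L + 1) with hM
  have hMpos : 0 < M := by positivity
  have hM0 : (0 : ℝ) < M := by positivity
  have hM1 : (M : ℝ) ≤ 2 * K := by rw [hM]; push_cast; rw [pow_succ]; linarith
  have hKM : (K : ℝ) / M ≤ 1 := by
    rw [div_le_one hM0, hM]; push_cast; exact hL2.le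
  have hs : (0 : ℝ) < K / M := by positivity
  have hr : (0 : ℝ) < 1 / M := by positivity
  set m : ℝ := ((K : ℝ) ^ d)⁻¹ with hm
  have hm0 : 0 ≤ m := by positivity
  have hm1 : m ≤ 1 := inv_le_one_of_one_le₀ (one_le_pow₀ hK')
  have hmE : ((K : ℝ≥0∞) ^ d)⁻¹ = ENNReal.ofReal m := by
    rw [hm, ENNReal.ofReal_inv_of_pos (by positivity), ENNReal.ofReal_pow hK0.le,
      ENNReal.ofReal_natCast]
  have hmE0 : ENNReal.ofReal m ≠ 0 := by
    rw [Ne, ENNReal.ofReal_eq_zero, not_le]; positivity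
  have h1 := hcells 1 one_pos (unifCell ((K : ℝ) / M) 0) (by simp) (by
    filter_upwards [ae_unifCell_mem hs 0] with x hx
    exact openCell_subset_box hKM hx) N (L + 1)
  have hthin : ∀ k, thinCost nrm p N ((unifCell ((K : ℝ) / M) 0).restrict
      (cell (1 / (M : ℝ)) k)) ≤ if k ∈ Fintype.piFinset (fun _ : Fin d => Finset.Ico (0 : ℤ) K) then
        ENNReal.ofReal ((1 / (M : ℝ)) ^ p * binomAvg m (1 - m) g N) else 0 := by
    intro k
    rw [unifCell_restrict_cell hK hMpos]
    split_ifs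
    · rw [hmE, thinCost_smul _ hmE0 ENNReal.ofReal_ne_top]
      simp_rw [sampleCost_unifCell hp hr, hgE]
      rw [binomAvg_const_mul, ENNReal.ofReal_mul (by positivity)]
      refine mul_le_mul_right ?_ _
      have := (binomAvg_ofReal hm0 (sub_nonneg.2 hm1) hg0 N).2
      rw [ENNReal.ofReal_sub _ hm0, ENNReal.ofReal_one] at this
      rw [this]
    · rw [thinCost_of_univ_eq_zero (by simp)]
  have hcard : (Fintype.piFinset (fun _ : Fin d => Finset.Ico (0 : ℤ) K)).card = K ^ d := by
    simp [Fintype.card_piFinset]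
  have hsum : ∑ k ∈ gridIdx d M, thinCost nrm p N ((unifCell ((K : ℝ) / M) 0).restrict
      (cell (1 / (M : ℝ)) k)) ≤
      ENNReal.ofReal ((K : ℝ) ^ d * ((1 / (M : ℝ)) ^ p * binomAvg m (1 - m) g N)) := by
    refine (Finset.sum_le_sum fun k _ => hthin k).trans ?_
    rw [← Finset.sum_filter, Finset.sum_const, nsmul_eq_mul,
      ENNReal.ofReal_mul (p := (K : ℝ) ^ d) (by positivity)]
    refine mul_le_mul_left ?_ _
    rw [ENNReal.ofReal_pow hK0.le, ENNReal.ofReal_natCast]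
    have : ((gridIdx d M).filter fun k => k ∈ Fintype.piFinset
        (fun _ : Fin d => Finset.Ico (0 : ℤ) K)).card ≤ K ^ d := by
      rw [← hcard]
      exact Finset.card_le_card fun k hk => (Finset.mem_filter.1 hk).2
    exact_mod_cast this
  have hb0 : 0 ≤ binomAvg m (1 - m) g N := (binomAvg_ofReal hm0 (sub_nonneg.2 hm1) hg0 N).1
  have hbin : binomAvg m (1 - m) g N ≤
      g n + D * (√((N : ℝ) / (K : ℝ) ^ d) + |(N : ℝ) / (K : ℝ) ^ d - n|) := by
    have e1 : ∀ j : ℕ, g j ≤ (g n + D * |(N : ℝ) * m - n|) + D * |(j : ℝ) - N * m| := by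
      intro j
      have h2 : |(j : ℝ) - n| ≤ |(j : ℝ) - N * m| + |(N : ℝ) * m - n| := abs_sub_le _ _ _
      have h3 := hlip n j
      have h4 : 0 < D := by positivity
      nlinarith
    have e2 := binomAvg_mono_real hm0 (sub_nonneg.2 hm1) e1 N
    rw [binomAvg_add, binomAvg_const (by ring), binomAvg_const_mul] at e2
    have e3 := binomAvg_abs_le_sqrt hm0 hm1 N
    have e4 : (N : ℝ) / (K : ℝ) ^ d = N * m := by rw [hm, div_eq_mul_inv]
    rw [e4]
    have h4 : 0 < D := by positivity
    nlinarith
  rw [thinCost_of_prob, sampleCost_unifCell hp hs, hgE] at h1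
  have h2 := h1.trans (add_le_add hsum le_rfl)
  rw [← ENNReal.ofReal_mul (by positivity), ← ENNReal.ofReal_add (by positivity) (by positivity),
    ENNReal.ofReal_le_ofReal_iff (by positivity), Real.one_rpow, mul_one,
    Real.div_rpow hK0.le hM0.le, Real.div_rpow zero_le_one hM0.le, Real.one_rpow] at h2
  have hMp : (0 : ℝ) < (M : ℝ) ^ p := by positivity
  have hKp : (0 : ℝ) < (K : ℝ) ^ p := by positivity
  have h3 : g N ≤ (K : ℝ) ^ ((d : ℝ) - p) * binomAvg m (1 - m) g N +
      (M / K : ℝ) ^ p * (A * (2 ^ ((d : ℝ) / 2 - p)) ^ (L + 1) * √N) := by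
    rw [Real.rpow_sub hK0, Real.rpow_natCast, Real.div_rpow hM0.le hK0.le]
    have := mul_le_mul_of_nonneg_left h2 (by positivity : 0 ≤ (M : ℝ) ^ p / (K : ℝ) ^ p)
    calc g N = (M : ℝ) ^ p / (K : ℝ) ^ p * ((K : ℝ) ^ p / (M : ℝ) ^ p * g N) := by field_simp
      _ ≤ _ := this
      _ = _ := by field_simp
  refine h3.trans (add_le_add (mul_le_mul_of_nonneg_left hbin (by positivity)) ?_)
  have h5 : ((2 : ℝ) ^ ((d : ℝ) / 2 - p)) ^ (L + 1) = (M : ℝ) ^ ((d : ℝ) / 2 - p) := by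
    rw [hM]; push_cast
    rw [← Real.rpow_natCast, ← Real.rpow_natCast, ← Real.rpow_mul (by norm_num),
      ← Real.rpow_mul (by norm_num), mul_comm]
  have h6 : (M / K : ℝ) ^ p ≤ 2 ^ p :=
    Real.rpow_le_rpow (by positivity) (by rw [div_le_iff₀ hK0]; exact hM1) hp0
  have h7 : (M : ℝ) ^ ((d : ℝ) / 2 - p) ≤ 2 ^ ((d : ℝ) / 2 - p) * (K : ℝ) ^ ((d : ℝ) / 2 - p) := by
    rw [← Real.mul_rpow (by norm_num) hK0.le]
    exact Real.rpow_le_rpow hM0.le hM1 (by linarith)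
  rw [h5]
  calc (M / K : ℝ) ^ p * (A * (M : ℝ) ^ ((d : ℝ) / 2 - p) * √N)
      ≤ 2 ^ p * (A * (2 ^ ((d : ℝ) / 2 - p) * (K : ℝ) ^ ((d : ℝ) / 2 - p)) * √N) := by gcongr
    _ = _ := by ring

/-- `(N / K ^ d)`-homogeneity of the normalizing factors. -/
theorem rpow_sub_div_eq {N K : ℝ} (hN : 0 < N) (hK : 0 < K) (hd : 0 < d) (a b : ℝ) :
    K ^ ((d : ℝ) * a - b) / N ^ (a - b / d) = (N / K ^ d) ^ (-(a - b / d)) := by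
  have hd0 : (0 : ℝ) < d := by exact_mod_cast hd
  rw [Real.rpow_neg (by positivity), Real.div_rpow hN.le (by positivity), ← Real.rpow_natCast,
    ← Real.rpow_mul hK.le, inv_div]
  congr 2
  field_simp

theorem exists_tendsto_sampleCost (hd : 0 < d) (hp : 1 ≤ p) (hpd : p < (d : ℝ) / 2)
    (hC : 0 < C) (hnC : ∀ x, nrm x ≤ C * ‖x‖) :
    ∃ l : ℝ, Tendsto (fun N : ℕ => (sampleCost nrm p N (unifCube d)).toReal /
      (N : ℝ) ^ (1 - p / d)) atTop (𝓝 l) := by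
  have hd0 : (0 : ℝ) < d := by exact_mod_cast hd
  obtain ⟨D, E, hD, hE, hmain⟩ := exists_sampleCost_unifCube_le (nrm := nrm) hp hpd hC hnC
  obtain ⟨A, hA, hbound⟩ := exists_sampleCost_le (nrm := nrm) hp hpd hC hnC
  set g : ℕ → ℝ := fun n => (sampleCost nrm p n (unifCube d)).toReal with hg
  have hg0 : ∀ n, 0 ≤ g n := fun n => ENNReal.toReal_nonneg
  set θ := 1 - p / d with hθ
  set δ := 1 / 2 - p / d with hδ
  have hδ0 : 0 < δ := by
    have : p / d < 1 / 2 := by rw [div_lt_iff₀ hd0]; linarith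
    linarith
  have hgA : ∀ n : ℕ, g n ≤ A * (n : ℝ) ^ θ := by
    intro n
    have := hbound 1 one_pos (unifCube d) inferInstance (by
      rw [← unifCell_one_zero]
      filter_upwards [ae_unifCell_mem one_pos (0 : Fin d → ℝ)] with x hx
      exact openCell_subset_box le_rfl hx) n
    rw [Real.one_rpow, mul_one] at this
    exact ENNReal.toReal_le_of_le_ofReal (by positivity) this
  choose! K hK1 hK2 hK3 using fun n (hn : n ≠ 0) => exists_floor_root hd.ne' hn
  -- As N / K ^ d → n, the bracket in F tends to g n + D * √n, and √n / n ^ θ = n ^ (-δ); together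
  -- with the hierarchy error this is e n.
  refine exists_tendsto_of_eventually_le (B := A) (e := fun n => (D + E) * (n : ℝ) ^ (-δ))
    (F := fun n N => ((N : ℝ) / (K n N : ℝ) ^ d) ^ (-θ) * (g n + D * (√((N : ℝ) / (K n N : ℝ) ^ d) +
      |(N : ℝ) / (K n N : ℝ) ^ d - n|)) + E * ((N : ℝ) / (K n N : ℝ) ^ d) ^ (-δ)) ?_ ?_ ?_ ?_
  · intro n
    have h0 : (0 : ℝ) ≤ (n : ℝ) ^ θ := by positivity
    rw [abs_of_nonneg (div_nonneg (hg0 n) h0)]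
    exact div_le_of_le_mul₀ h0 hA.le (hgA n)
  · have := ((tendsto_rpow_neg_atTop hδ0).comp tendsto_natCast_atTop_atTop).const_mul (D + E)
    rwa [mul_zero] at this
  · intro n hn
    have hn0 : (0 : ℝ) < n := by positivity
    have hu := hK1 n hn
    have h1 := (hu.rpow_const (p := -θ) (Or.inl hn0.ne')).mul
      ((((Real.continuous_sqrt.tendsto _).comp hu).add ((hu.sub_const (n : ℝ)).abs)).const_mul D
        |>.const_add (g n)) |>.add ((hu.rpow_const (p := -δ) (Or.inl hn0.ne')).const_mul E)
    have hlim : (n : ℝ) ^ (-θ) * (g n + D * (√(n : ℝ) + |(n : ℝ) - n|)) + E * (n : ℝ) ^ (-δ) =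
        g n / (n : ℝ) ^ θ + (D + E) * (n : ℝ) ^ (-δ) := by
      rw [sub_self, abs_zero, add_zero, Real.sqrt_eq_rpow, mul_add, mul_left_comm _ D,
        ← Real.rpow_add hn0, Real.rpow_neg hn0.le θ, div_eq_inv_mul (g n)]
      have : -θ + 1 / 2 = -δ := by rw [hθ, hδ]; ring
      rw [this]; ring
    rw [hlim] at h1
    exact h1
  · intro n hn
    filter_upwards [(hK2 n hn).eventually_gt_atTop 0, eventually_gt_atTop 0] with N hK hN
    have hN0 : (0 : ℝ) < N := by exact_mod_cast hN
    have hK0 : (0 : ℝ) < K n N := by exact_mod_cast hK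
    have h1 := hmain N n (K n N) hK
    have hNθ : (0 : ℝ) < (N : ℝ) ^ θ := by positivity
    have e1 := rpow_sub_div_eq hN0 hK0 hd 1 p
    have e2 := rpow_sub_div_eq hN0 hK0 hd (1 / 2) p
    rw [mul_one, ← hθ] at e1
    rw [mul_one_div, ← hδ] at e2
    have e3 : √(N : ℝ) / (N : ℝ) ^ θ = ((N : ℝ) ^ δ)⁻¹ := by
      rw [Real.sqrt_eq_rpow, ← Real.rpow_sub hN0, ← Real.rpow_neg hN0.le]
      congr 1; rw [hθ, hδ]; ring
    calc g N / (N : ℝ) ^ θ ≤ _ := div_le_div_of_nonneg_right h1 hNθ.le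
      _ = _ := by
        rw [add_div, ← e1, ← e2, mul_div_right_comm, mul_div_assoc, e3]
        rw [div_eq_mul_inv _ ((N : ℝ) ^ δ)]; ring

end UpperLimit

/-! ### Existence and positivity of the leaky limit. -/

section LowerLimit

variable {d : ℕ} {nrm : Seminorm ℝ (Fin d → ℝ)} {p C : ℝ}

theorem leakyCost_ne_top (hp : 1 ≤ p) (hC : 0 < C) (hnC : ∀ x, nrm x ≤ C * ‖x‖)
    (n : ℕ) : leakyCost nrm p n ≠ ∞ :=
  ne_top_of_le_ne_top (sampleCost_unifCube_ne_top hp hC hnC n) (leakyCost_le_sampleCost n)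

theorem pairwiseDisjoint_openCell {r : ℝ} (hr : 0 < r) (S : Set (Fin d → ℤ)) :
    S.PairwiseDisjoint fun k => openCell r (fun i => r * k i) := fun _ _ _ _ h =>
  (disjoint_cell r h).mono (openCell_subset_cell hr _) (openCell_subset_cell hr _)

/-- Superadditivity over K ^ d open subcubes, each a scaled copy of the leaky problem. The
correction pays for the surplus N / K ^ d - n and the fluctuation √n in every subcube. -/
theorem mul_leakyCost_le (hd : 0 < d) (hp : 1 ≤ p) (hC : 0 < C) (hnC : ∀ x, nrm x ≤ C * ‖x‖)
    {N n K : ℕ} (hK : 0 < K) (hN : N ≠ 0) (h : n * K ^ d ≤ N) :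
    (K : ℝ) ^ ((d : ℝ) - p) * (leakyCost nrm p n).toReal ≤
      (leakyCost nrm p N).toReal +
        (K : ℝ) ^ ((d : ℝ) - p) * (C ^ p * ((N : ℝ) / (K : ℝ) ^ d - n + √n)) := by
  classical
  have hp0 : 0 < p := by linarith
  have hK' : (1 : ℝ) ≤ K := by exact_mod_cast hK
  have hK0 : (0 : ℝ) < K := by linarith
  have hN0 : (0 : ℝ) < N := by positivity
  set r : ℝ := 1 / K with hr
  have hr0 : 0 < r := by positivity
  set S := Fintype.piFinset (fun _ : Fin d => Finset.Ico (0 : ℤ) K) with hS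
  have hcard : S.card = K ^ d := by
    simp [hS, Fintype.card_piFinset]
  let Q : (Fin d → ℤ) → Set (Fin d → ℝ) := fun k => openCell r (fun i => r * k i)
  have hnN : n ≤ N := (Nat.le_mul_of_pos_right n (by positivity)).trans h
  have hh : (n : ℝ) * (K : ℝ) ^ d ≤ N := by exact_mod_cast h
  have hα0 : 0 ≤ ((K : ℝ) ^ d)⁻¹ - n / N := by
    rw [sub_nonneg, div_le_iff₀ hN0, inv_mul_eq_div, le_div_iff₀ (by positivity)]
    exact hh
  have hQsub : ∀ k ∈ S, Q k ⊆ openCube d := by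
    intro k hk x hx i _
    have h1 := hx i trivial
    have h2 := Finset.mem_Ico.1 (Fintype.mem_piFinset.1 hk i)
    have h3 : (0 : ℝ) ≤ k i := by exact_mod_cast h2.1
    have h4 : (k i : ℝ) + 1 ≤ K := by exact_mod_cast h2.2
    have h5 : r * k i + r ≤ 1 := by
      calc r * k i + r = r * (k i + 1) := by ring
        _ ≤ r * K := by gcongr
        _ = 1 := by rw [hr]; field_simp
    have h6 : 0 ≤ r * k i := by positivity
    simp only [Set.mem_Ioo] at h1 ⊢
    constructor <;> linarith
  have hcell : ∀ k ∈ S, ENNReal.ofReal (r ^ p) * leakyCost nrm p n ≤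
      ∫⁻ x, pcost nrm p (((N : ℝ≥0∞) • unifCube d).restrict (Q k)) (exitCost nrm p (Q k)) x
        ∂(Measure.pi fun _ : Fin N => unifCube d) +
      ENNReal.ofReal (r ^ p * (C ^ p * ((N : ℝ) / (K : ℝ) ^ d - n + √n))) := by
    intro k hk
    have h1 : (unifCube d).restrict (Q k) =
        ENNReal.ofReal (((K : ℝ) ^ d)⁻¹) • unifCell r (fun i => r * k i) := by
      rw [unifCube_eq_restrict_openCube, Measure.restrict_restrict (measurableSet_openCell _ _),
        Set.inter_eq_left.2 (hQsub k hk), unifCell_eq hr0, smul_smul, ← ENNReal.ofReal_pow hr0.le,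
        ← ENNReal.ofReal_inv_of_pos (by positivity), ← ENNReal.ofReal_mul (by positivity)]
      have : ((K : ℝ) ^ d)⁻¹ * (r ^ d)⁻¹ = 1 := by
        rw [hr, one_div, inv_pow, inv_inv, inv_mul_cancel₀ (by positivity)]
      rw [this, ENNReal.ofReal_one, one_smul]
    have h2 : (n : ℝ≥0∞) / N = ENNReal.ofReal (n / N) := by
      rw [ENNReal.ofReal_div_of_pos hN0, ENNReal.ofReal_natCast, ENNReal.ofReal_natCast]
    -- The subcube carries the mass K ^ (-d) ≥ n / N, uniformly distributed, so there is a surplus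
    -- but no deficit.
    refine (leakyCost_le_cell (μ := unifCube d) (N := N)
      (ω := ENNReal.ofReal (n / N) • unifCell r (fun i => r * k i))
      (α := ENNReal.ofReal (((K : ℝ) ^ d)⁻¹ - n / N) • unifCell r (fun i => r * k i)) (β := 0)
      hd hp hC hnC hr0 (fun i => r * k i) hN hnN ?_ ?_).trans (add_le_add le_rfl ?_)
    · rw [← add_smul, ← ENNReal.ofReal_add (by positivity) hα0, add_sub_cancel]
      exact h1
    · rw [h2, add_zero]
    · rw [Measure.smul_apply, measure_univ, Measure.coe_zero, Pi.zero_apply, add_zero,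
        smul_eq_mul, mul_one, ← ENNReal.ofReal_natCast N, ← ENNReal.ofReal_mul hN0.le,
        ← ENNReal.ofReal_add (mul_nonneg hN0.le hα0) (by positivity),
        ← ENNReal.ofReal_mul (by positivity)]
      refine ENNReal.ofReal_le_ofReal (le_of_eq ?_)
      rw [Real.mul_rpow hC.le hr0.le]
      field_simp
  have hmeas : ∀ k, Measurable fun x : Fin N → Fin d → ℝ =>
      pcost nrm p (((N : ℝ≥0∞) • unifCube d).restrict (Q k)) (exitCost nrm p (Q k)) x := fun k =>
    measurable_pcost hp _ (upperSemicontinuous_exitCost hp0.le _)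
  have hsuper : ∑ k ∈ S, ∫⁻ x, pcost nrm p (((N : ℝ≥0∞) • unifCube d).restrict (Q k))
      (exitCost nrm p (Q k)) x ∂(Measure.pi fun _ : Fin N => unifCube d) ≤ leakyCost nrm p N := by
    rw [← lintegral_finsetSum _ fun k _ => hmeas k]
    refine lintegral_mono fun x => ?_
    exact sum_pcost_restrict_le hp0 S _ Q (fun k _ => measurableSet_openCell _ _)
      (pairwiseDisjoint_openCell hr0 _) (fun k hk y => exitCost_mono (hQsub k hk) y) x
  have hpos : 0 ≤ (N : ℝ) / (K : ℝ) ^ d - n + √n := by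
    have : (n : ℝ) ≤ N / (K : ℝ) ^ d := by rw [le_div_iff₀ (by positivity)]; exact hh
    have := Real.sqrt_nonneg (n : ℝ)
    linarith
  have h1 := Finset.sum_le_sum hcell
  rw [Finset.sum_add_distrib] at h1
  replace h1 := h1.trans (add_le_add hsuper le_rfl)
  rw [Finset.sum_const, Finset.sum_const, hcard, nsmul_eq_mul, nsmul_eq_mul,
    ← ENNReal.ofReal_toReal (leakyCost_ne_top hp hC hnC n),
    ← ENNReal.ofReal_toReal (leakyCost_ne_top hp hC hnC N), ← ENNReal.ofReal_natCast,
    ← ENNReal.ofReal_mul (by positivity), ← ENNReal.ofReal_mul (by positivity),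
    ← ENNReal.ofReal_mul (by positivity), ← ENNReal.ofReal_add ENNReal.toReal_nonneg
    (by positivity), ENNReal.ofReal_le_ofReal_iff (by positivity)] at h1
  have h2 : ((K ^ d : ℕ) : ℝ) * r ^ p = (K : ℝ) ^ ((d : ℝ) - p) := by
    rw [hr, Real.div_rpow zero_le_one hK0.le, Real.one_rpow, Real.rpow_sub hK0, Real.rpow_natCast]
    push_cast; ring
  calc _ = _ := by rw [← h2]; ring
    _ ≤ _ := h1
    _ = _ := by rw [← h2]; ring

theorem sampleCost_unifCube_le (hp : 1 ≤ p) (hpd : p < (d : ℝ) / 2)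
    (hC : 0 < C) (hnC : ∀ x, nrm x ≤ C * ‖x‖) :
    ∃ A : ℝ, 0 < A ∧ ∀ n : ℕ,
      (sampleCost nrm p n (unifCube d)).toReal ≤ A * (n : ℝ) ^ (1 - p / d) := by
  obtain ⟨A, hA, hbound⟩ := exists_sampleCost_le (nrm := nrm) hp hpd hC hnC
  refine ⟨A, hA, fun n => ?_⟩
  have := hbound 1 one_pos (unifCube d) inferInstance (by
    rw [← unifCell_one_zero]
    filter_upwards [ae_unifCell_mem one_pos (0 : Fin d → ℝ)] with x hx
    exact openCell_subset_box le_rfl hx) n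
  rw [Real.one_rpow, mul_one] at this
  exact ENNReal.toReal_le_of_le_ofReal (by positivity) this

theorem exists_tendsto_leakyCost (hd : 0 < d) (hp : 1 ≤ p) (hpd : p < (d : ℝ) / 2)
    (hC : 0 < C) (hnC : ∀ x, nrm x ≤ C * ‖x‖) :
    ∃ l : ℝ, Tendsto (fun N : ℕ => (leakyCost nrm p N).toReal /
      (N : ℝ) ^ (1 - p / d)) atTop (𝓝 l) := by
  have hd0 : (0 : ℝ) < d := by exact_mod_cast hd
  obtain ⟨A, hA, hbound⟩ := sampleCost_unifCube_le (nrm := nrm) hp hpd hC hnC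
  set g : ℕ → ℝ := fun n => (leakyCost nrm p n).toReal with hg
  have hg0 : ∀ n, 0 ≤ g n := fun n => ENNReal.toReal_nonneg
  set θ := 1 - p / d with hθ
  set δ := 1 / 2 - p / d with hδ
  have hδ0 : 0 < δ := by
    have : p / d < 1 / 2 := by rw [div_lt_iff₀ hd0]; linarith
    linarith
  have hgA : ∀ n : ℕ, g n ≤ A * (n : ℝ) ^ θ := fun n =>
    (ENNReal.toReal_mono (sampleCost_unifCube_ne_top hp hC hnC n)
      (leakyCost_le_sampleCost n)).trans (hbound n)
  choose! K hK1 hK2 hK3 using fun n (hn : n ≠ 0) => exists_floor_root hd.ne' hn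
  -- The leaky cost is almost superadditive, so the Fekete argument is applied to its negative.
  have hneg : ∃ l, Tendsto (fun N : ℕ => -(g N / (N : ℝ) ^ θ)) atTop (𝓝 l) := by
    refine exists_tendsto_of_eventually_le (B := A) (e := fun n => C ^ p * (n : ℝ) ^ (-δ))
      (F := fun n N => ((N : ℝ) / (K n N : ℝ) ^ d) ^ (-θ) * (-g n +
        C ^ p * ((N : ℝ) / (K n N : ℝ) ^ d - n + √n))) ?_ ?_ ?_ ?_
    · intro n
      have h0 : (0 : ℝ) ≤ (n : ℝ) ^ θ := by positivity
      rw [abs_neg, abs_of_nonneg (div_nonneg (hg0 n) h0)]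
      exact div_le_of_le_mul₀ h0 hA.le (hgA n)
    · have := ((tendsto_rpow_neg_atTop hδ0).comp tendsto_natCast_atTop_atTop).const_mul (C ^ p)
      rwa [mul_zero] at this
    · intro n hn
      have hn0 : (0 : ℝ) < n := by positivity
      have hu := hK1 n hn
      have h1 := (hu.rpow_const (p := -θ) (Or.inl hn0.ne')).mul
        ((((hu.sub_const (n : ℝ)).add_const √(n : ℝ)).const_mul (C ^ p)).const_add (-g n))
      have hlim : (n : ℝ) ^ (-θ) * (-g n + C ^ p * ((n : ℝ) - n + √(n : ℝ))) =
          -(g n / (n : ℝ) ^ θ) + C ^ p * (n : ℝ) ^ (-δ) := by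
        rw [sub_self, zero_add, Real.sqrt_eq_rpow, mul_add, mul_left_comm _ (C ^ p),
          ← Real.rpow_add hn0, Real.rpow_neg hn0.le θ, div_eq_inv_mul (g n)]
        have : -θ + 1 / 2 = -δ := by rw [hθ, hδ]; ring
        rw [this]; ring
      rw [hlim] at h1
      exact h1
    · intro n hn
      filter_upwards [(hK2 n hn).eventually_gt_atTop 0, eventually_gt_atTop 0] with N hK hN
      have hN0 : (0 : ℝ) < N := by exact_mod_cast hN
      have hK0 : (0 : ℝ) < K n N := by exact_mod_cast hK
      have h1 := mul_leakyCost_le (nrm := nrm) hd hp hC hnC hK hN.ne' (hK3 n hn N)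
      have hNθ : (0 : ℝ) < (N : ℝ) ^ θ := by positivity
      have e1 := rpow_sub_div_eq hN0 hK0 hd 1 p
      rw [mul_one, ← hθ] at e1
      rw [← e1, div_mul_eq_mul_div, ← neg_div]
      refine div_le_div_of_nonneg_right ?_ hNθ.le
      rw [mul_add]
      linarith
  obtain ⟨l, hl⟩ := hneg
  exact ⟨-l, by simpa using hl.neg⟩

/-- The source n times uniform has mass at most 1/2 near a point, within a distance of order n ^
(-1/d). So at least half a unit for each sample point in the middle of the cube comes from farther
away or through the boundary. The middle cube receives a fixed proportion of the points on average.
-/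
theorem exists_le_leakyCost (hd : 0 < d) (hp : 1 ≤ p) (hnrm : ∀ x, nrm x = 0 → x = 0) :
    ∃ b : ℝ, 0 < b ∧ ∀ n : ℕ, n ≠ 0 →
      ENNReal.ofReal (b * (n : ℝ) ^ (1 - p / d)) ≤ leakyCost nrm p n := by
  have hp0 : 0 < p := by linarith
  have hd0 : (0 : ℝ) < d := by exact_mod_cast hd
  obtain ⟨c, hc, hcn⟩ := exists_le_seminorm nrm hnrm
  refine ⟨(1 / 2) ^ d * ((c / 4) ^ p / 2), by positivity, fun n hn => ?_⟩
  have hn1 : (1 : ℝ) ≤ n := by exact_mod_cast Nat.one_le_iff_ne_zero.2 hn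
  have hn0 : (0 : ℝ) < n := by linarith
  -- A sup-norm ball of radius t / 4 has volume (t / 2) ^ d, hence source mass at most 2 ^ (-d) ≤ 1
  -- / 2. As t ≤ 1, points of I are at least t / 4 from the boundary.
  set t : ℝ := (n : ℝ) ^ (-(1 / (d : ℝ))) with ht
  have ht0 : 0 < t := by positivity
  have ht1 : t ≤ 1 := Real.rpow_le_one_of_one_le_of_nonpos hn1 (by
    rw [Left.neg_nonpos_iff]; positivity)
  have htd : n * t ^ d = 1 := by
    rw [ht, ← Real.rpow_natCast, ← Real.rpow_mul hn0.le, neg_mul, one_div_mul_cancel hd0.ne',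
      Real.rpow_neg_one, mul_inv_cancel₀ hn0.ne']
  set ρ : ℝ := (c / 4 * t) ^ p with hρ
  have hρ0 : 0 < ρ := by positivity
  let I : Set (Fin d → ℝ) := Set.univ.pi fun _ => Set.Icc (1 / 4) (3 / 4)
  have hI : MeasurableSet I := MeasurableSet.univ_pi fun _ => measurableSet_Icc
  have hIvol : unifCube d I = ENNReal.ofReal ((1 / 2) ^ d) := by
    have hsub : I ⊆ openCube d := Set.pi_mono fun _ _ x hx =>
      ⟨lt_of_lt_of_le (by norm_num) hx.1, lt_of_le_of_lt hx.2 (by norm_num)⟩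
    rw [unifCube_eq_restrict_openCube, Measure.restrict_apply hI, Set.inter_eq_left.2 hsub,
      show I = _ from Set.pi_univ_Icc (fun _ : Fin d => (1 / 4 : ℝ)) (fun _ => 3 / 4),
      Real.volume_Icc_pi, Finset.prod_const, Finset.card_univ, Fintype.card_fin,
      ENNReal.ofReal_pow (by norm_num)]
    norm_num
  have hgfar : ∀ x y : Fin d → ℝ, t / 4 ≤ ‖y - x‖ → ENNReal.ofReal ρ ≤ gcost nrm p y x := by
    intro x y hxy
    refine ENNReal.ofReal_le_ofReal (Real.rpow_le_rpow (by positivity) ?_ hp0.le)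
    refine le_trans ?_ (hcn _)
    calc c / 4 * t = c * (t / 4) := by ring
      _ ≤ _ := by gcongr
  have hexit : ∀ x ∈ I, ENNReal.ofReal ρ ≤ exitCost nrm p (openCube d) x := by
    intro x hx
    refine le_iInf₂ fun y hy => hgfar x y ?_
    by_contra! hlt
    refine hy fun i _ => ?_
    have h1 := (norm_le_pi_norm (y - x) i).trans_lt hlt
    rw [Pi.sub_apply, Real.norm_eq_abs, abs_lt] at h1
    have h2 := hx i trivial
    rw [Set.mem_Icc] at h2
    rw [Set.mem_Ioo]
    constructor <;> linarith
  have hpoint : ∀ x : Fin n → Fin d → ℝ,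
      ∑ j, I.indicator (fun _ => ENNReal.ofReal (ρ / 2)) (x j) ≤
        pcost nrm p ((n : ℝ≥0∞) • unifCube d) (exitCost nrm p (openCube d)) x := by
    intro x
    refine le_iInf₂ fun ν hν => Finset.sum_le_sum fun j _ => ?_
    by_cases hx : x j ∈ I
    swap
    · rw [Set.indicator_of_notMem hx]; exact zero_le
    rw [Set.indicator_of_mem hx]
    have hball : ν j (Metric.ball (x j) (t / 4)) ≤ ENNReal.ofReal (1 / 2) := by
      have h1 : ν j ≤ (n : ℝ≥0∞) • unifCube d :=
        (Finset.single_le_sum (f := ν) (fun i _ => Measure.zero_le _) (Finset.mem_univ j)).trans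
          hν.1
      refine (h1 _).trans ?_
      rw [Measure.smul_apply, smul_eq_mul]
      refine (mul_le_mul_right (Measure.restrict_apply_le _ _) _).trans ?_
      rw [Real.volume_pi_ball _ (by positivity), ← ENNReal.ofReal_natCast n,
        ← ENNReal.ofReal_mul hn0.le]
      refine ENNReal.ofReal_le_ofReal ?_
      rw [Fintype.card_fin]
      have : 2 * (t / 4) = 1 / 2 * t := by ring
      rw [this, mul_pow, mul_left_comm, htd, mul_one]
      exact pow_le_of_le_one (by norm_num) (by norm_num) hd.ne'
    have hfar : ENNReal.ofReal ρ * ν j (Metric.ball (x j) (t / 4))ᶜ ≤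
        ∫⁻ y, gcost nrm p y (x j) ∂ν j := by
      rw [← setLIntegral_const]
      refine (setLIntegral_mono (measurable_gcost_left nrm hp0.le _) fun y hy => ?_).trans
        (setLIntegral_le_lintegral _ _)
      refine hgfar _ _ ?_
      rw [← dist_eq_norm]
      simpa using hy
    have hsplit : (1 : ℝ≥0∞) ≤ ENNReal.ofReal (1 / 2) + ν j (Metric.ball (x j) (t / 4))ᶜ +
        (1 - ν j Set.univ) := by
      have h1 : ν j Set.univ ≤ ENNReal.ofReal (1 / 2) + ν j (Metric.ball (x j) (t / 4))ᶜ := by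
        rw [← measure_add_measure_compl (μ := ν j) (measurableSet_ball (x := x j) (ε := t / 4))]
        gcongr
      calc (1 : ℝ≥0∞) = ν j Set.univ + (1 - ν j Set.univ) := (add_tsub_cancel_of_le (hν.2 j)).symm
        _ ≤ _ := by gcongr
    have hhalf : ENNReal.ofReal (1 / 2) ≤ ν j (Metric.ball (x j) (t / 4))ᶜ +
        (1 - ν j Set.univ) := by
      have h2 : (1 : ℝ≥0∞) = ENNReal.ofReal (1 / 2) + ENNReal.ofReal (1 / 2) := by
        rw [← ENNReal.ofReal_add (by norm_num) (by norm_num)]; norm_num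
      rw [h2, add_assoc] at hsplit
      rw [← h2] at hsplit
      exact (ENNReal.add_le_add_iff_left ENNReal.ofReal_ne_top).1 (by rwa [← h2])
    calc ENNReal.ofReal (ρ / 2) = ENNReal.ofReal ρ * ENNReal.ofReal (1 / 2) := by
          rw [← ENNReal.ofReal_mul hρ0.le]; congr 1; ring
      _ ≤ ENNReal.ofReal ρ * (ν j (Metric.ball (x j) (t / 4))ᶜ + (1 - ν j Set.univ)) := by gcongr
      _ ≤ _ := by
        rw [mul_add, mul_comm _ (1 - ν j Set.univ)]
        exact add_le_add hfar (mul_le_mul_right (hexit _ hx) _)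
  have hint : ∫⁻ x, ∑ j, I.indicator (fun _ => ENNReal.ofReal (ρ / 2)) (x j)
      ∂(Measure.pi fun _ : Fin n => unifCube d) = n * (ENNReal.ofReal (ρ / 2) *
        ENNReal.ofReal ((1 / 2) ^ d)) := by
    have hm : Measurable (I.indicator fun _ : Fin d → ℝ => ENNReal.ofReal (ρ / 2)) :=
      measurable_const.indicator hI
    have hmj : ∀ j : Fin n, Measurable fun x : Fin n → Fin d → ℝ =>
        I.indicator (fun _ => ENNReal.ofReal (ρ / 2)) (x j) := fun j =>
      hm.comp (measurable_pi_apply j)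
    rw [lintegral_finsetSum _ fun j _ => hmj j]
    have : ∀ j : Fin n, ∫⁻ x, I.indicator (fun _ => ENNReal.ofReal (ρ / 2)) (x j)
        ∂(Measure.pi fun _ : Fin n => unifCube d) =
        ENNReal.ofReal (ρ / 2) * ENNReal.ofReal ((1 / 2) ^ d) := fun j => by
      rw [(measurePreserving_eval (fun _ : Fin n => unifCube d) j).lintegral_comp hm,
        lintegral_indicator_const hI, hIvol]
    rw [Finset.sum_congr rfl fun j _ => this j, Finset.sum_const, Finset.card_univ,
      Fintype.card_fin, nsmul_eq_mul]
  refine le_trans (le_of_eq ?_) (hint.symm.le.trans (lintegral_mono hpoint))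
  rw [← ENNReal.ofReal_natCast n, ← ENNReal.ofReal_mul (by positivity),
    ← ENNReal.ofReal_mul (by positivity)]
  congr 1
  rw [hρ, Real.mul_rpow (by positivity) ht0.le, ht, ← Real.rpow_mul hn0.le, Real.rpow_sub hn0,
    Real.rpow_one, neg_mul, Real.rpow_neg hn0.le, one_div_mul_eq_div]
  field_simp

end LowerLimit

/-! ### Hölder's inequality for sums and integrals of concave powers. -/

section Holder

theorem sum_rpow_mul_rpow_le {ι : Type*} (s : Finset ι) (a b : ι → ℝ≥0∞) {θ : ℝ} (hθ : 0 < θ)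
    (hθ1 : θ < 1) :
    ∑ i ∈ s, a i ^ θ * b i ^ (1 - θ) ≤ (∑ i ∈ s, a i) ^ θ * (∑ i ∈ s, b i) ^ (1 - θ) := by
  have h := ENNReal.inner_le_Lp_mul_Lq s (fun i => a i ^ θ) (fun i => b i ^ (1 - θ))
    (Real.holderConjugate_one_div hθ (sub_pos.2 hθ1) (by ring))
  have e1 : ∀ x : ℝ≥0∞, (x ^ θ) ^ (1 / θ) = x := fun x => by
    rw [← ENNReal.rpow_mul, mul_one_div_cancel hθ.ne', ENNReal.rpow_one]
  have e2 : ∀ x : ℝ≥0∞, (x ^ (1 - θ)) ^ (1 / (1 - θ)) = x := fun x => by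
    rw [← ENNReal.rpow_mul, mul_one_div_cancel (sub_pos.2 hθ1).ne', ENNReal.rpow_one]
  simpa only [e1, e2, one_div_one_div] using h

theorem lintegral_rpow_le {X : Type*} [MeasurableSpace X] (ν : Measure X) {h : X → ℝ≥0∞}
    (hh : Measurable h) {θ : ℝ} (hθ : 0 < θ) (hθ1 : θ < 1) :
    ∫⁻ x, h x ^ θ ∂ν ≤ (∫⁻ x, h x ∂ν) ^ θ * ν Set.univ ^ (1 - θ) := by
  have H := ENNReal.lintegral_mul_le_Lp_mul_Lq ν
    (Real.holderConjugate_one_div hθ (sub_pos.2 hθ1) (by ring))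
    (f := fun x => h x ^ θ) (g := fun _ => 1) (hh.pow_const _).aemeasurable aemeasurable_const
  have e1 : ∀ x : ℝ≥0∞, (x ^ θ) ^ (1 / θ) = x := fun x => by
    rw [← ENNReal.rpow_mul, mul_one_div_cancel hθ.ne', ENNReal.rpow_one]
  simpa only [Pi.mul_apply, mul_one, e1, one_div_one_div, ENNReal.one_rpow, lintegral_const,
    one_mul] using H

theorem sum_setLIntegral_rpow_le {X ι : Type*} [MeasurableSpace X] (ν : Measure X) (s : Finset ι)
    (Q : ι → Set X) {h : ι → X → ℝ≥0∞} (hh : ∀ i, Measurable (h i)) {θ : ℝ} (hθ : 0 < θ)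
    (hθ1 : θ < 1) :
    ∑ i ∈ s, ∫⁻ x in Q i, h i x ^ θ ∂ν ≤
      (∑ i ∈ s, ∫⁻ x in Q i, h i x ∂ν) ^ θ * (∑ i ∈ s, ν (Q i)) ^ (1 - θ) := by
  refine le_trans (Finset.sum_le_sum fun i _ => ?_) (sum_rpow_mul_rpow_le s _ _ hθ hθ1)
  simpa using lintegral_rpow_le (ν.restrict (Q i)) (hh i) hθ hθ1

end Holder

/-! ### Approximation of a measure by uniform distributions on a fine grid. -/

section GoodCells

variable {d : ℕ}

theorem volume_box (R : ℝ) : volume (box d R) = ENNReal.ofReal (2 * R) ^ d := by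
  rw [box, Real.volume_pi_Ico, Finset.prod_const, Finset.card_univ, Fintype.card_fin]
  congr 2; ring

theorem iUnion_cell_eq_box {R : ℝ} (hR : 0 < R) {M : ℕ} (hM : 0 < M) :
    ⋃ k ∈ gridIdx d M, cell (R / M) k = box d R := by
  ext x
  rw [Set.mem_iUnion₂, ← cellIdx_mem_gridIdx hR hM]
  constructor
  · rintro ⟨k, hk, hx⟩
    have : cellIdx (R / M) x = k := hx
    rwa [this]
  · exact fun h => ⟨_, h, rfl⟩

theorem pairwiseDisjoint_cell (r : ℝ) (S : Set (Fin d → ℤ)) :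
    S.PairwiseDisjoint fun k => cell r k := fun _ _ _ _ h => disjoint_cell r h

theorem sum_setLIntegral_cell (ν : Measure (Fin d → ℝ)) (f : (Fin d → ℝ) → ℝ≥0∞) (r : ℝ)
    (G : Finset (Fin d → ℤ)) :
    ∑ k ∈ G, ∫⁻ x in cell r k, f x ∂ν = ∫⁻ x in ⋃ k ∈ G, cell r k, f x ∂ν :=
  (lintegral_biUnion_finset (pairwiseDisjoint_cell r _) (fun _ _ => measurableSet_cell _ _) f).symm

/-- Approximation of an integrable density, in mean, by its values on a fine grid. -/
theorem exists_grid_approx {f : (Fin d → ℝ) → ℝ≥0∞} (hf : Measurable f) (hfin : ∫⁻ x, f x ≠ ∞)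
    {R ε : ℝ} (hR : 0 < R) (hε : 0 < ε) :
    ∃ δ : ℝ, 0 < δ ∧ ∀ r : ℝ, 0 < r → r < δ → ∃ v : (Fin d → ℤ) → ℝ≥0∞,
      ∀ G : Finset (Fin d → ℤ), (∀ k ∈ G, cell r k ⊆ box d R) →
        ∑ k ∈ G, ∫⁻ x in cell r k, ((f x - v k) + (v k - f x)) ≤ ENNReal.ofReal ε := by
  have hfae : ∀ᵐ x, f x < ∞ := ae_lt_top hf hfin
  have hint : Integrable (fun x => (f x).toReal) volume :=
    integrable_toReal_of_lintegral_ne_top hf.aemeasurable hfin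
  -- A compactly supported continuous approximation in mean is uniformly continuous, hence almost
  -- constant on small cells; v k is its value at a corner.
  obtain ⟨φ, hφc, hφ, hφcont, -⟩ := hint.exists_hasCompactSupport_lintegral_sub_le
    (ε := ENNReal.ofReal (ε / 4)) (by rw [Ne, ENNReal.ofReal_eq_zero, not_le]; linarith)
  set V : ℝ := (2 * R) ^ d with hV
  have hV0 : 0 < V := by positivity
  set η : ℝ := ε / (4 * V) with hη
  have hη0 : 0 < η := by positivity
  obtain ⟨δ, hδ, hunif⟩ := Metric.uniformContinuous_iff.1
    (hφc.uniformContinuous_of_continuous hφcont) η hη0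
  refine ⟨δ, hδ, fun r hr hrδ => ?_⟩
  let z : (Fin d → ℤ) → Fin d → ℝ := fun k i => r * k i
  refine ⟨fun k => ENNReal.ofReal (φ (z k)), fun G hG => ?_⟩
  have hz : ∀ k, z k ∈ cell r k := fun k => by
    rw [cell_eq_pi hr]
    intro i _
    refine ⟨le_rfl, ?_⟩
    simp only [z]
    nlinarith
  have hpt : ∀ k, ∀ᵐ x ∂(volume.restrict (cell r k)),
      (f x - ENNReal.ofReal (φ (z k))) + (ENNReal.ofReal (φ (z k)) - f x) ≤
        2 * ‖(f x).toReal - φ x‖ₑ + 2 * ENNReal.ofReal η := by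
    intro k
    filter_upwards [ae_restrict_of_ae hfae, ae_restrict_mem (measurableSet_cell r k)] with x hx hxk
    have h1 : |φ x - φ (z k)| < η := by
      rw [← Real.dist_eq]
      refine hunif ?_
      rw [dist_eq_norm]
      exact (norm_sub_le_of_mem_cell hr (hz k) hxk).trans_lt hrδ
    have h2 : ‖(f x).toReal - φ x‖ₑ = ENNReal.ofReal |(f x).toReal - φ x| :=
      Real.enorm_eq_ofReal_abs _
    have h3 : f x = ENNReal.ofReal (f x).toReal := (ENNReal.ofReal_toReal hx.ne).symm
    have key : ∀ a b t : ℝ, a ≤ b + t → ENNReal.ofReal a - ENNReal.ofReal b ≤ ENNReal.ofReal t := by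
      intro a b t h
      rw [tsub_le_iff_left]
      exact (ENNReal.ofReal_le_ofReal h).trans ENNReal.ofReal_add_le
    have h4 : ENNReal.ofReal (|(f x).toReal - φ x| + η) = ‖(f x).toReal - φ x‖ₑ +
        ENNReal.ofReal η := by
      rw [h2, ENNReal.ofReal_add (abs_nonneg _) hη0.le]
    rw [abs_lt] at h1
    have h5 := abs_le.1 (le_refl |(f x).toReal - φ x|)
    calc _ ≤ ENNReal.ofReal (|(f x).toReal - φ x| + η) +
          ENNReal.ofReal (|(f x).toReal - φ x| + η) := by
          rw [h3, ENNReal.toReal_ofReal ENNReal.toReal_nonneg]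
          refine add_le_add (key _ _ _ ?_) (key _ _ _ ?_) <;> linarith
      _ = _ := by rw [h4]; ring
  calc _ ≤ ∑ k ∈ G, ∫⁻ x in cell r k, (2 * ‖(f x).toReal - φ x‖ₑ + 2 * ENNReal.ofReal η) :=
        Finset.sum_le_sum fun k _ => lintegral_mono_ae (hpt k)
    _ = ∫⁻ x in ⋃ k ∈ G, cell r k, (2 * ‖(f x).toReal - φ x‖ₑ + 2 * ENNReal.ofReal η) :=
        sum_setLIntegral_cell _ _ _ _
    _ ≤ ∫⁻ x in box d R, (2 * ‖(f x).toReal - φ x‖ₑ + 2 * ENNReal.ofReal η) :=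
        lintegral_mono_set (Set.iUnion₂_subset hG)
    _ ≤ 2 * ENNReal.ofReal (ε / 4) + 2 * ENNReal.ofReal η * volume (box d R) := by
        rw [lintegral_add_right _ measurable_const, setLIntegral_const,
          lintegral_const_mul' _ _ (by norm_num)]
        gcongr
        exact (setLIntegral_le_lintegral _ _).trans hφ
    _ = ENNReal.ofReal ε := by
        have h2 : (2 : ℝ≥0∞) = ENNReal.ofReal 2 := by simp
        rw [volume_box, h2, ← ENNReal.ofReal_pow (by positivity),
          ← ENNReal.ofReal_mul (by norm_num), ← ENNReal.ofReal_mul (by norm_num),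
          ← ENNReal.ofReal_mul (by positivity), ← ENNReal.ofReal_add (by positivity)
          (by positivity), ← hV, hη]
        congr 1
        field_simp
        ring

/-- Apart from few cells of a fine grid, the measure `μ` is close to a uniform distribution
on each cell. -/
theorem exists_good_cells (μ : Measure (Fin d → ℝ)) [IsProbabilityMeasure μ] {R ε : ℝ}
    (hR : 0 < R) (hε : 0 < ε) :
    ∃ δ : ℝ, 0 < δ ∧ ∀ M : ℕ, 0 < M → R / M < δ → ∃ G ⊆ gridIdx d M,
      ∑ k ∈ gridIdx d M \ G, volume (cell (R / M) k) ≤ ENNReal.ofReal ε ∧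
      ∑ k ∈ G, ∫⁻ x in cell (R / M) k,
        (μ (cell (R / M) k) / ENNReal.ofReal (R / M) ^ d - μ.rnDeriv volume x) ≤
          ENNReal.ofReal ε := by
  classical
  set f := μ.rnDeriv volume with hf
  set σ := μ.singularPart volume with hσ
  have hld : μ.HaveLebesgueDecomposition volume :=
    Measure.haveLebesgueDecomposition_of_sigmaFinite μ volume
  have hfm : Measurable f := Measure.measurable_rnDeriv μ volume
  have hffin : ∫⁻ x, f x ≠ ∞ := (Measure.lintegral_rnDeriv_lt_top μ volume).ne
  have hdecomp : ∀ s, MeasurableSet s → μ s = σ s + ∫⁻ x in s, f x := fun s hs => by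
    conv_lhs => rw [Measure.haveLebesgueDecomposition_add μ volume]
    rw [Measure.add_apply, withDensity_apply _ hs]
  set η := ε / 4 with hη
  have hη0 : 0 < η := by positivity
  have hηE : ENNReal.ofReal η ≠ 0 := by rw [Ne, ENNReal.ofReal_eq_zero, not_le]; exact hη0
  obtain ⟨S, hS, hσS, hvS⟩ := Measure.mutuallySingular_singularPart μ volume
  -- All but η of the singular part sits on a compact null set K. Cells that meet K lie in a thin
  -- neighbourhood of K, whose volume tends to zero with the mesh.
  obtain ⟨K, hKS, hK, hσK⟩ := hS.compl.exists_isCompact_sdiff_lt (μ := σ) (measure_ne_top _ _) hηE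
  have hσKc : σ Kᶜ ≤ ENNReal.ofReal η := by
    have : Kᶜ ⊆ S ∪ (Sᶜ \ K) := fun x hx => by
      by_cases hxS : x ∈ S
      · exact Or.inl hxS
      · exact Or.inr ⟨hxS, hx⟩
    refine (measure_mono this).trans ((measure_union_le _ _).trans ?_)
    rw [hσS, zero_add]
    exact hσK.le
  have hvK : volume K = 0 := measure_mono_null hKS hvS
  have hthick : ∀ᶠ r in 𝓝 (0 : ℝ), volume (Metric.cthickening r K) < ENNReal.ofReal η := by
    have := tendsto_measure_cthickening_of_isCompact (μ := volume) hK
    rw [hvK] at this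
    exact this.eventually_lt_const (pos_iff_ne_zero.2 hηE)
  obtain ⟨δ₁, hδ₁, hthick⟩ := Metric.eventually_nhds_iff.1 hthick
  obtain ⟨δ₂, hδ₂, hgrid⟩ := exists_grid_approx hfm hffin hR hη0
  refine ⟨min δ₁ δ₂, lt_min hδ₁ hδ₂, fun M hM hrδ => ?_⟩
  have hM0 : (0 : ℝ) < M := by exact_mod_cast hM
  set r := R / M with hr
  have hr0 : 0 < r := by positivity
  obtain ⟨v, hvsum⟩ := hgrid r hr0 (hrδ.trans_le (min_le_right _ _))
  set G := (gridIdx d M).filter fun k => Disjoint (cell r k) K with hG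
  have hGsub : ∀ k ∈ G, cell r k ⊆ box d R := fun k hk => by
    rw [← iUnion_cell_eq_box hR hM]
    exact Set.subset_biUnion_of_mem (u := fun k => cell r k) (Finset.mem_filter.1 hk).1
  have hσG : ∑ k ∈ G, σ (cell r k) ≤ ENNReal.ofReal η := by
    rw [← measure_biUnion_finset (pairwiseDisjoint_cell r _) fun _ _ => measurableSet_cell _ _]
    refine (measure_mono (Set.iUnion₂_subset fun k hk => ?_)).trans hσKc
    exact Set.subset_compl_iff_disjoint_right.2 (Finset.mem_filter.1 hk).2
  have hηε : ENNReal.ofReal η ≤ ENNReal.ofReal ε :=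
    ENNReal.ofReal_le_ofReal (by rw [hη]; linarith)
  refine ⟨G, Finset.filter_subset _ _, ?_, ?_⟩
  · rw [← measure_biUnion_finset (pairwiseDisjoint_cell r _) fun _ _ => measurableSet_cell _ _]
    refine (measure_mono (Set.iUnion₂_subset fun k hk x hx => ?_)).trans
      ((hthick (y := r) ?_).le.trans hηε)
    · rw [Finset.mem_sdiff, hG, Finset.mem_filter] at hk
      have : ¬ Disjoint (cell r k) K := fun h => hk.2 ⟨hk.1, h⟩
      obtain ⟨y, hy, hyK⟩ := Set.not_disjoint_iff.1 this
      refine Metric.mem_cthickening_of_dist_le x y r K hyK ?_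
      rw [dist_eq_norm]
      exact norm_sub_le_of_mem_cell hr0 hy hx
    · rw [Real.dist_eq, sub_zero, abs_of_pos hr0]
      exact hrδ.trans_le (min_le_left _ _)
  · have hvol : ∀ k, volume (cell r k) = ENNReal.ofReal r ^ d := volume_cell hr0
    have hrE0 : ENNReal.ofReal r ^ d ≠ 0 :=
      pow_ne_zero _ (by rw [Ne, ENNReal.ofReal_eq_zero, not_le]; exact hr0)
    have hrEt : ENNReal.ofReal r ^ d ≠ ∞ := ENNReal.pow_ne_top ENNReal.ofReal_ne_top
    -- The mean density is compared with f through v k. The first difference, integrated over the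
    -- cell, is at most the singular mass of the cell plus the error of v k.
    have hcell : ∀ k, ∫⁻ x in cell r k, (μ (cell r k) / ENNReal.ofReal r ^ d - f x) ≤
        σ (cell r k) + ((∫⁻ x in cell r k, ((f x - v k) + (v k - f x))) +
          ∫⁻ x in cell r k, ((f x - v k) + (v k - f x))) := by
      intro k
      set c := μ (cell r k) / ENNReal.ofReal r ^ d with hc
      have h1 : ∫⁻ x in cell r k, (c - f x) ≤
          (∫⁻ x in cell r k, (c - v k)) + ∫⁻ x in cell r k, (v k - f x) := by
        rw [← lintegral_add_left measurable_const]
        exact lintegral_mono fun x => tsub_le_tsub_add_tsub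
      have h2 : ∫⁻ x in cell r k, (c - v k) ≤ σ (cell r k) + ∫⁻ x in cell r k, (f x - v k) := by
        rw [setLIntegral_const, hvol, ENNReal.sub_mul fun _ _ => hrEt, hc,
          ENNReal.div_mul_cancel hrE0 hrEt, hdecomp _ (measurableSet_cell r k), tsub_le_iff_right,
          add_assoc]
        refine add_le_add le_rfl ?_
        have h3 : v k * ENNReal.ofReal r ^ d = ∫⁻ x in cell r k, v k := by
          rw [setLIntegral_const, hvol]
        rw [h3, ← lintegral_add_left (hfm.sub_const _)]
        exact lintegral_mono fun x => le_tsub_add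
      rw [lintegral_add_left (hfm.sub_const _)]
      calc _ ≤ _ := h1
        _ ≤ (σ (cell r k) + ∫⁻ x in cell r k, (f x - v k)) + ∫⁻ x in cell r k, (v k - f x) := by
          gcongr
        _ = σ (cell r k) + ((∫⁻ x in cell r k, (f x - v k)) + ∫⁻ x in cell r k, (v k - f x)) := by
          ring
        _ ≤ _ := add_le_add le_rfl le_self_add
    refine (Finset.sum_le_sum fun k _ => hcell k).trans ?_
    rw [Finset.sum_add_distrib, Finset.sum_add_distrib]
    have h4 := hvsum G hGsub
    refine (add_le_add hσG (add_le_add h4 h4)).trans ?_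
    rw [← ENNReal.ofReal_add hη0.le hη0.le, ← ENNReal.ofReal_add hη0.le (by positivity)]
    exact ENNReal.ofReal_le_ofReal (by rw [hη]; linarith)

end GoodCells

/-! ### Common part, surplus and deficit of a measure on a cell. -/

section CellDecomposition

variable {d : ℕ} (μ : Measure (Fin d → ℝ)) (r : ℝ) (k : Fin d → ℤ)

/-- The mean density of `μ` on a cell. -/
noncomputable def cellMean : ℝ≥0∞ := μ (cell r k) / ENNReal.ofReal r ^ d

/-- The common part of `μ` on a cell and of the uniform distribution with the same mass. -/
noncomputable def cellCommon : Measure (Fin d → ℝ) :=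
  (volume.restrict (cell r k)).withDensity fun x => min (μ.rnDeriv volume x) (cellMean μ r k)

/-- The part of `μ` on a cell that exceeds the uniform distribution with the same mass. -/
noncomputable def cellSurplus : Measure (Fin d → ℝ) :=
  (μ.singularPart volume).restrict (cell r k) +
    (volume.restrict (cell r k)).withDensity fun x => μ.rnDeriv volume x - cellMean μ r k

/-- The part of the uniform distribution on a cell that exceeds `μ`. -/
noncomputable def cellDeficit : Measure (Fin d → ℝ) :=
  (volume.restrict (cell r k)).withDensity fun x => cellMean μ r k - μ.rnDeriv volume x

theorem restrict_cell_eq [IsFiniteMeasure μ] :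
    μ.restrict (cell r k) = cellCommon μ r k + cellSurplus μ r k := by
  have hld : μ.HaveLebesgueDecomposition volume :=
    Measure.haveLebesgueDecomposition_of_sigmaFinite μ volume
  have hfm := Measure.measurable_rnDeriv μ volume
  rw [cellCommon, cellSurplus, add_left_comm, ← withDensity_add_left (hfm.min measurable_const)]
  have : (fun x => min (μ.rnDeriv volume x) (cellMean μ r k)) +
      (fun x => μ.rnDeriv volume x - cellMean μ r k) = μ.rnDeriv volume := by
    funext x
    simp only [Pi.add_apply]
    rw [add_comm, tsub_add_min]
  rw [this, ← restrict_withDensity (measurableSet_cell r k), ← Measure.restrict_add,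
    ← Measure.haveLebesgueDecomposition_add μ volume]

variable {r}

theorem smul_unifCell_eq (hr : 0 < r) :
    μ (cell r k) • unifCell r (fun i => r * k i) = cellCommon μ r k + cellDeficit μ r k := by
  have hfm := Measure.measurable_rnDeriv μ volume
  rw [cellCommon, cellDeficit, ← withDensity_add_left (hfm.min measurable_const)]
  have : (fun x => min (μ.rnDeriv volume x) (cellMean μ r k)) +
      (fun x => cellMean μ r k - μ.rnDeriv volume x) = fun _ => cellMean μ r k := by
    funext x
    simp only [Pi.add_apply]
    rw [add_comm, min_comm, tsub_add_min]
  rw [this, withDensity_const, unifCell_eq_cell hr, smul_smul, cellMean, div_eq_mul_inv]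

theorem cellDeficit_univ : cellDeficit μ r k Set.univ =
    ∫⁻ x in cell r k, (cellMean μ r k - μ.rnDeriv volume x) := by
  rw [cellDeficit, withDensity_apply _ MeasurableSet.univ, Measure.restrict_univ]

/-- Both complete the same common part to measures of mass μ(cell). -/
theorem cellSurplus_univ [IsFiniteMeasure μ] (hr : 0 < r) :
    cellSurplus μ r k Set.univ = cellDeficit μ r k Set.univ := by
  have h1 := congrArg (fun ν => ν Set.univ) (restrict_cell_eq μ r k)
  have h2 := congrArg (fun ν => ν Set.univ) (smul_unifCell_eq μ k hr)
  simp only [Measure.add_apply, Measure.restrict_apply_univ, Measure.smul_apply, measure_univ,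
    smul_eq_mul, mul_one] at h1 h2
  have h3 : cellCommon μ r k Set.univ ≠ ∞ := ne_top_of_le_ne_top (measure_ne_top μ (cell r k))
    (by rw [h1]; exact le_self_add)
  exact (ENNReal.add_right_inj h3).1 (h1.symm.trans h2)

theorem lintegral_rnDeriv_sub_le [IsFiniteMeasure μ] (hr : 0 < r) :
    ∫⁻ x in cell r k, (μ.rnDeriv volume x - cellMean μ r k) ≤ cellDeficit μ r k Set.univ := by
  rw [← cellSurplus_univ μ k hr, cellSurplus, Measure.add_apply,
    withDensity_apply _ MeasurableSet.univ, Measure.restrict_univ]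
  exact le_add_self

end CellDecomposition

/-! ### From sums of powers of cell masses to the integral of f ^ (1 - p/d). -/

section CellPowers

variable {d : ℕ} {p : ℝ}

/-- The exponents match since d - d * (1 - p/d) = p. This identifies the costs r ^ p * μ(cell) ^ (1
- p/d) with the integral of a power of a step density. -/
theorem cellMean_rpow_mul {r : ℝ} (hr : 0 < r) (hd : 0 < d) (hpd : p < d)
    (μ : Measure (Fin d → ℝ)) (k : Fin d → ℤ) :
    cellMean μ r k ^ (1 - p / d) * volume (cell r k) =
      ENNReal.ofReal (r ^ p) * μ (cell r k) ^ (1 - p / d) := by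
  have hd0 : (0 : ℝ) < d := by exact_mod_cast hd
  have hθ : 0 ≤ 1 - p / d := by
    have : p / d < 1 := by rwa [div_lt_one hd0]
    linarith
  have hr0 : ENNReal.ofReal r ≠ 0 := by rw [Ne, ENNReal.ofReal_eq_zero, not_le]; exact hr
  rw [cellMean, volume_cell hr, ENNReal.div_rpow_of_nonneg _ _ hθ, div_eq_mul_inv,
    ← ENNReal.ofReal_rpow_of_pos hr, mul_assoc, mul_comm]
  congr 1
  rw [← ENNReal.rpow_neg, ← ENNReal.rpow_natCast, ← ENNReal.rpow_mul, ← ENNReal.rpow_add _ _ hr0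
    ENNReal.ofReal_ne_top]
  congr 1
  field_simp
  ring

theorem sum_volume_cell_le {R : ℝ} (hR : 0 < R) {M : ℕ} (hM : 0 < M) {G : Finset (Fin d → ℤ)}
    (hG : G ⊆ gridIdx d M) : ∑ k ∈ G, volume (cell (R / M) k) ≤ ENNReal.ofReal (2 * R) ^ d := by
  rw [← volume_box, ← iUnion_cell_eq_box hR hM,
    ← measure_biUnion_finset (pairwiseDisjoint_cell _ _) fun _ _ => measurableSet_cell _ _]
  exact measure_mono (Set.biUnion_subset_biUnion_left hG)

variable (μ : Measure (Fin d → ℝ)) {R : ℝ} {M : ℕ}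
  {G : Finset (Fin d → ℤ)} {ε : ℝ≥0∞}

/-- Subadditivity of t ^ θ separates the power of the mean density into f ^ θ and the power of the
deficit density. Hölder bounds the latter by the total deficit and the volume of the box. -/
theorem sum_rpow_cell_le (hp : 0 < p) (hpd : p < d) (hR : 0 < R) (hM : 0 < M)
    (hG : G ⊆ gridIdx d M) (hdef : ∑ k ∈ G, cellDeficit μ (R / M) k Set.univ ≤ ε) :
    ∑ k ∈ G, ENNReal.ofReal ((R / M) ^ p) * μ (cell (R / M) k) ^ (1 - p / d) ≤
      (∫⁻ x in box d R, μ.rnDeriv volume x ^ (1 - p / d)) +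
        ε ^ (1 - p / d) * (ENNReal.ofReal (2 * R) ^ d) ^ (p / d) := by
  have hd0 : (0 : ℝ) < d := hp.trans hpd
  have hd : 0 < d := by exact_mod_cast hd0
  have hpd1 : p / d < 1 := by rwa [div_lt_one hd0]
  have hpd0 : 0 < p / d := by positivity
  have hM0 : (0 : ℝ) < M := by exact_mod_cast hM
  have hr : 0 < R / M := by positivity
  have hfm := Measure.measurable_rnDeriv μ volume
  set θ := 1 - p / d with hθ
  have hθ0 : 0 < θ := by linarith
  have hθ1 : θ < 1 := by linarith
  have hcell : ∀ k, ENNReal.ofReal ((R / M) ^ p) * μ (cell (R / M) k) ^ θ ≤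
      (∫⁻ x in cell (R / M) k, μ.rnDeriv volume x ^ θ) +
      ∫⁻ x in cell (R / M) k, (cellMean μ (R / M) k - μ.rnDeriv volume x) ^ θ := by
    intro k
    rw [← cellMean_rpow_mul hr hd hpd, ← setLIntegral_const,
      ← lintegral_add_left (hfm.pow_const _)]
    refine lintegral_mono fun x => ?_
    refine le_trans ?_ (ENNReal.rpow_add_le_add_rpow _ _ hθ0.le hθ1.le)
    exact ENNReal.rpow_le_rpow le_add_tsub hθ0.le
  refine (Finset.sum_le_sum fun k _ => hcell k).trans ?_
  rw [Finset.sum_add_distrib]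
  refine add_le_add ?_ ?_
  · rw [sum_setLIntegral_cell, ← iUnion_cell_eq_box hR hM]
    exact lintegral_mono_set (Set.biUnion_subset_biUnion_left hG)
  · refine (sum_setLIntegral_rpow_le volume G _ (fun k => measurable_const.sub hfm) hθ0
      hθ1).trans ?_
    have h1 : 1 - θ = p / d := by rw [hθ]; ring
    rw [h1]
    simp only [cellDeficit_univ] at hdef
    exact mul_le_mul' (ENNReal.rpow_le_rpow hdef hθ0.le)
      (ENNReal.rpow_le_rpow (sum_volume_cell_le hR hM hG) hpd0.le)

/-- Hölder with exponent θ on the masses and p/d on the volumes: a family of cells of small total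
volume contributes little, whatever mass it carries. -/
theorem sum_rpow_cell_le_rpow [IsProbabilityMeasure μ] (hp : 0 < p) (hpd : p < d) (hR : 0 < R) (hM : 0 < M)
    (hbad : ∑ k ∈ G, volume (cell (R / M) k) ≤ ε) :
    ∑ k ∈ G, ENNReal.ofReal ((R / M) ^ p) * μ (cell (R / M) k) ^ (1 - p / d) ≤ ε ^ (p / d) := by
  have hd0 : (0 : ℝ) < d := hp.trans hpd
  have hd : 0 < d := by exact_mod_cast hd0
  have hpd1 : p / d < 1 := by rwa [div_lt_one hd0]
  have hpd0 : 0 < p / d := by positivity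
  have hM0 : (0 : ℝ) < M := by exact_mod_cast hM
  have hr : 0 < R / M := by positivity
  have h1 : ENNReal.ofReal ((R / M) ^ p) = (ENNReal.ofReal (R / M) ^ d) ^ (1 - (1 - p / d)) := by
    rw [← ENNReal.ofReal_rpow_of_pos hr, ← ENNReal.rpow_natCast, ← ENNReal.rpow_mul]
    congr 1; field_simp; ring
  calc _ = ∑ k ∈ G, μ (cell (R / M) k) ^ (1 - p / d) *
        volume (cell (R / M) k) ^ (1 - (1 - p / d)) := by
        refine Finset.sum_congr rfl fun k _ => ?_
        rw [mul_comm, volume_cell hr, h1]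
    _ ≤ (∑ k ∈ G, μ (cell (R / M) k)) ^ (1 - p / d) *
        (∑ k ∈ G, volume (cell (R / M) k)) ^ (1 - (1 - p / d)) :=
        sum_rpow_mul_rpow_le G _ _ (by linarith) (by linarith)
    _ ≤ 1 ^ (1 - p / d) * ε ^ (p / d) := by
        rw [sub_sub_cancel]
        refine mul_le_mul' (ENNReal.rpow_le_rpow ?_ (by linarith))
          (ENNReal.rpow_le_rpow hbad hpd0.le)
        rw [← measure_biUnion_finset (pairwiseDisjoint_cell _ _)
          fun _ _ => measurableSet_cell _ _]
        exact prob_le_one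
    _ = _ := by rw [ENNReal.one_rpow, one_mul]

/-- The reverse comparison, needed for the lower bound. On good cells the density excess is at most
the surplus, which has the mass of the deficit; on the other cells Hölder is applied to f itself. -/
theorem lintegral_rpow_box_le [IsProbabilityMeasure μ] (hp : 0 < p) (hpd : p < d) (hR : 0 < R) (hM : 0 < M)
    (hG : G ⊆ gridIdx d M) (hdef : ∑ k ∈ G, cellDeficit μ (R / M) k Set.univ ≤ ε)
    (hbad : ∑ k ∈ gridIdx d M \ G, volume (cell (R / M) k) ≤ ε) :
    ∫⁻ x in box d R, μ.rnDeriv volume x ^ (1 - p / d) ≤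
      ∑ k ∈ G, ENNReal.ofReal ((R / M) ^ p) * μ (cell (R / M) k) ^ (1 - p / d) +
        (ε ^ (1 - p / d) * (ENNReal.ofReal (2 * R) ^ d) ^ (p / d) + ε ^ (p / d)) := by
  have hd0 : (0 : ℝ) < d := hp.trans hpd
  have hd : 0 < d := by exact_mod_cast hd0
  have hpd1 : p / d < 1 := by rwa [div_lt_one hd0]
  have hpd0 : 0 < p / d := by positivity
  have hM0 : (0 : ℝ) < M := by exact_mod_cast hM
  have hr : 0 < R / M := by positivity
  have hfm := Measure.measurable_rnDeriv μ volume
  set θ := 1 - p / d with hθ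
  have hθ0 : 0 < θ := by linarith
  have hθ1 : θ < 1 := by linarith
  have h1 : 1 - θ = p / d := by rw [hθ]; ring
  have hcell : ∀ k, ∫⁻ x in cell (R / M) k, μ.rnDeriv volume x ^ θ ≤
      ENNReal.ofReal ((R / M) ^ p) * μ (cell (R / M) k) ^ θ +
      ∫⁻ x in cell (R / M) k, (μ.rnDeriv volume x - cellMean μ (R / M) k) ^ θ := by
    intro k
    rw [← cellMean_rpow_mul hr hd hpd, ← setLIntegral_const,
      ← lintegral_add_left measurable_const]
    refine lintegral_mono fun x => ?_
    refine le_trans ?_ (ENNReal.rpow_add_le_add_rpow _ _ hθ0.le hθ1.le)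
    exact ENNReal.rpow_le_rpow le_add_tsub hθ0.le
  have hgood : ∑ k ∈ G, ∫⁻ x in cell (R / M) k, μ.rnDeriv volume x ^ θ ≤
      ∑ k ∈ G, ENNReal.ofReal ((R / M) ^ p) * μ (cell (R / M) k) ^ θ +
        ε ^ θ * (ENNReal.ofReal (2 * R) ^ d) ^ (p / d) := by
    refine (Finset.sum_le_sum fun k _ => hcell k).trans ?_
    rw [Finset.sum_add_distrib]
    refine add_le_add le_rfl ?_
    refine (sum_setLIntegral_rpow_le volume G _ (fun k => hfm.sub_const _) hθ0 hθ1).trans ?_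
    rw [h1]
    refine mul_le_mul' (ENNReal.rpow_le_rpow ?_ hθ0.le)
      (ENNReal.rpow_le_rpow (sum_volume_cell_le hR hM hG) hpd0.le)
    exact (Finset.sum_le_sum fun k _ => lintegral_rnDeriv_sub_le μ k hr).trans hdef
  have hbad' : ∑ k ∈ gridIdx d M \ G, ∫⁻ x in cell (R / M) k, μ.rnDeriv volume x ^ θ ≤
      ε ^ (p / d) := by
    refine (sum_setLIntegral_rpow_le volume (gridIdx d M \ G) _ (fun _ => hfm) hθ0 hθ1).trans ?_
    rw [h1, sum_setLIntegral_cell]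
    calc _ ≤ (1 : ℝ≥0∞) ^ θ * ε ^ (p / d) := by
          refine mul_le_mul' (ENNReal.rpow_le_rpow ?_ hθ0.le) (ENNReal.rpow_le_rpow hbad hpd0.le)
          exact (Measure.setLIntegral_rnDeriv_le _).trans prob_le_one
      _ = _ := by rw [ENNReal.one_rpow, one_mul]
  calc _ = ∑ k ∈ gridIdx d M \ G, (∫⁻ x in cell (R / M) k, μ.rnDeriv volume x ^ θ) +
        ∑ k ∈ G, ∫⁻ x in cell (R / M) k, μ.rnDeriv volume x ^ θ := by
        rw [Finset.sum_sdiff hG, sum_setLIntegral_cell, iUnion_cell_eq_box hR hM]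
    _ ≤ _ := add_le_add hbad' hgood
    _ = _ := by ring

end CellPowers

/-! ### Choice of the mesh for a given sample size. -/

section Mesh

variable {d : ℕ} {p : ℝ}

/-- The choice of a dyadic mesh with about `a` sample points per cell. -/
theorem exists_mesh (hp : 1 ≤ p) (hpd : p < (d : ℝ) / 2) {R a δ : ℝ} (hR : 0 < R) (ha : 0 < a)
    (hδ : 0 < δ) :
    ∀ᶠ N : ℕ in atTop, ∃ L : ℕ, R / (2 ^ L : ℕ) < δ ∧
      (R / (2 ^ L : ℕ)) ^ p * N ≤ 2 ^ p * a ^ (p / d) * (N : ℝ) ^ (1 - p / d) ∧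
      (R / (2 ^ L : ℕ)) ^ p * (2 * (2 ^ L : ℕ)) ^ d ≤
        2 ^ d * R ^ d * a ^ (-(1 - p / d)) * (N : ℝ) ^ (1 - p / d) ∧
      R ^ p * (2 ^ ((d : ℝ) / 2 - p)) ^ L * √N ≤
        R ^ ((d : ℝ) / 2) * a ^ (-(1 / 2 - p / d)) * (N : ℝ) ^ (1 - p / d) := by
  have hd0 : (0 : ℝ) < d := by linarith
  have hp0 : 0 ≤ p := by linarith
  have hy : Tendsto (fun N : ℕ => ((N : ℝ) / a) ^ (1 / (d : ℝ))) atTop atTop :=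
    (tendsto_rpow_atTop (by positivity)).comp (tendsto_natCast_atTop_atTop.atTop_div_const ha)
  filter_upwards [hy.eventually_gt_atTop (2 / δ), hy.eventually_ge_atTop (1 / R),
    eventually_gt_atTop 0] with N hN1 hN2 hN
  have hN0 : (0 : ℝ) < N := by exact_mod_cast hN
  set y := ((N : ℝ) / a) ^ (1 / (d : ℝ)) with hydef
  have hy0 : 0 < y := by positivity
  have hypow : ∀ t : ℝ, y ^ t = ((N : ℝ) / a) ^ (t / d) := fun t => by
    rw [hydef, ← Real.rpow_mul (by positivity)]; congr 1; ring
  -- The side R / 2 ^ L lies between 1 / y and 2 / y, so its volume is a / N up to the factor 2 ^ d.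
  obtain ⟨L, hL1, hL2⟩ := exists_pow_two_near (x := R * y)
    (by rw [div_le_iff₀ hR] at hN2; linarith)
  have h2L : (0 : ℝ) < 2 ^ L := by positivity
  push_cast
  have hr2 : R / 2 ^ L ≤ 2 / y := by
    rw [div_le_div_iff₀ h2L hy0]; rw [pow_succ] at hL2; linarith
  refine ⟨L, hr2.trans_lt ?_, ?_, ?_, ?_⟩
  · rw [div_lt_iff₀ hδ] at hN1
    rw [div_lt_iff₀ hy0]; linarith
  · calc (R / 2 ^ L) ^ p * N ≤ (2 / y) ^ p * N := by gcongr
      _ = 2 ^ p * (((N : ℝ) / a) ^ (p / d))⁻¹ * (N : ℝ) ^ (1 : ℝ) := by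
        rw [Real.div_rpow (by norm_num) hy0.le, hypow, Real.rpow_one, div_eq_mul_inv]
      _ = _ := by
        rw [Real.div_rpow hN0.le ha.le, inv_div, Real.rpow_sub hN0]
        ring
  · calc (R / 2 ^ L) ^ p * (2 * 2 ^ L) ^ d = 2 ^ d * (R ^ p * ((2 : ℝ) ^ L) ^ ((d : ℝ) - p)) := by
          rw [Real.div_rpow hR.le h2L.le, Real.rpow_sub h2L, Real.rpow_natCast, mul_pow]
          ring
      _ ≤ 2 ^ d * (R ^ p * (R * y) ^ ((d : ℝ) - p)) := by
          have : (0 : ℝ) ≤ (d : ℝ) - p := by linarith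
          gcongr
      _ = _ := by
          have e1 : ((d : ℝ) - p) / d = 1 - p / d := by field_simp
          rw [Real.mul_rpow hR.le hy0.le, hypow, ← mul_assoc (R ^ p), ← Real.rpow_add hR,
            add_sub_cancel, Real.rpow_natCast, e1, Real.div_rpow hN0.le ha.le, Real.rpow_neg ha.le]
          ring
  · have e0 : (2 ^ ((d : ℝ) / 2 - p)) ^ L = ((2 : ℝ) ^ L) ^ ((d : ℝ) / 2 - p) := by
      rw [← Real.rpow_natCast, ← Real.rpow_natCast, ← Real.rpow_mul (by norm_num),
        ← Real.rpow_mul (by norm_num), mul_comm]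
    rw [e0]
    calc R ^ p * ((2 : ℝ) ^ L) ^ ((d : ℝ) / 2 - p) * √N
        ≤ R ^ p * (R * y) ^ ((d : ℝ) / 2 - p) * √N := by
          have : (0 : ℝ) ≤ (d : ℝ) / 2 - p := by linarith
          gcongr
      _ = _ := by
          have e1 : ((d : ℝ) / 2 - p) / d = 1 / 2 - p / d := by field_simp
          have e2 : (1 : ℝ) - p / d = (1 / 2 - p / d) + 1 / 2 := by ring
          rw [Real.mul_rpow hR.le hy0.le, hypow, ← mul_assoc (R ^ p), ← Real.rpow_add hR,
            add_sub_cancel, e1, Real.div_rpow hN0.le ha.le, Real.rpow_neg ha.le, e2,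
            Real.rpow_add hN0, Real.sqrt_eq_rpow]
          ring

end Mesh

/-! ### The asymptotic upper bound for general measures. -/

section UpperBound

variable {d : ℕ} {nrm : Seminorm ℝ (Fin d → ℝ)} {p C : ℝ}

/-- The additive constant absorbs the finitely many small n, so the bounds can be averaged over
binomial numbers. -/
theorem exists_le_of_tendsto {g : ℕ → ℝ} {θ l η : ℝ} (hη : 0 < η)
    (h : Tendsto (fun n : ℕ => g n / (n : ℝ) ^ θ) atTop (𝓝 l)) :
    ∃ A : ℝ, 0 < A ∧ ∀ n : ℕ, g n ≤ (l + η) * (n : ℝ) ^ θ + A ∧ (l - η) * (n : ℝ) ^ θ ≤ g n + A := by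
  have h1 : ∀ᶠ n : ℕ in atTop, l - η < g n / (n : ℝ) ^ θ ∧ g n / (n : ℝ) ^ θ < l + η :=
    (h.eventually_const_lt (by linarith)).and (h.eventually_lt_const (by linarith))
  obtain ⟨n₀, hn₀⟩ := eventually_atTop.1 (h1.and (eventually_gt_atTop 0))
  set A : ℝ := 1 + ∑ n ∈ Finset.range n₀, (|g n - (l + η) * (n : ℝ) ^ θ| +
    |(l - η) * (n : ℝ) ^ θ - g n|) with hA
  have hA0 : 0 < A := by positivity
  refine ⟨A, hA0, fun n => ?_⟩
  rcases lt_or_ge n n₀ with hn | hn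
  · have h2 := Finset.single_le_sum (f := fun n : ℕ => |g n - (l + η) * (n : ℝ) ^ θ| +
      |(l - η) * (n : ℝ) ^ θ - g n|) (fun _ _ => by positivity) (Finset.mem_range.2 hn)
    have h3 := le_abs_self (g n - (l + η) * (n : ℝ) ^ θ)
    have h4 := le_abs_self ((l - η) * (n : ℝ) ^ θ - g n)
    have h5 := abs_nonneg (g n - (l + η) * (n : ℝ) ^ θ)
    have h6 := abs_nonneg ((l - η) * (n : ℝ) ^ θ - g n)
    constructor <;> linarith
  · obtain ⟨⟨h2, h3⟩, h4⟩ := hn₀ n hn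
    have hn0 : (0 : ℝ) < (n : ℝ) ^ θ := Real.rpow_pos_of_pos (by exact_mod_cast h4) _
    rw [lt_div_iff₀ hn0] at h2
    rw [div_lt_iff₀ hn0] at h3
    constructor <;> linarith

theorem ae_normalized_mem_cell (μ : Measure (Fin d → ℝ)) {r : ℝ} {k : Fin d → ℤ}
    (h0 : (μ.restrict (cell r k)) Set.univ ≠ 0) :
    ∀ᵐ x ∂(normalized (μ.restrict (cell r k))), x ∈ cell r k :=
  ae_normalized h0 (ae_restrict_mem (measurableSet_cell r k))

/-- The normalized restriction of μ and the uniform distribution on the cell share the normalized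
common part, so the cost changes by at most the deficit times the diameter cost. Jensen's inequality
carries the power through the binomial average. -/
theorem thinCost_cell_le (hp : 1 ≤ p) (hC : 0 < C) (hnC : ∀ x, nrm x ≤ C * ‖x‖)
    {θ : ℝ} (hθ : 0 < θ) (hθ1 : θ ≤ 1) {a A : ℝ≥0∞}
    (hg : ∀ n : ℕ, sampleCost nrm p n (unifCube d) ≤ a * (n : ℝ≥0∞) ^ θ + A)
    (μ : Measure (Fin d → ℝ)) [IsProbabilityMeasure μ] {r : ℝ} (hr : 0 < r) (k : Fin d → ℤ)
    (N : ℕ) :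
    thinCost nrm p N (μ.restrict (cell r k)) ≤
      ENNReal.ofReal (r ^ p) * (a * (N * μ (cell r k)) ^ θ + A) +
        2 * ENNReal.ofReal ((C * r) ^ p) * N * cellDeficit μ r k Set.univ := by
  have hp0 : 0 ≤ p := by linarith
  set m := μ (cell r k) with hm
  set D := ENNReal.ofReal ((C * r) ^ p) with hD
  have hm1 : (μ.restrict (cell r k)) Set.univ = m := Measure.restrict_apply_univ _
  have hmle : m ≤ 1 := prob_le_one
  by_cases h0 : m = 0
  · rw [thinCost_of_univ_eq_zero (by rw [hm1, h0])]; exact zero_le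
  have hmt : m ≠ ∞ := measure_ne_top _ _
  have hn : normalized (μ.restrict (cell r k)) =
      m⁻¹ • cellCommon μ r k + m⁻¹ • cellSurplus μ r k := by
    rw [normalized_of_ne_zero (by rwa [hm1]), hm1, ← smul_add, ← restrict_cell_eq]
  have hu : unifCell r (fun i => r * k i) =
      m⁻¹ • cellCommon μ r k + m⁻¹ • cellDeficit μ r k := by
    rw [← smul_add, ← smul_unifCell_eq μ k hr, smul_smul, ENNReal.inv_mul_cancel h0 hmt, one_smul]
  have hs : ∀ n : ℕ, sampleCost nrm p n (normalized (μ.restrict (cell r k))) ≤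
      ENNReal.ofReal (r ^ p) * (a * ((n : ℝ≥0∞) * 1) ^ θ + A) +
        (2 * D * (m⁻¹ * cellDeficit μ r k Set.univ)) * n := by
    intro n
    have h1 := sampleCost_le_add_of_common (nrm := nrm) hp hn hu
      (ae_normalized_mem_cell μ (by rwa [hm1])) (D := D)
      (fun y hy x hx => gcost_le_of_norm_le hp0 hC hnC (norm_sub_le_of_mem_cell hr hx hy)) n
    refine h1.trans ?_
    rw [sampleCost_unifCell hp hr, mul_one, Measure.smul_apply, smul_eq_mul,
      mul_comm (n : ℝ≥0∞)]
    gcongr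
    exact hg n
  refine (thinCost_mono_of_le hs N).trans ?_
  have h1m : m + (1 - m) = 1 := add_tsub_cancel_of_le hmle
  rw [hm1, binomAvg_add, binomAvg_const_mul, binomAvg_add, binomAvg_const_mul,
    binomAvg_const h1m, binomAvg_const_mul, binomAvg_cast h1m]
  refine add_le_add (mul_le_mul_right (add_le_add (mul_le_mul_right ?_ _) le_rfl) _) (le_of_eq ?_)
  · simpa using binomAvg_rpow_le_ennreal hmle ENNReal.one_ne_top hθ hθ1 N
  · calc _ = 2 * D * N * cellDeficit μ r k Set.univ * (m⁻¹ * m) := by ring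
      _ = _ := by rw [ENNReal.inv_mul_cancel h0 hmt, mul_one]

theorem ofReal_natCast_rpow (N : ℕ) {θ : ℝ} (hθ : 0 ≤ θ) :
    ENNReal.ofReal ((N : ℝ) ^ θ) = (N : ℝ≥0∞) ^ θ := by
  rw [← ENNReal.ofReal_rpow_of_nonneg (by positivity) hθ, ENNReal.ofReal_natCast]

/-- The five terms come from the uniform cost on good cells, the additive constant A paid once per
cell, the deficits on good cells, the bad cells, and the dyadic hierarchy. The parameter t is N
times the cell volume, up to a bounded factor. -/
theorem thinCost_box_eventually_le (hp : 1 ≤ p) (hpd : p < (d : ℝ) / 2) (hC : 0 < C)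
    (hnC : ∀ x, nrm x ≤ C * ‖x‖) :
    ∃ A₁ A₂ : ℝ, 0 < A₁ ∧ 0 < A₂ ∧ ∀ (μ : Measure (Fin d → ℝ)) [IsProbabilityMeasure μ]
      {a A R t : ℝ} (_ : 0 ≤ a) (_ : 0 ≤ A)
      (_ : ∀ n : ℕ, (sampleCost nrm p n (unifCube d)).toReal ≤ a * (n : ℝ) ^ (1 - p / d) + A)
      (_ : 0 < R) (_ : 0 < t) {ε : ℝ} (_ : 0 < ε),
      ∀ᶠ N : ℕ in atTop, thinCost nrm p N (μ.restrict (box d R)) ≤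
        (ENNReal.ofReal a * ((∫⁻ x in box d R, μ.rnDeriv volume x ^ (1 - p / d)) +
            ENNReal.ofReal ε ^ (1 - p / d) * (ENNReal.ofReal (2 * R) ^ d) ^ (p / d)) +
          ENNReal.ofReal (A * (2 ^ d * R ^ d * t ^ (-(1 - p / d)))) +
          ENNReal.ofReal (2 * C ^ p * (2 ^ p * t ^ (p / d))) * ENNReal.ofReal ε +
          ENNReal.ofReal A₁ * ENNReal.ofReal ε ^ (p / d) +
          ENNReal.ofReal (A₂ * (R ^ ((d : ℝ) / 2) * t ^ (-(1 / 2 - p / d))))) *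
        (N : ℝ≥0∞) ^ (1 - p / d) := by
  classical
  have hp0 : 0 < p := by linarith
  have hd0 : (0 : ℝ) < d := by linarith
  have hpd1 : p < d := by linarith
  have hpd2 : p / d < 1 := by rwa [div_lt_one hd0]
  have hpd0 : 0 < p / d := by positivity
  obtain ⟨A₁, hA₁, hthin⟩ := exists_thinCost_le (nrm := nrm) hp hpd hC hnC
  obtain ⟨A₂, hA₂, hcells⟩ := exists_thinCost_le_sum_cells (nrm := nrm) hp hpd hC hnC
  refine ⟨A₁, A₂, hA₁, hA₂, fun μ _ a A R t ha hA hg hR ht ε hε => ?_⟩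
  set θ := 1 - p / d with hθ
  have hθ0 : 0 < θ := by linarith
  have hθ1 : θ < 1 := by linarith
  have hgE : ∀ n : ℕ, sampleCost nrm p n (unifCube d) ≤
      ENNReal.ofReal a * (n : ℝ≥0∞) ^ θ + ENNReal.ofReal A := fun n => by
    rw [← ENNReal.ofReal_toReal (sampleCost_unifCube_ne_top hp hC hnC n),
      ← ofReal_natCast_rpow n hθ0.le, ← ENNReal.ofReal_mul ha,
      ← ENNReal.ofReal_add (by positivity) hA]
    exact ENNReal.ofReal_le_ofReal (hg n)
  obtain ⟨δ, hδ, hgood⟩ := exists_good_cells μ hR hε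
  filter_upwards [exists_mesh hp hpd hR ht hδ] with N hN
  obtain ⟨L, hL, hb1, hb2, hb3⟩ := hN
  obtain ⟨G, hGsub, hGbad, hGdef⟩ := hgood (2 ^ L) (by positivity) hL
  have hMpos : 0 < 2 ^ L := by positivity
  have hr : 0 < R / (2 ^ L : ℕ) := by positivity
  change ∑ k ∈ G, ∫⁻ x in cell (R / (2 ^ L : ℕ)) k,
    (cellMean μ (R / (2 ^ L : ℕ)) k - μ.rnDeriv volume x) ≤ _ at hGdef
  simp only [← cellDeficit_univ] at hGdef
  have hpow := sum_rpow_cell_le μ hp0 hpd1 hR hMpos hGsub hGdef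
  have hbadpow := sum_rpow_cell_le_rpow μ hp0 hpd1 hR hMpos hGbad
  set M : ℕ := 2 ^ L with hM
  set r := R / (M : ℝ) with hrdef
  set e := ENNReal.ofReal ε with he
  have h1 := hcells R hR (μ.restrict (box d R)) ((Measure.restrict_le_self _).trans (by simp))
    (ae_restrict_mem (measurableSet_box R)) N L
  have hsub : ∀ k ∈ gridIdx d M, cell r k ⊆ box d R := fun k hk => by
    rw [← iUnion_cell_eq_box hR hMpos]
    exact Set.subset_biUnion_of_mem (u := fun k => cell r k) hk
  have hrestr : ∀ k ∈ gridIdx d M, (μ.restrict (box d R)).restrict (cell r k) =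
      μ.restrict (cell r k) := fun k hk => by
    rw [Measure.restrict_restrict (measurableSet_cell _ _), Set.inter_eq_left.2 (hsub k hk)]
  rw [Finset.sum_congr rfl fun k hk => by rw [hrestr k hk]] at h1
  have hgoodsum : ∑ k ∈ G, thinCost nrm p N (μ.restrict (cell r k)) ≤
      ENNReal.ofReal a * ((∑ k ∈ G, ENNReal.ofReal (r ^ p) * μ (cell r k) ^ θ) *
        (N : ℝ≥0∞) ^ θ) + ENNReal.ofReal (r ^ p * (2 * M) ^ d) * ENNReal.ofReal A +
        ENNReal.ofReal (2 * C ^ p) * ENNReal.ofReal (r ^ p * N) * e := by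
    refine (Finset.sum_le_sum fun k _ =>
      thinCost_cell_le hp hC hnC hθ0 hθ1.le hgE μ hr k N).trans ?_
    simp only [mul_add]
    rw [Finset.sum_add_distrib, Finset.sum_add_distrib]
    refine add_le_add (add_le_add (le_of_eq ?_) ?_) ?_
    · rw [Finset.sum_mul, Finset.mul_sum]
      refine Finset.sum_congr rfl fun k _ => ?_
      rw [ENNReal.mul_rpow_of_nonneg _ _ hθ0.le]; ring
    · rw [Finset.sum_const, nsmul_eq_mul, ← mul_assoc]
      refine mul_le_mul_left ?_ _
      rw [mul_comm (r ^ p), ENNReal.ofReal_mul (by positivity)]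
      refine mul_le_mul_left ?_ _
      have hc : G.card ≤ (2 * M) ^ d := (Finset.card_le_card hGsub).trans_eq (card_gridIdx M)
      have : ENNReal.ofReal ((2 * (M : ℝ)) ^ d) = (((2 * M) ^ d : ℕ) : ℝ≥0∞) := by
        rw [← ENNReal.ofReal_natCast]; push_cast; rfl
      rw [this]
      exact_mod_cast hc
    · rw [← Finset.mul_sum]
      refine mul_le_mul' (le_of_eq ?_) hGdef
      rw [Real.mul_rpow hC.le hr.le, ENNReal.ofReal_mul (by positivity),
        ENNReal.ofReal_mul (by positivity), ENNReal.ofReal_mul (by positivity),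
        ENNReal.ofReal_natCast, ENNReal.ofReal_ofNat]
      ring
  have hbadsum : ∑ k ∈ gridIdx d M \ G, thinCost nrm p N (μ.restrict (cell r k)) ≤
      ENNReal.ofReal A₁ * e ^ (p / d) * (N : ℝ≥0∞) ^ θ := by
    have h2 : ∀ k, thinCost nrm p N (μ.restrict (cell r k)) ≤
        ENNReal.ofReal A₁ * (ENNReal.ofReal (r ^ p) * μ (cell r k) ^ θ) * (N : ℝ≥0∞) ^ θ := by
      intro k
      refine (hthin r hr (fun i => r * k i) (μ.restrict (cell r k))
        ((Measure.restrict_le_self _).trans (by simp)) ?_ N).trans (le_of_eq ?_)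
      · filter_upwards [ae_restrict_mem (measurableSet_cell r k)] with x hx
        rw [cell_eq_pi_add hr] at hx
        intro i _
        have := hx i trivial
        simp only [Set.mem_Ico, Pi.sub_apply] at this ⊢
        constructor <;> linarith
      · rw [Measure.restrict_apply_univ, ENNReal.mul_rpow_of_nonneg _ _ hθ0.le,
          ENNReal.ofReal_mul hA₁.le]
        ring
    refine (Finset.sum_le_sum fun k _ => h2 k).trans ?_
    rw [← Finset.sum_mul, ← Finset.mul_sum]
    gcongr
  have h3 : thinCost nrm p N (μ.restrict (box d R)) ≤
      (ENNReal.ofReal A₁ * e ^ (p / d) * (N : ℝ≥0∞) ^ θ +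
        (ENNReal.ofReal a * ((∑ k ∈ G, ENNReal.ofReal (r ^ p) * μ (cell r k) ^ θ) *
        (N : ℝ≥0∞) ^ θ) + ENNReal.ofReal (r ^ p * (2 * M) ^ d) * ENNReal.ofReal A +
        ENNReal.ofReal (2 * C ^ p) * ENNReal.ofReal (r ^ p * N) * e)) +
      ENNReal.ofReal A₂ * ENNReal.ofReal (R ^ p * (2 ^ ((d : ℝ) / 2 - p)) ^ L * √N) := by
    refine h1.trans (add_le_add ?_ (le_of_eq ?_))
    · rw [← Finset.sum_sdiff hGsub]
      exact add_le_add hbadsum hgoodsum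
    · rw [← ENNReal.ofReal_mul hA₂.le]
      congr 1; ring
  refine h3.trans ?_
  have hNE := ofReal_natCast_rpow N hθ0.le
  have k1 : ENNReal.ofReal (r ^ p * N) ≤ ENNReal.ofReal (2 ^ p * t ^ (p / d)) *
      (N : ℝ≥0∞) ^ θ := by
    rw [← hNE, ← ENNReal.ofReal_mul (by positivity)]; exact ENNReal.ofReal_le_ofReal hb1
  have k2 : ENNReal.ofReal (r ^ p * (2 * M) ^ d) ≤ ENNReal.ofReal (2 ^ d * R ^ d * t ^ (-θ)) *
      (N : ℝ≥0∞) ^ θ := by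
    rw [← hNE, ← ENNReal.ofReal_mul (by positivity)]; exact ENNReal.ofReal_le_ofReal hb2
  have k3 : ENNReal.ofReal (R ^ p * (2 ^ ((d : ℝ) / 2 - p)) ^ L * √N) ≤
      ENNReal.ofReal (R ^ ((d : ℝ) / 2) * t ^ (-(1 / 2 - p / d))) * (N : ℝ≥0∞) ^ θ := by
    rw [← hNE, ← ENNReal.ofReal_mul (by positivity)]; exact ENNReal.ofReal_le_ofReal hb3
  rw [ENNReal.ofReal_mul (p := A) hA, ENNReal.ofReal_mul (p := A₂) hA₂.le,
    ENNReal.ofReal_mul (p := 2 * C ^ p) (by positivity)]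
  set V := (ENNReal.ofReal (2 * R) ^ d) ^ (p / d)
  set I := ∫⁻ x in box d R, μ.rnDeriv volume x ^ θ
  calc _ ≤ (ENNReal.ofReal A₁ * e ^ (p / d) * (N : ℝ≥0∞) ^ θ +
        (ENNReal.ofReal a * ((I + e ^ θ * V) * (N : ℝ≥0∞) ^ θ) +
        (ENNReal.ofReal (2 ^ d * R ^ d * t ^ (-θ)) * (N : ℝ≥0∞) ^ θ) * ENNReal.ofReal A +
        ENNReal.ofReal (2 * C ^ p) * (ENNReal.ofReal (2 ^ p * t ^ (p / d)) *
          (N : ℝ≥0∞) ^ θ) * e)) +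
        ENNReal.ofReal A₂ * (ENNReal.ofReal (R ^ ((d : ℝ) / 2) * t ^ (-(1 / 2 - p / d))) *
          (N : ℝ≥0∞) ^ θ) := by gcongr
    _ = _ := by ring

theorem lintegral_rnDeriv_rpow_box_ne_top (hp : 0 < p) (hpd : p < d) (μ : Measure (Fin d → ℝ))
    [IsProbabilityMeasure μ] (R : ℝ) :
    ∫⁻ x in box d R, μ.rnDeriv volume x ^ (1 - p / d) ≠ ∞ := by
  have hd0 : (0 : ℝ) < d := hp.trans hpd
  have hpd1 : p / d < 1 := by rwa [div_lt_one hd0]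
  have hpd0 : 0 < p / d := by positivity
  refine ne_top_of_le_ne_top ?_ (lintegral_rpow_le (volume.restrict (box d R))
    (Measure.measurable_rnDeriv μ volume) (by linarith : 0 < 1 - p / d) (by linarith))
  refine ENNReal.mul_ne_top (ENNReal.rpow_ne_top_of_nonneg (by linarith) ?_)
    (ENNReal.rpow_ne_top_of_nonneg (by linarith) ?_)
  · exact ne_top_of_le_ne_top ENNReal.one_ne_top
      ((Measure.setLIntegral_rnDeriv_le _).trans prob_le_one)
  · rw [Measure.restrict_apply_univ, volume_box]
    exact ENNReal.pow_ne_top ENNReal.ofReal_ne_top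

theorem limsup_div_le_of_eventually_le {s : ℕ → ℝ≥0∞} {θ : ℝ} {T : ℝ≥0∞}
    (h : ∀ᶠ N : ℕ in atTop, s N ≤ T * (N : ℝ≥0∞) ^ θ) :
    limsup (fun N : ℕ => s N / (N : ℝ≥0∞) ^ θ) atTop ≤ T := by
  refine limsup_le_of_le (by isBoundedDefault) ?_
  filter_upwards [h] with N hN
  exact ENNReal.div_le_of_le_mul hN

theorem tendsto_ofReal_rpow_zero {θ : ℝ} (hθ : 0 < θ) :
    Tendsto (fun ε : ℝ => ENNReal.ofReal ε ^ θ) (𝓝[>] 0) (𝓝 0) := by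
  have h := ((ENNReal.continuous_rpow_const (y := θ)).comp ENNReal.continuous_ofReal).tendsto 0
  simp only [Function.comp_apply, ENNReal.ofReal_zero, ENNReal.zero_rpow_of_pos hθ] at h
  exact h.mono_left nhdsWithin_le_nhds

theorem tendsto_ofReal_mul_rpow_neg (b : ℝ) {θ : ℝ} (hθ : 0 < θ) :
    Tendsto (fun t : ℝ => ENNReal.ofReal (b * t ^ (-θ))) atTop (𝓝 0) := by
  have := (tendsto_rpow_neg_atTop hθ).const_mul b
  rw [mul_zero] at this
  have h := (ENNReal.continuous_ofReal.tendsto 0).comp this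
  rw [ENNReal.ofReal_zero] at h
  exact h

theorem limsup_thinCost_box_le (hp : 1 ≤ p) (hpd : p < (d : ℝ) / 2) (hC : 0 < C)
    (hnC : ∀ x, nrm x ≤ C * ‖x‖) {l : ℝ}
    (hl : Tendsto (fun N : ℕ => (sampleCost nrm p N (unifCube d)).toReal /
      (N : ℝ) ^ (1 - p / d)) atTop (𝓝 l)) (hl0 : 0 ≤ l) (μ : Measure (Fin d → ℝ))
    [IsProbabilityMeasure μ] {R : ℝ} (hR : 0 < R) :
    limsup (fun N : ℕ => thinCost nrm p N (μ.restrict (box d R)) / (N : ℝ≥0∞) ^ (1 - p / d)) atTop ≤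
      ENNReal.ofReal l * ∫⁻ x in box d R, μ.rnDeriv volume x ^ (1 - p / d) := by
  have hp0 : 0 < p := by linarith
  have hd0 : (0 : ℝ) < d := by linarith
  have hpd1 : p < d := by linarith
  have hpd2 : p / d < 1 / 2 := by rw [div_lt_iff₀ hd0]; linarith
  have hpd0 : 0 < p / d := by positivity
  obtain ⟨A₁, A₂, hA₁, hA₂, hmain⟩ := thinCost_box_eventually_le (nrm := nrm) hp hpd hC hnC
  have hI := lintegral_rnDeriv_rpow_box_ne_top hp0 hpd1 μ R
  set I := ∫⁻ x in box d R, μ.rnDeriv volume x ^ (1 - p / d)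
  set S := limsup (fun N : ℕ => thinCost nrm p N (μ.restrict (box d R)) /
    (N : ℝ≥0∞) ^ (1 - p / d)) atTop
  set V := (ENNReal.ofReal (2 * R) ^ d) ^ (p / d) with hV
  have hVt : V ≠ ∞ := ENNReal.rpow_ne_top_of_nonneg hpd0.le
    (ENNReal.pow_ne_top ENNReal.ofReal_ne_top)
  have step1 : ∀ η : ℝ, 0 < η → S ≤ ENNReal.ofReal (l + η) * I := by
    intro η hη
    obtain ⟨A, hA, hg⟩ := exists_le_of_tendsto hη hl
    -- The limit ε → 0 has to precede t → ∞, since the deficit term is of order t ^ (p / d) * ε.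
    have step2 : ∀ t : ℝ, 0 < t → S ≤ ENNReal.ofReal (l + η) * I +
        ENNReal.ofReal (A * (2 ^ d * R ^ d) * t ^ (-(1 - p / d))) +
        ENNReal.ofReal (A₂ * R ^ ((d : ℝ) / 2) * t ^ (-(1 / 2 - p / d))) := by
      intro t ht
      have h1 : ∀ ε : ℝ, 0 < ε → S ≤ _ := fun ε hε => limsup_div_le_of_eventually_le
        (hmain μ (a := l + η) (by linarith) hA.le (fun n => (hg n).1) hR ht hε)
      have e1 := tendsto_ofReal_rpow_zero (by linarith : 0 < 1 - p / d)
      have e2 := tendsto_ofReal_rpow_zero hpd0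
      have e3 : Tendsto (fun ε : ℝ => ENNReal.ofReal ε) (𝓝[>] 0) (𝓝 0) := by
        simpa using tendsto_ofReal_rpow_zero one_pos
      have h2 := ((((ENNReal.Tendsto.const_mul (a := ENNReal.ofReal (l + η))
        (tendsto_const_nhds (x := I) |>.add (ENNReal.Tendsto.mul_const e1 (Or.inr hVt)))
        (Or.inr ENNReal.ofReal_ne_top)).add_const
        (ENNReal.ofReal (A * (2 ^ d * R ^ d * t ^ (-(1 - p / d)))))).add
        (ENNReal.Tendsto.const_mul (a := ENNReal.ofReal (2 * C ^ p * (2 ^ p * t ^ (p / d)))) e3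
          (Or.inr ENNReal.ofReal_ne_top))).add
        (ENNReal.Tendsto.const_mul (a := ENNReal.ofReal A₁) e2
          (Or.inr ENNReal.ofReal_ne_top))).add_const
        (ENNReal.ofReal (A₂ * (R ^ ((d : ℝ) / 2) * t ^ (-(1 / 2 - p / d)))))
      have h3 := ge_of_tendsto h2 (eventually_mem_nhdsWithin.mono fun ε hε => h1 ε hε)
      simpa [mul_assoc] using h3
    have h4 := ((tendsto_const_nhds (x := ENNReal.ofReal (l + η) * I)).add
      (tendsto_ofReal_mul_rpow_neg (A * (2 ^ d * R ^ d)) (by linarith : 0 < 1 - p / d))).add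
      (tendsto_ofReal_mul_rpow_neg (A₂ * R ^ ((d : ℝ) / 2)) (by linarith : 0 < 1 / 2 - p / d))
    simpa using ge_of_tendsto h4 ((eventually_gt_atTop 0).mono fun t ht => step2 t ht)
  have h5 : Tendsto (fun η : ℝ => ENNReal.ofReal (l + η) * I) (𝓝[>] 0)
      (𝓝 (ENNReal.ofReal l * I)) := by
    refine ENNReal.Tendsto.mul_const ?_ (Or.inr hI)
    have : Tendsto (fun η : ℝ => ENNReal.ofReal (l + η)) (𝓝 0) (𝓝 (ENNReal.ofReal (l + 0))) :=
      (ENNReal.continuous_ofReal.comp (by fun_prop : Continuous fun η : ℝ => l + η)).tendsto 0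
    rw [add_zero] at this
    exact this.mono_left nhdsWithin_le_nhds
  exact ge_of_tendsto h5 (eventually_mem_nhdsWithin.mono fun η hη => step1 η hη)

/-- The box of radius 2 ^ K contributes the integral of f ^ θ over it, the complement at most B * ρ
^ K, and the split itself only √N; then K → ∞. -/
theorem limsup_sampleCost_le (hp : 1 ≤ p) (hpd : p < (d : ℝ) / 2) (hC : 0 < C)
    (hnC : ∀ x, nrm x ≤ C * ‖x‖) {l : ℝ}
    (hl : Tendsto (fun N : ℕ => (sampleCost nrm p N (unifCube d)).toReal /
      (N : ℝ) ^ (1 - p / d)) atTop (𝓝 l)) (hl0 : 0 ≤ l) (μ : Measure (Fin d → ℝ))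
    [IsProbabilityMeasure μ] {q : ℝ} (hq : (d : ℝ) * p / ((d : ℝ) - p) < q)
    (hμ : ∫⁻ x, ENNReal.ofReal (‖x‖ ^ q) ∂μ ≠ ∞) (hμp : ∫⁻ x, gcost nrm p x 0 ∂μ ≠ ∞) :
    limsup (fun N : ℕ => sampleCost nrm p N μ / (N : ℝ≥0∞) ^ (1 - p / d)) atTop ≤
      ENNReal.ofReal l * ∫⁻ x, μ.rnDeriv volume x ^ (1 - p / d) := by
  have hp0 : 0 < p := by linarith
  have hd0 : (0 : ℝ) < d := by linarith
  have hpd2 : p / d < 1 / 2 := by rw [div_lt_iff₀ hd0]; linarith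
  have hpd0 : 0 < p / d := by positivity
  set θ := 1 - p / d with hθ
  obtain ⟨B, hB, ρ, hρ, htail⟩ := exists_thinCost_compl_box_le (nrm := nrm) hp hpd hC hnC μ hq hμ hμp
  have hK : ∀ K : ℕ, limsup (fun N : ℕ => sampleCost nrm p N μ / (N : ℝ≥0∞) ^ θ) atTop ≤
      ENNReal.ofReal l * (∫⁻ x, μ.rnDeriv volume x ^ θ) + B * ρ ^ K := by
    intro K
    obtain ⟨B', hB', hsplit⟩ := exists_sampleCost_le_split (nrm := nrm) hp μ hμp
      (measurableSet_box (d := d) (2 ^ K))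
    have hrest : Tendsto (fun N : ℕ => B' * (N : ℝ≥0∞) ^ (-(1 / 2 - p / d))) atTop (𝓝 0) := by
      have h1 := ENNReal.tendsto_nat_nhds_top
      have h2 := ((ENNReal.continuous_rpow_const (y := -(1 / 2 - p / d))).tendsto ∞).comp h1
      rw [ENNReal.top_rpow_of_neg (by linarith)] at h2
      simpa using ENNReal.Tendsto.const_mul h2 (Or.inr hB')
    have hle : ∀ᶠ N : ℕ in atTop, sampleCost nrm p N μ / (N : ℝ≥0∞) ^ θ ≤
        thinCost nrm p N (μ.restrict (box d (2 ^ K))) / (N : ℝ≥0∞) ^ θ +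
          (B * ρ ^ K + B' * (N : ℝ≥0∞) ^ (-(1 / 2 - p / d))) := by
      filter_upwards [eventually_ne_atTop 0] with N hN
      have hN0 : (N : ℝ≥0∞) ≠ 0 := by exact_mod_cast hN
      have hNt : (N : ℝ≥0∞) ≠ ∞ := ENNReal.natCast_ne_top N
      have hNθ0 : (N : ℝ≥0∞) ^ θ ≠ 0 := (ENNReal.rpow_pos (pos_iff_ne_zero.2 hN0) hNt).ne'
      have hNθt : (N : ℝ≥0∞) ^ θ ≠ ∞ := ENNReal.rpow_ne_top_of_nonneg (by linarith) hNt
      have e1 : (N : ℝ≥0∞) ^ (-(1 / 2 - p / d)) * (N : ℝ≥0∞) ^ θ = (N : ℝ≥0∞) ^ (1 / 2 : ℝ) := by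
        rw [← ENNReal.rpow_add _ _ hN0 hNt]; congr 1; rw [hθ]; ring
      rw [ENNReal.div_le_iff hNθ0 hNθt, add_mul, add_mul, ENNReal.div_mul_cancel hNθ0 hNθt,
        mul_assoc B', e1, ← add_assoc]
      exact (hsplit N).trans (add_le_add (add_le_add le_rfl (htail K N)) le_rfl)
    refine (limsup_le_limsup hle).trans ?_
    have hsum := ENNReal.limsup_add_of_right_tendsto_zero hrest
      (fun N : ℕ => thinCost nrm p N (μ.restrict (box d (2 ^ K))) / (N : ℝ≥0∞) ^ θ + B * ρ ^ K)
    rw [limsup_add_const _ _ _ (by isBoundedDefault) (by isBoundedDefault)] at hsum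
    simp only [← add_assoc]
    refine hsum.le.trans ?_
    exact add_le_add ((limsup_thinCost_box_le hp hpd hC hnC hl hl0 μ (by positivity)).trans
      (mul_le_mul_right (setLIntegral_le_lintegral _ _) _)) le_rfl
  have h6 : Tendsto (fun K : ℕ => ENNReal.ofReal l * (∫⁻ x, μ.rnDeriv volume x ^ θ) + B * ρ ^ K)
      atTop (𝓝 (ENNReal.ofReal l * (∫⁻ x, μ.rnDeriv volume x ^ θ) + B * 0)) :=
    tendsto_const_nhds.add (ENNReal.Tendsto.const_mul
      (ENNReal.tendsto_pow_atTop_nhds_zero_of_lt_one hρ) (Or.inr hB))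
  simpa using ge_of_tendsto' h6 hK

end UpperBound

/-! ### The lower bound for general measures on a single cell. -/

section LowerBound

variable {d : ℕ} {nrm : Seminorm ℝ (Fin d → ℝ)} {p C : ℝ}

/-- The leaky cost with as many points as the cell expects is compared with the actual problem on
the cell. In the error, 1 and c come from rounding to an integer, 2 * N * Δ from surplus and
deficit, and the square root from the fluctuation. -/
theorem mul_rpow_le_of_le_leakyCost (hd : 0 < d) (hp : 1 ≤ p) (hC : 0 < C)
    (hnC : ∀ x, nrm x ≤ C * ‖x‖) {θ : ℝ} (hθ : 0 < θ) (hθ1 : θ ≤ 1) {c A : ℝ≥0∞}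
    (hg : ∀ n : ℕ, c * (n : ℝ≥0∞) ^ θ ≤ leakyCost nrm p n + A)
    (μ : Measure (Fin d → ℝ)) [IsProbabilityMeasure μ] {r : ℝ} (hr : 0 < r) (k : Fin d → ℤ)
    {N : ℕ} (hN : N ≠ 0) :
    ENNReal.ofReal (r ^ p) * (c * (N * μ (cell r k)) ^ θ) ≤
      (∫⁻ x, pcost nrm p (((N : ℝ≥0∞) • μ).restrict (openCell r fun i => r * k i))
        (exitCost nrm p (openCell r fun i => r * k i)) x ∂(Measure.pi fun _ : Fin N => μ)) +
      (ENNReal.ofReal ((C * r) ^ p) * (1 + 2 * N * cellDeficit μ r k Set.univ +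
        (N * μ (cell r k)) ^ (1 / 2 : ℝ)) + ENNReal.ofReal (r ^ p) * (A + c)) := by
  set m := μ (cell r k) with hm
  have hm1 : m ≤ 1 := prob_le_one
  have hmt : m ≠ ∞ := measure_ne_top _ _
  set Q := openCell r (fun i => r * k i) with hQ
  have hQm : MeasurableSet Q := measurableSet_openCell _ _
  set Δ := cellDeficit μ r k Set.univ with hΔ
  have hN0 : (N : ℝ≥0∞) ≠ 0 := by exact_mod_cast hN
  have hNt : (N : ℝ≥0∞) ≠ ∞ := ENNReal.natCast_ne_top N
  by_cases h0 : m = 0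
  · rw [h0, mul_zero, ENNReal.zero_rpow_of_pos hθ, mul_zero, mul_zero]; exact zero_le
  -- `leakyCost` needs an integer number of points; rounding down loses at most one unit of mass.
  set a := ⌊((N : ℝ≥0∞) * m).toReal⌋₊ with ha
  have hNm : (N : ℝ≥0∞) * m ≠ ∞ := ENNReal.mul_ne_top hNt hmt
  have ha1 : (a : ℝ≥0∞) ≤ N * m := by
    rw [← ENNReal.ofReal_toReal hNm, ← ENNReal.ofReal_natCast]
    exact ENNReal.ofReal_le_ofReal (Nat.floor_le ENNReal.toReal_nonneg)
  have ha2 : (N : ℝ≥0∞) * m ≤ a + 1 := by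
    rw [← ENNReal.ofReal_toReal hNm, ← ENNReal.ofReal_natCast a, ← ENNReal.ofReal_one,
      ← ENNReal.ofReal_add (by positivity) zero_le_one]
    exact ENNReal.ofReal_le_ofReal (Nat.lt_floor_add_one _).le
  have haN : a ≤ N := by
    have : (a : ℝ≥0∞) ≤ N := ha1.trans (mul_le_of_le_one_right' hm1)
    exact_mod_cast this
  -- The factor that shrinks the uniform measure of mass m to mass a / N. Common part and deficit
  -- are scaled by t, and the lost share of the common part is counted as surplus.
  set t : ℝ≥0∞ := (a / N) / m with ht
  have htm : t * m = a / N := ENNReal.div_mul_cancel h0 hmt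
  have hNtm : (N : ℝ≥0∞) * (t * m) = a := by rw [htm]; exact ENNReal.mul_div_cancel hN0 hNt
  have ht1 : t ≤ 1 := by
    rw [ht, ENNReal.div_le_iff h0 hmt, one_mul]
    exact ENNReal.div_le_of_le_mul (by rwa [mul_comm])
  have htadd : t + (1 - t) = 1 := add_tsub_cancel_of_le ht1
  have hcommon : cellCommon μ r k Set.univ ≤ m := by
    have h1 := congrArg (fun ν => ν Set.univ) (restrict_cell_eq μ r k)
    simp only [Measure.add_apply, Measure.restrict_apply_univ] at h1
    rw [hm, h1]; exact le_self_add
  have hres : ∀ ν : Measure (Fin d → ℝ), ν.restrict Q Set.univ ≤ ν Set.univ := fun ν =>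
    Measure.restrict_le_self _
  have key := leakyCost_le_cell (nrm := nrm) hd hp hC hnC hr (fun i => r * k i) (μ := μ)
    (ω := t • (cellCommon μ r k).restrict Q)
    (α := (1 - t) • (cellCommon μ r k).restrict Q + (cellSurplus μ r k).restrict Q)
    (β := t • (cellDeficit μ r k).restrict Q) hN haN
    (by
      rw [← add_assoc, ← add_smul, htadd, one_smul, ← Measure.restrict_add, ← restrict_cell_eq,
        Measure.restrict_restrict hQm, Set.inter_eq_left.2 (openCell_subset_cell hr k)])
    (by
      rw [← smul_add, ← Measure.restrict_add, ← smul_unifCell_eq μ k hr, Measure.restrict_smul,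
        Measure.restrict_eq_self_of_ae_mem (ae_unifCell_mem hr _), smul_smul, htm])
  have hα : (N : ℝ≥0∞) * ((1 - t) * m) ≤ 1 := by
    rw [ENNReal.sub_mul (fun _ _ => hmt), one_mul, ENNReal.mul_sub (fun _ _ => hNt), hNtm]
    exact tsub_le_iff_left.2 ha2
  have hmass : (N : ℝ≥0∞) * (((1 - t) • (cellCommon μ r k).restrict Q +
      (cellSurplus μ r k).restrict Q) Set.univ + (t • (cellDeficit μ r k).restrict Q) Set.univ) ≤
      1 + 2 * N * Δ := by
    simp only [Measure.add_apply, Measure.smul_apply, smul_eq_mul]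
    calc _ ≤ (N : ℝ≥0∞) * ((1 - t) * m + Δ + 1 * Δ) := by
          refine mul_le_mul_right (add_le_add (add_le_add (mul_le_mul_right
            ((hres _).trans hcommon) _) ?_) (mul_le_mul' ht1 (hres _))) _
          rw [hΔ, ← cellSurplus_univ μ k hr]
          exact hres _
      _ = (N : ℝ≥0∞) * ((1 - t) * m) + 2 * N * Δ := by ring
      _ ≤ _ := add_le_add hα le_rfl
  have hsqrt : ENNReal.ofReal √a ≤ (N * m) ^ (1 / 2 : ℝ) := by
    rw [Real.sqrt_eq_rpow, ofReal_natCast_rpow a (by norm_num)]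
    exact ENNReal.rpow_le_rpow ha1 (by norm_num)
  have hpow : c * (N * m) ^ θ ≤ leakyCost nrm p a + (A + c) := by
    calc c * (N * m) ^ θ ≤ c * ((a : ℝ≥0∞) ^ θ + 1 ^ θ) := by
          refine mul_le_mul_right ((ENNReal.rpow_le_rpow ha2 hθ.le).trans
            (ENNReal.rpow_add_le_add_rpow _ _ hθ.le hθ1)) _
      _ = c * (a : ℝ≥0∞) ^ θ + c := by rw [ENNReal.one_rpow, mul_add, mul_one]
      _ ≤ _ := by rw [← add_assoc]; exact add_le_add (hg a) le_rfl
  refine (mul_le_mul_right hpow _).trans ?_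
  rw [mul_add, ← add_assoc]
  refine add_le_add (key.trans (add_le_add le_rfl (mul_le_mul_right ?_ _))) le_rfl
  exact add_le_add hmass hsqrt

theorem sum_lintegral_pcost_openCell_le (hp : 1 ≤ p) (μ : Measure (Fin d → ℝ)) {r : ℝ}
    (hr : 0 < r) (G : Finset (Fin d → ℤ)) (N : ℕ) :
    ∑ k ∈ G, ∫⁻ x, pcost nrm p (((N : ℝ≥0∞) • μ).restrict (openCell r fun i => r * k i))
      (exitCost nrm p (openCell r fun i => r * k i)) x ∂(Measure.pi fun _ : Fin N => μ) ≤
      sampleCost nrm p N μ := by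
  have hp0 : 0 < p := by linarith
  rw [← lintegral_finsetSum _ fun k _ =>
    measurable_pcost hp _ (upperSemicontinuous_exitCost hp0.le _)]
  refine lintegral_mono fun x => ?_
  exact sum_pcost_restrict_le hp0 G _ (fun k => openCell r fun i => r * k i)
    (fun k _ => measurableSet_openCell _ _) (pairwiseDisjoint_openCell hr _)
    (fun k hk y => le_top) x

theorem sum_sqrt_cell_le (μ : Measure (Fin d → ℝ)) [IsProbabilityMeasure μ] {r : ℝ} {M : ℕ}
    {G : Finset (Fin d → ℤ)} (hG : G ⊆ gridIdx d M) (N : ℕ) :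
    ∑ k ∈ G, ((N : ℝ≥0∞) * μ (cell r k)) ^ (1 / 2 : ℝ) ≤
      ENNReal.ofReal ((2 * M : ℝ) ^ ((d : ℝ) / 2) * √N) := by
  have hc : (G.card : ℝ≥0∞) ≤ (((2 * M) ^ d : ℕ) : ℝ≥0∞) := by
    exact_mod_cast (Finset.card_le_card hG).trans_eq (card_gridIdx M)
  have hsum : ∑ k ∈ G, (N : ℝ≥0∞) * μ (cell r k) ≤ N := by
    rw [← Finset.mul_sum, ← measure_biUnion_finset (pairwiseDisjoint_cell r _)
      fun k _ => measurableSet_cell r k]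
    exact mul_le_of_le_one_right' prob_le_one
  refine (sum_rpow_le G _ (by norm_num : (0 : ℝ) < 1 / 2) (by norm_num)).trans ?_
  rw [ENNReal.ofReal_mul (by positivity), Real.sqrt_eq_rpow,
    ofReal_natCast_rpow N (by norm_num)]
  refine mul_le_mul' ((ENNReal.rpow_le_rpow hc (by norm_num)).trans (le_of_eq ?_))
    (ENNReal.rpow_le_rpow hsum (by norm_num))
  rw [← ofReal_natCast_rpow _ (by norm_num)]
  push_cast
  rw [← Real.rpow_natCast, ← Real.rpow_mul (by positivity)]
  congr 2; ring

end LowerBound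

/-! ### Summation over cells and the asymptotic lower bound. -/

section LowerBound

variable {d : ℕ} {nrm : Seminorm ℝ (Fin d → ℝ)} {p C : ℝ}

/-- The good cells are summed by superadditivity and the others are simply omitted; the omission is
paid for in the comparison with the integral over the box. The number of cells, about N / t, makes
the additive errors small for large t. -/
theorem lintegral_box_eventually_le (hp : 1 ≤ p) (hpd : p < (d : ℝ) / 2) (hC : 0 < C)
    (hnC : ∀ x, nrm x ≤ C * ‖x‖) (μ : Measure (Fin d → ℝ)) [IsProbabilityMeasure μ]
    {c A R t ε : ℝ} (hc : 0 ≤ c) (hA : 0 ≤ A)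
    (hg : ∀ n : ℕ, c * (n : ℝ) ^ (1 - p / d) ≤ (leakyCost nrm p n).toReal + A)
    (hR : 0 < R) (ht : 0 < t) (hε : 0 < ε) :
    ∀ᶠ N : ℕ in atTop, ENNReal.ofReal c *
        (∫⁻ x in box d R, μ.rnDeriv volume x ^ (1 - p / d)) * (N : ℝ≥0∞) ^ (1 - p / d) ≤
      sampleCost nrm p N μ +
        (ENNReal.ofReal c * (ENNReal.ofReal ε ^ (1 - p / d) *
            (ENNReal.ofReal (2 * R) ^ d) ^ (p / d) + ENNReal.ofReal ε ^ (p / d)) +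
          ENNReal.ofReal ((C ^ p + (A + c)) * (2 ^ d * R ^ d * t ^ (-(1 - p / d)))) +
          ENNReal.ofReal (2 * C ^ p * (2 ^ p * t ^ (p / d))) * ENNReal.ofReal ε +
          ENNReal.ofReal (C ^ p * 2 ^ ((d : ℝ) / 2) *
            (R ^ ((d : ℝ) / 2) * t ^ (-(1 / 2 - p / d))))) *
        (N : ℝ≥0∞) ^ (1 - p / d) := by
  classical
  have hp0 : 0 < p := by linarith
  have hd0 : (0 : ℝ) < d := by linarith
  have hd : 0 < d := by exact_mod_cast hd0
  have hpd1 : p < d := by linarith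
  have hpd2 : p / d < 1 := by rwa [div_lt_one hd0]
  have hpd0 : 0 < p / d := by positivity
  set θ := 1 - p / d with hθ
  have hθ0 : 0 < θ := by linarith
  have hθ1 : θ < 1 := by linarith
  have hgE : ∀ n : ℕ, ENNReal.ofReal c * (n : ℝ≥0∞) ^ θ ≤ leakyCost nrm p n + ENNReal.ofReal A :=
    fun n => by
      rw [← ENNReal.ofReal_toReal (leakyCost_ne_top hp hC hnC n),
        ← ofReal_natCast_rpow n hθ0.le, ← ENNReal.ofReal_mul hc,
        ← ENNReal.ofReal_add ENNReal.toReal_nonneg hA]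
      exact ENNReal.ofReal_le_ofReal (hg n)
  obtain ⟨δ, hδ, hgood⟩ := exists_good_cells μ hR hε
  filter_upwards [exists_mesh hp hpd hR ht hδ, eventually_ne_atTop 0] with N hN hN0
  obtain ⟨L, hL, hb1, hb2, hb3⟩ := hN
  obtain ⟨G, hGsub, hGbad, hGdef⟩ := hgood (2 ^ L) (by positivity) hL
  have hMpos : 0 < 2 ^ L := by positivity
  have hr : 0 < R / (2 ^ L : ℕ) := by positivity
  change ∑ k ∈ G, ∫⁻ x in cell (R / (2 ^ L : ℕ)) k,
    (cellMean μ (R / (2 ^ L : ℕ)) k - μ.rnDeriv volume x) ≤ _ at hGdef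
  simp only [← cellDeficit_univ] at hGdef
  have hpow := lintegral_rpow_box_le μ hp0 hpd1 hR hMpos hGsub hGdef hGbad
  have hML : ((2 ^ L : ℕ) : ℝ) ^ ((d : ℝ) / 2) = (2 ^ ((d : ℝ) / 2 - p)) ^ L *
      ((2 ^ L : ℕ) : ℝ) ^ p := by
    push_cast
    rw [← Real.rpow_natCast 2 L, ← Real.rpow_natCast _ L, ← Real.rpow_mul (by positivity),
      ← Real.rpow_mul (by positivity), ← Real.rpow_mul (by positivity),
      ← Real.rpow_add (by positivity)]
    congr 1; ring
  set M : ℕ := 2 ^ L with hM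
  have hM0 : (0 : ℝ) < M := by exact_mod_cast hMpos
  set r := R / (M : ℝ) with hrdef
  set e := ENNReal.ofReal ε with he
  set D := ENNReal.ofReal ((C * r) ^ p) with hD
  have hDeq : D = ENNReal.ofReal (C ^ p) * ENNReal.ofReal (r ^ p) := by
    rw [hD, Real.mul_rpow hC.le hr.le, ENNReal.ofReal_mul (by positivity)]
  have hcard : (G.card : ℝ≥0∞) ≤ ENNReal.ofReal ((2 * (M : ℝ)) ^ d) := by
    have : ENNReal.ofReal ((2 * (M : ℝ)) ^ d) = (((2 * M) ^ d : ℕ) : ℝ≥0∞) := by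
      rw [← ENNReal.ofReal_natCast]; push_cast; rfl
    rw [this]
    exact_mod_cast (Finset.card_le_card hGsub).trans_eq (card_gridIdx M)
  have hsqrt := sum_sqrt_cell_le μ (r := r) hGsub N
  have hNE := ofReal_natCast_rpow N hθ0.le
  set n := (N : ℝ≥0∞) ^ θ with hn
  have k1 : ENNReal.ofReal (r ^ p) * N ≤ ENNReal.ofReal (2 ^ p * t ^ (p / d)) * n := by
    rw [← hNE, ← ENNReal.ofReal_mul (by positivity), ← ENNReal.ofReal_natCast N,
      ← ENNReal.ofReal_mul (by positivity)]
    exact ENNReal.ofReal_le_ofReal hb1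
  have k2 : ENNReal.ofReal (r ^ p) * G.card ≤
      ENNReal.ofReal (2 ^ d * R ^ d * t ^ (-θ)) * n := by
    refine (mul_le_mul_right hcard _).trans ?_
    rw [← hNE, ← ENNReal.ofReal_mul (by positivity), ← ENNReal.ofReal_mul (by positivity)]
    exact ENNReal.ofReal_le_ofReal hb2
  have k3 : ENNReal.ofReal (r ^ p) * ENNReal.ofReal ((2 * M : ℝ) ^ ((d : ℝ) / 2) * √N) ≤
      ENNReal.ofReal (2 ^ ((d : ℝ) / 2)) *
        ENNReal.ofReal (R ^ ((d : ℝ) / 2) * t ^ (-(1 / 2 - p / d))) * n := by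
    rw [← hNE, ← ENNReal.ofReal_mul (by positivity), ← ENNReal.ofReal_mul (by positivity),
      ← ENNReal.ofReal_mul (by positivity)]
    refine ENNReal.ofReal_le_ofReal (le_trans (le_of_eq ?_) (le_of_le_of_eq
      (mul_le_mul_of_nonneg_left hb3 (by positivity : (0 : ℝ) ≤ 2 ^ ((d : ℝ) / 2))) (by ring)))
    rw [Real.mul_rpow (by positivity) hM0.le, hML, hrdef, Real.div_rpow hR.le hM0.le]
    field_simp
  have hsum : ENNReal.ofReal c * (∑ k ∈ G, ENNReal.ofReal (r ^ p) * μ (cell r k) ^ θ) * n ≤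
      sampleCost nrm p N μ + (D * (G.card + 2 * N * e +
        ENNReal.ofReal ((2 * M : ℝ) ^ ((d : ℝ) / 2) * √N)) +
        G.card * (ENNReal.ofReal (r ^ p) * (ENNReal.ofReal A + ENNReal.ofReal c))) := by
    calc _ = ∑ k ∈ G, ENNReal.ofReal (r ^ p) * (ENNReal.ofReal c * (N * μ (cell r k)) ^ θ) := by
          rw [Finset.mul_sum, Finset.sum_mul]
          refine Finset.sum_congr rfl fun k _ => ?_
          rw [ENNReal.mul_rpow_of_nonneg _ _ hθ0.le]; ring
      _ ≤ _ := Finset.sum_le_sum fun k _ =>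
          mul_rpow_le_of_le_leakyCost hd hp hC hnC hθ0 hθ1.le hgE μ hr k hN0
      _ ≤ _ := by
          rw [Finset.sum_add_distrib]
          refine add_le_add (sum_lintegral_pcost_openCell_le hp μ hr G N) ?_
          rw [Finset.sum_add_distrib, Finset.sum_const, nsmul_eq_mul, ← Finset.mul_sum,
            Finset.sum_add_distrib, Finset.sum_add_distrib, Finset.sum_const, nsmul_eq_mul,
            mul_one, ← Finset.mul_sum]
          exact add_le_add (mul_le_mul_right (add_le_add (add_le_add le_rfl
            (mul_le_mul_right hGdef _)) hsqrt) _) le_rfl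
  have hCp : (0 : ℝ) ≤ C ^ p := by positivity
  rw [ENNReal.ofReal_mul (p := C ^ p + (A + c)) (by positivity), ENNReal.ofReal_add hCp
    (by positivity), ENNReal.ofReal_add hA hc, ENNReal.ofReal_mul (p := 2 * C ^ p) (by positivity),
    ENNReal.ofReal_mul (p := C ^ p * 2 ^ ((d : ℝ) / 2)) (by positivity),
    ENNReal.ofReal_mul (p := C ^ p) hCp, ENNReal.ofReal_mul (p := 2) (q := C ^ p) zero_le_two,
    ENNReal.ofReal_ofNat]
  set V := (ENNReal.ofReal (2 * R) ^ d) ^ (p / d)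
  set I := ∫⁻ x in box d R, μ.rnDeriv volume x ^ θ
  set S := ∑ k ∈ G, ENNReal.ofReal (r ^ p) * μ (cell r k) ^ θ
  set rp := ENNReal.ofReal (r ^ p)
  set cp := ENNReal.ofReal (C ^ p)
  set a' := ENNReal.ofReal A
  set c' := ENNReal.ofReal c
  calc c' * I * n ≤ c' * (S + (e ^ θ * V + e ^ (p / d))) * n := by gcongr
    _ = c' * S * n + c' * (e ^ θ * V + e ^ (p / d)) * n := by ring
    _ ≤ _ := add_le_add hsum le_rfl
    _ = sampleCost nrm p N μ + ((cp + (a' + c')) * (rp * G.card) + 2 * cp * (rp * N) * e +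
          cp * (rp * ENNReal.ofReal ((2 * M : ℝ) ^ ((d : ℝ) / 2) * √N)) +
          c' * (e ^ θ * V + e ^ (p / d)) * n) := by rw [hDeq]; ring
    _ ≤ sampleCost nrm p N μ + ((cp + (a' + c')) *
          (ENNReal.ofReal (2 ^ d * R ^ d * t ^ (-θ)) * n) +
          2 * cp * (ENNReal.ofReal (2 ^ p * t ^ (p / d)) * n) * e +
          cp * (ENNReal.ofReal (2 ^ ((d : ℝ) / 2)) *
            ENNReal.ofReal (R ^ ((d : ℝ) / 2) * t ^ (-(1 / 2 - p / d))) * n) +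
          c' * (e ^ θ * V + e ^ (p / d)) * n) := by
          refine add_le_add le_rfl (add_le_add (add_le_add (add_le_add
            (mul_le_mul_right k2 _) (mul_le_mul_left (mul_le_mul_right k1 _) _))
            (mul_le_mul_right k3 _)) le_rfl)
    _ = _ := by ring

theorem le_liminf_div_add {s : ℕ → ℝ≥0∞} {θ : ℝ} (hθ : 0 ≤ θ) {T E : ℝ≥0∞}
    (h : ∀ᶠ N : ℕ in atTop, T * (N : ℝ≥0∞) ^ θ ≤ s N + E * (N : ℝ≥0∞) ^ θ) :
    T ≤ liminf (fun N : ℕ => s N / (N : ℝ≥0∞) ^ θ) atTop + E := by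
  rw [← tsub_le_iff_right]
  refine le_liminf_of_le (by isBoundedDefault) ?_
  filter_upwards [h, eventually_ne_atTop 0] with N hN hN0
  have hNθ0 : (N : ℝ≥0∞) ^ θ ≠ 0 :=
    (ENNReal.rpow_pos (pos_iff_ne_zero.2 (by exact_mod_cast hN0)) (ENNReal.natCast_ne_top N)).ne'
  have hNθt : (N : ℝ≥0∞) ^ θ ≠ ∞ := ENNReal.rpow_ne_top_of_nonneg hθ (ENNReal.natCast_ne_top N)
  rw [tsub_le_iff_right, ← ENNReal.mul_le_mul_iff_left hNθ0 hNθt, add_mul,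
    ENNReal.div_mul_cancel hNθ0 hNθt]
  exact hN

theorem le_liminf_sampleCost_box (hp : 1 ≤ p) (hpd : p < (d : ℝ) / 2) (hC : 0 < C)
    (hnC : ∀ x, nrm x ≤ C * ‖x‖) {l : ℝ}
    (hl : Tendsto (fun N : ℕ => (leakyCost nrm p N).toReal /
      (N : ℝ) ^ (1 - p / d)) atTop (𝓝 l)) (hl0 : 0 < l) (μ : Measure (Fin d → ℝ))
    [IsProbabilityMeasure μ] {R : ℝ} (hR : 0 < R) :
    ENNReal.ofReal l * (∫⁻ x in box d R, μ.rnDeriv volume x ^ (1 - p / d)) ≤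
      liminf (fun N : ℕ => sampleCost nrm p N μ / (N : ℝ≥0∞) ^ (1 - p / d)) atTop := by
  have hp0 : 0 < p := by linarith
  have hd0 : (0 : ℝ) < d := by linarith
  have hpd1 : p < d := by linarith
  have hpd2 : p / d < 1 / 2 := by rw [div_lt_iff₀ hd0]; linarith
  have hpd0 : 0 < p / d := by positivity
  have hI := lintegral_rnDeriv_rpow_box_ne_top hp0 hpd1 μ R
  set I := ∫⁻ x in box d R, μ.rnDeriv volume x ^ (1 - p / d)
  set S := liminf (fun N : ℕ => sampleCost nrm p N μ / (N : ℝ≥0∞) ^ (1 - p / d)) atTop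
  set V := (ENNReal.ofReal (2 * R) ^ d) ^ (p / d) with hV
  have hVt : V ≠ ∞ := ENNReal.rpow_ne_top_of_nonneg hpd0.le
    (ENNReal.pow_ne_top ENNReal.ofReal_ne_top)
  -- The restriction η < l keeps the coefficient l - η nonnegative; the positivity of the leaky
  -- limit leaves room for such η.
  have step1 : ∀ η : ℝ, 0 < η → η < l → ENNReal.ofReal (l - η) * I ≤ S := by
    intro η hη hηl
    obtain ⟨A, hA, hg⟩ := exists_le_of_tendsto hη hl
    have step2 : ∀ t : ℝ, 0 < t → ENNReal.ofReal (l - η) * I ≤ S +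
        (ENNReal.ofReal ((C ^ p + (A + (l - η))) * (2 ^ d * R ^ d) * t ^ (-(1 - p / d))) +
        ENNReal.ofReal (C ^ p * 2 ^ ((d : ℝ) / 2) * R ^ ((d : ℝ) / 2) *
          t ^ (-(1 / 2 - p / d)))) := by
      intro t ht
      have h1 : ∀ ε : ℝ, 0 < ε → ENNReal.ofReal (l - η) * I ≤ S + _ := fun ε hε =>
        le_liminf_div_add (by linarith : 0 ≤ 1 - p / d)
          (lintegral_box_eventually_le hp hpd hC hnC μ (c := l - η) (by linarith) hA.le
            (fun n => (hg n).2) hR ht hε)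
      have e1 := tendsto_ofReal_rpow_zero (by linarith : 0 < 1 - p / d)
      have e2 := tendsto_ofReal_rpow_zero hpd0
      have e3 : Tendsto (fun ε : ℝ => ENNReal.ofReal ε) (𝓝[>] 0) (𝓝 0) := by
        simpa using tendsto_ofReal_rpow_zero one_pos
      have h2 := (tendsto_const_nhds (x := S)).add
        ((((ENNReal.Tendsto.const_mul (a := ENNReal.ofReal (l - η))
        ((ENNReal.Tendsto.mul_const e1 (Or.inr hVt)).add e2)
        (Or.inr ENNReal.ofReal_ne_top)).add_const
        (ENNReal.ofReal ((C ^ p + (A + (l - η))) * (2 ^ d * R ^ d * t ^ (-(1 - p / d)))))).add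
        (ENNReal.Tendsto.const_mul (a := ENNReal.ofReal (2 * C ^ p * (2 ^ p * t ^ (p / d)))) e3
          (Or.inr ENNReal.ofReal_ne_top))).add_const
        (ENNReal.ofReal (C ^ p * 2 ^ ((d : ℝ) / 2) *
            (R ^ ((d : ℝ) / 2) * t ^ (-(1 / 2 - p / d))))))
      have h3 := ge_of_tendsto h2 (eventually_mem_nhdsWithin.mono fun ε hε => h1 ε hε)
      simpa [mul_assoc] using h3
    have h4 := (tendsto_const_nhds (x := S)).add
      ((tendsto_ofReal_mul_rpow_neg ((C ^ p + (A + (l - η))) * (2 ^ d * R ^ d))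
        (by linarith : 0 < 1 - p / d)).add
      (tendsto_ofReal_mul_rpow_neg (C ^ p * 2 ^ ((d : ℝ) / 2) * R ^ ((d : ℝ) / 2))
        (by linarith : 0 < 1 / 2 - p / d)))
    simpa using ge_of_tendsto h4 ((eventually_gt_atTop 0).mono fun t ht => step2 t ht)
  have h5 : Tendsto (fun η : ℝ => ENNReal.ofReal (l - η) * I) (𝓝[>] 0)
      (𝓝 (ENNReal.ofReal l * I)) := by
    refine ENNReal.Tendsto.mul_const ?_ (Or.inr hI)
    have : Tendsto (fun η : ℝ => ENNReal.ofReal (l - η)) (𝓝 0) (𝓝 (ENNReal.ofReal (l - 0))) :=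
      (ENNReal.continuous_ofReal.comp (by fun_prop : Continuous fun η : ℝ => l - η)).tendsto 0
    rw [sub_zero] at this
    exact this.mono_left nhdsWithin_le_nhds
  refine le_of_tendsto h5 ?_
  filter_upwards [Ioo_mem_nhdsGT hl0] with η hη using step1 η hη.1 hη.2

theorem iUnion_box : ⋃ K : ℕ, box d ((2 : ℝ) ^ K) = Set.univ := by
  refine Set.eq_univ_of_forall fun x => ?_
  obtain ⟨K, hK⟩ := pow_unbounded_of_one_lt ‖x‖ (one_lt_two (α := ℝ))
  refine Set.mem_iUnion.2 ⟨K, fun i _ => ?_⟩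
  have := (abs_lt.1 ((norm_le_pi_norm x i).trans_lt hK))
  exact ⟨this.1.le, this.2⟩

/-- Costs outside a box can be discarded in a lower bound, so monotone convergence over boxes
suffices and no tail estimate is needed. -/
theorem le_liminf_sampleCost (hp : 1 ≤ p) (hpd : p < (d : ℝ) / 2) (hC : 0 < C)
    (hnC : ∀ x, nrm x ≤ C * ‖x‖) {l : ℝ}
    (hl : Tendsto (fun N : ℕ => (leakyCost nrm p N).toReal /
      (N : ℝ) ^ (1 - p / d)) atTop (𝓝 l)) (hl0 : 0 < l) (μ : Measure (Fin d → ℝ))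
    [IsProbabilityMeasure μ] :
    ENNReal.ofReal l * (∫⁻ x, μ.rnDeriv volume x ^ (1 - p / d)) ≤
      liminf (fun N : ℕ => sampleCost nrm p N μ / (N : ℝ≥0∞) ^ (1 - p / d)) atTop := by
  have hmono : Monotone fun K : ℕ => box d ((2 : ℝ) ^ K) := fun K L hKL =>
    box_mono (pow_le_pow_right₀ one_le_two hKL)
  have h : ∫⁻ x, μ.rnDeriv volume x ^ (1 - p / d) =
      ⨆ K : ℕ, ∫⁻ x in box d ((2 : ℝ) ^ K), μ.rnDeriv volume x ^ (1 - p / d) := by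
    rw [← setLIntegral_iUnion_of_directed _ hmono.directed_le, iUnion_box, setLIntegral_univ]
  rw [h, ENNReal.mul_iSup]
  exact iSup_le fun K => le_liminf_sampleCost_box hp hpd hC hnC hl hl0 μ (by positivity)

end LowerBound

/-! ### Return from costs to quantization errors. -/

variable {d : ℕ} {nrm : Seminorm ℝ (Fin d → ℝ)} {p : ℝ}

/-- The rate N ^ (1/d) for the error corresponds to N ^ (p/d) for its `p`-th power, hence to N ^ (1
- p/d) for the unnormalized cost. -/
theorem natCast_rpow_mul_rpow (hp : 0 < p) {N : ℕ} (hN : N ≠ 0) (s : ℝ≥0∞) :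
    (N : ℝ≥0∞) ^ (1 / (d : ℝ)) * ((N : ℝ≥0∞)⁻¹ * s) ^ (1 / p) =
      (s / (N : ℝ≥0∞) ^ (1 - p / d)) ^ (1 / p) := by
  have hN0 : (N : ℝ≥0∞) ≠ 0 := by exact_mod_cast hN
  have hNt : (N : ℝ≥0∞) ≠ ∞ := ENNReal.natCast_ne_top N
  have h1 : (N : ℝ≥0∞) ^ (1 / (d : ℝ)) = ((N : ℝ≥0∞) ^ (p / d)) ^ (1 / p) := by
    rw [← ENNReal.rpow_mul]; congr 1; field_simp
  rw [h1, ← ENNReal.mul_rpow_of_nonneg _ _ (by positivity), ← mul_assoc,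
    div_eq_mul_inv s, ← ENNReal.rpow_neg, ← ENNReal.rpow_neg_one, ← ENNReal.rpow_add _ _ hN0 hNt, mul_comm s]
  congr 3; ring

theorem tendsto_div_rpow_of_toReal (hp : 0 < p) {s : ℕ → ℝ≥0∞} {θ l : ℝ} (hl0 : 0 ≤ l)
    (hl : Tendsto (fun N : ℕ => (s N).toReal / (N : ℝ) ^ θ) atTop (𝓝 l)) (hs : ∀ N, s N ≠ ∞) :
    Tendsto (fun N : ℕ => (s N / (N : ℝ≥0∞) ^ θ) ^ (1 / p)) atTop
      (𝓝 (((l ^ (1 / p)).toNNReal : ℝ≥0) : ℝ≥0∞)) := by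
  have h1 : ENNReal.ofReal l ^ (1 / p) = (((l ^ (1 / p)).toNNReal : ℝ≥0) : ℝ≥0∞) :=
    ENNReal.ofReal_rpow_of_nonneg hl0 (by positivity)
  rw [← h1]
  refine (ENNReal.continuous_rpow_const.tendsto _).comp ?_
  refine ((ENNReal.continuous_ofReal.tendsto l).comp hl).congr' ?_
  filter_upwards [eventually_gt_atTop 0] with N hN
  have hN' : (0 : ℝ) < N := by exact_mod_cast hN
  rw [Function.comp_apply, ENNReal.ofReal_div_of_pos (by positivity), ENNReal.ofReal_toReal (hs N),
    ← ENNReal.ofReal_rpow_of_pos hN', ENNReal.ofReal_natCast]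

theorem moments_ne_top (hnrm : ∀ x, nrm x = 0 → x = 0) (hp : 0 < p) {q : ℝ} (hpq : p < q)
    (μ : Measure (Fin d → ℝ)) [IsProbabilityMeasure μ]
    (hμ : ∫⁻ x, ENNReal.ofReal (nrm x ^ q) ∂μ ≠ ∞) :
    ∫⁻ x, ENNReal.ofReal (‖x‖ ^ q) ∂μ ≠ ∞ ∧ ∫⁻ x, gcost nrm p x 0 ∂μ ≠ ∞ := by
  have hq : 0 < q := hp.trans hpq
  constructor
  · obtain ⟨c, hc, hcn⟩ := exists_le_seminorm nrm hnrm
    refine ne_top_of_le_ne_top (ENNReal.mul_ne_top (a := ENNReal.ofReal ((c⁻¹) ^ q))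
      ENNReal.ofReal_ne_top hμ) ?_
    rw [← lintegral_const_mul' _ _ ENNReal.ofReal_ne_top]
    refine lintegral_mono fun x => ?_
    rw [← ENNReal.ofReal_mul (by positivity), ← Real.mul_rpow (by positivity) (apply_nonneg _ _)]
    refine ENNReal.ofReal_le_ofReal (Real.rpow_le_rpow (norm_nonneg _) ?_ hq.le)
    rw [inv_mul_eq_div, le_div_iff₀ hc, mul_comm]
    exact hcn x
  · refine ne_top_of_le_ne_top (ENNReal.add_ne_top.2 ⟨ENNReal.one_ne_top, hμ⟩) ?_
    calc ∫⁻ x, gcost nrm p x 0 ∂μ ≤ ∫⁻ x, (1 + ENNReal.ofReal (nrm x ^ q)) ∂μ := by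
          refine lintegral_mono fun x => ?_
          rw [gcost, sub_zero, ← ENNReal.ofReal_one,
            ← ENNReal.ofReal_add zero_le_one (Real.rpow_nonneg (apply_nonneg _ _) _)]
          refine ENNReal.ofReal_le_ofReal ?_
          rcases le_total (nrm x) 1 with h | h
          · exact (Real.rpow_le_one (apply_nonneg _ _) h hp.le).trans
              (le_add_of_nonneg_right (Real.rpow_nonneg (apply_nonneg _ _) _))
          · exact (Real.rpow_le_rpow_of_exponent_le h hpq.le).trans
              (le_add_of_nonneg_left zero_le_one)
      _ = _ := by rw [lintegral_add_left measurable_const, lintegral_one, measure_univ]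

end RandQuant

theorem theorem1p4 (d : ℕ) (hd : 3 ≤ d)
    (nrm : Seminorm ℝ (Fin d → ℝ)) (hnrm : ∀ x, nrm x = 0 → x = 0)
    (p : ℝ) (hp1 : 1 ≤ p) (hpd : p < (d : ℝ) / 2) :
    ∃ κ κ' : ℝ≥0, 0 < κ ∧ 0 < κ' ∧
      Tendsto (fun N : ℕ => (N : ℝ≥0∞) ^ (1 / (d : ℝ)) *
          RandQuant.Vrand nrm N p (RandQuant.unifCube d)) atTop (𝓝 (κ : ℝ≥0∞)) ∧
      Tendsto (fun N : ℕ => (N : ℝ≥0∞) ^ (1 / (d : ℝ)) *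
          RandQuant.VrandLeaky nrm N p) atTop (𝓝 (κ' : ℝ≥0∞)) ∧
      ∀ (μ : Measure (Fin d → ℝ)) (q : ℝ), IsProbabilityMeasure μ →
        (d : ℝ) * p / ((d : ℝ) - p) < q →
        ∫⁻ x, ENNReal.ofReal (nrm x ^ q) ∂μ < ∞ →
        (RandQuant.HasRiemannIntegrableDensity μ ∨ p = 1) →
        limsup (fun N : ℕ => (N : ℝ≥0∞) ^ (1 / (d : ℝ)) * RandQuant.Vrand nrm N p μ) atTop
            ≤ (κ : ℝ≥0∞) *
              (∫⁻ x, μ.rnDeriv volume x ^ (1 - p / (d : ℝ)) ∂volume) ^ (1 / p) ∧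
        (κ' : ℝ≥0∞) *
              (∫⁻ x, μ.rnDeriv volume x ^ (1 - p / (d : ℝ)) ∂volume) ^ (1 / p)
            ≤ liminf (fun N : ℕ => (N : ℝ≥0∞) ^ (1 / (d : ℝ)) * RandQuant.Vrand nrm N p μ)
                atTop := by
  obtain ⟨C, hC, hnC⟩ := RandQuant.exists_seminorm_le nrm
  have hp0 : 0 < p := by linarith
  have hd0 : (0 : ℝ) < d := by linarith
  have hdn : 0 < d := by exact_mod_cast hd0
  have hpd1 : p < d := by linarith
  obtain ⟨l, hl⟩ := RandQuant.exists_tendsto_sampleCost (nrm := nrm) hdn hp1 hpd hC hnC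
  obtain ⟨l', hl'⟩ := RandQuant.exists_tendsto_leakyCost (nrm := nrm) hdn hp1 hpd hC hnC
  obtain ⟨b, hb, hbl⟩ := RandQuant.exists_le_leakyCost (nrm := nrm) (p := p) hdn hp1 hnrm
  -- Positivity is only shown for the leaky constant; the other one dominates it because the leaky
  -- cost is smaller.
  have hl'0 : 0 < l' := hb.trans_le (ge_of_tendsto hl' (by
    filter_upwards [eventually_gt_atTop 0] with n hn
    rw [le_div_iff₀ (by positivity)]
    exact (ENNReal.ofReal_le_iff_le_toReal (RandQuant.leakyCost_ne_top hp1 hC hnC n)).1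
      (hbl n hn.ne')))
  have hll' : l' ≤ l := le_of_tendsto_of_tendsto' hl' hl fun n =>
    div_le_div_of_nonneg_right (ENNReal.toReal_mono
      (RandQuant.sampleCost_unifCube_ne_top hp1 hC hnC n) (RandQuant.leakyCost_le_sampleCost n))
      (by positivity)
  have hl0 : 0 < l := hl'0.trans_le hll'
  have hV : ∀ (μ : Measure (Fin d → ℝ)) [IsProbabilityMeasure μ],
      (fun N : ℕ => (N : ℝ≥0∞) ^ (1 / (d : ℝ)) * RandQuant.Vrand nrm N p μ) =ᶠ[atTop]
      fun N : ℕ => (RandQuant.sampleCost nrm p N μ / (N : ℝ≥0∞) ^ (1 - p / d)) ^ (1 / p) := by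
    intro μ _
    filter_upwards [eventually_ne_atTop 0] with N hN
    rw [RandQuant.Vrand_eq hp0 hN, RandQuant.natCast_rpow_mul_rpow hp0 hN]
  have hmono : Monotone fun x : ℝ≥0∞ => x ^ (1 / p) := ENNReal.monotone_rpow_of_nonneg (by positivity)
  refine ⟨(l ^ (1 / p)).toNNReal, (l' ^ (1 / p)).toNNReal, Real.toNNReal_pos.2 (by positivity),
    Real.toNNReal_pos.2 (by positivity), ?_, ?_, ?_⟩
  · rw [tendsto_congr' (hV _)]
    exact RandQuant.tendsto_div_rpow_of_toReal hp0 hl0.le hl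
      (RandQuant.sampleCost_unifCube_ne_top hp1 hC hnC)
  · refine Tendsto.congr' ?_ (RandQuant.tendsto_div_rpow_of_toReal hp0 hl'0.le hl'
      (RandQuant.leakyCost_ne_top hp1 hC hnC))
    filter_upwards [eventually_ne_atTop 0] with N hN
    rw [RandQuant.VrandLeaky_eq hdn hp0 hN, RandQuant.natCast_rpow_mul_rpow hp0 hN]
  · intro μ q hμ hq hint _
    -- As p * (d - p) < d * p, the moment condition gives in particular a finite moment of order p.
    have hpq : p < q := lt_trans (by
      rw [lt_div_iff₀ (by linarith)]; nlinarith) hq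
    obtain ⟨h1, h2⟩ := RandQuant.moments_ne_top hnrm hp0 hpq μ hint.ne
    rw [limsup_congr (hV μ), liminf_congr (hV μ)]
    change limsup ((fun x : ℝ≥0∞ => x ^ (1 / p)) ∘ _) atTop ≤ _ ∧
      _ ≤ liminf ((fun x : ℝ≥0∞ => x ^ (1 / p)) ∘ _) atTop
    -- The root x ^ (1 / p) is monotone and continuous, so it commutes with both limits.
    rw [← hmono.map_limsup_of_continuousAt _ ENNReal.continuous_rpow_const.continuousAt,
      ← hmono.map_liminf_of_continuousAt _ ENNReal.continuous_rpow_const.continuousAt]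
    have hk : ∀ x : ℝ, 0 ≤ x → (((x ^ (1 / p)).toNNReal : ℝ≥0) : ℝ≥0∞) =
        ENNReal.ofReal x ^ (1 / p) := fun x hx =>
      (ENNReal.ofReal_rpow_of_nonneg hx (by positivity)).symm
    rw [hk l hl0.le, hk l' hl'0.le, ← ENNReal.mul_rpow_of_nonneg _ _ (by positivity),
      ← ENNReal.mul_rpow_of_nonneg _ _ (by positivity)]
    exact ⟨hmono (RandQuant.limsup_sampleCost_le hp1 hpd hC hnC hl hl0.le μ hq h1 h2),
      hmono (RandQuant.le_liminf_sampleCost hp1 hpd hC hnC hl' hl'0 μ)⟩
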